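/- **Setting.** Let $\mathbb F_q$ be a finite field of characteristic $p>3$, $\mathcal O=\mathbb F_q[t]$, $K=\mathbb F_q(t)$, $K_\infty=\mathbb F_q((t^{-1}))$ with the absolute value $|\alpha|=q^{N}$ if $t^N$ is the highest power of $t$ occurring in $\alpha\ne0$, $|0|=0$; vectors carry the maximum norm. Let $\mathbb T=\{\alpha\in K_\infty:|\alpha|<1\}$ and normalise the Haar measure on $K_\infty$ so that $\mathbb T$ has measure $1$. Let $\psi(\alpha)=\exp\!\big(\tfrac{2\pi i}{p}\mathrm{Tr}_{\mathbb F_q/\mathbb F_p}(\alpha_{-1})\big)$, $\alpha_{-1}$ being the coefficient of $t^{-1}$ in $\alpha$. Write $\widehat Y=q^Y$. Let $n>18$, let $F_1\in\mathcal O[x_1,\dots,x_n]$ be a non-singular cubic form and $F_2(\mathbf x)=\mathbf x^tM\mathbf x$ a quadratic form with $M\in\mathcal O^{n\times n}$ symmetric of rank at least $n-1$, such that $V(F_1,F_2)\subset\mathbb P^{n-1}_K$ is a non-singular complete intersection. Let $H$ be the maximum of the absolute values of the coefficients of $F_1,F_2$, and let $H(\mathbf x)$ be the Hessian matrix of $F_1$.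 Fix $\mathbf x_0\in K_\infty^n$ with $F_1(\mathbf x_0)=F_2(\mathbf x_0)=0$, $|\mathbf x_0|<H^{-1}$, $\mathrm{rk}\,H(\mathbf x_0)\ge n-2$ and $\mathrm{rk}(\gamma_1H(\mathbf x_0)+\gamma_2M)\ge n-3$ for all $(\gamma_1,\gamma_2)\in K_\infty^2\setminus\{0\}$. For $L\in\mathbb N$ let $w(\mathbf x)=1$ if $|t^L(\mathbf x-\mathbf x_0)|<1$ and $w(\mathbf x)=0$ otherwise. Let $N\in\mathcal O\setminus\{0\}$ and $\mathbf b\in\mathcal O^n$ with $N\mid F_1(\mathbf b),F_2(\mathbf b)$, and put $r_N=rN/(r,N)$. For monic $r$, let $A_r$ be the set of $\underline a\in\mathcal O^2$ with $|\underline a|<|r|$ and $(a_1,a_2,r)=1$, and let $$S_r(\underline a)=\sum_{\substack{\mathbf x\in\mathcal O^n,\ |\mathbf x|<|r_N|\\ \mathbf x\equiv\mathbf b\,(N)}}\psi\Big(\frac{a_1F_1(\mathbf x)+a_2F_2(\mathbf x)}{r}\Big),\qquad S_r=\sum_{\underline a\in A_r}S_r(\underline a),\qquad \mathfrak S_{\mathbf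 b,N}=\sum_{r\ \mathrm{monic}}|r_N|^{-n}S_r .$$ Let $\lambda=\min_{\max(|\gamma_1|,|\gamma_2|)=1}|\gamma_1\nabla F_1(\mathbf x_0)+\gamma_2\nabla F_2(\mathbf x_0)|$, $G_i(\mathbf x)=F_i(\mathbf x_0+t^{-L}\mathbf x)$ and $$\sigma_\infty=\widehat L^{-n}\int_{|\underline\gamma|<\widehat L\lambda^{-1}}\int_{\mathbb T^n}\psi\big(\gamma_1G_1(\mathbf x)+\gamma_2G_2(\mathbf x)\big)\,d\mathbf x\,d\underline\gamma .$$ *The main term.* Let $R_1\ge R_2\ge1$ be integers and $T=(R_1-R_2)/2$. A pair $\underline c\in\mathcal O^2$ is primitive if $(c_1,c_2)=1$ and either $c_1$ is monic or $c_1=0$ and $c_2$ is monic. For $d$ monic and $\underline c$ primitive, $\underline a/r\in L(d\underline c)$ means that $d\,\underline c\cdot\underline a=kr$ for some $k\in\mathcal O$ with $(k,d)=1$. For $P\ge 1$ put $$M(P)=\widehat P^{\,n}\sum_{\substack{r\ \mathrm{monic}\\ |r|\le\widehat R_1\widehat R_2}}|r_N|^{-n}\sum_{(d,\underline c)}\ \int_{D_{r,\underline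 c}}\Big(\sum_{\substack{\underline a\in A_r\\ \underline a/r\in L(d\underline c)}}S_r(\underline a)\Big)\int_{K_\infty^n}w(\mathbf x)\,\psi\big(t^{3P}\theta_1F_1(\mathbf x)+t^{2P}\theta_2F_2(\mathbf x)\big)\,d\mathbf x\,d\underline\theta .$$ Here $(d,\underline c)$ runs over $d\mid r$ monic and $\underline c$ primitive with $|dc_1|\le\widehat T|r|^{1/2}$, $|dc_2|<\widehat T^{-1}|r|^{1/2}$ and $\max\{\widehat R_1|dc_2|,\widehat R_2|dc_1|\}\ge|r|$. The set $D_{r,\underline c}$ consists of the $\underline\theta\in\mathbb T^2$ with $|r\theta_i|<\widehat R_i^{-1}$ for $i=1,2$, except that, when $c_2=0$ and $|r|\le\widehat P^{1-2/n}$, those with $|\theta_1|>|r|^{-1}\widehat P^{-8(n-16)/(3n-24)}$ are omitted. **Proposition.** (i) There is $L_0$ (depending on $F_1,F_2,\mathbf x_0$) such that for every integer $L\ge L_0$ the singular integral $\sigma_\infty$ is real and positive, and there is $\delta''>0$ with $$M(P)=\sigma_\infty\,\mathfrak S_{\mathbf b,N}\,q^{(n-5)P}+O\big(q^{(n-5-\delta'')P}\big)$$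 for all integers $P\ge1$ and all $R_1\ge R_2\ge1$ with $\widehat R_1\asymp\widehat P^{4/3}$ and $\widehat R_2\asymp\widehat P^{1/3}$; the implied constant depends only on $q,F_1,F_2,w,N$ and the constants implied in $\asymp$. (ii) The series $\mathfrak S_{\mathbf b,N}$ converges absolutely. It is real and positive if for every prime $\varpi$ of $\mathcal O$ there is $\mathbf x_\varpi\in\mathcal O_\varpi^n$ with $F_1(\mathbf x_\varpi)=F_2(\mathbf x_\varpi)=0$ and $\mathbf x_\varpi\equiv\mathbf b\pmod N$. -/

import Mathlib

open scoped Polynomial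
open MeasureTheory

namespace FFCircle

/-! ### The completion at infinity of `F(t)` -/

/-- `K_∞ = F((t⁻¹))`: Laurent series in the variable `t⁻¹`. The coefficient of `t ^ i` of
`α : KInf F` is therefore `α.coeff (-i)`. It carries Mathlib's valuation topology. -/
abbrev KInf (F : Type*) [Field F] : Type _ := LaurentSeries F

noncomputable section

/-- The embedding `F[t] → K_∞`; the polynomial variable goes to `t = (t⁻¹)⁻¹`. -/
def ofPoly {F : Type*} [Field F] : F[X] →+* KInf F :=
  Polynomial.eval₂RingHom HahnSeries.C (HahnSeries.single (-1 : ℤ) (1 : F))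

/-- The element `t` of `K_∞`. -/
def tInf {F : Type*} [Field F] : KInf F := ofPoly (Polynomial.X : F[X])

/-- `q ^ Y` for real `Y`, where `q = #F`. -/
def hat (F : Type*) [Fintype F] (Y : ℝ) : ℝ := (Fintype.card F : ℝ) ^ Y

open scoped Classical in
/-- The absolute value on `K_∞`: `|α| = q ^ N` if `t ^ N` is the highest power of `t` in `α`. -/
def absInf {F : Type*} [Field F] [Fintype F] (α : KInf F) : ℝ :=
  if α = 0 then 0 else (Fintype.card F : ℝ) ^ (-α.order)

open scoped Classical in
/-- The absolute value `|f| = q ^ (deg f)` on `F[t]`. -/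
def polyAbs {F : Type*} [Field F] [Fintype F] (f : F[X]) : ℝ :=
  if f = 0 then 0 else (Fintype.card F : ℝ) ^ f.natDegree

/-- The unit interval `𝕋 = {|α| < 1}` in `K_∞`. -/
def unitInterval (F : Type*) [Field F] [Fintype F] : Set (KInf F) := {α | absInf α < 1}

instance instMeasurableSpaceKInf (F : Type*) [Field F] : MeasurableSpace (KInf F) :=
  borel (KInf F)

instance instBorelSpaceKInf (F : Type*) [Field F] : BorelSpace (KInf F) := ⟨rfl⟩

theorem absInf_lt_one_iff {F : Type*} [Field F] [Fintype F] (α : KInf F) :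
    absInf α < 1 ↔ ∀ n : ℤ, n < 1 → α.coeff n = 0 := by
  have hq : (1 : ℝ) < Fintype.card F := by exact_mod_cast Fintype.one_lt_card
  unfold absInf
  by_cases h : α = 0
  · simp [h]
  · rw [if_neg h, zpow_lt_one_iff_right₀ hq]
    constructor
    · intro ho n hn
      exact HahnSeries.coeff_eq_zero_of_lt_order (by omega)
    · intro hc
      by_contra! ho
      exact h (HahnSeries.coeff_order_eq_zero.mp (hc α.order (by omega)))

theorem exists_coeff_ball_subset {F : Type*} [Field F] {s : Set (KInf F)} {x : KInf F}
    (hs : s ∈ nhds x) : ∃ D : ℤ, {y : KInf F | ∀ n : ℤ, n < D → (y - x).coeff n = 0} ⊆ s := by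
  obtain ⟨γ, hγ⟩ := Valued.mem_nhds.mp hs
  set g := MonoidWithZeroHom.ValueGroup₀.embedding γ.1 with hg
  have hg0 : g ≠ 0 := by
    rw [hg, map_ne_zero]
    exact γ.ne_zero
  refine ⟨1 - WithZero.log g, fun y hy => hγ ?_⟩
  change Valued.v.restrict (y - x) < γ.1
  rw [Valuation.restrict_lt_iff_lt_embedding]
  refine lt_of_le_of_lt ((LaurentSeries.valuation_le_iff_coeff_lt_eq_zero F).mpr hy) ?_
  rw [← hg, ← WithZero.lt_log_iff_exp_lt hg0]
  omega

theorem isCompact_unitInterval (F : Type*) [Field F] [Fintype F] :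
    IsCompact (unitInterval F) := by
  let _ : TopologicalSpace F := ⊥
  have : DiscreteTopology F := ⟨rfl⟩
  let φ : (ℕ → F) → KInf F := fun a =>
    (HahnSeries.single (1 : ℤ) (1 : F)) * HahnSeries.ofPowerSeries ℤ F (PowerSeries.mk a)
  have hφ : ∀ (a : ℕ → F) (m : ℤ), (φ a).coeff (m + 1) =
      (HahnSeries.ofPowerSeries ℤ F (PowerSeries.mk a)).coeff m := fun a m => by
    simp [φ, HahnSeries.coeff_single_mul_add]
  have hφ1 : ∀ (a : ℕ → F) (m : ℕ), (φ a).coeff ((m : ℤ) + 1) = a m := fun a m => by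
    rw [hφ, HahnSeries.ofPowerSeries_apply_coeff, PowerSeries.coeff_mk]
  have hφ0 : ∀ (a : ℕ → F) (m : ℤ), m < 1 → (φ a).coeff m = 0 := fun a m hm => by
    have h := hφ a (m - 1)
    rw [sub_add_cancel] at h
    rw [h, HahnSeries.ofPowerSeries_apply]
    apply HahnSeries.embDomain_of_notMem_range
    rintro ⟨k, hk⟩
    simp at hk
    omega
  have hcont : Continuous φ := by
    rw [continuous_iff_continuousAt]
    intro a s hs
    obtain ⟨D, hD⟩ := exists_coeff_ball_subset hs
    have hU : {c : ℕ → F | ∀ m ∈ Set.Iio D.toNat, c m ∈ ({a m} : Set F)} ∈ nhds a :=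
      (isOpen_set_pi (Set.finite_Iio D.toNat) fun m _ => isOpen_discrete {a m}).mem_nhds
        fun m _ => rfl
    refine Filter.mem_map.mpr (Filter.mem_of_superset hU fun c hc => hD fun m hm => ?_)
    rw [HahnSeries.coeff_sub, sub_eq_zero]
    by_cases h1 : m < 1
    · rw [hφ0 _ _ h1, hφ0 _ _ h1]
    · obtain ⟨k, rfl⟩ : ∃ k : ℕ, m = (k : ℤ) + 1 := ⟨(m - 1).toNat, by omega⟩
      rw [hφ1, hφ1]
      exact hc k (by simp only [Set.mem_Iio]; omega)
  have himg : unitInterval F = Set.range φ := by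
    ext α
    change absInf α < 1 ↔ _
    rw [absInf_lt_one_iff]
    constructor
    · intro h
      refine ⟨fun m => α.coeff ((m : ℤ) + 1), ?_⟩
      ext m
      by_cases hm : m < 1
      · rw [hφ0 _ _ hm, h m hm]
      · obtain ⟨k, rfl⟩ : ∃ k : ℕ, m = (k : ℤ) + 1 := ⟨(m - 1).toNat, by omega⟩
        rw [hφ1]
    · rintro ⟨a, rfl⟩
      exact hφ0 a
  rw [himg]
  exact isCompact_range hcont

theorem interior_unitInterval_nonempty (F : Type*) [Field F] [Fintype F] :
    (interior (unitInterval F)).Nonempty := by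
  have hy : Valued.v (HahnSeries.single (1 : ℤ) (1 : F) : KInf F) = WithZero.exp (-1) :=
    LaurentSeries.valuation_single_zpow F 1
  have hset : unitInterval F = {x : KInf F | Valued.v.restrict x ≤
      Valued.v.restrict (HahnSeries.single (1 : ℤ) (1 : F) : KInf F)} := by
    ext α
    change absInf α < 1 ↔ Valued.v.restrict α ≤ _
    rw [absInf_lt_one_iff, Valuation.restrict_le_iff, hy,
      LaurentSeries.valuation_le_iff_coeff_lt_eq_zero]
  have hopen : IsOpen (unitInterval F) := by
    rw [hset]
    refine Valued.isOpen_closedBall _ fun h => ?_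
    have h' := congrArg MonoidWithZeroHom.ValueGroup₀.embedding h
    rw [Valuation.embedding_restrict, map_zero, hy] at h'
    exact WithZero.exp_ne_zero h'
  rw [hopen.interior_eq]
  exact ⟨0, by simp [unitInterval, absInf]⟩

/-- The Haar measure on `K_∞` for which `𝕋` has measure `1`. -/
def haarInf (F : Type*) [Field F] [Fintype F] : Measure (KInf F) :=
  Measure.addHaarMeasure
    ⟨⟨unitInterval F, isCompact_unitInterval F⟩, interior_unitInterval_nonempty F⟩

/-- The product measure on `K_∞ ^ n`. -/
def haarInfPi (F : Type*) [Field F] [Fintype F] (n : ℕ) : Measure (Fin n → KInf F) :=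
  Measure.pi fun _ => haarInf F

/-- The product measure on `K_∞ ^ 2`. -/
def haarInfProd (F : Type*) [Field F] [Fintype F] : Measure (KInf F × KInf F) :=
  (haarInf F).prod (haarInf F)

/-- The character `ψ(α) = e_p(Tr(α_{-1}))` of `K_∞`, with `α_{-1}` the coefficient of `t⁻¹`. -/
def psi (p : ℕ) [Fact p.Prime] {F : Type*} [Field F] [Algebra (ZMod p) F] (α : KInf F) : ℂ :=
  ZMod.stdAddChar (Algebra.trace (ZMod p) F (α.coeff 1))

/-! ### Forms over `F[t]` -/

/-- The value at a point of `K_∞ ^ n` of a polynomial with coefficients in `F[t]`. -/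
def evalInf {F : Type*} [Field F] {n : ℕ} (G : MvPolynomial (Fin n) F[X])
    (x : Fin n → KInf F) : KInf F :=
  MvPolynomial.eval₂ ofPoly x G

/-- An algebraic closure of `F(t)`. -/
abbrev KBar (F : Type*) [Field F] : Type _ := AlgebraicClosure (RatFunc F)

/-- The values at geometric points of a polynomial with coefficients in `F[t]`. -/
def evalBar {F : Type*} [Field F] {n : ℕ} (G : MvPolynomial (Fin n) F[X])
    (x : Fin n → KBar F) : KBar F :=
  MvPolynomial.eval₂ ((algebraMap (RatFunc F) (KBar F)).comp (algebraMap F[X] (RatFunc F))) x G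

/-- The projective hypersurface `G = 0` is non-singular. -/
def NonsingularForm {F : Type*} [Field F] {n : ℕ} (G : MvPolynomial (Fin n) F[X]) : Prop :=
  ∀ x : Fin n → KBar F, evalBar G x = 0 → (∀ i, evalBar (MvPolynomial.pderiv i G) x = 0) → x = 0

/-- `V(F₁, F₂) ⊂ ℙ^{n-1}` is a non-singular complete intersection (Jacobian criterion). -/
def NonsingularPair {F : Type*} [Field F] {n : ℕ} (F₁ F₂ : MvPolynomial (Fin n) F[X]) : Prop :=
  ∀ x : Fin n → KBar F, x ≠ 0 → evalBar F₁ x = 0 → evalBar F₂ x = 0 →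
    LinearIndependent (KBar F)
      ![fun i => evalBar (MvPolynomial.pderiv i F₁) x,
        fun i => evalBar (MvPolynomial.pderiv i F₂) x]

/-- The quadratic form `𝐱ᵗ M 𝐱`. -/
def quadOf {F : Type*} [Field F] {n : ℕ} (M : Matrix (Fin n) (Fin n) F[X]) :
    MvPolynomial (Fin n) F[X] :=
  ∑ i, ∑ j, MvPolynomial.C (M i j) * MvPolynomial.X i * MvPolynomial.X j

/-- The height of a polynomial: the largest absolute value of a coefficient. -/
def height {F : Type*} [Field F] [Fintype F] {n : ℕ} (G : MvPolynomial (Fin n) F[X]) : ℝ :=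
  ⨆ m : Fin n →₀ ℕ, polyAbs (G.coeff m)

/-- The Hessian matrix of `G` at `x`. -/
def hessian {F : Type*} [Field F] {n : ℕ} (G : MvPolynomial (Fin n) F[X])
    (x : Fin n → KInf F) : Matrix (Fin n) (Fin n) (KInf F) :=
  Matrix.of fun i j => evalInf (MvPolynomial.pderiv i (MvPolynomial.pderiv j G)) x

/-- The centre `𝐱₀` of the weight function: a common zero over `K_∞` of the cubic form `F₁` and
the quadratic form `𝐱ᵗ M 𝐱`, of small absolute value and satisfying the rank conditions. -/
structure IsCentre {F : Type*} [Field F] [Fintype F] {n : ℕ} (F₁ : MvPolynomial (Fin n) F[X])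
    (M : Matrix (Fin n) (Fin n) F[X]) (x₀ : Fin n → KInf F) : Prop where
  cubic_zero : evalInf F₁ x₀ = 0
  quadric_zero : evalInf (quadOf M) x₀ = 0
  rank_hessian : n ≤ (hessian F₁ x₀).rank + 2
  rank_pencil : ∀ γ₁ γ₂ : KInf F, (γ₁ ≠ 0 ∨ γ₂ ≠ 0) →
    n ≤ (γ₁ • hessian F₁ x₀ + γ₂ • M.map ofPoly).rank + 3
  small : ∀ i, absInf (x₀ i) < (max (height F₁) (height (quadOf M)))⁻¹

/-! ### Weight function, oscillatory integrals and singular integral -/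

open scoped Classical in
/-- `w(x) = χ_𝕋(t ^ L (x - x₀))`. -/
def weight {F : Type*} [Field F] [Fintype F] {n : ℕ} (x₀ : Fin n → KInf F) (L : ℕ)
    (x : Fin n → KInf F) : ℝ :=
  if ∀ i, absInf (tInf ^ L * (x i - x₀ i)) < 1 then 1 else 0

/-- `I_s(θ, v) = ∫ w(x) ψ(t^{3P} θ₁ F₁(x) + t^{2P} θ₂ F₂(x) + t^P v·x / s) dx` over `K_∞ ^ n`. -/
def oscInt (p : ℕ) [Fact p.Prime] {F : Type*} [Field F] [Fintype F] [Algebra (ZMod p) F] {n : ℕ}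
    (F₁ F₂ : MvPolynomial (Fin n) F[X]) (x₀ : Fin n → KInf F) (L P : ℕ) (s : F[X])
    (θ : KInf F × KInf F) (v : Fin n → F[X]) : ℂ :=
  ∫ x, (weight x₀ L x : ℂ) *
    psi p (tInf ^ (3 * P) * θ.1 * evalInf F₁ x + tInf ^ (2 * P) * θ.2 * evalInf F₂ x +
      tInf ^ P * (∑ i, ofPoly (v i) * x i) / ofPoly s) ∂(haarInfPi F n)

/-- `λ`: the minimum of `|γ₁ ∇F₁(x₀) + γ₂ ∇F₂(x₀)|` over `max(|γ₁|, |γ₂|) = 1`. -/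
def gradMin {F : Type*} [Field F] [Fintype F] {n : ℕ}
    (F₁ F₂ : MvPolynomial (Fin n) F[X]) (x₀ : Fin n → KInf F) : ℝ :=
  ⨅ γ : {γ : KInf F × KInf F // max (absInf γ.1) (absInf γ.2) = 1},
    ⨆ i, absInf (γ.1.1 * evalInf (MvPolynomial.pderiv i F₁) x₀ +
      γ.1.2 * evalInf (MvPolynomial.pderiv i F₂) x₀)

/-- The singular integral
`σ_∞ = q^{-Ln} ∫_{|γ| < 1 / (λ q^{-L})} ∫_{𝕋ⁿ} ψ(γ₁ G₁(x) + γ₂ G₂(x)) dx dγ`,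
where `G_i(x) = F_i(x₀ + t^{-L} x)`. -/
def singularIntegral (p : ℕ) [Fact p.Prime] {F : Type*} [Field F] [Fintype F]
    [Algebra (ZMod p) F] {n : ℕ} (F₁ F₂ : MvPolynomial (Fin n) F[X]) (x₀ : Fin n → KInf F)
    (L : ℕ) : ℂ :=
  (((hat F L) ^ n)⁻¹ : ℝ) *
    ∫ γ in {γ : KInf F × KInf F |
        max (absInf γ.1) (absInf γ.2) < (gradMin F₁ F₂ x₀ * (hat F L)⁻¹)⁻¹},
      ∫ x in {x : Fin n → KInf F | ∀ i, x i ∈ unitInterval F},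
        psi p (γ.1 * evalInf F₁ (fun i => x₀ i + (tInf ^ L)⁻¹ * x i) +
          γ.2 * evalInf F₂ (fun i => x₀ i + (tInf ^ L)⁻¹ * x i)) ∂(haarInfPi F n)
      ∂(haarInfProd F)

/-! ### Exponential sums and singular series -/

open scoped Classical in
/-- `r_N = r N / (r, N)`. -/
def rN {F : Type*} [Field F] (r N : F[X]) : F[X] := r * N / EuclideanDomain.gcd r N

/-- Numerators of the fractions `a / r ∈ 𝕋²` in lowest terms: `|a| < |r|` and `(a, r) = 1`. -/
def numerators {F : Type*} [Field F] [Fintype F] (r : F[X]) : Set (F[X] × F[X]) :=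
  {a | polyAbs a.1 < polyAbs r ∧ polyAbs a.2 < polyAbs r ∧
    ∀ g : F[X], g ∣ a.1 → g ∣ a.2 → g ∣ r → IsUnit g}

/-- Residues modulo `r_N` that are congruent to `b` modulo `N`. -/
def residues {F : Type*} [Field F] [Fintype F] {n : ℕ} (b : Fin n → F[X]) (N r : F[X]) :
    Set (Fin n → F[X]) :=
  {x | (∀ i, polyAbs (x i) < polyAbs (rN r N)) ∧ ∀ i, N ∣ x i - b i}

/-- `(c₁, c₂)` is primitive: coprime, with `c₁` monic, or `c₁ = 0` and `c₂` monic. -/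
def Primitive {F : Type*} [Field F] (c : F[X] × F[X]) : Prop :=
  IsCoprime c.1 c.2 ∧ (c.1.Monic ∨ (c.1 = 0 ∧ c.2.Monic))

/-- `a / r` satisfies `d c · (a / r) = k` for some `k` coprime to `d`; for `a` in `numerators r`
this says that `a / r` lies on the generalised line `L(d c)`. -/
def OnLine {F : Type*} [Field F] (d : F[X]) (c a : F[X] × F[X]) (r : F[X]) : Prop :=
  ∃ k : F[X], IsCoprime k d ∧ d * (c.1 * a.1 + c.2 * a.2) = k * r

/-- The phase `ψ((a₁ F₁(x) + a₂ F₂(x)) / r)` for `x ∈ F[t]ⁿ`. -/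
def phase (p : ℕ) [Fact p.Prime] {F : Type*} [Field F] [Algebra (ZMod p) F] {n : ℕ}
    (F₁ F₂ : MvPolynomial (Fin n) F[X]) (r : F[X]) (a : F[X] × F[X]) (x : Fin n → F[X]) : ℂ :=
  psi p (ofPoly (a.1 * MvPolynomial.eval x F₁ + a.2 * MvPolynomial.eval x F₂) / ofPoly r)

/-- The exponential sum `S_{dc, r, b, N}(v)`. -/
def lineSum (p : ℕ) [Fact p.Prime] {F : Type*} [Field F] [Fintype F] [Algebra (ZMod p) F] {n : ℕ}
    (F₁ F₂ : MvPolynomial (Fin n) F[X]) (b : Fin n → F[X]) (N r d : F[X]) (c : F[X] × F[X])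
    (v : Fin n → F[X]) : ℂ :=
  ∑ᶠ a ∈ {a | a ∈ numerators r ∧ OnLine d c a r}, ∑ᶠ x ∈ residues b N r,
    phase p F₁ F₂ r a x * psi p (-ofPoly (∑ i, v i * x i) / ofPoly (rN r N))

/-- The complete exponential sum `S_r`, over all numerators `a` modulo `r`. -/
def completeSum (p : ℕ) [Fact p.Prime] {F : Type*} [Field F] [Fintype F] [Algebra (ZMod p) F]
    {n : ℕ} (F₁ F₂ : MvPolynomial (Fin n) F[X]) (b : Fin n → F[X]) (N r : F[X]) : ℂ :=
  ∑ᶠ a ∈ numerators r, ∑ᶠ x ∈ residues b N r, phase p F₁ F₂ r a x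

/-- The term `|r_N|^{-n} S_r` of the singular series. -/
def seriesTerm (p : ℕ) [Fact p.Prime] {F : Type*} [Field F] [Fintype F] [Algebra (ZMod p) F]
    {n : ℕ} (F₁ F₂ : MvPolynomial (Fin n) F[X]) (b : Fin n → F[X]) (N r : F[X]) : ℂ :=
  ((polyAbs (rN r N) ^ n)⁻¹ : ℝ) * completeSum p F₁ F₂ b N r

/-- The singular series `𝔖_{b,N}`: the sum of `|r_N|^{-n} S_r` over all monic `r`. -/
def singularSeries (p : ℕ) [Fact p.Prime] {F : Type*} [Field F] [Fintype F] [Algebra (ZMod p) F]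
    {n : ℕ} (F₁ F₂ : MvPolynomial (Fin n) F[X]) (b : Fin n → F[X]) (N : F[X]) : ℂ :=
  ∑' r : {r : F[X] // r.Monic}, seriesTerm p F₁ F₂ b N r.1

/-- For every prime `ϖ` of `F[t]` there is a common zero of `F₁`, `F₂` over `𝓞_ϖ` that is
congruent to `b` modulo `N`. -/
def LocallySoluble {F : Type*} [Field F] {n : ℕ} (F₁ F₂ : MvPolynomial (Fin n) F[X])
    (b : Fin n → F[X]) (N : F[X]) : Prop :=
  ∀ ϖ : IsDedekindDomain.HeightOneSpectrum F[X],
    ∃ x : Fin n → ϖ.adicCompletionIntegers (RatFunc F),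
      MvPolynomial.aeval x F₁ = 0 ∧ MvPolynomial.aeval x F₂ = 0 ∧
      ∀ i, algebraMap F[X] (ϖ.adicCompletionIntegers (RatFunc F)) N ∣
        x i - algebraMap F[X] (ϖ.adicCompletionIntegers (RatFunc F)) (b i)

/-! ### The main term of the two-dimensional Farey dissection -/

/-- The pairs `(d, c)` that occur for the denominator `r` in the Farey dissection of `𝕋²` with
parameters `R₁ ≥ R₂`; here `q ^ T = q ^ ((R₁ - R₂) / 2)` and `c^⊥ = (-c₂, c₁)`. -/
def lines {F : Type*} [Field F] [Fintype F] (R₁ R₂ : ℕ) (r : F[X]) :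
    Set (F[X] × (F[X] × F[X])) :=
  {dc | dc.1 ∣ r ∧ dc.1.Monic ∧ Primitive dc.2 ∧
    polyAbs (dc.1 * dc.2.1) ≤ hat F (((R₁ : ℝ) - R₂) / 2) * Real.sqrt (polyAbs r) ∧
    polyAbs (dc.1 * dc.2.2) < (hat F (((R₁ : ℝ) - R₂) / 2))⁻¹ * Real.sqrt (polyAbs r) ∧
    polyAbs r ≤ max (hat F R₁ * polyAbs (dc.1 * dc.2.2)) (hat F R₂ * polyAbs (dc.1 * dc.2.1))}

/-- `D(|r| R̂)`: the `θ ∈ 𝕋²` with `|r θ_i| < q ^ (-R_i)`. -/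
def box {F : Type*} [Field F] [Fintype F] (R₁ R₂ : ℕ) (r : F[X]) : Set (KInf F × KInf F) :=
  {θ | θ.1 ∈ unitInterval F ∧ θ.2 ∈ unitInterval F ∧
    polyAbs r * absInf θ.1 < (hat F R₁)⁻¹ ∧ polyAbs r * absInf θ.2 < (hat F R₂)⁻¹}

/-- The part treated by Weyl's inequality, and so not belonging to the main term:
`c₂ = 0`, `|θ₁| > |r|⁻¹ q^{-δP}` with `δ = 8(n - 16)/(3n - 24)`, and `|r| ≤ q^{(1 - 2/n)P}`. -/
def weylPart {F : Type*} [Field F] [Fintype F] (n P : ℕ) (r : F[X]) (c : F[X] × F[X]) :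
    Set (KInf F × KInf F) :=
  {θ | c.2 = 0 ∧
    (polyAbs r)⁻¹ * hat F (-(8 * ((n : ℝ) - 16) / (3 * (n : ℝ) - 24) * P)) < absInf θ.1 ∧
    polyAbs r ≤ hat F ((1 - 2 / (n : ℝ)) * P)}

/-- The main term `M(P)`: the contribution of `v = 0` outside the part treated by Weyl's
inequality, for the Farey dissection with parameters `R₁`, `R₂`. -/
def mainTerm (p : ℕ) [Fact p.Prime] {F : Type*} [Field F] [Fintype F] [Algebra (ZMod p) F] {n : ℕ}
    (F₁ F₂ : MvPolynomial (Fin n) F[X]) (x₀ : Fin n → KInf F) (L : ℕ) (b : Fin n → F[X])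
    (N : F[X]) (P R₁ R₂ : ℕ) : ℂ :=
  ((hat F P) ^ n : ℝ) *
    ∑ᶠ r ∈ {r : F[X] | r.Monic ∧ polyAbs r ≤ hat F R₁ * hat F R₂},
      ((polyAbs (rN r N) ^ n)⁻¹ : ℝ) *
        ∑ᶠ dc ∈ lines R₁ R₂ r,
          ∫ θ in box R₁ R₂ r \ weylPart n P r dc.2,
            lineSum p F₁ F₂ b N r dc.1 dc.2 0 * oscInt p F₁ F₂ x₀ L P (rN r N) θ 0
            ∂(haarInfProd F)

end

end FFCircle

/-!
Everything rests on one estimate for complete exponential sums: the series over monic `r` of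
`∑_a sup_v |r|⁻ⁿ |∑_{x mod r} ψ((a₁ F₁(x) + a₂ F₂(x) + v · x) / r)|`, taken over the numerators `a`
belonging to `r`, converges even after multiplication by `|r| ^ (1/40)`
(`FormPair.summable_majorant`). The sum over `a` is submultiplicative in `r`, so it is enough to treat
powers of a prime `w`, where elementary bounds suffice (`FormPair.exists_expSum_prime_pow_bound`):

* Weyl differencing saves `|r₁| ^ (n/8)`, with `r₁` the denominator of `a₁ / r`. It leads to the
  number of pairs `(h, h')` that are annihilated by the Hessian of `F₁` modulo `r₁`. This number is
  compared with the number of such pairs of polynomials of small degree, for which the congruence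
  is an equation; for fixed `h - h'` a polynomial form of the Nullstellensatz bounds the number of
  solutions independently of the field.
* At primes of good reduction the same count modulo `w`, and stationary phase modulo `w ^ k` with
  `k ≥ 2`, replace Weyl's inequality when `w` does not divide `a₁`.
* When a high power of `w` divides `a₁`, the quadratic form takes over, by stationary phase and, for
  `k = 1`, Gauss sums; that `M` has corank at most one costs one variable.

A linear term `v` is allowed because the congruence `x ≡ b (N)` is detected by additive characters,
so that every `S_r(a)` is bounded by the supremum over `v`. This gives the absolute convergence of
the singular series.

For the main term, non-singularity makes the gradients of `F₁` and `F₂` at `x₀` linearly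
independent, and for large `L` the oscillatory integral vanishes outside an explicit compact open
group of size about `q ^ (-3P) × q ^ (-2P)` (`exists_localIntegral_eq_zero`). For
`|r| ≤ q ^ (P/3 - O(1))` this group lies in all the domains of integration, and by Dirichlet's
box principle the lines partition the numerators, so the contribution of `r` is exactly the expected
one. The remaining `r` contribute `O(q ^ ((n-5)P - P/120))` by the convergence above
(`exists_mainTerm_bound`). The singular integral is positive because the integral of a character
over a compact open group is its volume or zero (`singularIntegral_pos`).

Partial sums of the singular series over the divisors of `R` count solutions of the congruences
modulo `R`; for `R = ∏_{deg w ≤ m} w ^ m` they factor over the primes. The product of the factors at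
large primes differs from `1` by part of the tail of a convergent series, so it is at least `1/2`;
each of the other factors is bounded from below by Hensel's lemma in the two variables of a minor of
the Jacobian matrix (`Approximable.exists_density_bound`). The local zero may be the origin, where
the Jacobian matrix vanishes; a multiple of a global zero, which exists by the Chevalley–Warning
theorem, is then used in its place (`exists_global_zero`, `singularSeries_pos`).
-/

namespace FFCircle

noncomputable section

/-! ### Absolute values -/

section AbsoluteValues

variable {F : Type*} [Field F]

theorem ofPoly_C_mul_X_pow (a : F) (k : ℕ) :
    ofPoly (Polynomial.C a * Polynomial.X ^ k) = HahnSeries.single (-(k : ℤ)) a := by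
  simp only [ofPoly, Polynomial.coe_eval₂RingHom, Polynomial.eval₂_mul, Polynomial.eval₂_C,
    Polynomial.eval₂_X_pow, HahnSeries.single_pow]
  rw [HahnSeries.C_apply, HahnSeries.single_mul_single]
  simp

theorem coeff_ofPoly (f : F[X]) (m : ℤ) :
    (ofPoly f).coeff m = if m ≤ 0 then f.coeff (-m).toNat else 0 := by
  induction f using Polynomial.induction_on' with
  | add f g hf hg => rw [map_add, HahnSeries.coeff_add, hf, hg]; split_ifs <;> simp
  | monomial k a =>
    rw [← Polynomial.C_mul_X_pow_eq_monomial, ofPoly_C_mul_X_pow, HahnSeries.coeff_single,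
      Polynomial.coeff_C_mul_X_pow]
    split_ifs <;> first | rfl | omega

theorem ofPoly_injective : Function.Injective (ofPoly (F := F)) := by
  intro f g h
  ext k
  have := congrArg (fun a : KInf F => a.coeff (-(k : ℤ))) h
  simpa [coeff_ofPoly] using this

theorem ofPoly_eq_zero {f : F[X]} : ofPoly f = 0 ↔ f = 0 :=
  map_eq_zero_iff _ ofPoly_injective

theorem order_ofPoly {f : F[X]} (hf : f ≠ 0) : (ofPoly f).order = -(f.natDegree : ℤ) := by
  apply le_antisymm
  · apply HahnSeries.order_le_of_coeff_ne_zero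
    simpa [coeff_ofPoly] using hf
  · by_contra! h
    have h1 := HahnSeries.coeff_order_eq_zero.not.mpr (ofPoly_eq_zero.not.mpr hf)
    rw [coeff_ofPoly] at h1
    split_ifs at h1 with h2
    · exact h1 (Polynomial.coeff_eq_zero_of_natDegree_lt (by omega))
    · exact h1 rfl

variable [Fintype F]

variable (F) in
theorem one_lt_q : (1 : ℝ) < Fintype.card F := by exact_mod_cast Fintype.one_lt_card

variable (F) in
theorem q_pos : (0 : ℝ) < Fintype.card F := by linarith [one_lt_q F]

@[simp] theorem absInf_zero : absInf (0 : KInf F) = 0 := by simp [absInf]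

theorem absInf_of_ne {α : KInf F} (h : α ≠ 0) :
    absInf α = (Fintype.card F : ℝ) ^ (-α.order) := by simp [absInf, h]

theorem absInf_pos {α : KInf F} (h : α ≠ 0) : 0 < absInf α := by
  rw [absInf_of_ne h]; exact zpow_pos (q_pos F) _

theorem absInf_nonneg (α : KInf F) : 0 ≤ absInf α := by
  by_cases h : α = 0
  · simp [h]
  · exact (absInf_pos h).le

theorem absInf_mul (α β : KInf F) : absInf (α * β) = absInf α * absInf β := by
  by_cases ha : α = 0
  · simp [ha]
  by_cases hb : β = 0
  · simp [hb]
  rw [absInf_of_ne ha, absInf_of_ne hb, absInf_of_ne (mul_ne_zero ha hb),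
    HahnSeries.order_mul ha hb, ← zpow_add₀ (q_pos F).ne']
  congr 1; ring

@[simp] theorem absInf_one : absInf (1 : KInf F) = 1 := by
  rw [absInf_of_ne one_ne_zero]; simp

@[simp] theorem absInf_neg (α : KInf F) : absInf (-α) = absInf α := by
  by_cases ha : α = 0
  · simp [ha]
  rw [absInf_of_ne ha, absInf_of_ne (neg_ne_zero.mpr ha), HahnSeries.order_neg]

theorem absInf_pow (α : KInf F) (k : ℕ) : absInf (α ^ k) = absInf α ^ k := by
  induction k with
  | zero => simp
  | succ k ih => rw [pow_succ, pow_succ, absInf_mul, ih]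

theorem absInf_inv (α : KInf F) : absInf α⁻¹ = (absInf α)⁻¹ := by
  by_cases ha : α = 0
  · simp [ha]
  have : absInf α⁻¹ * absInf α = 1 := by rw [← absInf_mul, inv_mul_cancel₀ ha, absInf_one]
  exact eq_inv_of_mul_eq_one_left this

theorem absInf_le_zpow_iff (α : KInf F) (k : ℤ) :
    absInf α ≤ (Fintype.card F : ℝ) ^ k ↔ ∀ m : ℤ, m < -k → α.coeff m = 0 := by
  by_cases h : α = 0
  · simp [h, (zpow_pos (q_pos F) k).le]
  rw [absInf_of_ne h, zpow_le_zpow_iff_right₀ (one_lt_q F)]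
  constructor
  · intro ho m hm
    exact HahnSeries.coeff_eq_zero_of_lt_order (by omega)
  · intro hc
    by_contra! ho
    exact h (HahnSeries.coeff_order_eq_zero.mp (hc α.order (by omega)))

theorem absInf_lt_zpow_iff (α : KInf F) (k : ℤ) :
    absInf α < (Fintype.card F : ℝ) ^ k ↔ ∀ m : ℤ, m ≤ -k → α.coeff m = 0 := by
  have : absInf α < (Fintype.card F : ℝ) ^ k ↔ absInf α ≤ (Fintype.card F : ℝ) ^ (k - 1) := by
    by_cases h : α = 0
    · simp [h, (zpow_pos (q_pos F) k), (zpow_pos (q_pos F) (k - 1)).le]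
    rw [absInf_of_ne h, zpow_le_zpow_iff_right₀ (one_lt_q F), zpow_lt_zpow_iff_right₀ (one_lt_q F)]
    omega
  rw [this, absInf_le_zpow_iff]
  exact forall_congr' fun m => imp_congr_left (by omega)

theorem absInf_add_le (α β : KInf F) : absInf (α + β) ≤ max (absInf α) (absInf β) := by
  by_cases ha : α = 0
  · simp [ha]
  by_cases hb : β = 0
  · simp [hb]
  wlog h : absInf α ≤ absInf β generalizing α β
  · rw [add_comm, max_comm]; exact this β α hb ha (by linarith)
  rw [max_eq_right h, absInf_of_ne hb, absInf_le_zpow_iff]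
  rw [absInf_of_ne hb, absInf_le_zpow_iff] at h
  intro m hm
  rw [HahnSeries.coeff_add, h m hm, HahnSeries.coeff_eq_zero_of_lt_order (by omega), add_zero]

theorem absInf_sub_le (α β : KInf F) : absInf (α - β) ≤ max (absInf α) (absInf β) := by
  rw [sub_eq_add_neg, ← absInf_neg β]; exact absInf_add_le _ _

theorem absInf_sum_le {ι : Type*} (s : Finset ι) (f : ι → KInf F) {B : ℝ} (hB : 0 ≤ B)
    (h : ∀ i ∈ s, absInf (f i) ≤ B) : absInf (∑ i ∈ s, f i) ≤ B := by
  classical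
  induction s using Finset.induction_on with
  | empty => simpa
  | insert a s ha ih =>
    rw [Finset.sum_insert ha]
    exact (absInf_add_le _ _).trans (max_le (h _ (Finset.mem_insert_self _ _))
      (ih fun i hi => h i (Finset.mem_insert_of_mem hi)))

theorem absInf_ofPoly (f : F[X]) : absInf (ofPoly f) = polyAbs f := by
  by_cases hf : f = 0
  · simp [hf, polyAbs]
  rw [absInf_of_ne (ofPoly_eq_zero.not.mpr hf), order_ofPoly hf]
  simp [polyAbs, hf]

theorem absInf_tInf_pow (k : ℕ) : absInf (tInf ^ k : KInf F) = (Fintype.card F : ℝ) ^ k := by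
  rw [absInf_pow, tInf, absInf_ofPoly]; simp [polyAbs]

@[simp] theorem polyAbs_zero : polyAbs (0 : F[X]) = 0 := by simp [polyAbs]

theorem polyAbs_of_ne {f : F[X]} (h : f ≠ 0) :
    polyAbs f = (Fintype.card F : ℝ) ^ f.natDegree := by simp [polyAbs, h]

theorem one_le_polyAbs {f : F[X]} (h : f ≠ 0) : 1 ≤ polyAbs f := by
  rw [polyAbs_of_ne h]; exact one_le_pow₀ (one_lt_q F).le

theorem polyAbs_pos {f : F[X]} (h : f ≠ 0) : 0 < polyAbs f := by
  linarith [one_le_polyAbs h]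

theorem polyAbs_nonneg (f : F[X]) : 0 ≤ polyAbs f := by
  rw [← absInf_ofPoly]; exact absInf_nonneg _

theorem polyAbs_mul (f g : F[X]) : polyAbs (f * g) = polyAbs f * polyAbs g := by
  rw [← absInf_ofPoly, map_mul, absInf_mul, absInf_ofPoly, absInf_ofPoly]

@[simp] theorem polyAbs_one : polyAbs (1 : F[X]) = 1 := by simp [polyAbs]

theorem polyAbs_pow (f : F[X]) (k : ℕ) : polyAbs (f ^ k) = polyAbs f ^ k := by
  rw [← absInf_ofPoly, map_pow, absInf_pow, absInf_ofPoly]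

theorem polyAbs_lt_iff {f g : F[X]} : polyAbs f < polyAbs g ↔ f.degree < g.degree := by
  by_cases hg : g = 0
  · simp [hg, polyAbs_nonneg]
  by_cases hf : f = 0
  · simp [hf, polyAbs_pos hg, bot_lt_iff_ne_bot, hg]
  rw [polyAbs_of_ne hf, polyAbs_of_ne hg, pow_lt_pow_iff_right₀ (one_lt_q F),
    Polynomial.degree_eq_natDegree hf, Polynomial.degree_eq_natDegree hg, Nat.cast_lt]

theorem polyAbs_le_of_dvd {f g : F[X]} (hg : g ≠ 0) (h : f ∣ g) : polyAbs f ≤ polyAbs g := by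
  obtain ⟨k, rfl⟩ := h
  have hk : k ≠ 0 := right_ne_zero_of_mul hg
  rw [polyAbs_mul]
  nlinarith [one_le_polyAbs hk, polyAbs_nonneg f]

theorem eq_zero_of_dvd_of_polyAbs_lt {f g : F[X]} (h : g ∣ f) (hlt : polyAbs f < polyAbs g) :
    f = 0 := by
  by_contra hf
  exact absurd (polyAbs_le_of_dvd hf h) (not_le.mpr hlt)

theorem polyAbs_sub_lt {f g : F[X]} {B : ℝ} (hf : polyAbs f < B) (hg : polyAbs g < B) :
    polyAbs (f - g) < B := by
  rw [← absInf_ofPoly] at hf hg ⊢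
  rw [map_sub]
  exact (absInf_sub_le _ _).trans_lt (max_lt hf hg)

end AbsoluteValues

/-! ### Residue rings and averages of periodic functions -/

section Averages

variable {F : Type*} [Field F]

/-- The residue ring `F[t] / (r)`. -/
abbrev Res (r : F[X]) : Type _ := F[X] ⧸ Ideal.span {r}

/-- The reduction map `F[t] → F[t] / (r)`. -/
abbrev toRes (r : F[X]) : F[X] →+* Res r := Ideal.Quotient.mk (Ideal.span {r})

theorem toRes_eq_iff {r f g : F[X]} : toRes r f = toRes r g ↔ r ∣ f - g := by
  rw [Ideal.Quotient.eq, Ideal.mem_span_singleton]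

theorem toRes_eq_zero {r f : F[X]} : toRes r f = 0 ↔ r ∣ f := by
  rw [Ideal.Quotient.eq_zero_iff_dvd]

theorem toRes_out {r : F[X]} (x : Res r) : toRes r x.out = x := Ideal.Quotient.mk_out x

/-- The function `g` on `F[t]ⁿ` depends only on its argument modulo `r`. -/
def PeriodicMod {n : ℕ} (r : F[X]) (g : (Fin n → F[X]) → ℂ) : Prop :=
  ∀ x y : Fin n → F[X], (∀ i, r ∣ x i - y i) → g x = g y

theorem PeriodicMod.apply_out {n : ℕ} {r : F[X]} {g : (Fin n → F[X]) → ℂ} (hg : PeriodicMod r g)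
    (x : Fin n → F[X]) : g (fun i => (toRes r (x i)).out) = g x :=
  hg _ _ fun _ => toRes_eq_iff.mp (toRes_out _)

theorem PeriodicMod.of_dvd {n : ℕ} {r s : F[X]} {g : (Fin n → F[X]) → ℂ} (hg : PeriodicMod r g)
    (h : r ∣ s) : PeriodicMod s g :=
  fun x y hxy => hg x y fun i => h.trans (hxy i)

theorem PeriodicMod.mul {n : ℕ} {r : F[X]} {g h : (Fin n → F[X]) → ℂ} (hg : PeriodicMod r g)
    (hh : PeriodicMod r h) : PeriodicMod r (fun x => g x * h x) :=
  fun x y hxy => by simp only; rw [hg x y hxy, hh x y hxy]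

theorem PeriodicMod.exists_lift {n : ℕ} {r : F[X]} {g : (Fin n → F[X]) → ℂ}
    (hg : PeriodicMod r g) : ∃ G : (Fin n → Res r) → ℂ, ∀ x, g x = G fun i => toRes r (x i) :=
  ⟨fun x => g fun i => (x i).out, fun x => (hg.apply_out x).symm⟩

variable [Fintype F]

theorem finite_res {r : F[X]} (hr : r ≠ 0) : Finite (Res r) := by
  have : Module.Finite F (Res r) := by
    have := (AdjoinRoot.powerBasis hr).finite
    exact this
  exact Module.finite_of_finite F

theorem card_res {r : F[X]} (hr : r ≠ 0) : (Nat.card (Res r) : ℝ) = polyAbs r := by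
  have : Module.Finite F (Res r) := by
    have := (AdjoinRoot.powerBasis hr).finite
    exact this
  have := Module.natCard_eq_pow_finrank (K := F) (V := Res r)
  rw [this, finrank_quotient_span_eq_natDegree, polyAbs_of_ne hr]
  simp

/-- The mean value over residues modulo `r` of a function on `F[t]ⁿ`; meaningful for functions
that are periodic modulo `r`. -/
def avg {n : ℕ} (r : F[X]) (g : (Fin n → F[X]) → ℂ) : ℂ :=
  ((polyAbs r ^ n : ℝ) : ℂ)⁻¹ * ∑ᶠ x : Fin n → Res r, g fun i => (x i).out

/-- The mean value of a function that factors through the residues. -/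
theorem avg_eq_sum {n : ℕ} {r : F[X]} [Fintype (Res r)] (g : (Fin n → F[X]) → ℂ)
    (G : (Fin n → Res r) → ℂ) (hG : ∀ x, g x = G fun i => toRes r (x i)) :
    avg r g = ((polyAbs r ^ n : ℝ) : ℂ)⁻¹ * ∑ x, G x := by
  rw [avg, finsum_eq_sum_of_fintype]
  congr 1
  refine Finset.sum_congr rfl fun x _ => ?_
  rw [hG]
  simp only [toRes_out]

theorem card_res_pi {n : ℕ} {r : F[X]} (hr : r ≠ 0) [Fintype (Res r)] :
    (Fintype.card (Fin n → Res r) : ℝ) = polyAbs r ^ n := by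
  rw [Fintype.card_fun, Fintype.card_fin, Nat.cast_pow, ← card_res hr, Nat.card_eq_fintype_card]

theorem bijOn_toRes {n : ℕ} {r : F[X]} (hr : r ≠ 0) :
    Set.BijOn (fun (x : Fin n → F[X]) i => toRes r (x i)) {x | ∀ i, polyAbs (x i) < polyAbs r}
      Set.univ := by
  refine ⟨fun _ _ => Set.mem_univ _, fun x hx y hy h => ?_, fun x _ => ?_⟩
  · funext i
    exact sub_eq_zero.mp (eq_zero_of_dvd_of_polyAbs_lt (toRes_eq_iff.mp (congrFun h i))
      (polyAbs_sub_lt (hx i) (hy i)))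
  · refine ⟨fun i => (x i).out % r, fun i => ?_, ?_⟩
    · rw [polyAbs_lt_iff]
      exact EuclideanDomain.mod_lt _ hr
    · funext i
      conv_rhs => rw [← toRes_out (x i)]
      rw [toRes_eq_iff]
      exact ⟨-((x i).out / r), by linear_combination EuclideanDomain.mod_add_div (x i).out r⟩

theorem avg_eq_finsum_box {n : ℕ} {r : F[X]} (hr : r ≠ 0) {g : (Fin n → F[X]) → ℂ}
    (hg : PeriodicMod r g) : avg r g = ((polyAbs r ^ n : ℝ) : ℂ)⁻¹ *
      ∑ᶠ x ∈ {x : Fin n → F[X] | ∀ i, polyAbs (x i) < polyAbs r}, g x := by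
  rw [avg]
  congr 1
  rw [← finsum_mem_univ]
  refine (finsum_mem_eq_of_bijOn _ (bijOn_toRes hr) fun x _ => ?_).symm
  exact (hg.apply_out x).symm

theorem avg_congr {n : ℕ} {r : F[X]} {g h : (Fin n → F[X]) → ℂ} (H : ∀ x, g x = h x) :
    avg r g = avg r h := by rw [funext H]

theorem avg_const_mul {n : ℕ} {r : F[X]} (hr : r ≠ 0) (c : ℂ) (g : (Fin n → F[X]) → ℂ) :
    avg r (fun x => c * g x) = c * avg r g := by
  have := finite_res hr
  have := Fintype.ofFinite (Res r)
  simp only [avg, finsum_eq_sum_of_fintype, ← Finset.mul_sum]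
  ring

theorem avg_sum {n : ℕ} {r : F[X]} (hr : r ≠ 0) {ι : Type*} (s : Finset ι)
    (g : ι → (Fin n → F[X]) → ℂ) :
    avg r (fun x => ∑ i ∈ s, g i x) = ∑ i ∈ s, avg r (g i) := by
  have := finite_res hr
  have := Fintype.ofFinite (Res r)
  simp only [avg, finsum_eq_sum_of_fintype, ← Finset.mul_sum]
  rw [Finset.sum_comm]

theorem avg_const {n : ℕ} {r : F[X]} (hr : r ≠ 0) (c : ℂ) :
    avg r (fun _ : Fin n → F[X] => c) = c := by
  have := finite_res hr
  have := Fintype.ofFinite (Res r)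
  have h := polyAbs_pos hr
  rw [avg, finsum_eq_sum_of_fintype, Finset.sum_const, Finset.card_univ, nsmul_eq_mul,
    ← Complex.ofReal_natCast, card_res_pi hr]
  rw [← mul_assoc, inv_mul_cancel₀, one_mul]
  exact_mod_cast (pow_pos h n).ne'

theorem norm_avg_le {n : ℕ} {r : F[X]} (hr : r ≠ 0) {g : (Fin n → F[X]) → ℂ} {B : ℝ}
    (h : ∀ x, ‖g x‖ ≤ B) : ‖avg r g‖ ≤ B := by
  have := finite_res hr
  have := Fintype.ofFinite (Res r)
  have hp := pow_pos (polyAbs_pos hr) n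
  rw [avg, finsum_eq_sum_of_fintype, norm_mul, norm_inv, Complex.norm_real,
    Real.norm_of_nonneg hp.le, inv_mul_le_iff₀ hp, ← card_res_pi hr]
  refine (norm_sum_le _ _).trans ((Finset.sum_le_sum fun x _ => h _).trans ?_)
  simp

theorem avg_shift {n : ℕ} {r : F[X]} (hr : r ≠ 0) {g : (Fin n → F[X]) → ℂ}
    (hg : PeriodicMod r g) (h : Fin n → F[X]) : avg r (fun x => g (x + h)) = avg r g := by
  have := finite_res hr
  have := Fintype.ofFinite (Res r)
  obtain ⟨G, hG⟩ := hg.exists_lift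
  rw [avg_eq_sum g G hG, avg_eq_sum _ (fun x => G (x + fun i => toRes r (h i)))]
  · exact congrArg _ (Equiv.sum_comp (Equiv.addRight fun i => toRes r (h i)) G)
  · intro x
    rw [hG]
    rfl

theorem sum_comp_of_surjective {G H : Type*} [AddCommGroup G] [AddCommGroup H] [Fintype G]
    [Fintype H] (π : G →+ H) (hπ : Function.Surjective π) (f : H → ℂ) :
    (Fintype.card H : ℂ) * ∑ x, f (π x) = (Fintype.card G : ℂ) * ∑ y, f y := by
  classical
  have key : ∀ y : H, (Finset.univ.filter fun x => π x = y).card =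
      (Finset.univ.filter fun x => π x = 0).card := fun y => by
    obtain ⟨x₀, rfl⟩ := hπ y
    refine Finset.card_bij (fun x _ => x - x₀) ?_ ?_ ?_
    · intro a ha; simpa [sub_eq_zero] using ha
    · intro a _ b _ hab; simpa using hab
    · intro b hb; exact ⟨b + x₀, by simpa using hb, by simp⟩
  have h1 : ∀ f : H → ℂ, ∑ x, f (π x) =
      ((Finset.univ.filter fun x => π x = 0).card : ℂ) * ∑ y, f y := fun f => by
    rw [← Finset.sum_fiberwise Finset.univ π fun x => f (π x), Finset.mul_sum]
    refine Finset.sum_congr rfl fun y _ => ?_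
    rw [Finset.sum_congr rfl (g := fun _ => f y), Finset.sum_const, key, nsmul_eq_mul]
    intro x hx
    rw [(Finset.mem_filter.mp hx).2]
  have h2 := h1 fun _ => 1
  simp only [Finset.sum_const, Finset.card_univ, nsmul_eq_mul, mul_one] at h2
  rw [h1, h2]; ring

/-- The average of a function that is periodic modulo `m` may be taken modulo any multiple of `m`. -/
theorem avg_of_dvd {n : ℕ} {m r : F[X]} (hr : r ≠ 0) (hmr : m ∣ r) {g : (Fin n → F[X]) → ℂ}
    (hg : PeriodicMod m g) : avg r g = avg m g := by
  have hm : m ≠ 0 := fun h => hr (by simpa [h] using hmr)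
  have := finite_res hr
  have := Fintype.ofFinite (Res r)
  have := finite_res hm
  have := Fintype.ofFinite (Res m)
  obtain ⟨G, hG⟩ := hg.exists_lift
  let π₀ : Res r →+* Res m := Ideal.Quotient.factor
    (Ideal.span_singleton_le_span_singleton.mpr hmr)
  have hπ₀ : ∀ f, π₀ (toRes r f) = toRes m f := fun f => by simp [π₀]
  let π : (Fin n → Res r) →+ (Fin n → Res m) :=
    { toFun := fun x i => π₀ (x i)
      map_zero' := by funext i; simp
      map_add' := fun x y => by funext i; simp }
  have hπ : Function.Surjective π := fun y => ⟨fun i => toRes r (y i).out, by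
    funext i
    exact (hπ₀ _).trans (toRes_out _)⟩
  have h := sum_comp_of_surjective π hπ G
  rw [avg_eq_sum g G hG, avg_eq_sum g (fun x => G (π x)) fun x => by
    rw [hG]; rfl]
  rw [← Complex.ofReal_natCast, ← Complex.ofReal_natCast, card_res_pi hr, card_res_pi hm] at h
  have h1 : ((polyAbs r ^ n : ℝ) : ℂ) ≠ 0 := by exact_mod_cast (pow_pos (polyAbs_pos hr) n).ne'
  have h2 : ((polyAbs m ^ n : ℝ) : ℂ) ≠ 0 := by exact_mod_cast (pow_pos (polyAbs_pos hm) n).ne'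
  field_simp
  linear_combination h

/-- The Chinese remainder theorem for averages. -/
theorem avg_mul_of_coprime {n : ℕ} {r s : F[X]} (hr : r ≠ 0) (hs : s ≠ 0) (hrs : IsCoprime r s)
    {g h : (Fin n → F[X]) → ℂ} (hg : PeriodicMod r g) (hh : PeriodicMod s h) :
    avg (r * s) (fun x => g x * h x) = avg r g * avg s h := by
  have hmul := mul_ne_zero hr hs
  have := finite_res hr
  have := Fintype.ofFinite (Res r)
  have := finite_res hs
  have := Fintype.ofFinite (Res s)
  have := finite_res hmul
  have := Fintype.ofFinite (Res (r * s))
  obtain ⟨G, hG⟩ := hg.exists_lift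
  obtain ⟨H, hH⟩ := hh.exists_lift
  let π : (Fin n → Res (r * s)) → (Fin n → Res r) × (Fin n → Res s) := fun x =>
    (fun i => toRes r (x i).out, fun i => toRes s (x i).out)
  have hinj : Function.Injective π := by
    intro x y hxy
    funext i
    have h1 := toRes_eq_iff.mp (congrFun (congrArg Prod.fst hxy) i)
    have h2 := toRes_eq_iff.mp (congrFun (congrArg Prod.snd hxy) i)
    rw [← toRes_out (x i), ← toRes_out (y i), toRes_eq_iff]
    exact hrs.mul_dvd h1 h2
  have hcard : Fintype.card (Fin n → Res (r * s)) =
      Fintype.card ((Fin n → Res r) × (Fin n → Res s)) := by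
    have : (Fintype.card (Fin n → Res (r * s)) : ℝ) =
      Fintype.card ((Fin n → Res r) × (Fin n → Res s)) := by
      rw [Fintype.card_prod, Nat.cast_mul, card_res_pi hmul, card_res_pi hr, card_res_pi hs,
        polyAbs_mul, mul_pow]
    exact_mod_cast this
  have hbij : Function.Bijective π := (Fintype.bijective_iff_injective_and_card π).mpr ⟨hinj, hcard⟩
  rw [avg_eq_sum g G hG, avg_eq_sum h H hH, avg, finsum_eq_sum_of_fintype, polyAbs_mul, mul_pow]
  have : ∑ x : Fin n → Res (r * s), g (fun i => (x i).out) * h (fun i => (x i).out) =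
      (∑ x, G x) * ∑ x, H x := by
    rw [Finset.sum_mul_sum, ← Fintype.sum_prod_type', ← Function.Bijective.sum_comp hbij]
    exact Finset.sum_congr rfl fun x _ => by rw [hG, hH]
  rw [this]
  push_cast
  rw [mul_inv]
  ring

end Averages


/-! ### The additive character -/

section Characters

variable (p : ℕ) [Fact p.Prime] {F : Type*} [Field F] [Algebra (ZMod p) F]

theorem psi_add (α β : KInf F) : psi p (α + β) = psi p α * psi p β := by
  simp [psi, AddChar.map_add_eq_mul]

@[simp] theorem psi_zero : psi p (0 : KInf F) = 1 := by simp [psi]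

@[simp] theorem norm_psi (α : KInf F) : ‖psi p α‖ = 1 := by
  have : NeZero p := ⟨(Fact.out : p.Prime).ne_zero⟩
  rw [psi, ZMod.stdAddChar_apply]
  exact Circle.norm_coe _

@[simp] theorem psi_ofPoly (f : F[X]) : psi p (ofPoly f) = 1 := by
  simp [psi, coeff_ofPoly]

theorem psi_of_absInf_le [Fintype F] {α : KInf F} (h : absInf α < (Fintype.card F : ℝ) ^ (-1 : ℤ)) :
    psi p α = 1 := by
  rw [absInf_lt_zpow_iff] at h
  simp [psi, h 1 (by norm_num)]

/-- The trace form is non-degenerate, so `ψ` is non-trivial on `F t⁻¹`. -/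
theorem exists_psi_single_ne_one [Finite F] : ∃ u : F, u ≠ 0 ∧
    psi p (HahnSeries.single (1 : ℤ) u : KInf F) ≠ 1 := by
  have hp : NeZero p := ⟨(Fact.out : p.Prime).ne_zero⟩
  have hfin : Module.Finite (ZMod p) F := Module.Finite.of_finite
  have : ∃ u : F, Algebra.trace (ZMod p) F u ≠ 0 := by
    by_contra! h
    exact Algebra.trace_ne_zero (ZMod p) F (LinearMap.ext h)
  obtain ⟨u, hu⟩ := this
  refine ⟨u, fun h => hu (by simp [h]), ?_⟩
  simp only [psi, HahnSeries.coeff_single_same]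
  intro h
  exact hu (ZMod.injective_stdAddChar (h.trans (AddChar.map_zero_eq_one _).symm))

theorem exists_psi_mul_ne_one [Finite F] {α : KInf F} (h : α ≠ 0) :
    ∃ β : KInf F, psi p (α * β) ≠ 1 ∧ α * β ≠ 0 ∧ (α * β).order = 1 := by
  obtain ⟨u, hu0, hu⟩ := exists_psi_single_ne_one p (F := F)
  refine ⟨α⁻¹ * HahnSeries.single (1 : ℤ) u, ?_⟩
  rw [mul_inv_cancel_left₀ h]
  exact ⟨hu, by simpa using hu0, HahnSeries.order_single hu0⟩

/-- The additive character `f ↦ ψ(f / r)` of `F[t] / (r)`. -/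
def chi (r : F[X]) : AddChar (Res r) ℂ where
  toFun x := psi p (ofPoly x.out / ofPoly r)
  map_zero_eq_one' := by
    have : r ∣ (0 : Res r).out := by rw [← toRes_eq_zero, toRes_out]
    obtain ⟨k, hk⟩ := this
    by_cases hr : r = 0
    · simp [hr]
    rw [hk, map_mul, mul_div_cancel_left₀ _ (ofPoly_eq_zero.not.mpr hr), psi_ofPoly]
  map_add_eq_mul' x y := by
    have : r ∣ (x + y).out - (x.out + y.out) := by
      rw [← toRes_eq_iff, toRes_out, map_add, toRes_out, toRes_out]
    obtain ⟨k, hk⟩ := this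
    by_cases hr : r = 0
    · simp [hr]
    rw [← psi_add, sub_eq_iff_eq_add.mp hk, map_add, map_mul, map_add, ← add_div, add_div,
      mul_div_cancel_left₀ _ (ofPoly_eq_zero.not.mpr hr), psi_add, psi_ofPoly, one_mul]

theorem psi_div_congr {r f g : F[X]} (h : r ∣ f - g) :
    psi p (ofPoly f / ofPoly r) = psi p (ofPoly g / ofPoly r) := by
  obtain ⟨k, hk⟩ := h
  by_cases hr : r = 0
  · simp [hr]
  rw [sub_eq_iff_eq_add.mp hk, map_add, map_mul, add_div,
    mul_div_cancel_left₀ _ (ofPoly_eq_zero.not.mpr hr), psi_add, psi_ofPoly, one_mul]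

theorem chi_toRes (r f : F[X]) : chi p r (toRes r f) = psi p (ofPoly f / ofPoly r) :=
  psi_div_congr p (toRes_eq_iff.mp (toRes_out _))

theorem norm_chi (r : F[X]) (x : Res r) : ‖chi p r x‖ = 1 := norm_psi p _

/-- The characters `ψ(f · / r)` separate the residue classes modulo `r`. -/
theorem dvd_of_forall_psi_eq_one [Finite F] {r f : F[X]} (hr : r ≠ 0)
    (h : ∀ g : F[X], psi p (ofPoly (f * g) / ofPoly r) = 1) : r ∣ f := by
  have := Fintype.ofFinite F
  have hr' := ofPoly_eq_zero.not.mpr hr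
  rw [← EuclideanDomain.mod_eq_zero]
  by_contra hne
  set s := f % r with hs
  have hdeg : s.degree < r.degree := EuclideanDomain.mod_lt f hr
  have hnat : s.natDegree < r.natDegree := Polynomial.natDegree_lt_natDegree hne hdeg
  obtain ⟨u, hu0, hu⟩ := exists_psi_single_ne_one p (F := F)
  have key : ∀ g : F[X], psi p (ofPoly (s * g) / ofPoly r) = 1 := fun g => by
    rw [← h g]
    apply psi_div_congr
    exact ⟨-(f / r) * g, by linear_combination g * EuclideanDomain.mod_add_div f r⟩
  set α : KInf F := ofPoly s / ofPoly r with hα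
  have hα0 : α ≠ 0 := div_ne_zero (ofPoly_eq_zero.not.mpr hne) hr'
  have hord : α.order = (r.natDegree : ℤ) - s.natDegree := by
    have : (α * ofPoly r).order = (ofPoly s).order := by rw [hα, div_mul_cancel₀ _ hr']
    rw [HahnSeries.order_mul hα0 hr', order_ofPoly hr, order_ofPoly hne] at this
    omega
  have hlead : α.coeff α.order ≠ 0 := by
    rwa [Ne, HahnSeries.coeff_order_eq_zero]
  apply hu
  have h2 := key (Polynomial.C (u / α.coeff α.order) *
    Polynomial.X ^ (r.natDegree - s.natDegree - 1))
  rw [map_mul, mul_div_right_comm, ← hα, ofPoly_C_mul_X_pow] at h2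
  rw [← h2, psi, psi]
  congr 2
  rw [HahnSeries.coeff_single_same]
  have h3 : (1 : ℤ) = α.order + (-((r.natDegree - s.natDegree - 1 : ℕ) : ℤ)) := by omega
  rw [h3, HahnSeries.coeff_mul_single_add]
  field_simp

theorem chi_isPrimitive [Finite F] {r : F[X]} (hr : r ≠ 0) : (chi p r).IsPrimitive := by
  intro a ha h
  apply ha
  rw [← toRes_out a, toRes_eq_zero]
  refine dvd_of_forall_psi_eq_one p hr fun g => ?_
  have := DFunLike.congr_fun h (toRes r g)
  rw [AddChar.mulShift_apply, AddChar.one_apply] at this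
  conv_lhs at this => rw [← toRes_out a]
  rw [← map_mul, chi_toRes] at this
  exact this

end Characters

/-! ### Cubic and quadratic forms given by symmetric tensors -/

section Tensors

variable {n : ℕ} {R : Type*} [CommRing R]

/-- The vector `(∑_{i,j} c_{ijk} x_i y_j)_k`. -/
def triV (c : Fin n → Fin n → Fin n → R) (x y : Fin n → R) : Fin n → R :=
  fun k => ∑ i, ∑ j, c i j k * x i * y j

/-- A tensor that is invariant under permutations of its three indices. -/
def SymTensor (c : Fin n → Fin n → Fin n → R) : Prop :=
  (∀ i j k, c i j k = c j i k) ∧ ∀ i j k, c i j k = c i k j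

/-- The trilinear form of the tensor `c`. -/
def tri (c : Fin n → Fin n → Fin n → R) (x y z : Fin n → R) : R := triV c x y ⬝ᵥ z

variable (c : Fin n → Fin n → Fin n → R)

theorem tri_eq_sum (x y z : Fin n → R) :
    tri c x y z = ∑ i, ∑ j, ∑ k, c i j k * x i * y j * z k := by
  simp only [tri, triV, dotProduct, Finset.sum_mul]
  rw [Finset.sum_comm]
  exact Finset.sum_congr rfl fun i _ => Finset.sum_comm

theorem triV_add_left (x x' y : Fin n → R) : triV c (x + x') y = triV c x y + triV c x' y := by
  funext k; simp [triV, ← Finset.sum_add_distrib, mul_add, add_mul]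

theorem triV_add_right (x y y' : Fin n → R) : triV c x (y + y') = triV c x y + triV c x y' := by
  funext k; simp [triV, ← Finset.sum_add_distrib, mul_add]

theorem triV_smul_left (a : R) (x y : Fin n → R) : triV c (a • x) y = a • triV c x y := by
  funext k
  simp only [triV, Pi.smul_apply, smul_eq_mul, Finset.mul_sum]
  exact Finset.sum_congr rfl fun i _ => Finset.sum_congr rfl fun j _ => by ring

theorem triV_smul_right (a : R) (x y : Fin n → R) : triV c x (a • y) = a • triV c x y := by
  funext k
  simp only [triV, Pi.smul_apply, smul_eq_mul, Finset.mul_sum]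
  exact Finset.sum_congr rfl fun i _ => Finset.sum_congr rfl fun j _ => by ring

theorem triV_const_smul (a : R) (x y : Fin n → R) :
    triV (fun i j k => a * c i j k) x y = a • triV c x y := by
  funext k
  simp only [triV, Pi.smul_apply, smul_eq_mul, Finset.mul_sum]
  exact Finset.sum_congr rfl fun i _ => Finset.sum_congr rfl fun j _ => by ring

theorem triV_map {S : Type*} [CommRing S] (φ : R →+* S) (x y : Fin n → R) :
    triV (fun i j k => φ (c i j k)) (φ ∘ x) (φ ∘ y) = φ ∘ triV c x y := by
  funext k; simp [triV]

theorem tri_map {S : Type*} [CommRing S] (φ : R →+* S) (x y z : Fin n → R) :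
    tri (fun i j k => φ (c i j k)) (φ ∘ x) (φ ∘ y) (φ ∘ z) = φ (tri c x y z) := by
  simp [tri_eq_sum]

variable {c}

theorem SymTensor.triV_comm (hc : SymTensor c) (x y : Fin n → R) : triV c x y = triV c y x := by
  funext k
  simp only [triV]
  rw [Finset.sum_comm]
  exact Finset.sum_congr rfl fun i _ => Finset.sum_congr rfl fun j _ => by rw [hc.1]; ring

theorem SymTensor.tri_swap (hc : SymTensor c) (x y z : Fin n → R) :
    tri c x y z = tri c x z y := by
  simp only [tri_eq_sum]
  refine Finset.sum_congr rfl fun i _ => ?_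
  rw [Finset.sum_comm]
  exact Finset.sum_congr rfl fun j _ => Finset.sum_congr rfl fun k _ => by rw [hc.2]; ring

theorem SymTensor.tri_swap_left (hc : SymTensor c) (x y z : Fin n → R) :
    tri c x y z = tri c y x z := by rw [tri, tri, hc.triV_comm]

theorem SymTensor.map (hc : SymTensor c) {S : Type*} [CommRing S] (φ : R →+* S) :
    SymTensor (fun i j k => φ (c i j k)) :=
  ⟨fun i j k => congrArg φ (hc.1 i j k), fun i j k => congrArg φ (hc.2 i j k)⟩

theorem SymTensor.const_mul (hc : SymTensor c) (a : R) :
    SymTensor (fun i j k => a * c i j k) :=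
  ⟨fun i j k => congrArg (a * ·) (hc.1 i j k), fun i j k => congrArg (a * ·) (hc.2 i j k)⟩

/-- Taylor expansion of the cubic form `tri c x x x`. -/
theorem SymTensor.tri_add (hc : SymTensor c) (x z : Fin n → R) :
    tri c (x + z) (x + z) (x + z) = tri c x x x + 3 * (triV c x x ⬝ᵥ z) +
      3 * (triV c z z ⬝ᵥ x) + tri c z z z := by
  have h1 : tri c x z x = triV c x x ⬝ᵥ z := by rw [hc.tri_swap]; rfl
  have h2 : tri c z x x = triV c x x ⬝ᵥ z := by rw [hc.tri_swap_left, h1]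
  have h3 : tri c x z z = triV c z z ⬝ᵥ x := by rw [hc.tri_swap_left, hc.tri_swap]; rfl
  have h4 : tri c z x z = triV c z z ⬝ᵥ x := by rw [hc.tri_swap]; rfl
  simp only [tri] at *
  simp only [triV_add_left, triV_add_right, add_dotProduct, dotProduct_add, h1, h2, h3, h4]
  ring

end Tensors


section Forms

variable {n : ℕ} {F : Type*} [Field F]

/-- Euler's identity, applied three times, writes a cubic form with a symmetric tensor. -/
theorem exists_symTensor (h6 : (6 : F) ≠ 0) {G : MvPolynomial (Fin n) F[X]}
    (hG : G.IsHomogeneous 3) : ∃ c : Fin n → Fin n → Fin n → F[X], SymTensor c ∧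
      (G = ∑ i, ∑ j, ∑ k, MvPolynomial.C (c i j k) * MvPolynomial.X i * MvPolynomial.X j *
        MvPolynomial.X k) ∧
      (∀ k, MvPolynomial.pderiv k G =
        ∑ i, ∑ j, MvPolynomial.C (3 * c i j k) * MvPolynomial.X i * MvPolynomial.X j) ∧
      ∀ j k, MvPolynomial.pderiv j (MvPolynomial.pderiv k G) =
        ∑ i, MvPolynomial.C (6 * c i j k) * MvPolynomial.X i := by
  let s : F[X] := Polynomial.C (6 : F)⁻¹
  have hs : 6 * s = 1 := by
    have : (6 : F[X]) = Polynomial.C 6 := (map_ofNat Polynomial.C 6).symm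
    rw [this, ← Polynomial.C_mul, mul_inv_cancel₀ h6, Polynomial.C_1]
  have comm : ∀ i j (Q : MvPolynomial (Fin n) F[X]), MvPolynomial.pderiv i
      (MvPolynomial.pderiv j Q) = MvPolynomial.pderiv j (MvPolynomial.pderiv i Q) := by
    intro i j Q
    induction Q using MvPolynomial.induction_on with
    | C a => simp
    | add f g hf hg => simp [hf, hg]
    | mul_X f k hf =>
      simp only [Derivation.leibniz, MvPolynomial.pderiv_X, smul_eq_mul, map_add, hf]
      have : ∀ i j : Fin n, MvPolynomial.pderiv i
          (Pi.single (M := fun _ => MvPolynomial (Fin n) F[X]) j 1 k) = 0 := by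
        intro i j
        by_cases h : k = j
        · subst h; simp
        · simp [h]
      simp only [this]
      ring
  -- the third derivatives are constants
  let d : Fin n → Fin n → Fin n → F[X] := fun i j k =>
    MvPolynomial.coeff 0 (MvPolynomial.pderiv i (MvPolynomial.pderiv j (MvPolynomial.pderiv k G)))
  have h1 : ∀ k, (MvPolynomial.pderiv k G).IsHomogeneous 2 := fun k => hG.pderiv
  have h2 : ∀ j k, (MvPolynomial.pderiv j (MvPolynomial.pderiv k G)).IsHomogeneous 1 :=
    fun j k => (h1 k).pderiv
  have h3 : ∀ i j k, MvPolynomial.pderiv i (MvPolynomial.pderiv j (MvPolynomial.pderiv k G)) =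
      MvPolynomial.C (d i j k) := fun i j k => by
    have : (MvPolynomial.pderiv i (MvPolynomial.pderiv j (MvPolynomial.pderiv k G))).IsHomogeneous
      0 := (h2 j k).pderiv
    exact MvPolynomial.totalDegree_eq_zero_iff_eq_C.mp
      ((MvPolynomial.totalDegree_zero_iff_isHomogeneous _).mpr this)
  have e1 : ∀ j k, MvPolynomial.pderiv j (MvPolynomial.pderiv k G) =
      ∑ i, MvPolynomial.C (d i j k) * MvPolynomial.X i := fun j k => by
    have := (h2 j k).sum_X_mul_pderiv
    rw [one_smul] at this
    rw [← this]
    exact Finset.sum_congr rfl fun i _ => by rw [h3]; ring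
  have e2 : ∀ k, 2 * MvPolynomial.pderiv k G =
      ∑ i, ∑ j, MvPolynomial.C (d i j k) * MvPolynomial.X i * MvPolynomial.X j := fun k => by
    have := (h1 k).sum_X_mul_pderiv
    rw [two_smul, ← two_mul] at this
    rw [← this, Finset.sum_comm]
    refine Finset.sum_congr rfl fun i _ => ?_
    rw [e1, Finset.mul_sum]
    exact Finset.sum_congr rfl fun i _ => by ring
  have e3 : 6 * G = ∑ i, ∑ j, ∑ k, MvPolynomial.C (d i j k) * MvPolynomial.X i *
      MvPolynomial.X j * MvPolynomial.X k := by
    have := hG.sum_X_mul_pderiv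
    rw [nsmul_eq_mul] at this
    have h' : 6 * G = ∑ k, MvPolynomial.X k * (2 * MvPolynomial.pderiv k G) := by
      calc 6 * G = 2 * (((3 : ℕ) : MvPolynomial (Fin n) F[X]) * G) := by push_cast; ring
        _ = _ := by
          rw [← this, Finset.mul_sum]
          exact Finset.sum_congr rfl fun i _ => by ring
    rw [h', Finset.sum_congr rfl fun k _ => by rw [e2, Finset.mul_sum], Finset.sum_comm]
    refine Finset.sum_congr rfl fun i _ => ?_
    simp only [Finset.mul_sum]
    rw [Finset.sum_comm]
    exact Finset.sum_congr rfl fun j _ => Finset.sum_congr rfl fun k _ => by ring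
  have hs6 : (6 : MvPolynomial (Fin n) F[X]) * MvPolynomial.C s = 1 := by
    rw [← MvPolynomial.C_1, ← hs, map_mul, map_ofNat]
  refine ⟨fun i j k => s * d i j k, ⟨fun i j k => ?_, fun i j k => ?_⟩, ?_, ?_, ?_⟩
  · simp only [d]; rw [comm]
  · simp only [d]; rw [comm j k]
  · calc G = MvPolynomial.C s * (6 * G) := by linear_combination (-G) * hs6
      _ = _ := by
        rw [e3]
        simp only [Finset.mul_sum, map_mul, mul_assoc]
  · intro k
    calc MvPolynomial.pderiv k G = 3 * MvPolynomial.C s * (2 * MvPolynomial.pderiv k G) := by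
          linear_combination (-MvPolynomial.pderiv k G) * hs6
      _ = _ := by
        rw [e2]
        simp only [Finset.mul_sum, map_mul, mul_assoc, map_ofNat]
  · intro j k
    rw [e1]
    refine Finset.sum_congr rfl fun i _ => ?_
    rw [← mul_assoc, hs, one_mul]

section Evaluation

variable {S : Type*} [CommRing S] (φ : F[X] →+* S) {c : Fin n → Fin n → Fin n → F[X]}

theorem eval₂_cubic {G : MvPolynomial (Fin n) F[X]}
    (hG : G = ∑ i, ∑ j, ∑ k, MvPolynomial.C (c i j k) * MvPolynomial.X i * MvPolynomial.X j *
        MvPolynomial.X k) (x : Fin n → S) :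
    MvPolynomial.eval₂ φ x G = tri (fun i j k => φ (c i j k)) x x x := by
  rw [hG, tri_eq_sum]
  simp

theorem eval₂_cubic_grad {G : MvPolynomial (Fin n) F[X]} {k : Fin n}
    (hG : MvPolynomial.pderiv k G =
        ∑ i, ∑ j, MvPolynomial.C (3 * c i j k) * MvPolynomial.X i * MvPolynomial.X j)
    (x : Fin n → S) : MvPolynomial.eval₂ φ x (MvPolynomial.pderiv k G) =
      3 * triV (fun i j k => φ (c i j k)) x x k := by
  rw [hG, triV]
  simp [Finset.mul_sum, mul_assoc, map_ofNat φ 3]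

theorem eval₂_quadOf (M : Matrix (Fin n) (Fin n) F[X]) (x : Fin n → S) :
    MvPolynomial.eval₂ φ x (quadOf M) = x ⬝ᵥ (M.map φ).mulVec x := by
  simp only [quadOf, dotProduct, Matrix.mulVec, Finset.mul_sum]
  simp only [MvPolynomial.eval₂_sum, MvPolynomial.eval₂_mul, MvPolynomial.eval₂_C,
    MvPolynomial.eval₂_X, Matrix.map_apply]
  exact Finset.sum_congr rfl fun i _ => Finset.sum_congr rfl fun j _ => by ring

theorem eval₂_quadOf_grad {M : Matrix (Fin n) (Fin n) F[X]} (hM : M.IsSymm) (x : Fin n → S)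
    (k : Fin n) : MvPolynomial.eval₂ φ x (MvPolynomial.pderiv k (quadOf M)) =
      2 * (M.map φ).mulVec x k := by
  have : MvPolynomial.pderiv k (quadOf M) =
      ∑ j, MvPolynomial.C (2 * M k j) * MvPolynomial.X j := by
    have h1 : ∀ i j : Fin n, MvPolynomial.pderiv k
        (MvPolynomial.C (M i j) * MvPolynomial.X i * MvPolynomial.X j) =
        (if j = k then MvPolynomial.C (M i j) * MvPolynomial.X i else 0) +
        if i = k then MvPolynomial.C (M i j) * MvPolynomial.X j else 0 := by
      intro i j
      simp only [Derivation.leibniz, MvPolynomial.pderiv_X, smul_eq_mul, MvPolynomial.pderiv_C,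
        mul_zero, add_zero, Pi.single_apply]
      split_ifs <;> ring
    simp only [quadOf, map_sum, h1, Finset.sum_add_distrib]
    rw [Finset.sum_comm (f := fun i j : Fin n =>
      if i = k then MvPolynomial.C (M i j) * MvPolynomial.X j else 0)]
    simp only [Finset.sum_ite_eq', Finset.mem_univ, if_true]
    rw [← Finset.sum_add_distrib]
    refine Finset.sum_congr rfl fun j _ => ?_
    rw [hM.apply, two_mul, map_add]
    ring
  rw [this]
  simp [Matrix.mulVec, dotProduct, Finset.mul_sum, mul_assoc, map_ofNat φ 2]

end Evaluation

/-- An effective Nullstellensatz over `F[t]`: if a family of polynomials has no common zero over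
the algebraic closure except possibly the origin, then a power of every variable, multiplied by a
non-zero constant, lies in the ideal generated by the family. -/
theorem exists_C_mul_X_pow_mem_span {ι : Type*} (f : ι → MvPolynomial (Fin n) F[X])
    (h : ∀ x : Fin n → KBar F, (∀ s, evalBar (f s) x = 0) → x = 0) :
    ∃ (D : ℕ) (Δ : F[X]), Δ ≠ 0 ∧
      ∀ i, MvPolynomial.C Δ * MvPolynomial.X i ^ D ∈ Ideal.span (Set.range f) := by
  set K := RatFunc F
  set I := Ideal.span (Set.range f)
  let _ : Algebra (MvPolynomial (Fin n) F[X]) (MvPolynomial (Fin n) K) :=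
    (MvPolynomial.map (algebraMap F[X] K)).toAlgebra
  set J := I.map (algebraMap (MvPolynomial (Fin n) F[X]) (MvPolynomial (Fin n) K))
  have hloc : IsLocalization ((nonZeroDivisors F[X]).map (MvPolynomial.C (σ := Fin n)))
    (MvPolynomial (Fin n) K) := MvPolynomial.isLocalization (nonZeroDivisors F[X]) K
  have hinj : Function.Injective (algebraMap (MvPolynomial (Fin n) F[X]) (MvPolynomial (Fin n) K)) :=
    MvPolynomial.map_injective _ (IsFractionRing.injective F[X] K)
  have key : ∀ i, ∃ (D : ℕ) (Δ : F[X]), Δ ≠ 0 ∧ MvPolynomial.C Δ * MvPolynomial.X i ^ D ∈ I := by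
    intro i
    -- Hilbert's Nullstellensatz over `K`, after which denominators are cleared
    have h1 : (MvPolynomial.X i : MvPolynomial (Fin n) K) ∈ J.radical := by
      rw [← MvPolynomial.vanishingIdeal_zeroLocus_eq_radical (K := KBar F)]
      intro x hx
      have hx0 : x = 0 := by
        apply h
        intro s
        have : algebraMap (MvPolynomial (Fin n) F[X]) (MvPolynomial (Fin n) K) (f s) ∈ J :=
          Ideal.mem_map_of_mem _ (Ideal.subset_span ⟨s, rfl⟩)
        have h2 := hx _ this
        rw [RingHom.algebraMap_toAlgebra, MvPolynomial.aeval_def, MvPolynomial.eval₂_map] at h2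
        exact h2
      simp [hx0]
    obtain ⟨D, hD⟩ := h1
    obtain ⟨⟨⟨a, ha⟩, ⟨_, ⟨Δ, hΔ, rfl⟩⟩⟩, hs⟩ :=
      (IsLocalization.mem_map_algebraMap_iff ((nonZeroDivisors F[X]).map
        (MvPolynomial.C (σ := Fin n))) (MvPolynomial (Fin n) K)).mp hD
    refine ⟨D, Δ, nonZeroDivisors.ne_zero hΔ, ?_⟩
    have : MvPolynomial.C Δ * MvPolynomial.X i ^ D = a := by
      apply hinj
      rw [← hs, map_mul, map_pow, RingHom.algebraMap_toAlgebra, MvPolynomial.map_X, mul_comm]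
    rw [this]
    exact ha
  choose D Δ hΔ hmem using key
  refine ⟨∑ i, D i, ∏ i, Δ i, Finset.prod_ne_zero_iff.mpr fun i _ => hΔ i, fun i => ?_⟩
  rw [← Finset.mul_prod_erase _ _ (Finset.mem_univ i),
    ← Finset.add_sum_erase _ _ (Finset.mem_univ i), pow_add, map_mul]
  have := I.mul_mem_right (MvPolynomial.C (∏ j ∈ Finset.univ.erase i, Δ j) *
    MvPolynomial.X i ^ (∑ j ∈ Finset.univ.erase i, D j)) (hmem i)
  convert this using 1
  ring

end Forms


/-! ### Counting solutions of polynomial systems over a field -/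

section Counting

variable {n : ℕ}

theorem exists_eval_indicator {k : Type*} [Field k] (Z : Finset (Fin n → k)) (z : Fin n → k) :
    ∃ P : MvPolynomial (Fin n) k, MvPolynomial.eval z P = 1 ∧
      ∀ w ∈ Z, w ≠ z → MvPolynomial.eval w P = 0 := by
  classical
  have : ∀ w : Fin n → k, ∃ Q : MvPolynomial (Fin n) k, w ≠ z →
      MvPolynomial.eval z Q = 1 ∧ MvPolynomial.eval w Q = 0 := by
    intro w
    by_cases hw : w = z
    · exact ⟨0, fun h => absurd hw h⟩
    obtain ⟨i, hi⟩ := Function.ne_iff.mp hw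
    refine ⟨(MvPolynomial.X i - MvPolynomial.C (w i)) * MvPolynomial.C (z i - w i)⁻¹, fun _ => ?_⟩
    have h0 : z i - w i ≠ 0 := sub_ne_zero.mpr (Ne.symm hi)
    simp [h0]
  choose Q hQ using this
  refine ⟨∏ w ∈ Z.erase z, Q w, ?_, fun w hw hwz => ?_⟩
  · rw [map_prod]
    exact Finset.prod_eq_one fun w hw => (hQ w (Finset.ne_of_mem_erase hw)).1
  · rw [map_prod]
    exact Finset.prod_eq_zero (Finset.mem_erase.mpr ⟨hwz, hw⟩) (hQ w hwz).2

/-- If on a finite set of points every `z_i ^ D` agrees with a polynomial of degree less than `D`,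
then the monomials with all exponents below `D` span the functions on the set, which therefore has
at most `D ^ n` points. -/
theorem card_le_of_pow_eq_lower {k : Type*} [Field k] (Z : Finset (Fin n → k)) (D : ℕ)
    (P : Fin n → MvPolynomial (Fin n) k) (hP : ∀ i, (P i).totalDegree < D)
    (h : ∀ z ∈ Z, ∀ i, z i ^ D = MvPolynomial.eval z (P i)) : Z.card ≤ D ^ n := by
  classical
  let W : Submodule k (Z → k) := Submodule.span k
    (Set.range fun (μ : Fin n → Fin D) (z : Z) => ∏ i, z.1 i ^ (μ i : ℕ))
  have key : ∀ m : ℕ, ∀ Q : MvPolynomial (Fin n) k, Q.totalDegree ≤ m →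
      (fun z : Z => MvPolynomial.eval z.1 Q) ∈ W := by
    intro m
    induction m using Nat.strong_induction_on with
    | _ m ih =>
      intro Q hQ
      -- a factor `z i ^ D` of a monomial is replaced by `P i`, which lowers the degree
      have hmono : ∀ μ ∈ Q.support, (fun z : Z => ∏ i, z.1 i ^ (μ i)) ∈ W := by
        intro μ hμ
        by_cases hall : ∀ i, μ i < D
        · exact Submodule.subset_span ⟨fun i => ⟨μ i, hall i⟩, rfl⟩
        push Not at hall
        obtain ⟨i, hi⟩ := hall
        let ν : Fin n →₀ ℕ := μ - Finsupp.single i D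
        have hle : Finsupp.single i D ≤ μ := by
          rw [Finsupp.single_le_iff]; exact hi
        have hμν : μ = Finsupp.single i D + ν := (add_tsub_cancel_of_le hle).symm
        have hdeg : ∀ κ : Fin n →₀ ℕ, (κ.sum fun _ e => e) = ∑ j, κ j := fun κ =>
          Finsupp.sum_fintype _ _ fun _ => rfl
        have hμm : (∑ j, μ j) ≤ m := by
          rw [← hdeg]; exact (MvPolynomial.le_totalDegree hμ).trans hQ
        have hsum : ∑ j, μ j = D + ∑ j, ν j := by
          conv_lhs => rw [hμν]
          simp only [Finsupp.add_apply, Finset.sum_add_distrib]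
          congr 1
          simp [Finsupp.single_apply]
        have hlt : (P i * MvPolynomial.monomial ν 1).totalDegree < m := by
          refine (MvPolynomial.totalDegree_mul _ _).trans_lt ?_
          have h1 : (MvPolynomial.monomial ν (1 : k)).totalDegree = ∑ j, ν j := by
            rw [MvPolynomial.totalDegree_monomial _ one_ne_zero]; exact hdeg ν
          have h2 := hP i
          omega
        have := ih _ hlt _ le_rfl
        convert this using 2 with z
        rw [map_mul, ← h z.1 z.2 i, MvPolynomial.eval_monomial, one_mul, hμν]
        simp only [Finsupp.add_apply, pow_add, Finset.prod_mul_distrib]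
        congr 1
        · rw [Finset.prod_eq_single i] <;> simp +contextual [eq_comm]
        · rw [Finsupp.prod_fintype]
          intro j; simp
      have : (fun z : Z => MvPolynomial.eval z.1 Q) =
          ∑ μ ∈ Q.support, Q.coeff μ • fun z : Z => ∏ i, z.1 i ^ (μ i) := by
        funext z
        rw [MvPolynomial.eval_eq']
        simp
      rw [this]
      exact W.sum_mem fun μ hμ => W.smul_mem _ (hmono μ hμ)
  -- every function on a finite set of points is a polynomial function
  have htop : W = ⊤ := by
    rw [eq_top_iff]
    intro f _
    choose I hI using exists_eval_indicator Z
    have : f = fun z : Z => MvPolynomial.eval z.1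
        (∑ w : Z, MvPolynomial.C (f w) * I w.1) := by
      funext z
      rw [map_sum, Finset.sum_eq_single z]
      · simp [(hI z.1).1]
      · intro w _ hwz
        rw [map_mul, (hI w.1).2 z.1 z.2 (fun h => hwz (Subtype.ext h.symm)), mul_zero]
      · simp
    rw [this]
    exact key _ _ le_rfl
  have h1 : Module.finrank k W ≤ D ^ n := by
    refine (finrank_range_le_card (R := k)
      fun (μ : Fin n → Fin D) (z : Z) => ∏ i, z.1 i ^ (μ i : ℕ)).trans ?_
    simp
  rw [htop, finrank_top, Module.finrank_fintype_fun_eq_card] at h1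
  simpa using h1

/-- The quadratic polynomials `∑_{i,j} c_{ijk} X_i X_j`. -/
def gradPoly {R : Type*} [CommRing R] (c : Fin n → Fin n → Fin n → R) (k : Fin n) :
    MvPolynomial (Fin n) R :=
  ∑ i, ∑ j, MvPolynomial.C (c i j k) * MvPolynomial.X i * MvPolynomial.X j

/-- A certificate that the quadrics `∑_{i,j} c_{ijk} X_i X_j` have no common zero besides the
origin wherever `Δ ≠ 0`: each `Δ X_i ^ (D + 2)` is a combination of them with coefficients that are
homogeneous of degree `D`. -/
def NonsingCert {R : Type*} [CommRing R] (c : Fin n → Fin n → Fin n → R) (D : ℕ) (Δ : R) : Prop :=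
  ∃ g : Fin n → Fin n → MvPolynomial (Fin n) R, (∀ i j, (g i j).IsHomogeneous D) ∧
    ∀ i, MvPolynomial.C Δ * MvPolynomial.X i ^ (D + 2) = ∑ j, g i j * gradPoly c j

theorem eval_gradPoly {R : Type*} [CommRing R] (c : Fin n → Fin n → Fin n → R) (k : Fin n)
    (x : Fin n → R) : MvPolynomial.eval x (gradPoly c k) = triV c x x k := by
  simp [gradPoly, triV]

theorem NonsingCert.map {R S : Type*} [CommRing R] [CommRing S] (φ : R →+* S)
    {c : Fin n → Fin n → Fin n → R} {D : ℕ} {Δ : R} (h : NonsingCert c D Δ) :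
    NonsingCert (fun i j k => φ (c i j k)) D (φ Δ) := by
  obtain ⟨g, hg, h⟩ := h
  refine ⟨fun i j => MvPolynomial.map φ (g i j), fun i j => (hg i j).map φ, fun i => ?_⟩
  have := congrArg (MvPolynomial.map φ) (h i)
  simp only [map_mul, map_pow, MvPolynomial.map_C, MvPolynomial.map_X, map_sum] at this
  rw [this]
  refine Finset.sum_congr rfl fun j _ => ?_
  simp [gradPoly]

/-- The gradient of a non-singular cubic form agrees with a given affine map at boundedly many
points: the certificate expresses `z i ^ (D + 2)` through polynomials of lower degree there. -/
theorem NonsingCert.card_le {k : Type*} [Field k] {c : Fin n → Fin n → Fin n → k} {D : ℕ}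
    {Δ : k} (h : NonsingCert c D Δ) (hΔ : Δ ≠ 0) (A : Matrix (Fin n) (Fin n) k) (b : Fin n → k)
    (Z : Finset (Fin n → k)) (hZ : ∀ z ∈ Z, triV c z z = A.mulVec z + b) :
    Z.card ≤ (D + 2) ^ n := by
  obtain ⟨g, hg, h⟩ := h
  let ℓ : Fin n → MvPolynomial (Fin n) k := fun j =>
    ∑ i, MvPolynomial.C (A j i) * MvPolynomial.X i + MvPolynomial.C (b j)
  have hℓ : ∀ j, (ℓ j).totalDegree ≤ 1 := fun j => by
    refine (MvPolynomial.totalDegree_add _ _).trans (max_le ?_ (by simp))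
    refine MvPolynomial.totalDegree_finsetSum_le fun i _ => ?_
    refine (MvPolynomial.totalDegree_mul _ _).trans ?_
    simp
  refine card_le_of_pow_eq_lower Z (D + 2)
    (fun i => MvPolynomial.C Δ⁻¹ * ∑ j, g i j * ℓ j) (fun i => ?_) fun z hz i => ?_
  · refine (MvPolynomial.totalDegree_mul _ _).trans_lt ?_
    rw [MvPolynomial.totalDegree_C, zero_add]
    refine lt_of_le_of_lt (MvPolynomial.totalDegree_finsetSum_le (d := D + 1) fun j _ => ?_)
      (by omega)
    exact (MvPolynomial.totalDegree_mul _ _).trans (add_le_add (hg i j).totalDegree_le (hℓ j))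
  · have h1 := congrArg (MvPolynomial.eval z) (h i)
    simp only [map_mul, map_pow, MvPolynomial.eval_C, MvPolynomial.eval_X, map_sum,
      eval_gradPoly] at h1 ⊢
    rw [eq_inv_mul_iff_mul_eq₀ hΔ, h1]
    refine Finset.sum_congr rfl fun j _ => ?_
    rw [hZ z hz]
    congr 1
    simp [ℓ, Matrix.mulVec, dotProduct]

/-- The equation `c(z, z - w, ·) = 0` says that the quadratic map `c(z, z, ·)` is affine at `z`. -/
theorem NonsingCert.card_le_shifted {k : Type*} [Field k] {c : Fin n → Fin n → Fin n → k} {D : ℕ}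
    {Δ : k} (h : NonsingCert c D Δ) (hΔ : Δ ≠ 0) (w : Fin n → k)
    (Z : Finset (Fin n → k)) (hZ : ∀ z ∈ Z, triV c z (z - w) = 0) :
    Z.card ≤ (D + 2) ^ n := by
  refine h.card_le hΔ (Matrix.of fun j i => ∑ l, c i l j * w l) 0 Z fun z hz => ?_
  have h1 := hZ z hz
  have h2 : triV c z z = triV c z (z - w) + triV c z w := by
    rw [← triV_add_right, sub_add_cancel]
  rw [h2, h1, zero_add, add_zero]
  funext j
  simp only [triV, Matrix.mulVec, dotProduct, Matrix.of_apply, Finset.sum_mul]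
  exact Finset.sum_congr rfl fun i _ => Finset.sum_congr rfl fun l _ => by ring

/-- The pairs in a finite group of vectors annihilated by the Hessian: for each difference there are
boundedly many of them. -/
theorem NonsingCert.card_pairs_le {k V : Type*} [Field k] {c : Fin n → Fin n → Fin n → k} {D : ℕ}
    {Δ : k} (h : NonsingCert c D Δ) (hΔ : Δ ≠ 0) [AddCommGroup V] [Finite V]
    (e : V →+ (Fin n → k)) (he : Function.Injective e) :
    Nat.card {xx : V × V // triV c (e xx.1) (e xx.2) = 0} ≤ Nat.card V * (D + 2) ^ n := by
  classical
  have := Fintype.ofFinite V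
  rw [Nat.card_eq_fintype_card, Fintype.card_subtype, Nat.card_eq_fintype_card]
  set S := Finset.univ.filter fun xx : V × V => triV c (e xx.1) (e xx.2) = 0
  have hfib : ∀ w, (S.filter fun xx => xx.1 - xx.2 = w).card ≤ (D + 2) ^ n := by
    intro w
    have h1 : (S.filter fun xx => xx.1 - xx.2 = w).card =
        ((S.filter fun xx => xx.1 - xx.2 = w).image fun xx => e xx.1).card := by
      rw [Finset.card_image_of_injOn]
      rintro ⟨a, b⟩ hab ⟨a', b'⟩ hab' h
      simp only [Finset.coe_filter, Set.mem_ofPred_eq] at hab hab'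
      have h2 := he h
      simp only at h2
      subst h2
      rw [← hab'.2] at hab
      simpa using hab.2
    rw [h1]
    refine h.card_le_shifted hΔ (e w) _ ?_
    intro z hz
    obtain ⟨⟨a, b⟩, hab, rfl⟩ := Finset.mem_image.mp hz
    simp only [S, Finset.mem_filter, Finset.mem_univ, true_and] at hab
    have h3 : e a - e w = e b := by
      rw [← hab.2, map_sub]; abel
    rw [h3]
    exact hab.1
  calc S.card = ∑ w, (S.filter fun xx => xx.1 - xx.2 = w).card :=
        Finset.card_eq_sum_card_fiberwise fun _ _ => Finset.mem_univ _
    _ ≤ ∑ _w : V, (D + 2) ^ n := Finset.sum_le_sum fun w _ => hfib w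
    _ = _ := by simp

theorem gradPoly_isHomogeneous {R : Type*} [CommRing R] (c : Fin n → Fin n → Fin n → R)
    (k : Fin n) : (gradPoly c k).IsHomogeneous 2 := by
  refine MvPolynomial.IsHomogeneous.sum _ _ _ fun i _ =>
    MvPolynomial.IsHomogeneous.sum _ _ _ fun j _ => ?_
  simpa using ((MvPolynomial.isHomogeneous_C (Fin n) (c i j k)).mul
    (MvPolynomial.isHomogeneous_X R i)).mul (MvPolynomial.isHomogeneous_X R j)

/-- A certificate exists for a cubic form over `F[t]` whose gradient has no non-trivial zero over the
algebraic closure. The coefficients can be taken homogeneous by comparing degrees. -/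
theorem exists_nonsingCert {F : Type*} [Field F] {c : Fin n → Fin n → Fin n → F[X]}
    (h : ∀ x : Fin n → KBar F, (∀ k, evalBar (gradPoly c k) x = 0) → x = 0) :
    ∃ (D : ℕ) (Δ : F[X]), Δ ≠ 0 ∧ NonsingCert c D Δ := by
  obtain ⟨D, Δ, hΔ, hmem⟩ := exists_C_mul_X_pow_mem_span (gradPoly c) h
  refine ⟨D, Δ, hΔ, ?_⟩
  have : ∀ i, ∃ g : Fin n → MvPolynomial (Fin n) F[X], (∀ j, (g j).IsHomogeneous D) ∧
      MvPolynomial.C Δ * MvPolynomial.X i ^ (D + 2) = ∑ j, g j * gradPoly c j := by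
    intro i
    have h2 := Ideal.mul_mem_left _ (MvPolynomial.X i ^ 2) (hmem i)
    obtain ⟨g, hg⟩ := Ideal.mem_span_range_iff_exists_fun.mp h2
    refine ⟨fun j => MvPolynomial.homogeneousComponent D (g j),
      fun j => MvPolynomial.homogeneousComponent_isHomogeneous _ _, ?_⟩
    have hX : (MvPolynomial.C Δ * MvPolynomial.X i ^ (D + 2)).IsHomogeneous (D + 2) := by
      simpa using (MvPolynomial.isHomogeneous_C (Fin n) Δ).mul
        ((MvPolynomial.isHomogeneous_X F[X] i).pow (D + 2))
    have h3 : MvPolynomial.C Δ * MvPolynomial.X i ^ (D + 2) = ∑ j, g j * gradPoly c j := by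
      rw [hg]; ring
    have h4 := MvPolynomial.homogeneousComponent_of_mem
      ((MvPolynomial.mem_homogeneousSubmodule _ _).mpr hX) (m := D + 2) (n := D + 2)
    rw [if_pos rfl] at h4
    rw [← h4, h3, map_sum]
    refine Finset.sum_congr rfl fun j _ => ?_
    conv_lhs => rw [← MvPolynomial.sum_homogeneousComponent (g j), Finset.sum_mul, map_sum]
    have h5 : ∀ m, MvPolynomial.homogeneousComponent (D + 2)
        (MvPolynomial.homogeneousComponent m (g j) * gradPoly c j) =
        if m = D then MvPolynomial.homogeneousComponent m (g j) * gradPoly c j else 0 := fun m => by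
      have h6 := ((MvPolynomial.homogeneousComponent_isHomogeneous m (g j)).mul
        (gradPoly_isHomogeneous c j))
      rw [MvPolynomial.homogeneousComponent_of_mem
        ((MvPolynomial.mem_homogeneousSubmodule _ _).mpr h6)]
      exact if_congr (by omega) rfl rfl
    simp only [h5]
    rw [Finset.sum_ite_eq']
    split_ifs with hmem
    · rfl
    · rw [Finset.mem_range, not_lt] at hmem
      rw [MvPolynomial.homogeneousComponent_eq_zero _ _ (by omega), zero_mul]
  choose g hg using this
  exact ⟨g, fun i j => (hg i).1 j, fun i => (hg i).2⟩

end Counting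


/-! ### Exponential sums over finite commutative rings -/

section RingSums

variable {n : ℕ} {R : Type*} [CommRing R]

/-- The polynomial `c(x, x, x) + xᵗ M x + v · x`. -/
def cubicPhase (c : Fin n → Fin n → Fin n → R) (M : Matrix (Fin n) (Fin n) R) (v x : Fin n → R) :
    R := tri c x x x + x ⬝ᵥ M.mulVec x + v ⬝ᵥ x

variable {c : Fin n → Fin n → Fin n → R} {M : Matrix (Fin n) (Fin n) R} {v : Fin n → R}

theorem dotProduct_mulVec_comm (hM : M.IsSymm) (x y : Fin n → R) :
    x ⬝ᵥ M.mulVec y = M.mulVec x ⬝ᵥ y := by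
  rw [Matrix.dotProduct_mulVec, ← Matrix.mulVec_transpose, hM.eq]

theorem cubicPhase_add (hc : SymTensor c) (hM : M.IsSymm) (x z : Fin n → R) :
    cubicPhase c M v (x + z) = cubicPhase c M v x +
      ((3 : R) • triV c x x + (2 : R) • M.mulVec x + v) ⬝ᵥ z + 3 * (triV c z z ⬝ᵥ x) + tri c z z z +
      z ⬝ᵥ M.mulVec z := by
  simp only [cubicPhase, hc.tri_add, Matrix.mulVec_add, add_dotProduct, dotProduct_add,
    smul_dotProduct, smul_eq_mul]
  rw [dotProduct_mulVec_comm hM x z, dotProduct_comm z (M.mulVec x)]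
  ring

theorem cubicPhase_second_difference (hc : SymTensor c) (hM : M.IsSymm) (x h h' : Fin n → R) :
    cubicPhase c M v (x + h' + h) - cubicPhase c M v (x + h') -
      (cubicPhase c M v (x + h) - cubicPhase c M v x) =
    ((6 : R) • triV c h h') ⬝ᵥ x +
      (((3 : R) • triV c h' h' + (2 : R) • M.mulVec h') ⬝ᵥ h + 3 * (triV c h h ⬝ᵥ h')) := by
  rw [cubicPhase_add hc hM (x + h') h, cubicPhase_add hc hM x h]
  have e : triV c x h' ⬝ᵥ h = triV c h h' ⬝ᵥ x := by
    have h1 := hc.tri_swap x h' h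
    rw [hc.tri_swap_left x h h', hc.tri_swap h x h'] at h1
    exact h1
  simp only [Matrix.mulVec_add, add_dotProduct, dotProduct_add, smul_dotProduct, smul_eq_mul,
    triV_add_left, triV_add_right, hc.triV_comm h' x, e]
  ring

variable {χ : AddChar R ℂ}

theorem norm_sum_sq_le {G : Type*} [AddCommGroup G] [Fintype G] (h1 : ∀ x, ‖χ x‖ = 1)
    (f : G → R) : ‖∑ x, χ (f x)‖ ^ 2 ≤ ∑ h, ‖∑ x, χ (f (x + h) - f x)‖ := by
  have hconj : ∀ x, (starRingEnd ℂ) (χ x) = χ (-x) := fun x => by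
    rw [AddChar.map_neg_eq_inv, Complex.inv_def, Complex.normSq_eq_norm_sq, h1]
    simp
  have h2 : (∑ x, χ (f x)) * (starRingEnd ℂ) (∑ x, χ (f x)) =
      ∑ h, ∑ x, χ (f (x + h) - f x) := by
    rw [map_sum, Finset.sum_mul_sum, Finset.sum_comm, Finset.sum_comm (γ := G)
      (f := fun h x => χ (f (x + h) - f x))]
    refine Finset.sum_congr rfl fun y _ => ?_
    rw [← Equiv.sum_comp (Equiv.addLeft y)]
    refine Finset.sum_congr rfl fun x _ => ?_
    rw [hconj, ← AddChar.map_add_eq_mul, sub_eq_add_neg]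
    rfl
  have h3 : ‖∑ x, χ (f x)‖ ^ 2 = ‖(∑ x, χ (f x)) * (starRingEnd ℂ) (∑ x, χ (f x))‖ := by
    rw [norm_mul, RCLike.norm_conj, sq]
  rw [h3, h2]
  exact norm_sum_le _ _

theorem norm_sum_pow_four_le {G : Type*} [AddCommGroup G] [Fintype G] (h1 : ∀ x, ‖χ x‖ = 1)
    (f : G → R) : ‖∑ x, χ (f x)‖ ^ 4 ≤ Fintype.card G *
      ∑ h, ∑ h', ‖∑ x, χ (f (x + h' + h) - f (x + h') - (f (x + h) - f x))‖ := by
  calc ‖∑ x, χ (f x)‖ ^ 4 = (‖∑ x, χ (f x)‖ ^ 2) ^ 2 := by ring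
    _ ≤ (∑ h, ‖∑ x, χ (f (x + h) - f x)‖) ^ 2 :=
        pow_le_pow_left₀ (sq_nonneg _) (norm_sum_sq_le h1 f) 2
    _ ≤ Fintype.card G * ∑ h, ‖∑ x, χ (f (x + h) - f x)‖ ^ 2 := by
        simpa using sq_sum_le_card_mul_sum_sq (s := (Finset.univ : Finset G))
          (f := fun h => ‖∑ x, χ (f (x + h) - f x)‖)
    _ ≤ _ := by
        gcongr with h
        exact norm_sum_sq_le h1 fun x => f (x + h) - f x

variable [Fintype R]

theorem sum_char_shift {G : Type*} [AddCommGroup G] [Fintype G] (f : G → ℂ) (z : G) :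
    ∑ x, f (x + z) = ∑ x, f x := Equiv.sum_comp (Equiv.addRight z) f

/-- Orthogonality of the characters `x ↦ χ(w · x)`. -/
theorem sum_char_dotProduct [DecidableEq R] (hχ : χ.IsPrimitive) (w : Fin n → R) :
    ∑ x : Fin n → R, χ (w ⬝ᵥ x) = if w = 0 then (Fintype.card (Fin n → R) : ℂ) else 0 := by
  split_ifs with h
  · simp [h]
  obtain ⟨i, hi⟩ := Function.ne_iff.mp h
  obtain ⟨y, hy⟩ : ∃ y, χ (w i * y) ≠ 1 := by
    by_contra! hall
    exact hχ hi (by ext y; simpa using hall y)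
  have h1 := sum_char_shift (fun x : Fin n → R => χ (w ⬝ᵥ x)) (Pi.single i y)
  simp only [dotProduct_add, AddChar.map_add_eq_mul, dotProduct_single, ← Finset.sum_mul] at h1
  have h2 : (∑ x : Fin n → R, χ (w ⬝ᵥ x)) * (χ (w i * y) - 1) = 0 := by
    rw [mul_sub, h1]; ring
  exact (mul_eq_zero.mp h2).resolve_right (sub_ne_zero.mpr hy)

theorem norm_sum_char_affine [DecidableEq R] (hχ : χ.IsPrimitive) (h1 : ∀ x, ‖χ x‖ = 1)
    (w : Fin n → R) (b : R) : ‖∑ x : Fin n → R, χ (w ⬝ᵥ x + b)‖ =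
      if w = 0 then (Fintype.card (Fin n → R) : ℝ) else 0 := by
  simp only [AddChar.map_add_eq_mul, ← Finset.sum_mul]
  rw [norm_mul, h1, mul_one, sum_char_dotProduct hχ]
  split_ifs <;> simp

/-- Weyl's inequality for cubic polynomials over a finite ring. -/
theorem weyl_cubic [DecidableEq R] (hχ : χ.IsPrimitive) (h1 : ∀ x, ‖χ x‖ = 1)
    (hc : SymTensor c) (hM : M.IsSymm) (h6 : IsUnit (6 : R)) :
    ‖∑ x, χ (cubicPhase c M v x)‖ ^ 4 ≤ (Fintype.card (Fin n → R) : ℝ) ^ 2 *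
      ∑ h : Fin n → R, ((Finset.univ.filter fun h' => triV c h h' = 0).card : ℝ) := by
  refine (norm_sum_pow_four_le h1 (cubicPhase c M v)).trans ?_
  rw [sq, mul_assoc]
  gcongr
  rw [Finset.mul_sum]
  gcongr with h
  have h6' : ∀ h', (6 : R) • triV c h h' = 0 ↔ triV c h h' = 0 := fun h' => by
    constructor
    · intro h0
      funext i
      have := congrFun h0 i
      simp only [Pi.smul_apply, smul_eq_mul, Pi.zero_apply] at this
      exact (h6.mul_right_eq_zero).mp this
    · intro h0; simp [h0]
  simp only [cubicPhase_second_difference hc hM, norm_sum_char_affine hχ h1, h6']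
  rw [← Finset.sum_filter, Finset.sum_const, nsmul_eq_mul, mul_comm]

/-- Gauss sums of quadratic polynomials over a finite ring. -/
theorem gauss_quadratic [DecidableEq R] (hχ : χ.IsPrimitive) (h1 : ∀ x, ‖χ x‖ = 1)
    (hM : M.IsSymm) (h6 : IsUnit (6 : R)) :
    ‖∑ x, χ (cubicPhase (0 : Fin n → Fin n → Fin n → R) M v x)‖ ^ 2 ≤
      (Fintype.card (Fin n → R) : ℝ) * (Finset.univ.filter fun h => M.mulVec h = 0).card := by
  have hc : SymTensor (0 : Fin n → Fin n → Fin n → R) := ⟨fun _ _ _ => rfl, fun _ _ _ => rfl⟩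
  have h0 : ∀ x y, triV (0 : Fin n → Fin n → Fin n → R) x y = 0 := fun x y => by
    funext k; simp [triV]
  refine (norm_sum_sq_le h1 (cubicPhase _ M v)).trans ?_
  have h2 : IsUnit (2 : R) := by
    have : (6 : R) = 2 * 3 := by norm_num
    exact isUnit_of_mul_isUnit_left (this ▸ h6)
  have h2' : ∀ h, (2 : R) • M.mulVec h = 0 ↔ M.mulVec h = 0 := fun h => by
    constructor
    · intro h0
      funext i
      have := congrFun h0 i
      simp only [Pi.smul_apply, smul_eq_mul, Pi.zero_apply] at this
      exact (h2.mul_right_eq_zero).mp this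
    · intro h0; simp [h0]
  have key : ∀ x h, cubicPhase (0 : Fin n → Fin n → Fin n → R) M v (x + h) -
      cubicPhase 0 M v x = ((2 : R) • M.mulVec h) ⬝ᵥ x + (v ⬝ᵥ h + h ⬝ᵥ M.mulVec h) := fun x h => by
    rw [cubicPhase_add hc hM]
    simp only [h0, tri, zero_dotProduct, smul_zero, zero_add, add_dotProduct, smul_dotProduct,
      mul_zero, add_zero]
    rw [← dotProduct_mulVec_comm hM x h, dotProduct_comm x]
    ring
  simp only [key, norm_sum_char_affine hχ h1, h2']
  rw [← Finset.sum_filter, Finset.sum_const, nsmul_eq_mul, mul_comm]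

/-- The method of stationary phase: averaging over translations by multiples of an element `l` of
square zero leaves only the points where `l` kills the gradient. -/
theorem stationary_phase [DecidableEq R] (hχ : χ.IsPrimitive) (h1 : ∀ x, ‖χ x‖ = 1)
    (hc : SymTensor c) (hM : M.IsSymm) {l : R} (hl : l * l = 0) :
    ‖∑ x, χ (cubicPhase c M v x)‖ ≤
      (Finset.univ.filter fun x =>
        l • ((3 : R) • triV c x x + (2 : R) • M.mulVec x + v) = 0).card := by
  set f := cubicPhase c M v
  set g : (Fin n → R) → (Fin n → R) := fun x => (3 : R) • triV c x x + (2 : R) • M.mulVec x + v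
  -- the terms of order at least two in `z` contain `l * l`
  have key : ∀ x z, f (x + l • z) = f x + (l • g x) ⬝ᵥ z := fun x z => by
    have e1 : triV c (l • z) (l • z) = 0 := by
      rw [triV_smul_left, triV_smul_right, smul_smul, hl, zero_smul]
    have e2 : (l • z) ⬝ᵥ M.mulVec (l • z) = 0 := by
      rw [Matrix.mulVec_smul, smul_dotProduct, dotProduct_smul, smul_smul, hl, zero_smul]
    simp only [f, g, cubicPhase_add hc hM, tri, e1, e2, zero_dotProduct, mul_zero, add_zero,
      dotProduct_smul, smul_dotProduct, smul_zero]
  have hN : (0 : ℝ) < Fintype.card (Fin n → R) := by exact_mod_cast Fintype.card_pos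
  have h2 : (Fintype.card (Fin n → R) : ℂ) * ∑ x, χ (f x) =
      ∑ x, χ (f x) * if l • g x = 0 then (Fintype.card (Fin n → R) : ℂ) else 0 := by
    have : ∀ z : Fin n → R, ∑ x, χ (f x) = ∑ x, χ (f x) * χ ((l • g x) ⬝ᵥ z) := fun z => by
      rw [← sum_char_shift (fun x => χ (f x)) (l • z)]
      simp only [key, AddChar.map_add_eq_mul]
    calc (Fintype.card (Fin n → R) : ℂ) * ∑ x, χ (f x)
        = ∑ z : Fin n → R, ∑ x, χ (f x) * χ ((l • g x) ⬝ᵥ z) := by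
          simp_rw [← this]
          simp
      _ = _ := by
          rw [Finset.sum_comm]
          simp_rw [← Finset.mul_sum, sum_char_dotProduct hχ]
  have h3 : (Fintype.card (Fin n → R) : ℝ) * ‖∑ x, χ (f x)‖ ≤ (Fintype.card (Fin n → R) : ℝ) *
      (Finset.univ.filter fun x => l • g x = 0).card := by
    have : (Fintype.card (Fin n → R) : ℝ) * ‖∑ x, χ (f x)‖ =
        ‖(Fintype.card (Fin n → R) : ℂ) * ∑ x, χ (f x)‖ := by simp
    rw [this, h2]
    refine (norm_sum_le _ _).trans (le_of_eq ?_)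
    simp only [norm_mul, h1, one_mul]
    rw [Finset.card_filter]
    push_cast
    rw [Finset.mul_sum]
    refine Finset.sum_congr rfl fun x _ => ?_
    split_ifs <;> simp
  exact le_of_mul_le_mul_left h3 hN

end RingSums

section Subgroups

open scoped Classical in
theorem card_filter_eq_zero {G H : Type*} [AddCommGroup G] [Fintype G] [AddCommGroup H]
    (φ : G →+ H) : (Finset.univ.filter fun x => φ x = 0).card = Nat.card φ.ker := by
  rw [Nat.card_eq_fintype_card, Fintype.card_subtype]
  exact congrArg Finset.card (Finset.filter_congr fun x _ => AddMonoidHom.mem_ker.symm)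

open scoped Classical in
/-- Restricting a homomorphism along `ι : V → G` does not decrease the proportion of zeros. -/
theorem card_zeros_mul_card_le {G H V : Type*} [AddCommGroup G] [Fintype G] [AddCommGroup H]
    [AddCommGroup V] [Fintype V] (φ : G →+ H) (ι : V →+ G) :
    (Finset.univ.filter fun x => φ x = 0).card * Fintype.card V ≤
      Fintype.card G * (Finset.univ.filter fun x => φ (ι x) = 0).card := by
  have h1 := card_filter_eq_zero φ
  have h2 : (Finset.univ.filter fun x => φ (ι x) = 0).card = Nat.card (φ.comp ι).ker :=
    card_filter_eq_zero (φ.comp ι)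
  rw [h1, h2, ← Nat.card_eq_fintype_card, ← Nat.card_eq_fintype_card, ← φ.ker.card_mul_index,
    ← (φ.comp ι).ker.card_mul_index, AddSubgroup.index_ker, AddSubgroup.index_ker]
  have h3 : Nat.card (φ.comp ι).range ≤ Nat.card φ.range := by
    apply AddSubgroup.card_le_of_le
    rintro _ ⟨x, rfl⟩
    exact ⟨ι x, rfl⟩
  calc _ ≤ Nat.card φ.ker * (Nat.card (φ.comp ι).ker * Nat.card φ.range) := by gcongr
    _ = _ := by ring

open scoped Classical in
/-- Restricting both arguments of a biadditive map along `ι : V → G` does not decrease the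
proportion of zeros. -/
theorem card_biadditive_zeros_le {G H V : Type*} [AddCommGroup G] [Fintype G] [AddCommGroup H]
    [AddCommGroup V] [Fintype V] (β : G →+ G →+ H) (ι : V →+ G) :
    (∑ h, (Finset.univ.filter fun h' => β h h' = 0).card) * Fintype.card V ^ 2 ≤
      Fintype.card G ^ 2 *
        ∑ x, (Finset.univ.filter fun x' => β (ι x) (ι x') = 0).card := by
  have swap : ∑ h, (Finset.univ.filter fun x' => β h (ι x') = 0).card =
      ∑ x', (Finset.univ.filter fun h => β.flip (ι x') h = 0).card := by
    simp only [Finset.card_filter]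
    rw [Finset.sum_comm]
    rfl
  have swap' : ∑ x', (Finset.univ.filter fun x => β.flip (ι x') (ι x) = 0).card =
      ∑ x, (Finset.univ.filter fun x' => β (ι x) (ι x') = 0).card := by
    simp only [Finset.card_filter]
    rw [Finset.sum_comm]
    rfl
  calc _ = (∑ h, (Finset.univ.filter fun h' => β h h' = 0).card * Fintype.card V) *
        Fintype.card V := by
        rw [← Finset.sum_mul]; ring
    _ ≤ (∑ h, Fintype.card G * (Finset.univ.filter fun x' => β h (ι x') = 0).card) *
        Fintype.card V :=
        Nat.mul_le_mul_right _ (Finset.sum_le_sum fun h _ => card_zeros_mul_card_le (β h) ι)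
    _ = Fintype.card G * ∑ x', (Finset.univ.filter fun h => β.flip (ι x') h = 0).card *
        Fintype.card V := by
        rw [← Finset.mul_sum, swap, ← Finset.sum_mul]; ring
    _ ≤ Fintype.card G * ∑ x',
        Fintype.card G * (Finset.univ.filter fun x => β.flip (ι x') (ι x) = 0).card :=
        Nat.mul_le_mul_left _ (Finset.sum_le_sum fun x' _ =>
          card_zeros_mul_card_le (β.flip (ι x')) ι)
    _ = _ := by rw [← Finset.mul_sum, swap']; ring

theorem sum_card_filter_eq {G H : Type*} [Fintype G] [Fintype H] (P : G → H → Prop)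
    [∀ h, DecidablePred (P h)] : ∑ h, (Finset.univ.filter fun h' => P h h').card =
      Nat.card {x : G × H // P x.1 x.2} := by
  classical
  rw [Nat.card_eq_fintype_card, Fintype.card_subtype, Finset.card_filter,
    ← Finset.univ_product_univ, Finset.sum_product]
  simp only [Finset.card_filter]

/-- The version of `card_biadditive_zeros_le` for cardinalities of types. -/
theorem natCard_biadditive_zeros_le {G H V : Type*} [AddCommGroup G] [Finite G] [AddCommGroup H]
    [AddCommGroup V] [Finite V] (β : G →+ G →+ H) (ι : V →+ G) :
    Nat.card {x : G × G // β x.1 x.2 = 0} * Nat.card V ^ 2 ≤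
      Nat.card G ^ 2 * Nat.card {x : V × V // β (ι x.1) (ι x.2) = 0} := by
  classical
  have := Fintype.ofFinite G
  have := Fintype.ofFinite V
  have := card_biadditive_zeros_le β ι
  rwa [sum_card_filter_eq fun h h' => β h h' = 0,
    sum_card_filter_eq fun x x' => β (ι x) (ι x') = 0, ← Nat.card_eq_fintype_card,
    ← Nat.card_eq_fintype_card] at this

/-- The number of solutions of `l y = 0` in a finite ring. -/
def annCard {R : Type*} [CommRing R] (l : R) : ℕ := Nat.card (AddMonoidHom.mulLeft l).ker

theorem annCard_mul_card_range {R : Type*} [CommRing R] (l : R) :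
    annCard l * Nat.card (AddMonoidHom.mulLeft l).range = Nat.card R := by
  rw [annCard, ← AddSubgroup.index_ker, AddSubgroup.card_mul_index]

theorem annCard_mul_le {R : Type*} [CommRing R] [Finite R] (l m : R) :
    annCard (l * m) ≤ annCard l * annCard m := by
  let φ : (AddMonoidHom.mulLeft (l * m)).ker →+ (AddMonoidHom.mulLeft l).ker :=
    { toFun := fun y => ⟨m * y.1, by
        have := y.2
        rw [AddMonoidHom.mem_ker, AddMonoidHom.coe_mulLeft] at this ⊢
        rw [← mul_assoc, this]⟩
      map_zero' := by simp
      map_add' := fun x y => by ext; simp [mul_add] }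
  have h1 : annCard (l * m) = Nat.card φ.ker * Nat.card φ.range := by
    rw [annCard, ← AddSubgroup.index_ker, AddSubgroup.card_mul_index]
  have h2 : Nat.card φ.range ≤ annCard l :=
    Nat.card_le_card_of_injective (fun x => x.1) Subtype.val_injective
  have h3 : Nat.card φ.ker ≤ annCard m := by
    refine Nat.card_le_card_of_injective
      (fun x => (⟨x.1.1, ?_⟩ : (AddMonoidHom.mulLeft m).ker)) ?_
    · have := x.2
      rw [AddMonoidHom.mem_ker] at this ⊢
      exact congrArg Subtype.val this
    · intro x y hxy
      exact Subtype.ext (Subtype.ext (congrArg (fun z : (AddMonoidHom.mulLeft m).ker => z.1) hxy))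
  rw [h1, mul_comm]
  exact Nat.mul_le_mul h2 h3

open scoped Classical in
/-- If `B M + b ⊗ e_{i₀} = Δ`, a matrix of corank at most one up to the factor `Δ`, then few vectors
`x` satisfy `l M x = 0`. -/
theorem card_smul_mulVec_eq_zero {n : ℕ} {R : Type*} [CommRing R] [Fintype R]
    {M B : Matrix (Fin n) (Fin n) R} {b : Fin n → R} {i₀ : Fin n} {Δ : R}
    (hB : ∀ x : Fin n → R, ∀ i, B.mulVec (M.mulVec x) i + b i * x i₀ = Δ * x i) (l : R) :
    (Finset.univ.filter fun x : Fin n → R => l • M.mulVec x = 0).card * annCard l ≤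
      Fintype.card R * (annCard l * annCard Δ) ^ n := by
  let φ : (Fin n → R) →+ (Fin n → R) :=
    { toFun := fun x => l • M.mulVec x
      map_zero' := by simp
      map_add' := fun x y => by rw [Matrix.mulVec_add, smul_add] }
  have h1 : (Finset.univ.filter fun x : Fin n → R => l • M.mulVec x = 0).card =
    Nat.card φ.ker := by
    convert card_filter_eq_zero φ
    rfl
  let ε : φ.ker →+ (AddMonoidHom.mulLeft l).range :=
    { toFun := fun x => ⟨l * x.1 i₀, ⟨x.1 i₀, rfl⟩⟩
      map_zero' := by simp
      map_add' := fun x y => by ext; simp [mul_add] }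
  have h2 : Nat.card φ.ker = Nat.card ε.ker * Nat.card ε.range := by
    rw [← AddSubgroup.index_ker, AddSubgroup.card_mul_index]
  have h3 : Nat.card ε.range ≤ Nat.card (AddMonoidHom.mulLeft l).range :=
    Nat.card_le_card_of_injective (fun x => x.1) Subtype.val_injective
  have h4 : Nat.card ε.ker ≤ (annCard l * annCard Δ) ^ n := by
    have h5 : Nat.card (Fin n → (AddMonoidHom.mulLeft (l * Δ)).ker) = annCard (l * Δ) ^ n := by
      rw [Nat.card_fun]; simp [annCard]
    refine le_trans ?_ (Nat.pow_le_pow_left (annCard_mul_le l Δ) n)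
    rw [← h5]
    refine Nat.card_le_card_of_injective
      (fun x i => (⟨x.1.1 i, ?_⟩ : (AddMonoidHom.mulLeft (l * Δ)).ker)) ?_
    · have e1 : l * x.1.1 i₀ = 0 := congrArg Subtype.val x.2
      have e2 : l • M.mulVec x.1.1 = 0 := x.1.2
      rw [AddMonoidHom.mem_ker, AddMonoidHom.coe_mulLeft, mul_assoc, ← hB, mul_add]
      have e3 : l * B.mulVec (M.mulVec x.1.1) i = 0 := by
        have := congrFun (Matrix.mulVec_smul B l (M.mulVec x.1.1)) i
        rw [e2] at this
        simpa using this.symm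
      rw [e3]
      linear_combination b i * e1
    · intro x y hxy
      refine Subtype.ext (Subtype.ext (funext fun i => ?_))
      exact congrArg Subtype.val (congrFun hxy i)
  rw [h1, h2]
  calc _ ≤ (annCard l * annCard Δ) ^ n * Nat.card (AddMonoidHom.mulLeft l).range * annCard l := by
        gcongr
    _ = (annCard l * Nat.card (AddMonoidHom.mulLeft l).range) * (annCard l * annCard Δ) ^ n := by
        ring
    _ = _ := by rw [annCard_mul_card_range, Nat.card_eq_fintype_card]

end Subgroups


/-! ### Complete exponential sums of a cubic and a quadratic form -/

/-- A cubic form, given by a symmetric tensor `c`, and a quadratic form, given by a symmetric matrix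
`M`, over `F[t]`, in characteristic different from `2` and `3`, together with certificates that the
cubic form is non-singular and that `M` has corank at most one. -/
structure FormPair (F : Type*) [Field F] (n : ℕ) where
  /-- the tensor of the cubic form -/
  c : Fin n → Fin n → Fin n → F[X]
  /-- the matrix of the quadratic form -/
  M : Matrix (Fin n) (Fin n) F[X]
  symm_c : SymTensor c
  symm_M : M.IsSymm
  six_ne_zero : (6 : F) ≠ 0
  /-- the degree of the coefficients in the certificate of non-singularity -/
  D : ℕ
  /-- the constant in the certificate of non-singularity -/
  Δ : F[X]
  Δ_ne_zero : Δ ≠ 0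
  cert : NonsingCert c D Δ
  /-- an approximate left inverse of `M` -/
  B : Matrix (Fin n) (Fin n) F[X]
  /-- the correction to the approximate left inverse -/
  b : Fin n → F[X]
  /-- the coordinate that parametrises the kernel of `M` -/
  i₀ : Fin n
  /-- the constant in the certificate for the corank -/
  E : F[X]
  E_ne_zero : E ≠ 0
  corank : ∀ i j, (B * M) i j + b i * (if j = i₀ then 1 else 0) = if i = j then E else 0

namespace FormPair

variable {F : Type*} [Field F] {n : ℕ} (Φ : FormPair F n)

/-- The polynomial `a₁ F₁(x) + a₂ F₂(x) + v · x`. -/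
def poly (a : F[X] × F[X]) (v x : Fin n → F[X]) : F[X] :=
  a.1 * tri Φ.c x x x + a.2 * (x ⬝ᵥ Φ.M.mulVec x) + v ⬝ᵥ x

theorem corank_map {S : Type*} [CommRing S] (φ : F[X] →+* S) (x : Fin n → S) (i : Fin n) :
    (Φ.B.map φ).mulVec ((Φ.M.map φ).mulVec x) i + φ (Φ.b i) * x Φ.i₀ = φ Φ.E * x i := by
  have h : ∀ j, ((Φ.B.map φ) * (Φ.M.map φ)) i j + φ (Φ.b i) * (if j = Φ.i₀ then 1 else 0) =
      if i = j then φ Φ.E else 0 := fun j => by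
    rw [← Matrix.map_mul, Matrix.map_apply]
    have := congrArg φ (Φ.corank i j)
    simp only [map_add, map_mul] at this
    split_ifs at this ⊢ <;> simpa using this
  rw [Matrix.mulVec_mulVec]
  have h2 : φ (Φ.b i) * x Φ.i₀ =
      ∑ j, φ (Φ.b i) * (if j = Φ.i₀ then 1 else 0) * x j := by simp
  rw [h2, Matrix.mulVec, dotProduct, ← Finset.sum_add_distrib]
  simp only [← add_mul, h]
  simp

/-- The reductions of the coefficients in the residue ring modulo `r`, with the phase `a / r`. -/
theorem toRes_poly (r : F[X]) (a : F[X] × F[X]) (v x : Fin n → F[X]) :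
    toRes r (Φ.poly a v x) = cubicPhase (fun i j k => toRes r a.1 * toRes r (Φ.c i j k))
      (toRes r a.2 • Φ.M.map (toRes r)) (fun i => toRes r (v i)) fun i => toRes r (x i) := by
  have h1 := tri_map Φ.c (toRes r) x x x
  have h2 : toRes r (x ⬝ᵥ Φ.M.mulVec x) =
      (fun i => toRes r (x i)) ⬝ᵥ (Φ.M.map (toRes r)).mulVec fun i => toRes r (x i) := by
    rw [RingHom.map_dotProduct]
    congr 1
    funext i
    exact RingHom.map_mulVec (toRes r) Φ.M x i
  have h3 : toRes r (v ⬝ᵥ x) = (fun i => toRes r (v i)) ⬝ᵥ fun i => toRes r (x i) := by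
    rw [RingHom.map_dotProduct]; rfl
  rw [poly, map_add, map_add, map_mul, map_mul, ← h1, h2, h3, cubicPhase, tri, tri,
    triV_const_smul, Matrix.smul_mulVec, smul_dotProduct, dotProduct_smul]
  rfl

theorem isUnit_six (Φ : FormPair F n) (r : F[X]) : IsUnit (6 : Res r) := by
  have : (6 : Res r) = toRes r (Polynomial.C 6) := by
    rw [map_ofNat Polynomial.C 6, map_ofNat (toRes r) 6]
  rw [this]
  exact (Polynomial.isUnit_C.mpr (isUnit_iff_ne_zero.mpr Φ.six_ne_zero)).map (toRes r)

theorem isUnit_two (Φ : FormPair F n) (r : F[X]) : IsUnit (2 : Res r) := by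
  have h := Φ.isUnit_six r
  have : (6 : Res r) = 2 * 3 := by norm_num
  exact isUnit_of_mul_isUnit_left (this ▸ h)

theorem isUnit_three (Φ : FormPair F n) (r : F[X]) : IsUnit (3 : Res r) := by
  have h := Φ.isUnit_six r
  have : (6 : Res r) = 2 * 3 := by norm_num
  exact isUnit_of_mul_isUnit_right (this ▸ h)

theorem symm_smul_map (r : F[X]) (s : Res r) : (s • Φ.M.map (toRes r)).IsSymm := by
  have := Φ.symm_M
  ext i j
  simp [Matrix.transpose_apply, this.apply]

theorem symm_const_mul (r : F[X]) (s : Res r) :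
    SymTensor fun i j k => s * toRes r (Φ.c i j k) := (Φ.symm_c.map (toRes r)).const_mul s

theorem exists_degree_bound : ∃ h : ℕ, ∀ i j k, (Φ.c i j k).natDegree ≤ h := by
  refine ⟨∑ i, ∑ j, ∑ k, (Φ.c i j k).natDegree, fun i j k => ?_⟩
  calc (Φ.c i j k).natDegree ≤ ∑ k, (Φ.c i j k).natDegree :=
        Finset.single_le_sum (f := fun k => (Φ.c i j k).natDegree) (fun _ _ => Nat.zero_le _)
          (Finset.mem_univ k)
    _ ≤ ∑ j, ∑ k, (Φ.c i j k).natDegree :=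
        Finset.single_le_sum (f := fun j => ∑ k, (Φ.c i j k).natDegree) (fun _ _ => Nat.zero_le _)
          (Finset.mem_univ j)
    _ ≤ _ := Finset.single_le_sum (f := fun i => ∑ j, ∑ k, (Φ.c i j k).natDegree)
          (fun _ _ => Nat.zero_le _) (Finset.mem_univ i)

/-- Vectors of `n` polynomials of degree less than `y`. -/
abbrev LowDeg (F : Type*) [Field F] (n y : ℕ) : Type _ := Fin n → Polynomial.degreeLT F y

theorem card_hessian_zeros_le (y : ℕ) [Finite (LowDeg F n y)] :
    Nat.card {xx : LowDeg F n y × LowDeg F n y //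
      triV Φ.c (fun i => (xx.1 i : F[X])) (fun i => (xx.2 i : F[X])) = 0} ≤
      Nat.card (LowDeg F n y) * (Φ.D + 2) ^ n := by
  let κ := algebraMap F[X] (RatFunc F)
  have hκ : Function.Injective κ := IsFractionRing.injective _ _
  let e : LowDeg F n y →+ (Fin n → RatFunc F) :=
    AddMonoidHom.mk' (fun x i => κ (x i : F[X])) fun x x' => by funext i; simp
  have he : Function.Injective e := fun x y h => funext fun i => Subtype.ext (hκ (congrFun h i))
  have h1 := (Φ.cert.map κ).card_pairs_le ((map_ne_zero_iff κ hκ).mpr Φ.Δ_ne_zero) e he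
  refine le_trans (Nat.card_mono (Set.toFinite _) fun xx h4 => ?_) h1
  change triV Φ.c (fun i => (xx.1 i : F[X])) (fun i => (xx.2 i : F[X])) = 0 at h4
  have := triV_map Φ.c κ (fun i => (xx.1 i : F[X])) (fun i => (xx.2 i : F[X]))
  rw [h4] at this
  refine this.trans ?_
  funext i
  simp

variable (p : ℕ) [Fact p.Prime] [Algebra (ZMod p) F]

/-- The summand of the complete exponential sum. -/
def summand (r : F[X]) (a : F[X] × F[X]) (v x : Fin n → F[X]) : ℂ :=
  psi p (ofPoly (Φ.poly a v x) / ofPoly r)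

theorem summand_eq_chi (r : F[X]) (a : F[X] × F[X]) (v x : Fin n → F[X]) :
    Φ.summand p r a v x = chi p r (cubicPhase (fun i j k => toRes r a.1 * toRes r (Φ.c i j k))
      (toRes r a.2 • Φ.M.map (toRes r)) (fun i => toRes r (v i)) fun i => toRes r (x i)) := by
  rw [← toRes_poly, chi_toRes, summand]

theorem summand_periodic (r : F[X]) (a : F[X] × F[X]) (v : Fin n → F[X]) :
    PeriodicMod r (Φ.summand p r a v) := by
  intro x y h
  rw [summand_eq_chi, summand_eq_chi]
  congr 3
  funext i
  exact toRes_eq_iff.mpr (h i)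

variable [Fintype F]

/-- The normalised complete exponential sum
`|r|⁻ⁿ ∑_{x mod r} ψ((a₁ F₁(x) + a₂ F₂(x) + v · x)/r)`. -/
def expSum (r : F[X]) (a : F[X] × F[X]) (v : Fin n → F[X]) : ℂ := avg r (Φ.summand p r a v)

theorem norm_expSum_le_one {r : F[X]} (hr : r ≠ 0) (a : F[X] × F[X]) (v : Fin n → F[X]) :
    ‖Φ.expSum p r a v‖ ≤ 1 := norm_avg_le hr fun _ => (norm_psi p _).le

theorem polyAbs_pow_mul_norm_expSum {r : F[X]} [Fintype (Res r)] (hr : r ≠ 0) (a : F[X] × F[X])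
    (v : Fin n → F[X]) : polyAbs r ^ n * ‖Φ.expSum p r a v‖ =
    ‖∑ x : Fin n → Res r, chi p r (cubicPhase (fun i j k => toRes r a.1 * toRes r (Φ.c i j k))
      (toRes r a.2 • Φ.M.map (toRes r)) (fun i => toRes r (v i)) x)‖ := by
  have h := pow_pos (polyAbs_pos hr) n
  rw [expSum, avg_eq_sum _ (fun x => chi p r (cubicPhase
    (fun i j k => toRes r a.1 * toRes r (Φ.c i j k))
      (toRes r a.2 • Φ.M.map (toRes r)) (fun i => toRes r (v i)) x)) fun x => Φ.summand_eq_chi p ..,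
    norm_mul, norm_inv, Complex.norm_real, Real.norm_of_nonneg h.le, mul_inv_cancel_left₀ h.ne']

end FormPair


namespace FormPair

variable {F : Type*} [Field F] {n : ℕ} (Φ : FormPair F n)

theorem triV_mem_degreeLT {h y d : ℕ} (hh : ∀ i j k, (Φ.c i j k).natDegree ≤ h)
    (hy : 2 * y + h ≤ d + 1) (x x' : LowDeg F n y) (k : Fin n) :
    triV Φ.c (fun i => (x i : F[X])) (fun i => (x' i : F[X])) k ∈ Polynomial.degreeLT F d := by
  refine Submodule.sum_mem _ fun i _ => Submodule.sum_mem _ fun j _ => ?_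
  have h1 := Polynomial.mem_degreeLT.mp (x i).2
  have h2 := Polynomial.mem_degreeLT.mp (x' j).2
  rw [Polynomial.mem_degreeLT]
  by_cases hx : (x i : F[X]) = 0
  · simp [hx]
  by_cases hx' : (x' j : F[X]) = 0
  · simp [hx']
  rw [Polynomial.degree_eq_natDegree hx, Nat.cast_lt] at h1
  rw [Polynomial.degree_eq_natDegree hx', Nat.cast_lt] at h2
  refine Polynomial.degree_le_natDegree.trans_lt ?_
  rw [Nat.cast_lt]
  change (Φ.c i j k * (x i : F[X]) * (x' j : F[X])).natDegree < d
  have h3 := Polynomial.natDegree_mul_le (p := Φ.c i j k * (x i : F[X])) (q := (x' j : F[X]))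
  have h4 := Polynomial.natDegree_mul_le (p := Φ.c i j k) (q := (x i : F[X]))
  have h5 := hh i j k
  omega

/-- The biadditive map `(h, h') ↦ a ∑ c_{ijk} h_i h'_j` over the residue ring. -/
def hessianMap (r s : F[X]) : (Fin n → Res r) →+ (Fin n → Res r) →+ (Fin n → Res r) :=
  AddMonoidHom.mk' (fun h => AddMonoidHom.mk'
    (fun h' => triV (fun i j k => toRes r s * toRes r (Φ.c i j k)) h h')
    (triV_add_right _ h)) fun x y => by ext z; simp [triV_add_left]

theorem hessianMap_apply (r s : F[X]) (h h' : Fin n → Res r) : Φ.hessianMap r s h h' =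
    triV (fun i j k => toRes r s * toRes r (Φ.c i j k)) h h' := rfl

variable (p : ℕ) [Fact p.Prime] [Algebra (ZMod p) F] [Fintype F]

theorem finite_lowDeg (y : ℕ) : Finite (LowDeg F n y) :=
  Finite.of_equiv _ (Equiv.piCongrRight fun _ : Fin n => (Polynomial.degreeLTEquiv F y).toEquiv).symm

theorem card_lowDeg (y : ℕ) : Nat.card (LowDeg F n y) = Fintype.card F ^ (y * n) := by
  rw [Nat.card_congr (Equiv.piCongrRight fun _ => (Polynomial.degreeLTEquiv F y).toEquiv)]
  simp [pow_mul]

/-- The zeros of the Hessian map modulo `r` are counted by restricting it to vectors of degree less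
than `y`, where the congruence becomes an equation over `F[t]`. -/
theorem card_hessianMap_zeros_le {h : ℕ} (hh : ∀ i j k, (Φ.c i j k).natDegree ≤ h) {r r₁ s : F[X]}
    (hr : r ≠ 0) (hr₁ : r₁ ≠ 0) (hdvd : ∀ f, r ∣ s * f → r₁ ∣ f) {y : ℕ}
    (hy : y = (r₁.natDegree + 1 - h) / 2) :
    Nat.card {x : (Fin n → Res r) × (Fin n → Res r) // Φ.hessianMap r s x.1 x.2 = 0} *
      (Fintype.card F) ^ (y * n) ≤ Nat.card (Fin n → Res r) ^ 2 * (Φ.D + 2) ^ n := by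
  have := finite_res hr
  have := finite_lowDeg (F := F) (n := n) y
  let ι : LowDeg F n y →+ (Fin n → Res r) :=
    AddMonoidHom.mk' (fun x i => toRes r (x i : F[X])) fun x x' => by funext i; simp
  have h2 := natCard_biadditive_zeros_le (Φ.hessianMap r s) ι
  have h3 : Nat.card {x : LowDeg F n y × LowDeg F n y // Φ.hessianMap r s (ι x.1) (ι x.2) = 0} ≤
      Nat.card (LowDeg F n y) * (Φ.D + 2) ^ n := by
    refine le_trans ?_ (Φ.card_hessian_zeros_le y)
    refine Nat.card_mono (Set.toFinite _) fun xx h4 => ?_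
    change Φ.hessianMap r s (ι xx.1) (ι xx.2) = 0 at h4
    change triV Φ.c (fun i => (xx.1 i : F[X])) (fun i => (xx.2 i : F[X])) = 0
    -- for small `y` the components have degree less than that of `r₁`, so that divisibility
    -- by `r₁` makes them vanish; otherwise `y = 0` and there is only the zero vector
    by_cases hy : 2 * y + h ≤ r₁.natDegree + 1
    · funext k
      refine Polynomial.eq_zero_of_dvd_of_degree_lt (p := r₁) ?_ ?_
      · apply hdvd
        rw [← toRes_eq_zero, map_mul]
        have h6 := congrFun h4 k
        rw [hessianMap_apply, triV_const_smul] at h6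
        have h7 := congrFun (triV_map Φ.c (toRes r) (fun i => (xx.1 i : F[X]))
          (fun i => (xx.2 i : F[X]))) k
        rw [Function.comp_apply] at h7
        rw [← h7]
        exact h6
      · rw [Polynomial.degree_eq_natDegree hr₁]
        exact Polynomial.mem_degreeLT.mp (Φ.triV_mem_degreeLT hh hy xx.1 xx.2 k)
    · have hy0 : y = 0 := by omega
      have hx : ∀ i, (xx.1 i : F[X]) = 0 := fun i => by
        have := (Polynomial.mem_degreeLT.mp (xx.1 i).2).trans_le
          (Nat.cast_le.mpr hy0.le : (y : WithBot ℕ) ≤ (0 : ℕ))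
        simpa using this
      funext k
      simp [triV, hx]
  have hV : Nat.card (LowDeg F n y) = Fintype.card F ^ (y * n) := card_lowDeg y
  rw [hV] at h2 h3
  have hpos : 0 < Fintype.card F ^ (y * n) := pow_pos Fintype.card_pos _
  refine Nat.le_of_mul_le_mul_right ?_ hpos
  calc _ = _ * (Fintype.card F ^ (y * n)) ^ 2 := by rw [mul_assoc, ← sq]
    _ ≤ _ := h2
    _ ≤ Nat.card (Fin n → Res r) ^ 2 * (Fintype.card F ^ (y * n) * (Φ.D + 2) ^ n) :=
        Nat.mul_le_mul_left _ h3
    _ = _ := by ring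

/-- Weyl differencing, in terms of the number of zeros of the Hessian map. -/
theorem norm_expSum_pow_four_le {r : F[X]} (hr : r ≠ 0) (a : F[X] × F[X]) (v : Fin n → F[X])
    {Z : ℝ} (hZ : (Nat.card {x : (Fin n → Res r) × (Fin n → Res r) //
      Φ.hessianMap r a.1 x.1 x.2 = 0} : ℝ) ≤ (Nat.card (Fin n → Res r) : ℝ) ^ 2 * Z) :
    ‖Φ.expSum p r a v‖ ^ 4 ≤ Z := by
  classical
  have := finite_res hr
  have := Fintype.ofFinite (Res r)
  set G : ℝ := polyAbs r ^ n with hG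
  have hGpos : 0 < G := pow_pos (polyAbs_pos hr) n
  have hcardG : (Fintype.card (Fin n → Res r) : ℝ) = G := card_res_pi hr
  have h1 := weyl_cubic (χ := chi p r) (v := fun i => toRes r (v i)) (chi_isPrimitive p hr)
    (norm_chi p r) (Φ.symm_const_mul r (toRes r a.1)) (Φ.symm_smul_map r (toRes r a.2))
    (Φ.isUnit_six r)
  rw [← Φ.polyAbs_pow_mul_norm_expSum p hr, ← hG, hcardG, ← Nat.cast_sum,
    sum_card_filter_eq fun h h' => triV (fun i j k => toRes r a.1 * toRes r (Φ.c i j k)) h h' = 0]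
    at h1
  rw [Nat.card_eq_fintype_card (α := Fin n → Res r), hcardG] at hZ
  have e1 : G ^ 4 * (‖Φ.expSum p r a v‖ ^ 4) ≤ G ^ 4 * Z := by
    calc _ = (G * ‖Φ.expSum p r a v‖) ^ 4 := by ring
      _ ≤ _ := h1
      _ ≤ G ^ 2 * (G ^ 2 * Z) := mul_le_mul_of_nonneg_left hZ (by positivity)
      _ = _ := by ring
  exact le_of_mul_le_mul_left e1 (by positivity)

/-- Weyl's inequality for the complete sums. The saving depends only on the denominator `r₁` of
the coefficient of the cubic form. -/
theorem exists_weyl_bound : ∃ C : ℝ, 0 < C ∧ ∀ (r r₁ : F[X]) (a : F[X] × F[X])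
    (v : Fin n → F[X]), r ≠ 0 → r₁ ≠ 0 → (∀ f, r ∣ a.1 * f → r₁ ∣ f) →
    ‖Φ.expSum p r a v‖ ^ 4 ≤ C * polyAbs r₁ ^ (-((n : ℝ) / 2)) := by
  obtain ⟨h, hh⟩ := Φ.exists_degree_bound
  have hq := one_lt_q F
  have hq0 := q_pos F
  set q : ℝ := (Fintype.card F : ℝ) with hqdef
  refine ⟨(Φ.D + 2 : ℝ) ^ n * q ^ ((h : ℝ) * n / 2), by positivity, ?_⟩
  intro r r₁ a v hr hr₁ hdvd
  obtain ⟨y, hy⟩ : ∃ y, y = (r₁.natDegree + 1 - h) / 2 := ⟨_, rfl⟩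
  set V : ℝ := q ^ (y * n) with hVdef
  have hVpos : 0 < V := by positivity
  have h5 : ‖Φ.expSum p r a v‖ ^ 4 ≤ (Φ.D + 2 : ℝ) ^ n / V := by
    refine Φ.norm_expSum_pow_four_le p hr a v ?_
    have h2 := (Nat.cast_le (α := ℝ)).mpr (Φ.card_hessianMap_zeros_le hh hr hr₁ hdvd hy)
    rw [← mul_div_assoc, le_div_iff₀ hVpos]
    push_cast at h2
    exact h2
  have h6 : V⁻¹ ≤ q ^ ((h : ℝ) * n / 2) * polyAbs r₁ ^ (-((n : ℝ) / 2)) := by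
    rw [inv_le_iff_one_le_mul₀' hVpos, polyAbs_of_ne hr₁, hVdef, ← Real.rpow_natCast q (y * n),
      ← Real.rpow_natCast q, ← Real.rpow_mul hq0.le, ← Real.rpow_add hq0, ← Real.rpow_add hq0]
    apply Real.one_le_rpow hq.le
    have e1 : r₁.natDegree ≤ 2 * y + h := by omega
    have e2 : (r₁.natDegree : ℝ) ≤ 2 * y + h := by exact_mod_cast e1
    push_cast
    nlinarith [Nat.cast_nonneg (α := ℝ) n]
  calc ‖Φ.expSum p r a v‖ ^ 4 ≤ (Φ.D + 2 : ℝ) ^ n * V⁻¹ := by rwa [← div_eq_mul_inv]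
    _ ≤ (Φ.D + 2 : ℝ) ^ n * (q ^ ((h : ℝ) * n / 2) * polyAbs r₁ ^ (-((n : ℝ) / 2))) := by gcongr
    _ = _ := by ring

end FormPair


theorem annCard_toRes_le {F : Type*} [Field F] [Fintype F] {r f : F[X]} (hf : f ≠ 0) :
    (annCard (toRes r f) : ℝ) ≤ polyAbs f := by
  have := finite_res hf
  rw [← card_res hf, Nat.cast_le, annCard]
  have : ∀ y : (AddMonoidHom.mulLeft (toRes r f)).ker, ∃ h, f * y.1.out = r * h := by
    intro y
    have h1 := y.2
    rw [AddMonoidHom.mem_ker, AddMonoidHom.coe_mulLeft, ← toRes_out y.1, ← map_mul,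
      toRes_eq_zero] at h1
    exact h1
  choose h hh using this
  refine Nat.card_le_card_of_injective (fun y => toRes f (h y)) fun y z hyz => ?_
  obtain ⟨s, hs⟩ := toRes_eq_iff.mp hyz
  apply Subtype.ext
  rw [← toRes_out y.1, ← toRes_out z.1, toRes_eq_iff]
  refine ⟨s, mul_left_cancel₀ hf ?_⟩
  linear_combination hh y - hh z + r * hs

namespace FormPair

variable {F : Type*} [Field F] {n : ℕ} (Φ : FormPair F n)

/-- The gradient of `a₁ F₁(x) + a₂ F₂(x) + v · x`. -/
def grad (a : F[X] × F[X]) (v x : Fin n → F[X]) : Fin n → F[X] :=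
  (3 * a.1) • triV Φ.c x x + (2 * a.2) • Φ.M.mulVec x + v

theorem map_grad {S : Type*} [CommRing S] (φ : F[X] →+* S) (a : F[X] × F[X])
    (v x : Fin n → F[X]) (i : Fin n) : φ (Φ.grad a v x i) =
      (3 * φ a.1) * triV (fun i j k => φ (Φ.c i j k)) (φ ∘ x) (φ ∘ x) i +
      (2 * φ a.2) * (Φ.M.map φ).mulVec (φ ∘ x) i + φ (v i) := by
  have h1 := congrFun (triV_map Φ.c φ x x) i
  have h2 := RingHom.map_mulVec φ Φ.M x i
  rw [h1, ← h2]
  simp [grad, map_ofNat φ]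

variable (p : ℕ) [Fact p.Prime] [Algebra (ZMod p) F] [Fintype F]

/-- Stationary phase: only the points where the gradient vanishes modulo `r / l` contribute. -/
theorem norm_expSum_mul_le {r : F[X]} (hr : r ≠ 0) (a : F[X] × F[X]) (v : Fin n → F[X])
    {l : F[X]} (hl : r ∣ l * l) : polyAbs r ^ n * ‖Φ.expSum p r a v‖ ≤
      Nat.card {x : Fin n → Res r // ∀ i, r ∣ l * Φ.grad a v (fun i => (x i).out) i} := by
  classical
  have := finite_res hr
  have := Fintype.ofFinite (Res r)
  have h1 := stationary_phase (χ := chi p r) (v := fun i => toRes r (v i)) (chi_isPrimitive p hr)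
    (norm_chi p r) (Φ.symm_const_mul r (toRes r a.1)) (Φ.symm_smul_map r (toRes r a.2))
    (l := toRes r l) (by rw [← map_mul, toRes_eq_zero]; exact hl)
  rw [← Φ.polyAbs_pow_mul_norm_expSum p hr] at h1
  refine h1.trans (le_of_eq ?_)
  rw [Nat.card_eq_fintype_card, Fintype.card_subtype, Nat.cast_inj]
  refine congrArg Finset.card (Finset.filter_congr fun x _ => ?_)
  rw [funext_iff]
  refine forall_congr' fun i => ?_
  rw [← toRes_eq_zero, map_mul, map_grad]
  have hx : (toRes r : F[X] → Res r) ∘ (fun i => (x i).out) = x := funext fun i => toRes_out (x i)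
  rw [hx, triV_const_smul]
  simp only [Pi.smul_apply, Pi.add_apply, Matrix.smul_mulVec, smul_eq_mul, Pi.zero_apply,
    ← mul_assoc]

/-- The bound obtained from the quadratic form, when the cubic form does not contribute modulo
`r / l`. -/
theorem norm_expSum_le_of_quadratic {w : F[X]} (hw : Prime w) {k e : ℕ} (hek : e ≤ k)
    (hke : k ≤ 2 * e) {a : F[X] × F[X]} (v : Fin n → F[X]) (ha₁ : w ^ k ∣ w ^ e * a.1)
    (ha₂ : ¬ w ∣ a.2) :
    ‖Φ.expSum p (w ^ k) a v‖ * polyAbs w ^ ((k - e) * (n - 1)) ≤ polyAbs Φ.E ^ n := by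
  classical
  set r := w ^ k with hrdef
  have hr : r ≠ 0 := pow_ne_zero _ hw.ne_zero
  have := finite_res hr
  have := Fintype.ofFinite (Res r)
  have hl : r ∣ w ^ e * w ^ e := by rw [← pow_add]; exact pow_dvd_pow _ (by omega)
  have h1 := Φ.norm_expSum_mul_le p hr a v hl
  set l := toRes r (w ^ e)
  -- two points of the set differ by an element of the kernel of `l M`
  have h2 : Nat.card {x : Fin n → Res r // ∀ i, r ∣ w ^ e * Φ.grad a v (fun i => (x i).out) i} ≤
      (Finset.univ.filter fun x : Fin n → Res r =>
        l • (Φ.M.map (toRes r)).mulVec x = 0).card := by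
    rw [← Fintype.card_subtype, ← Nat.card_eq_fintype_card]
    rcases isEmpty_or_nonempty {x : Fin n → Res r //
      ∀ i, r ∣ w ^ e * Φ.grad a v (fun i => (x i).out) i} with hemp | ⟨⟨x₀, hx₀⟩⟩
    · simp
    have hgrad : ∀ x : Fin n → Res r, (∀ i, r ∣ w ^ e * Φ.grad a v (fun i => (x i).out) i) →
        ∀ i, l * ((2 * toRes r a.2) * (Φ.M.map (toRes r)).mulVec x i + toRes r (v i)) = 0 := by
      intro x hx i
      have h3 := hx i
      rw [← toRes_eq_zero, map_mul, map_grad] at h3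
      have hx' : (toRes r : F[X] → Res r) ∘ (fun i => (x i).out) = x :=
        funext fun i => toRes_out (x i)
      have h4 : l * toRes r a.1 = 0 := by rw [← map_mul, toRes_eq_zero]; exact ha₁
      rw [hx'] at h3
      linear_combination h3 - 3 * triV (fun i j k => toRes r (Φ.c i j k)) x x i * h4
    refine Nat.card_le_card_of_injective (fun x => ⟨x.1 - x₀, ?_⟩) fun x y hxy => ?_
    · funext i
      have hu : IsUnit (2 * toRes r a.2) := by
        refine (Φ.isUnit_two r).mul ?_
        have hcop : IsCoprime a.2 r :=
          (((hw.irreducible.coprime_iff_not_dvd).mpr ha₂).symm).pow_right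
        obtain ⟨s, t, hst⟩ := hcop
        refine IsUnit.of_mul_eq_one (toRes r s) ?_
        rw [← map_mul, ← map_one (toRes r), toRes_eq_iff]
        exact ⟨-t, by linear_combination hst⟩
      change l * (Φ.M.map (toRes r)).mulVec (x.1 - x₀) i = 0
      rw [← hu.mul_right_eq_zero]
      have e1 := hgrad x.1 x.2 i
      have e2 := hgrad x₀ hx₀ i
      simp only [Matrix.mulVec_sub, Pi.sub_apply]
      linear_combination e1 - e2
    · exact Subtype.ext (sub_left_injective (congrArg Subtype.val hxy))
  have h3 := card_smul_mulVec_eq_zero (fun x i => Φ.corank_map (toRes r) x i) l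
  set N := (Finset.univ.filter fun x : Fin n → Res r =>
        l • (Φ.M.map (toRes r)).mulVec x = 0).card
  have hann : 0 < annCard l := Nat.card_pos
  have hn : n = (n - 1) + 1 := by
    have := Φ.i₀.pos
    omega
  have h4 : N ≤ Fintype.card (Res r) * annCard l ^ (n - 1) * annCard (toRes r Φ.E) ^ n := by
    refine Nat.le_of_mul_le_mul_right (h3.trans (le_of_eq ?_)) hann
    have e : annCard l ^ n = annCard l ^ (n - 1) * annCard l := by
      rw [← pow_succ]
      congr 1
    rw [mul_pow, e]
    ring
  have hw1 : 0 < polyAbs w := polyAbs_pos hw.ne_zero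
  have h5 : (N : ℝ) ≤ polyAbs w ^ k * (polyAbs w ^ e) ^ (n - 1) * polyAbs Φ.E ^ n := by
    have e0 : (Fintype.card (Res r) : ℝ) = polyAbs w ^ k := by
      rw [← Nat.card_eq_fintype_card, card_res hr, hrdef, polyAbs_pow]
    have e1 : (annCard l : ℝ) ≤ polyAbs w ^ e := by
      rw [← polyAbs_pow]
      exact annCard_toRes_le (pow_ne_zero _ hw.ne_zero)
    have e2 : (annCard (toRes r Φ.E) : ℝ) ≤ polyAbs Φ.E := annCard_toRes_le Φ.E_ne_zero
    calc (N : ℝ) ≤ (Fintype.card (Res r) : ℝ) * annCard l ^ (n - 1) *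
          annCard (toRes r Φ.E) ^ n := by exact_mod_cast h4
      _ ≤ _ := by rw [e0]; gcongr
  have h6 : polyAbs r ^ n * ‖Φ.expSum p r a v‖ ≤
      polyAbs w ^ k * (polyAbs w ^ e) ^ (n - 1) * polyAbs Φ.E ^ n :=
    h1.trans ((Nat.cast_le.mpr h2).trans h5)
  have h7 : polyAbs r ^ n = polyAbs w ^ k * (polyAbs w ^ e) ^ (n - 1) *
      polyAbs w ^ ((k - e) * (n - 1)) := by
    rw [hrdef, polyAbs_pow, ← pow_mul, ← pow_mul, ← pow_add, ← pow_add]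
    congr 1
    obtain ⟨m, rfl⟩ : ∃ m, n = m + 1 := ⟨n - 1, hn⟩
    obtain ⟨d, rfl⟩ : ∃ d, k = e + d := ⟨k - e, by omega⟩
    simp only [Nat.add_sub_cancel, Nat.add_sub_cancel_left]
    ring
  rw [h7] at h6
  have h8 : 0 < polyAbs w ^ k * (polyAbs w ^ e) ^ (n - 1) := by positivity
  refine le_of_mul_le_mul_left ?_ h8
  calc _ = polyAbs w ^ k * (polyAbs w ^ e) ^ (n - 1) *
      polyAbs w ^ ((k - e) * (n - 1)) * ‖Φ.expSum p r a v‖ := by ring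
    _ ≤ _ := h6

/-- The bound at a prime not dividing the numerator of the cubic form. -/
theorem norm_expSum_prime_le {w : F[X]} (hw : Prime w) (hΔ : ¬ w ∣ Φ.Δ) {a : F[X] × F[X]}
    (v : Fin n → F[X]) (ha₁ : ¬ w ∣ a.1) :
    ‖Φ.expSum p w a v‖ ^ 4 ≤ (Φ.D + 2 : ℝ) ^ n / polyAbs w ^ n := by
  have hr := hw.ne_zero
  have hmax : (Ideal.span {w}).IsMaximal :=
    PrincipalIdealRing.isMaximal_of_irreducible hw.irreducible
  let _ : Field (Res w) := Ideal.Quotient.field _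
  have := finite_res hr
  have := Fintype.ofFinite (Res w)
  have hcard : (Nat.card (Fin n → Res w) : ℝ) = polyAbs w ^ n := by
    rw [Nat.card_eq_fintype_card, card_res_pi hr]
  refine Φ.norm_expSum_pow_four_le p hr a v ?_
  have h1 := (Φ.cert.map (toRes w)).card_pairs_le (toRes_eq_zero.not.mpr hΔ)
    (AddMonoidHom.id _) Function.injective_id
  have h2 : Nat.card {x : (Fin n → Res w) × (Fin n → Res w) //
      Φ.hessianMap w a.1 x.1 x.2 = 0} ≤ Nat.card (Fin n → Res w) * (Φ.D + 2) ^ n := by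
    refine le_trans (Nat.card_mono (Set.toFinite _) fun xx h4 => ?_) h1
    change Φ.hessianMap w a.1 xx.1 xx.2 = 0 at h4
    rw [hessianMap_apply, triV_const_smul] at h4
    exact (smul_eq_zero.mp h4).resolve_left (toRes_eq_zero.not.mpr ha₁)
  have hpos : 0 < polyAbs w ^ n := pow_pos (polyAbs_pos hr) n
  calc _ ≤ ((Nat.card (Fin n → Res w) * (Φ.D + 2) ^ n : ℕ) : ℝ) := Nat.cast_le.mpr h2
    _ = _ := by
      push_cast
      rw [hcard]
      field_simp

/-- The bound at powers of a prime not dividing the numerator of the cubic form. -/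
theorem norm_expSum_prime_pow_le {w : F[X]} (hw : Prime w) (hΔ : ¬ w ∣ Φ.Δ) {k : ℕ} (hk : 2 ≤ k)
    {a : F[X] × F[X]} (v : Fin n → F[X]) (ha₁ : ¬ w ∣ a.1) :
    ‖Φ.expSum p (w ^ k) a v‖ ≤ (Φ.D + 2 : ℝ) ^ n / polyAbs w ^ n := by
  classical
  have hw0 := hw.ne_zero
  have hr : w ^ k ≠ 0 := pow_ne_zero _ hw0
  have hmax : (Ideal.span {w}).IsMaximal :=
    PrincipalIdealRing.isMaximal_of_irreducible hw.irreducible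
  let _ : Field (Res w) := Ideal.Quotient.field _
  have := finite_res hw0
  have := Fintype.ofFinite (Res w)
  have := finite_res hr
  have := Fintype.ofFinite (Res (w ^ k))
  have hl : w ^ k ∣ w ^ (k - 1) * w ^ (k - 1) := by
    rw [← pow_add]; exact pow_dvd_pow _ (by omega)
  have h1 := Φ.norm_expSum_mul_le p hr a v hl
  let φ : Fin n → Fin n → Fin n → Res w := fun i j k => toRes w (Φ.c i j k)
  set u : Res w := 3 * toRes w a.1
  have hu : u ≠ 0 :=
    mul_ne_zero (Φ.isUnit_three w).ne_zero (toRes_eq_zero.not.mpr ha₁)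
  -- the critical points modulo `w` solve an equation to which the certificate applies
  let Z : Finset (Fin n → Res w) := Finset.univ.filter fun z => triV φ z z =
    (-(u⁻¹ * (2 * toRes w a.2)) • Φ.M.map (toRes w)).mulVec z + fun i => -(u⁻¹ * toRes w (v i))
  have hZ : Z.card ≤ (Φ.D + 2) ^ n :=
    (Φ.cert.map (toRes w)).card_le (toRes_eq_zero.not.mpr hΔ) _ _ Z fun z hz =>
      (Finset.mem_filter.mp hz).2
  let π₀ : Res (w ^ k) →+* Res w := Ideal.Quotient.factor
    (Ideal.span_singleton_le_span_singleton.mpr (dvd_pow_self w (by omega)))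
  have hπ₀ : ∀ f, π₀ (toRes (w ^ k) f) = toRes w f := fun f => by simp [π₀]
  let π : (Fin n → Res (w ^ k)) →+ (Fin n → Res w) :=
    AddMonoidHom.mk' (fun x i => π₀ (x i)) fun x y => by funext i; simp
  have hπ : Function.Surjective π := fun y => ⟨fun i => toRes _ (y i).out, by
    funext i
    exact (hπ₀ _).trans (toRes_out _)⟩
  have h2 : Nat.card {x : Fin n → Res (w ^ k) //
      ∀ i, w ^ k ∣ w ^ (k - 1) * Φ.grad a v (fun i => (x i).out) i} ≤
      (Finset.univ.filter fun x => π x ∈ Z).card := by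
    rw [← Fintype.card_subtype, ← Nat.card_eq_fintype_card]
    refine Nat.card_mono (Set.toFinite _) fun x hx => ?_
    change π x ∈ Z
    refine Finset.mem_filter.mpr ⟨Finset.mem_univ _, ?_⟩
    funext i
    have h3 : w ∣ Φ.grad a v (fun i => (x i).out) i := by
      have h4 := hx i
      have h5 : w ^ k = w ^ (k - 1) * w := by rw [← pow_succ]; congr 1; omega
      obtain ⟨s, hs⟩ := h4
      exact ⟨s, mul_left_cancel₀ (pow_ne_zero (k - 1) hw0) (by linear_combination hs + s * h5)⟩
    rw [← toRes_eq_zero, map_grad] at h3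
    have hx' : (toRes w : F[X] → Res w) ∘ (fun i => (x i).out) = π x := by
      funext i
      change toRes w _ = π₀ (x i)
      conv_rhs => rw [← toRes_out (x i), hπ₀]
    rw [hx'] at h3
    simp only [Matrix.smul_mulVec, Pi.add_apply, Pi.smul_apply, smul_eq_mul]
    refine mul_left_cancel₀ hu ?_
    have huu : u * u⁻¹ = 1 := mul_inv_cancel₀ hu
    linear_combination h3 + (2 * toRes w a.2 * (Φ.M.map (toRes w)).mulVec (π x) i +
      toRes w (v i)) * huu
  have h3 := sum_comp_of_surjective π hπ fun z => if z ∈ Z then (1 : ℂ) else 0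
  rw [Finset.sum_boole, Finset.sum_boole] at h3
  have h4 : polyAbs w ^ n * ((Finset.univ.filter fun x => π x ∈ Z).card : ℝ) =
      polyAbs (w ^ k) ^ n * Z.card := by
    rw [← card_res_pi hw0, ← card_res_pi hr]
    rw [Finset.filter_mem_eq_inter, Finset.univ_inter] at h3
    exact_mod_cast h3
  have hwpos : 0 < polyAbs w ^ n := pow_pos (polyAbs_pos hw0) n
  have hrpos : 0 < polyAbs (w ^ k) ^ n := pow_pos (polyAbs_pos hr) n
  rw [le_div_iff₀ hwpos]
  refine le_of_mul_le_mul_left ?_ hrpos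
  calc _ = polyAbs w ^ n * (polyAbs (w ^ k) ^ n * ‖Φ.expSum p (w ^ k) a v‖) := by ring
    _ ≤ polyAbs w ^ n * ((Finset.univ.filter fun x => π x ∈ Z).card : ℝ) := by
      gcongr
      exact h1.trans (Nat.cast_le.mpr h2)
    _ = polyAbs (w ^ k) ^ n * Z.card := h4
    _ ≤ polyAbs (w ^ k) ^ n * (Φ.D + 2 : ℝ) ^ n := by
      gcongr
      exact_mod_cast hZ

/-- The bound for Gauss sums modulo a prime. -/
theorem norm_expSum_prime_gauss {w : F[X]} (hw : Prime w) {a : F[X] × F[X]} (v : Fin n → F[X])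
    (ha₁ : w ∣ a.1) (ha₂ : ¬ w ∣ a.2) :
    ‖Φ.expSum p w a v‖ ^ 2 ≤ polyAbs Φ.E ^ n / polyAbs w ^ (n - 1) := by
  classical
  have hr := hw.ne_zero
  have hmax : (Ideal.span {w}).IsMaximal :=
    PrincipalIdealRing.isMaximal_of_irreducible hw.irreducible
  let _ : Field (Res w) := Ideal.Quotient.field _
  have := finite_res hr
  have := Fintype.ofFinite (Res w)
  have hc0 : (fun i j k => toRes w a.1 * toRes w (Φ.c i j k)) = 0 := by
    funext i j k
    rw [toRes_eq_zero.mpr ha₁, zero_mul]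
    rfl
  have h1 := gauss_quadratic (χ := chi p w) (v := fun i => toRes w (v i)) (chi_isPrimitive p hr)
    (norm_chi p w) (Φ.symm_smul_map w (toRes w a.2)) (Φ.isUnit_six w)
  rw [← hc0, ← Φ.polyAbs_pow_mul_norm_expSum p hr, card_res_pi hr] at h1
  have h2 := card_smul_mulVec_eq_zero (fun x i => Φ.corank_map (toRes w) x i) 1
  have hann : annCard (1 : Res w) = 1 := by
    rw [annCard]
    have : (AddMonoidHom.mulLeft (1 : Res w)).ker = ⊥ := by
      rw [AddMonoidHom.ker_eq_bot_iff]
      intro x y h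
      simpa using h
    rw [this]
    exact AddSubgroup.card_bot
  rw [hann, mul_one, one_mul] at h2
  have h3 : ((Finset.univ.filter fun h : Fin n → Res w =>
      (toRes w a.2 • Φ.M.map (toRes w)).mulVec h = 0).card : ℝ) ≤
      polyAbs w * polyAbs Φ.E ^ n := by
    have e1 : (Finset.univ.filter fun h : Fin n → Res w =>
        (toRes w a.2 • Φ.M.map (toRes w)).mulVec h = 0) =
        Finset.univ.filter fun h : Fin n → Res w =>
          (1 : Res w) • (Φ.M.map (toRes w)).mulVec h = 0 := by
      refine Finset.filter_congr fun x _ => ?_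
      rw [Matrix.smul_mulVec, one_smul, smul_eq_zero, or_iff_right (toRes_eq_zero.not.mpr ha₂)]
    have e0 : (Fintype.card (Res w) : ℝ) = polyAbs w := by
      rw [← Nat.card_eq_fintype_card, card_res hr]
    have e2 : (annCard (toRes w Φ.E) : ℝ) ≤ polyAbs Φ.E := annCard_toRes_le Φ.E_ne_zero
    have hpos : 0 ≤ polyAbs w := polyAbs_nonneg w
    rw [e1]
    refine ((Nat.cast_le (α := ℝ)).mpr h2).trans ?_
    push_cast
    rw [e0]
    gcongr
  have hn : n = (n - 1) + 1 := by
    have := Φ.i₀.pos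
    omega
  have hpos : 0 < polyAbs w := polyAbs_pos hr
  have h4 : (polyAbs w ^ n * ‖Φ.expSum p w a v‖) ^ 2 ≤
      polyAbs w ^ n * (polyAbs w * polyAbs Φ.E ^ n) := h1.trans (by gcongr)
  rw [le_div_iff₀ (by positivity)]
  refine le_of_mul_le_mul_left ?_ (show 0 < polyAbs w ^ (n + 1) by positivity)
  calc _ = (polyAbs w ^ n * ‖Φ.expSum p w a v‖) ^ 2 := by
        have : polyAbs w ^ (n + 1) * polyAbs w ^ (n - 1) = (polyAbs w ^ n) ^ 2 := by
          rw [← pow_add, ← pow_mul]; congr 1; omega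
        rw [mul_pow, ← this]; ring
    _ ≤ _ := h4
    _ = _ := by ring

end FormPair


/-! ### The majorant of the singular series -/

theorem le_mul_rpow_of_pow_le {x A Q y : ℝ} {m : ℕ} (hx : 0 ≤ x) (hA : 1 ≤ A) (hQ : 0 < Q)
    (hm : m ≠ 0) (h : x ^ m ≤ A * Q ^ (-y)) : x ≤ A * Q ^ (-(y / m)) := by
  have hA0 : 0 ≤ A := by linarith
  rw [← pow_le_pow_iff_left₀ hx (by positivity) hm]
  refine h.trans ?_
  rw [mul_pow, ← Real.rpow_mul_natCast hQ.le]
  have : -(y / m) * (m : ℝ) = -y := by field_simp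
  rw [this]
  gcongr
  exact le_self_pow₀ hA hm

theorem le_mul_rpow_of_le {x A C Q y z : ℝ} (hA : 0 ≤ A) (hQ : 1 ≤ Q) (hAC : A ≤ C) (hzy : z ≤ y)
    (h : x ≤ A * Q ^ (-y)) : x ≤ C * Q ^ (-z) := by
  have hQ0 : 0 < Q := by linarith
  refine h.trans ?_
  gcongr
  exact hA.trans hAC

namespace FormPair

variable {F : Type*} [Field F] {n : ℕ} (Φ : FormPair F n)
variable (p : ℕ) [Fact p.Prime] [Algebra (ZMod p) F] [Fintype F]

/-- Bounds for the sums modulo powers of primes `w`, when `w ^ j` is the denominator of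
`a₁ / w ^ k`. The exponent exceeds by `1 + k / 20` the one that compensates for the number of such
numerators `a`. -/
theorem exists_expSum_prime_pow_bound (hn : 18 < n) : ∃ C : ℝ, 1 ≤ C ∧ ∀ (w : F[X]), Prime w →
    ∀ (k j : ℕ) (a : F[X] × F[X]) (v : Fin n → F[X]), 1 ≤ k → j ≤ k → w ^ k ∣ w ^ j * a.1 →
    (∀ f, w ^ k ∣ a.1 * f → w ^ j ∣ f) → (j < k → ¬ w ∣ a.2) →
    ‖Φ.expSum p (w ^ k) a v‖ ≤ C * polyAbs w ^ (-((k : ℝ) + j + 1 + k / 20)) := by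
  obtain ⟨C₀, hC₀, hweyl⟩ := Φ.exists_weyl_bound p
  have hn' : (19 : ℝ) ≤ n := by exact_mod_cast hn
  set A₁ : ℝ := C₀ + 1
  set A₂ : ℝ := (Φ.D + 2 : ℝ) ^ n
  set A₃ : ℝ := polyAbs Φ.E ^ n
  set A₄ : ℝ := polyAbs Φ.Δ
  have h₁ : 1 ≤ A₁ := by simp only [A₁]; linarith
  have h₂ : 1 ≤ A₂ := one_le_pow₀ (by linarith [Nat.cast_nonneg (α := ℝ) Φ.D])
  have h₃ : 1 ≤ A₃ := one_le_pow₀ (one_le_polyAbs Φ.E_ne_zero)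
  have h₄ : 1 ≤ A₄ := one_le_polyAbs Φ.Δ_ne_zero
  have h₁₄ : 1 ≤ A₁ * A₄ := one_le_mul_of_one_le_of_one_le h₁ h₄
  have h₂₃ : 1 ≤ A₂ * A₃ := one_le_mul_of_one_le_of_one_le h₂ h₃
  have hC14 : A₁ * A₄ ≤ A₁ * A₄ * (A₂ * A₃) := le_mul_of_one_le_right (by linarith) h₂₃
  have hC1 : A₁ ≤ A₁ * A₄ * (A₂ * A₃) :=
    (le_mul_of_one_le_right (by linarith) h₄).trans hC14
  have hC23 : A₂ * A₃ ≤ A₁ * A₄ * (A₂ * A₃) := le_mul_of_one_le_left (by linarith) h₁₄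
  have hC2 : A₂ ≤ A₁ * A₄ * (A₂ * A₃) := (le_mul_of_one_le_right (by linarith) h₃).trans hC23
  have hC3 : A₃ ≤ A₁ * A₄ * (A₂ * A₃) := (le_mul_of_one_le_left (by linarith) h₂).trans hC23
  refine ⟨A₁ * A₄ * (A₂ * A₃), one_le_mul_of_one_le_of_one_le h₁₄ h₂₃, ?_⟩
  intro w hw k j a v hk hjk hj1 hj2 ha₂
  have hw0 := hw.ne_zero
  have hr : w ^ k ≠ 0 := pow_ne_zero _ hw0
  have hQ : 1 ≤ polyAbs w := one_le_polyAbs hw0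
  set Q := polyAbs w with hQdef
  have hQ0 : 0 < Q := by linarith
  set S := ‖Φ.expSum p (w ^ k) a v‖ with hSdef
  have hS : 0 ≤ S := norm_nonneg _
  have hkR : (1 : ℝ) ≤ k := by exact_mod_cast hk
  have hjR : (j : ℝ) ≤ k := by exact_mod_cast hjk
  -- Weyl's inequality
  have hW : S ≤ A₁ * Q ^ (-((n : ℝ) / 8 * j)) := by
    have h := hweyl (w ^ k) (w ^ j) a v hr (pow_ne_zero _ hw0) hj2
    have h' : S ^ 4 ≤ A₁ * Q ^ (-((n : ℝ) / 2 * j)) := by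
      refine h.trans ?_
      rw [polyAbs_pow, ← Real.rpow_natCast_mul hQ0.le]
      have : (j : ℝ) * -((n : ℝ) / 2) = -((n : ℝ) / 2 * j) := by ring
      rw [this]
      gcongr
      simp only [A₁]; linarith
    have := le_mul_rpow_of_pow_le hS h₁ hQ0 (by norm_num) h'
    convert this using 3
    push_cast
    ring
  -- the case `j = k`, in which `w` does not divide `a₁`
  rcases hjk.eq_or_lt with rfl | hlt
  · have ha₁ : ¬ w ∣ a.1 := by
      intro h
      have h1 : w ^ j ∣ a.1 * w ^ (j - 1) := by
        obtain ⟨s, hs⟩ := h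
        refine ⟨s, ?_⟩
        have : w ^ j = w * w ^ (j - 1) := by rw [← pow_succ']; congr 1; omega
        rw [hs, this]; ring
      have h2 := hj2 _ h1
      rw [pow_dvd_pow_iff hw0 hw.not_isUnit] at h2
      omega
    rcases le_or_gt 4 j with h4 | h4
    · have h4' : (4 : ℝ) ≤ j := by exact_mod_cast h4
      refine le_mul_rpow_of_le (by linarith) hQ hC1 ?_ hW
      nlinarith
    have h4' : (j : ℝ) ≤ 3 := by exact_mod_cast (by omega : j ≤ 3)
    -- at the finitely many bad primes a factor `|w|` is absorbed by the constant
    by_cases hΔ : w ∣ Φ.Δ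
    · refine le_mul_rpow_of_le (by linarith) hQ hC14 ?_
        (y := (n : ℝ) / 8 * j + 1) (hW.trans ?_)
      · nlinarith
      · have hle : Q ≤ A₄ := polyAbs_le_of_dvd Φ.Δ_ne_zero hΔ
        have e : Q ^ (-((n : ℝ) / 8 * j)) = Q * Q ^ (-((n : ℝ) / 8 * j + 1)) := by
          conv_rhs => rw [← Real.rpow_one Q]
          rw [← Real.rpow_mul hQ0.le, ← Real.rpow_add hQ0]
          congr 1; ring
        rw [e, mul_assoc]
        gcongr
    rcases (show j = 1 ∨ 2 ≤ j by omega) with rfl | h2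
    · have h := Φ.norm_expSum_prime_le p hw hΔ v ha₁
      rw [← pow_one w, ← hSdef, pow_one w, ← hQdef, div_eq_mul_inv,
        ← Real.rpow_natCast Q, ← Real.rpow_neg hQ0.le] at h
      refine le_mul_rpow_of_le (by linarith) hQ hC2 ?_
        (le_mul_rpow_of_pow_le hS h₂ hQ0 (by norm_num) h)
      push_cast
      linarith
    · have h := Φ.norm_expSum_prime_pow_le p hw hΔ h2 v ha₁
      rw [← hSdef, ← hQdef, div_eq_mul_inv, ← Real.rpow_natCast Q, ← Real.rpow_neg hQ0.le] at h
      refine le_mul_rpow_of_le (by linarith) hQ hC2 ?_ h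
      linarith
  -- the case `j < k`, in which `w` does not divide `a₂`
  · have ha₂' := ha₂ hlt
    rcases hk.eq_or_lt with rfl | hk2
    · obtain rfl : j = 0 := by omega
      have h := Φ.norm_expSum_prime_gauss p hw v (by simpa using hj1) ha₂'
      rw [← pow_one w, ← hSdef, pow_one w, ← hQdef, div_eq_mul_inv,
        ← Real.rpow_natCast Q, ← Real.rpow_neg hQ0.le] at h
      refine le_mul_rpow_of_le (by linarith) hQ hC3 ?_
        (le_mul_rpow_of_pow_le hS h₃ hQ0 (by norm_num) h)
      rw [Nat.cast_sub (by omega)]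
      push_cast
      linarith
    -- the quadratic form, with `l = w ^ e`
    have hquad : ∀ e, j ≤ e → e ≤ k → k ≤ 2 * e →
        S ≤ A₃ * Q ^ (-(((k : ℝ) - e) * (n - 1))) := by
      intro e hje hek hke
      have h := Φ.norm_expSum_le_of_quadratic p hw hek hke v
        (hj1.trans (mul_dvd_mul_right (pow_dvd_pow w hje) _)) ha₂'
      rw [← hSdef, ← hQdef, ← Real.rpow_natCast Q] at h
      push_cast [Nat.cast_sub hek, Nat.cast_sub (show 1 ≤ n by omega)] at h
      rw [Real.rpow_neg hQ0.le, ← div_eq_mul_inv, le_div_iff₀ (by positivity)]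
      exact h
    have hk2R : (2 : ℝ) ≤ k := by exact_mod_cast hk2
    -- `e` must be at least `j` and at least `k / 2`
    rcases le_or_gt j ((k + 1) / 2) with h1 | h1
    · refine le_mul_rpow_of_le (by linarith) hQ hC3 ?_
        (hquad ((k + 1) / 2) h1 (by omega) (by omega))
      have e1 : (((k + 1) / 2 : ℕ) : ℝ) ≤ ((k : ℝ) + 1) / 2 := by
        have := Nat.cast_div_le (α := ℝ) (m := k + 1) (n := 2)
        push_cast at this
        exact this
      have e2 : (j : ℝ) ≤ (((k + 1) / 2 : ℕ) : ℝ) := by exact_mod_cast h1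
      nlinarith
    · rcases le_or_gt ((2.05 : ℝ) * k + 1) (19 * (k - j)) with h2 | h2
      · refine le_mul_rpow_of_le (by linarith) hQ hC3 ?_ (hquad j le_rfl hjk (by omega))
        nlinarith
      -- `j` is so close to `k` that Weyl's inequality is good enough
      · refine le_mul_rpow_of_le (by linarith) hQ hC1 ?_ hW
        have e3 : (1 : ℝ) ≤ k - j := by
          have : (j : ℝ) + 1 ≤ k := by exact_mod_cast hlt
          linarith
        have e4 : 7 ≤ k := by
          by_contra! hcon
          have : (k : ℝ) ≤ 6 := by exact_mod_cast (by omega : k ≤ 6)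
          linarith
        have e5 : (7 : ℝ) ≤ k := by exact_mod_cast e4
        have e6 : (19 : ℝ) / 8 * j ≤ n / 8 * j := by gcongr
        linarith

end FormPair


section Counting

variable {F : Type*} [Field F] [Fintype F]

theorem injOn_toRes (r : F[X]) : Set.InjOn (toRes r) {f | polyAbs f < polyAbs r} :=
  fun _ hf _ hg h => sub_eq_zero.mp
    (eq_zero_of_dvd_of_polyAbs_lt (toRes_eq_iff.mp h) (polyAbs_sub_lt hf hg))

theorem finite_polyAbs_lt (r : F[X]) : {f : F[X] | polyAbs f < polyAbs r}.Finite := by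
  by_cases hr : r = 0
  · subst hr
    convert Set.finite_empty
    ext f
    simp [polyAbs_nonneg]
  · have := finite_res hr
    exact Set.Finite.of_finite_image (Set.toFinite _) (injOn_toRes r)

/-- The polynomials `f` with `|f| < |r|`. -/
def lowPolys (r : F[X]) : Finset F[X] := (finite_polyAbs_lt r).toFinset

theorem mem_lowPolys {r f : F[X]} : f ∈ lowPolys r ↔ polyAbs f < polyAbs r := by
  simp [lowPolys]

theorem mod_mem_lowPolys {r : F[X]} (hr : r ≠ 0) (f : F[X]) : f % r ∈ lowPolys r := by
  rw [mem_lowPolys, polyAbs_lt_iff]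
  exact EuclideanDomain.mod_lt _ hr

theorem dvd_sub_mod {F : Type*} [Field F] (r f : F[X]) : r ∣ f - f % r :=
  ⟨f / r, by linear_combination -EuclideanDomain.mod_add_div f r⟩

theorem card_lowPolys {r : F[X]} (hr : r ≠ 0) : ((lowPolys r).card : ℝ) = polyAbs r := by
  rw [← card_res hr, Nat.cast_inj, lowPolys, ← Set.ncard_eq_toFinset_card _ (finite_polyAbs_lt r),
    ← (injOn_toRes r).ncard_image, ← Set.ncard_univ]
  congr 1
  refine Set.eq_univ_of_forall fun x => ⟨x.out % r, mem_lowPolys.mp (mod_mem_lowPolys hr _), ?_⟩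
  conv_rhs => rw [← toRes_out x]
  exact (toRes_eq_iff.mpr (dvd_sub_mod r _)).symm

theorem finite_numerators (r : F[X]) : (numerators r).Finite :=
  ((finite_polyAbs_lt r).prod (finite_polyAbs_lt r)).subset fun _ ha => ⟨ha.1, ha.2.1⟩

/-- The set of numerators of fractions with denominator `r`, as a finite set. -/
def numer (r : F[X]) : Finset (F[X] × F[X]) := (finite_numerators r).toFinset

theorem mem_numer {r : F[X]} {a : F[X] × F[X]} : a ∈ numer r ↔ a ∈ numerators r := by
  simp [numer]

theorem card_monic_le (A : Finset F[X]) (hA : ∀ f ∈ A, f.Monic) (d : ℕ) :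
    ((A.filter fun f => f.natDegree = d).card : ℝ) ≤ (Fintype.card F : ℝ) ^ d := by
  have h1 : polyAbs (Polynomial.X ^ d : F[X]) = (Fintype.card F : ℝ) ^ d := by
    rw [polyAbs_of_ne (pow_ne_zero _ Polynomial.X_ne_zero), Polynomial.natDegree_X_pow]
  rw [← h1, ← card_lowPolys (pow_ne_zero _ Polynomial.X_ne_zero), Nat.cast_le]
  refine Finset.card_le_card_of_injOn (fun f => f - Polynomial.X ^ d) (fun f hf => ?_)
    fun f _ g _ h => sub_left_injective h
  obtain ⟨hfA, hfd⟩ := Finset.mem_filter.mp hf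
  have hf := hA f hfA
  refine mem_lowPolys.mpr (polyAbs_lt_iff.mpr ?_)
  have hdeg : f.degree = (Polynomial.X ^ d : F[X]).degree := by
    rw [Polynomial.degree_eq_natDegree hf.ne_zero, hfd, Polynomial.degree_X_pow]
  rw [← hdeg]
  exact Polynomial.degree_sub_lt_left hdeg hf.ne_zero (by simp [hf.leadingCoeff])

/-- The zeta function of `F[t]` converges to the right of `1`. -/
theorem exists_sum_rpow_le {ε : ℝ} (hε : 0 < ε) : ∃ Z : ℝ, 0 ≤ Z ∧ ∀ A : Finset F[X],
    (∀ f ∈ A, f.Monic) → ∑ f ∈ A, polyAbs f ^ (-(1 + ε)) ≤ Z := by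
  have hq := one_lt_q F
  have hq0 := q_pos F
  set q : ℝ := (Fintype.card F : ℝ)
  have hlt : q ^ (-ε) < 1 :=
    Real.rpow_lt_one_of_one_lt_of_neg hq (by linarith)
  have hsum : Summable fun d : ℕ => (q ^ (-ε)) ^ d :=
    summable_geometric_of_lt_one (by positivity) hlt
  refine ⟨∑' d : ℕ, (q ^ (-ε)) ^ d, tsum_nonneg fun d => by positivity, fun A hA => ?_⟩
  have h1 : ∀ f ∈ A, f.natDegree ∈ A.image Polynomial.natDegree := fun f hf =>
    Finset.mem_image_of_mem _ hf
  rw [← Finset.sum_fiberwise_of_maps_to h1]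
  refine le_trans (Finset.sum_le_sum fun d _ => ?_)
    (hsum.sum_le_tsum (A.image Polynomial.natDegree) fun d _ => by positivity)
  have h2 : ∀ f ∈ A.filter fun f => f.natDegree = d, polyAbs f ^ (-(1 + ε)) =
      q ^ (-((d : ℝ) * (1 + ε))) := fun f hf => by
    obtain ⟨hfA, hfd⟩ := Finset.mem_filter.mp hf
    rw [polyAbs_of_ne (hA f hfA).ne_zero, hfd, ← Real.rpow_natCast_mul hq0.le]
    congr 1; ring
  rw [Finset.sum_congr rfl h2, Finset.sum_const, nsmul_eq_mul]
  calc _ ≤ q ^ d * q ^ (-((d : ℝ) * (1 + ε))) := by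
        gcongr
        exact card_monic_le A hA d
    _ = _ := by
        rw [← Real.rpow_natCast, ← Real.rpow_natCast, ← Real.rpow_add hq0, ← Real.rpow_mul hq0.le]
        congr 1; ring

/-- Upper bound for the Euler product of a submultiplicative function. -/
theorem sum_le_prod_of_submultiplicative {F : Type*} [Field F] {f b : F[X] → ℝ}
    (hf0 : ∀ r, 0 ≤ f r) (hf1 : f 1 ≤ 1)
    (hmul : ∀ r s, r ≠ 0 → s ≠ 0 → IsCoprime r s → f (r * s) ≤ f r * f s)
    (hb : ∀ w, w.Monic → Prime w → ∀ K : ℕ, ∑ k ∈ Finset.range K, f (w ^ (k + 1)) ≤ b w)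
    (T : Finset F[X]) (hT : ∀ w ∈ T, w.Monic ∧ Prime w) :
    ∀ A : Finset F[X], (∀ r ∈ A, r.Monic ∧ ∀ w, w.Monic → Prime w → w ∣ r → w ∈ T) →
      ∑ r ∈ A, f r ≤ ∏ w ∈ T, (1 + b w) := by
  classical
  induction T using Finset.induction_on with
  | empty =>
    intro A hA
    have : A ⊆ {1} := fun r hr => by
      obtain ⟨hmon, hno⟩ := hA r hr
      rw [Finset.mem_singleton]
      by_contra hne
      have hnu : ¬ IsUnit r := fun h => hne (hmon.eq_one_of_isUnit h)
      obtain ⟨w, hwm, hw, hwr⟩ := Polynomial.exists_monic_irreducible_factor r hnu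
      exact absurd (hno w hwm hw.prime hwr) (Finset.notMem_empty w)
    refine (Finset.sum_le_sum_of_subset_of_nonneg this fun r _ _ => hf0 r).trans ?_
    simpa using hf1
  | insert w T hwT ih =>
    intro A hA
    obtain ⟨hwm, hw⟩ := hT w (Finset.mem_insert_self _ _)
    have hb0 : 0 ≤ b w := by simpa using hb w hwm hw 0
    -- split off the powers of `w`
    have hdec : ∀ r : F[X], ∃ ks : ℕ × F[X], r ≠ 0 → r = w ^ ks.1 * ks.2 ∧ ¬ w ∣ ks.2 := fun r => by
      by_cases hr : r = 0
      · exact ⟨(0, 0), fun h => absurd hr h⟩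
      · obtain ⟨k, s, h1, h2⟩ := (FiniteMultiplicity.of_not_isUnit hw.not_isUnit
          hr).exists_eq_pow_mul_and_not_dvd |> fun ⟨c, h⟩ =>
            (⟨_, c, h⟩ : ∃ k s, r = w ^ k * s ∧ ¬ w ∣ s)
        exact ⟨(k, s), fun _ => ⟨h1, h2⟩⟩
    choose ks hks using hdec
    have hks1 : ∀ r ∈ A, r = w ^ (ks r).1 * (ks r).2 := fun r hr =>
      (hks r (hA r hr).1.ne_zero).1
    have hks2 : ∀ r ∈ A, ¬ w ∣ (ks r).2 := fun r hr => (hks r (hA r hr).1.ne_zero).2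
    have hinj : Set.InjOn ks A := fun r hr s hs h => by
      rw [hks1 r hr, hks1 s hs, h]
    set A' := A.image fun r => (ks r).2 with hA'
    set K := A.sup (fun r => (ks r).1) with hK
    have ihA := ih (fun w hw => hT w (Finset.mem_insert_of_mem hw)) A' fun s hs => by
      obtain ⟨r, hr, rfl⟩ := Finset.mem_image.mp hs
      obtain ⟨hmon, hno⟩ := hA r hr
      refine ⟨?_, fun w' hw'm hw' hdvd => ?_⟩
      · rw [hks1 r hr] at hmon
        exact (hwm.pow _).of_mul_monic_left hmon
      · have h := hno w' hw'm hw' (by rw [hks1 r hr]; exact hdvd.mul_left _)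
        rcases Finset.mem_insert.mp h with rfl | h
        · exact absurd hdvd (hks2 r hr)
        · exact h
    have h1 : ∑ r ∈ A, f r ≤ ∑ r ∈ A, f (w ^ (ks r).1) * f (ks r).2 :=
      Finset.sum_le_sum fun r hr => by
        conv_lhs => rw [hks1 r hr]
        have hs0 : (ks r).2 ≠ 0 := fun h => hks2 r hr (h ▸ dvd_zero w)
        exact hmul _ _ (pow_ne_zero _ hw.ne_zero) hs0
          (((hw.irreducible.coprime_iff_not_dvd).mpr (hks2 r hr)).pow_left)
    have h2 : ∑ r ∈ A, f (w ^ (ks r).1) * f (ks r).2 ≤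
        ∑ x ∈ Finset.range (K + 1) ×ˢ A', f (w ^ x.1) * f x.2 := by
      rw [← Finset.sum_image (g := ks) (f := fun x => f (w ^ x.1) * f x.2) hinj]
      refine Finset.sum_le_sum_of_subset_of_nonneg (fun x hx => ?_) fun x _ _ =>
        mul_nonneg (hf0 _) (hf0 _)
      obtain ⟨r, hr, rfl⟩ := Finset.mem_image.mp hx
      refine Finset.mem_product.mpr ⟨Finset.mem_range.mpr (Nat.lt_succ_of_le ?_),
        Finset.mem_image.mpr ⟨r, hr, rfl⟩⟩
      exact Finset.le_sup (f := fun r => (ks r).1) hr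
    rw [Finset.sum_product] at h2
    simp only [← Finset.mul_sum, ← Finset.sum_mul] at h2
    rw [Finset.sum_range_succ', pow_zero] at h2
    rw [Finset.prod_insert hwT]
    refine h1.trans (h2.trans (mul_le_mul ?_ ihA (Finset.sum_nonneg fun _ _ => hf0 _)
      (by linarith)))
    linarith [hb w hwm hw K]

/-- Convergence of a series of submultiplicative terms, from its Euler product. -/
theorem summable_of_submultiplicative {F : Type*} [Field F] {f b : F[X] → ℝ}
    (hf0 : ∀ r, 0 ≤ f r) (hf1 : f 1 ≤ 1)
    (hmul : ∀ r s, r ≠ 0 → s ≠ 0 → IsCoprime r s → f (r * s) ≤ f r * f s)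
    (hb : ∀ w, w.Monic → Prime w → ∀ K : ℕ, ∑ k ∈ Finset.range K, f (w ^ (k + 1)) ≤ b w)
    {S : ℝ} (hS : ∀ T : Finset F[X], (∀ w ∈ T, w.Monic) → ∑ w ∈ T, b w ≤ S) :
    Summable fun r : {r : F[X] // r.Monic} => f r.1 := by
  classical
  refine summable_of_sum_le (c := Real.exp S) (fun r => hf0 _) fun A => ?_
  let A₁ : Finset F[X] := A.map (Function.Embedding.subtype _)
  have hA₁ : ∀ r ∈ A₁, r.Monic := fun r hr => by
    obtain ⟨x, _, rfl⟩ := Finset.mem_map.mp hr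
    exact x.2
  have hprod : (∏ r ∈ A₁, r) ≠ 0 := Finset.prod_ne_zero_iff.mpr fun r hr => (hA₁ r hr).ne_zero
  let T : Finset F[X] := (UniqueFactorizationMonoid.normalizedFactors (∏ r ∈ A₁, r)).toFinset
  have hT : ∀ w ∈ T, w.Monic ∧ Prime w := fun w hw => by
    have hw := Multiset.mem_toFinset.mp hw
    have h1 := UniqueFactorizationMonoid.prime_of_normalized_factor w hw
    refine ⟨?_, h1⟩
    rw [← UniqueFactorizationMonoid.normalize_normalized_factor w hw]
    exact Polynomial.monic_normalize h1.ne_zero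
  have h1 := sum_le_prod_of_submultiplicative hf0 hf1 hmul hb T hT A₁ fun r hr =>
    ⟨hA₁ r hr, fun w hwm hw hwr => by
      refine Multiset.mem_toFinset.mpr ?_
      obtain ⟨w', hw', hass⟩ := UniqueFactorizationMonoid.exists_mem_normalizedFactors_of_dvd hprod
        hw.irreducible (hwr.trans (Finset.dvd_prod_of_mem _ hr))
      have h2 : w'.Monic := (hT w' (Multiset.mem_toFinset.mpr hw')).1
      rwa [Polynomial.eq_of_monic_of_associated hwm h2 hass]⟩
  have h2 : ∏ w ∈ T, (1 + b w) ≤ Real.exp S := by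
    refine le_trans ?_ (Real.exp_le_exp.mpr (hS T fun w hw => (hT w hw).1))
    rw [Real.exp_sum]
    refine Finset.prod_le_prod (fun w hw => ?_) fun w _ => by linarith [Real.add_one_le_exp (b w)]
    have : 0 ≤ b w := by simpa using hb w (hT w hw).1 (hT w hw).2 0
    linarith
  have h3 : ∑ r ∈ A, f r.1 = ∑ r ∈ A₁, f r := by
    rw [Finset.sum_map]; rfl
  rw [h3]
  exact h1.trans h2

end Counting


namespace FormPair

variable {F : Type*} [Field F] {n : ℕ} (Φ : FormPair F n)
theorem poly_mul (u : F[X]) (a : F[X] × F[X]) (v x : Fin n → F[X]) :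
    Φ.poly (u * a.1, u * a.2) (u • v) x = u * Φ.poly a v x := by
  simp only [poly, smul_dotProduct, smul_eq_mul]
  ring

variable (p : ℕ) [Fact p.Prime] [Algebra (ZMod p) F] [Fintype F]

theorem expSum_congr {r : F[X]} {a a' : F[X] × F[X]} (h₁ : r ∣ a.1 - a'.1) (h₂ : r ∣ a.2 - a'.2)
    (v : Fin n → F[X]) : Φ.expSum p r a v = Φ.expSum p r a' v := by
  refine avg_congr fun x => psi_div_congr p ?_
  obtain ⟨s, hs⟩ := h₁
  obtain ⟨t, ht⟩ := h₂
  refine ⟨s * tri Φ.c x x x + t * (x ⬝ᵥ Φ.M.mulVec x), ?_⟩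
  simp only [poly]
  linear_combination tri Φ.c x x x * hs + (x ⬝ᵥ Φ.M.mulVec x) * ht

/-- Twisted multiplicativity. -/
theorem expSum_mul {r s u v : F[X]} (hr : r ≠ 0) (hs : s ≠ 0) (huv : u * r + v * s = 1)
    (a : F[X] × F[X]) (y : Fin n → F[X]) : Φ.expSum p (r * s) a y =
      Φ.expSum p r (v * a.1, v * a.2) (v • y) * Φ.expSum p s (u * a.1, u * a.2) (u • y) := by
  rw [expSum, expSum, expSum, ← avg_mul_of_coprime hr hs ⟨u, v, huv⟩ (Φ.summand_periodic p r _ _)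
    (Φ.summand_periodic p s _ _)]
  refine avg_congr fun x => ?_
  simp only [summand, poly_mul]
  rw [← psi_add]
  congr 1
  have hr' := ofPoly_eq_zero.not.mpr hr
  have hs' := ofPoly_eq_zero.not.mpr hs
  have h := congrArg (ofPoly (F := F)) huv
  simp only [map_add, map_mul, map_one] at h ⊢
  field_simp
  linear_combination -(ofPoly (Φ.poly a y x)) * h

/-- The supremum over the linear terms of the normalised exponential sums. -/
def supSum (r : F[X]) (a : F[X] × F[X]) : ℝ := ⨆ v, ‖Φ.expSum p r a v‖

theorem norm_expSum_le_supSum {r : F[X]} (hr : r ≠ 0) (a : F[X] × F[X]) (v : Fin n → F[X]) :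
    ‖Φ.expSum p r a v‖ ≤ Φ.supSum p r a :=
  le_ciSup (f := fun v => ‖Φ.expSum p r a v‖)
    ⟨1, by rintro _ ⟨v, rfl⟩; exact Φ.norm_expSum_le_one p hr a v⟩ v

theorem supSum_nonneg (r : F[X]) (a : F[X] × F[X]) : 0 ≤ Φ.supSum p r a :=
  Real.iSup_nonneg fun _ => norm_nonneg _

/-- The sum of `supSum` over the numerators belonging to `r`: it bounds the contribution of `r`
to the singular series, for all `b` and `N`. -/
def majorant (r : F[X]) : ℝ := ∑ a ∈ numer r, Φ.supSum p r a

theorem majorant_nonneg (r : F[X]) : 0 ≤ Φ.majorant p r :=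
  Finset.sum_nonneg fun a _ => Φ.supSum_nonneg p r a

theorem majorant_one : Φ.majorant p 1 ≤ 1 := by
  have h : numer (1 : F[X]) ⊆ {((0 : F[X]), (0 : F[X]))} := fun a ha => by
    have ha := mem_numer.mp ha
    rw [Finset.mem_singleton]
    exact Prod.ext (eq_zero_of_dvd_of_polyAbs_lt (one_dvd _) ha.1)
      (eq_zero_of_dvd_of_polyAbs_lt (one_dvd _) ha.2.1)
  refine (Finset.sum_le_sum_of_subset_of_nonneg h fun a _ _ => Φ.supSum_nonneg p 1 a).trans ?_
  rw [Finset.sum_singleton]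
  exact ciSup_le fun v => Φ.norm_expSum_le_one p one_ne_zero _ v

theorem dvd_sub_of_mod_eq {F : Type*} [Field F] {t r f g : F[X]} (h : IsCoprime t r)
    (hfg : t * f % r = t * g % r) :
    r ∣ f - g := by
  refine h.symm.dvd_of_dvd_mul_left (y := t) ?_
  have h1 := dvd_sub_mod r (t * f)
  have h2 := dvd_sub_mod r (t * g)
  rw [← hfg] at h2
  have h3 := h1.sub h2
  have e : t * f - t * f % r - (t * g - t * f % r) = t * (f - g) := by ring
  rwa [e] at h3

theorem mod_mem_numer {r s t : F[X]} {a : F[X] × F[X]} (hr : r ≠ 0) (htr : IsCoprime t r)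
    (hrs : r ∣ s) (ha : a ∈ numer s) : (t * a.1 % r, t * a.2 % r) ∈ numer r := by
  obtain ⟨-, -, ha⟩ := mem_numer.mp ha
  refine mem_numer.mpr ⟨mem_lowPolys.mp (mod_mem_lowPolys hr _),
    mem_lowPolys.mp (mod_mem_lowPolys hr _), fun g h1 h2 h3 => ?_⟩
  have hgt : IsCoprime g t := (htr.of_isCoprime_of_dvd_right h3).symm
  have aux : ∀ f, g ∣ f % r → g ∣ f := fun f hf => by
    have := (h3.trans (dvd_sub_mod r f)).add hf
    rwa [sub_add_cancel] at this
  exact ha g (hgt.dvd_of_dvd_mul_left (aux _ h1)) (hgt.dvd_of_dvd_mul_left (aux _ h2))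
    (h3.trans hrs)

theorem supSum_mul_le {r s u v : F[X]} (hr : r ≠ 0) (hs : s ≠ 0) (huv : u * r + v * s = 1)
    {a b c : F[X] × F[X]} (hb₁ : r ∣ v * a.1 - b.1) (hb₂ : r ∣ v * a.2 - b.2)
    (hc₁ : s ∣ u * a.1 - c.1) (hc₂ : s ∣ u * a.2 - c.2) :
    Φ.supSum p (r * s) a ≤ Φ.supSum p r b * Φ.supSum p s c := by
  refine ciSup_le fun y => ?_
  rw [Φ.expSum_mul p hr hs huv, norm_mul, Φ.expSum_congr p (a := (v * a.1, v * a.2)) hb₁ hb₂,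
    Φ.expSum_congr p (a := (u * a.1, u * a.2)) hc₁ hc₂]
  exact mul_le_mul (Φ.norm_expSum_le_supSum p hr _ _) (Φ.norm_expSum_le_supSum p hs _ _)
    (norm_nonneg _) (Φ.supSum_nonneg p _ _)

theorem exists_splitting {r s u v : F[X]} (hr : r ≠ 0) (hs : s ≠ 0)
    (huv : u * r + v * s = 1) :
    ∃ φ : F[X] × F[X] → (F[X] × F[X]) × (F[X] × F[X]),
      Set.InjOn φ (numer (r * s)) ∧ (∀ a ∈ numer (r * s), φ a ∈ numer r ×ˢ numer s) ∧
      ∀ a, r ∣ v * a.1 - (φ a).1.1 ∧ r ∣ v * a.2 - (φ a).1.2 ∧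
        s ∣ u * a.1 - (φ a).2.1 ∧ s ∣ u * a.2 - (φ a).2.2 := by
  have hrs : IsCoprime r s := ⟨u, v, huv⟩
  have hvr : IsCoprime v r := ⟨s, u, by linear_combination huv⟩
  have hus : IsCoprime u s := ⟨r, v, by linear_combination huv⟩
  refine ⟨fun a => ((v * a.1 % r, v * a.2 % r), (u * a.1 % s, u * a.2 % s)), ?_, fun a ha => ?_,
    fun a => ⟨dvd_sub_mod _ _, dvd_sub_mod _ _, dvd_sub_mod _ _, dvd_sub_mod _ _⟩⟩
  · intro a ha b hb hab
    obtain ⟨ha1, ha2, -⟩ := mem_numer.mp ha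
    obtain ⟨hb1, hb2, -⟩ := mem_numer.mp hb
    simp only [Prod.mk.injEq] at hab
    obtain ⟨⟨e11, e12⟩, e21, e22⟩ := hab
    exact Prod.ext
      (sub_eq_zero.mp (eq_zero_of_dvd_of_polyAbs_lt (hrs.mul_dvd (dvd_sub_of_mod_eq hvr e11)
        (dvd_sub_of_mod_eq hus e21)) (polyAbs_sub_lt ha1 hb1)))
      (sub_eq_zero.mp (eq_zero_of_dvd_of_polyAbs_lt (hrs.mul_dvd (dvd_sub_of_mod_eq hvr e12)
        (dvd_sub_of_mod_eq hus e22)) (polyAbs_sub_lt ha2 hb2)))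
  · exact Finset.mem_product.mpr ⟨mod_mem_numer hr hvr (dvd_mul_right _ _) ha,
      mod_mem_numer hs hus (dvd_mul_left _ _) ha⟩

theorem _root_.FFCircle.sum_le_of_injOn {α β : Type*} {s : Finset α} {t : Finset β}
    {f : α → ℝ} {g : β → ℝ}
    (φ : α → β) (hinj : Set.InjOn φ s) (hmaps : ∀ a ∈ s, φ a ∈ t) (hg : ∀ b, 0 ≤ g b)
    (h : ∀ a ∈ s, f a ≤ g (φ a)) : ∑ a ∈ s, f a ≤ ∑ b ∈ t, g b := by
  classical
  refine (Finset.sum_le_sum h).trans ?_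
  rw [← Finset.sum_image (f := g) hinj]
  exact Finset.sum_le_sum_of_subset_of_nonneg (Finset.image_subset_iff.mpr hmaps) fun x _ _ => hg x

theorem majorant_mul_le {r s : F[X]} (hr : r ≠ 0) (hs : s ≠ 0) (hrs : IsCoprime r s) :
    Φ.majorant p (r * s) ≤ Φ.majorant p r * Φ.majorant p s := by
  obtain ⟨u, v, huv⟩ := hrs
  obtain ⟨φ, hinj, hmaps, hφ⟩ := exists_splitting hr hs huv
  rw [majorant, majorant, majorant, Finset.sum_mul_sum, ← Finset.sum_product']
  exact sum_le_of_injOn φ hinj hmaps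
    (fun x => mul_nonneg (Φ.supSum_nonneg p _ _) (Φ.supSum_nonneg p _ _)) fun a _ =>
    Φ.supSum_mul_le p hr hs huv (hφ a).1 (hφ a).2.1 (hφ a).2.2.1 (hφ a).2.2.2

theorem exists_denominator {w : F[X]} (hw : Prime w) {k : ℕ} (hk : 1 ≤ k) {a : F[X] × F[X]}
    (ha : a ∈ numerators (w ^ k)) : ∃ j ≤ k, w ^ k ∣ w ^ j * a.1 ∧
      (∀ f, w ^ k ∣ a.1 * f → w ^ j ∣ f) ∧ (j < k → ¬ w ∣ a.2) := by
  have hnot : w ∣ a.1 → ¬ w ∣ a.2 := fun h1 h2 =>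
    hw.not_isUnit (ha.2.2 w h1 h2 (dvd_pow_self w (by omega)))
  by_cases h0 : a.1 = 0
  · exact ⟨0, Nat.zero_le _, by simp [h0], fun f _ => by simp, fun _ => hnot (by simp [h0])⟩
  obtain ⟨c, hc, hwc⟩ := (FiniteMultiplicity.of_not_isUnit hw.not_isUnit
    h0).exists_eq_pow_mul_and_not_dvd
  set m := multiplicity w a.1
  have hm : m < k := by
    by_contra! h
    exact h0 (eq_zero_of_dvd_of_polyAbs_lt (hc ▸ (pow_dvd_pow w h).mul_right c) ha.1)
  refine ⟨k - m, Nat.sub_le _ _, ?_, fun f hf => ?_, fun hlt => hnot ?_⟩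
  · rw [hc, ← mul_assoc, ← pow_add, Nat.sub_add_cancel hm.le]
    exact dvd_mul_right _ _
  · have h1 : w ^ m * w ^ (k - m) ∣ w ^ m * (c * f) := by
      rw [← pow_add, Nat.add_sub_cancel' hm.le, ← mul_assoc, ← hc]
      exact hf
    exact hw.pow_dvd_of_dvd_mul_left _ hwc
      ((mul_dvd_mul_iff_left (pow_ne_zero _ hw.ne_zero)).mp h1)
  · rw [hc]
    exact (dvd_pow_self w (by omega)).mul_right c

theorem card_numerators_le {w : F[X]} (hw : w ≠ 0) {j k : ℕ} (hjk : j ≤ k)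
    (A : Finset (F[X] × F[X])) (hA : ∀ a ∈ A, a ∈ numerators (w ^ k) ∧ w ^ k ∣ w ^ j * a.1) :
    (A.card : ℝ) ≤ polyAbs w ^ (k + j) := by
  classical
  have h1 : A ⊆ (lowPolys (w ^ j) ×ˢ lowPolys (w ^ k)).image
      fun x => (w ^ (k - j) * x.1, x.2) := fun a ha => by
    obtain ⟨hnum, s, hs⟩ := hA a ha
    have e : w ^ k = w ^ j * w ^ (k - j) := by rw [← pow_add, Nat.add_sub_cancel' hjk]
    have e1 : a.1 = w ^ (k - j) * s := mul_left_cancel₀ (pow_ne_zero j hw) (by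
      linear_combination hs + s * e)
    refine Finset.mem_image.mpr ⟨(s, a.2), Finset.mem_product.mpr
      ⟨mem_lowPolys.mpr ?_, mem_lowPolys.mpr hnum.2.1⟩, Prod.ext e1.symm rfl⟩
    have h2 := hnum.1
    rw [e1, e, polyAbs_mul, polyAbs_mul, mul_comm] at h2
    exact lt_of_mul_lt_mul_right h2 (polyAbs_nonneg _)
  have h2 := (Finset.card_le_card h1).trans Finset.card_image_le
  rw [Finset.card_product] at h2
  refine (Nat.cast_le.mpr h2).trans (le_of_eq ?_)
  push_cast
  rw [card_lowPolys (pow_ne_zero _ hw), card_lowPolys (pow_ne_zero _ hw), polyAbs_pow, polyAbs_pow,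
    ← pow_add, add_comm]

/-- The numerators of `w ^ k` are sorted by the denominator `w ^ j` of `a₁ / w ^ k`; there are at most
`|w| ^ (k + j)` of each kind. -/
theorem exists_majorant_prime_pow_le (hn : 18 < n) : ∃ C : ℝ, 1 ≤ C ∧ ∀ w : F[X], Prime w →
    ∀ k : ℕ, 1 ≤ k →
      Φ.majorant p (w ^ k) ≤ C * (k + 1) * polyAbs w ^ (-(1 + (k : ℝ) / 20)) := by
  classical
  obtain ⟨C, hC, hbound⟩ := Φ.exists_expSum_prime_pow_bound p hn
  refine ⟨C, hC, fun w hw k hk => ?_⟩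
  have hw0 := hw.ne_zero
  have hQ0 : 0 < polyAbs w := polyAbs_pos hw0
  have h1 : ∀ a ∈ numer (w ^ k), ∃ j ≤ k, w ^ k ∣ w ^ j * a.1 ∧
      Φ.supSum p (w ^ k) a ≤ C * polyAbs w ^ (-((k : ℝ) + j + 1 + k / 20)) := fun a ha => by
    obtain ⟨j, hj, h1, h2, h3⟩ := exists_denominator hw hk (mem_numer.mp ha)
    exact ⟨j, hj, h1, ciSup_le fun v => hbound w hw k j a v hk hj h1 h2 h3⟩
  choose! j hj hj1 hj2 using h1
  have hmaps : ∀ a ∈ numer (w ^ k), j a ∈ Finset.range (k + 1) := fun a ha =>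
    Finset.mem_range.mpr (Nat.lt_succ_of_le (hj a ha))
  rw [majorant, ← Finset.sum_fiberwise_of_maps_to hmaps]
  have h2 : ∀ i ∈ Finset.range (k + 1),
      ∑ a ∈ (numer (w ^ k)).filter fun a => j a = i, Φ.supSum p (w ^ k) a ≤
        C * polyAbs w ^ (-(1 + (k : ℝ) / 20)) := fun i hi => by
    have hik : i ≤ k := Nat.lt_succ_iff.mp (Finset.mem_range.mp hi)
    have h3 : ∀ a ∈ (numer (w ^ k)).filter fun a => j a = i, Φ.supSum p (w ^ k) a ≤
        C * polyAbs w ^ (-((k : ℝ) + i + 1 + k / 20)) := fun a ha => by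
      obtain ⟨ha', rfl⟩ := Finset.mem_filter.mp ha
      exact hj2 a ha'
    refine (Finset.sum_le_sum h3).trans ?_
    rw [Finset.sum_const, nsmul_eq_mul]
    have h4 := card_numerators_le hw0 hik ((numer (w ^ k)).filter fun a => j a = i) fun a ha => by
      obtain ⟨ha', rfl⟩ := Finset.mem_filter.mp ha
      exact ⟨mem_numer.mp ha', hj1 a ha'⟩
    calc _ ≤ polyAbs w ^ (k + i) * (C * polyAbs w ^ (-((k : ℝ) + i + 1 + k / 20))) := by gcongr
      _ = C * (polyAbs w ^ ((k + i : ℕ) : ℝ) * polyAbs w ^ (-((k : ℝ) + i + 1 + k / 20))) := by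
        rw [Real.rpow_natCast]; ring
      _ = _ := by
        rw [← Real.rpow_add hQ0]
        congr 2
        push_cast
        ring
  refine (Finset.sum_le_sum h2).trans (le_of_eq ?_)
  rw [Finset.sum_const, Finset.card_range, nsmul_eq_mul]
  push_cast
  ring

/-- The majorant of the singular series converges, with a power to spare. -/
theorem summable_majorant (hn : 18 < n) : Summable fun r : {r : F[X] // r.Monic} =>
    Φ.majorant p r.1 * polyAbs r.1 ^ (1 / 40 : ℝ) := by
  obtain ⟨C, hC, hbound⟩ := Φ.exists_majorant_prime_pow_le p hn
  obtain ⟨Z, hZ0, hZ⟩ := exists_sum_rpow_le (F := F) (ε := 1 / 80) (by norm_num)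
  have hlt : (2 : ℝ) ^ (-(1 / 80) : ℝ) < 1 :=
    Real.rpow_lt_one_of_one_lt_of_neg one_lt_two (by norm_num)
  set x : ℝ := (2 : ℝ) ^ (-(1 / 80) : ℝ)
  have hx0 : 0 < x := by positivity
  have hsum : Summable fun k : ℕ => ((k : ℝ) + 2) * x ^ k := by
    have h1 := summable_pow_mul_geometric_of_norm_lt_one 1 (r := x) (by
      rwa [Real.norm_of_nonneg hx0.le])
    have h2 := (summable_geometric_of_lt_one hx0.le hlt).mul_left 2
    refine (h1.add h2).congr fun k => ?_
    ring
  set G : ℝ := ∑' k : ℕ, ((k : ℝ) + 2) * x ^ k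
  have hG0 : 0 ≤ G := tsum_nonneg fun k => by positivity
  refine summable_of_submultiplicative (f := fun r => Φ.majorant p r * polyAbs r ^ (1 / 40 : ℝ))
    (b := fun w => C * G * polyAbs w ^ (-(1 + 1 / 80) : ℝ)) (S := C * G * Z)
    (fun r => mul_nonneg (Φ.majorant_nonneg p r) (Real.rpow_nonneg (polyAbs_nonneg r) _))
    (by simpa using Φ.majorant_one p) ?_ ?_ ?_
  · intro r s hr hs hrs
    calc _ ≤ Φ.majorant p r * Φ.majorant p s * (polyAbs (r * s)) ^ (1 / 40 : ℝ) := by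
          have := polyAbs_nonneg (r * s)
          gcongr
          exact Φ.majorant_mul_le p hr hs hrs
      _ = _ := by
          rw [polyAbs_mul, Real.mul_rpow (polyAbs_nonneg _) (polyAbs_nonneg _)]
          ring
  · intro w hwm hw K
    have hQ0 : 0 < polyAbs w := polyAbs_pos hw.ne_zero
    have hQ2 : 2 ≤ polyAbs w := by
      have hdeg : 1 ≤ w.natDegree := by
        by_contra! h
        exact hw.not_isUnit (hwm.natDegree_eq_zero.mp (by omega) ▸ isUnit_one)
      rw [polyAbs_of_ne hw.ne_zero]
      calc (2 : ℝ) ≤ Fintype.card F := by exact_mod_cast Fintype.one_lt_card (α := F)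
        _ ≤ _ := le_self_pow₀ (one_lt_q F).le (by omega)
    have h1 : ∀ k : ℕ, Φ.majorant p (w ^ (k + 1)) * polyAbs (w ^ (k + 1)) ^ (1 / 40 : ℝ) ≤
        C * polyAbs w ^ (-(1 + 1 / 80) : ℝ) * (((k : ℝ) + 2) * x ^ k) := fun k => by
      have h2 := hbound w hw (k + 1) (by omega)
      push_cast at h2
      have h3 : polyAbs w ^ (-(1 + ((k : ℝ) + 1) / 20)) * polyAbs (w ^ (k + 1)) ^ (1 / 40 : ℝ) ≤
          polyAbs w ^ (-(1 + 1 / 80) : ℝ) * x ^ k := by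
        have h4 : polyAbs w ^ (-((k : ℝ) / 80)) ≤ x ^ k := by
          calc polyAbs w ^ (-((k : ℝ) / 80)) ≤ 2 ^ (-((k : ℝ) / 80)) :=
                Real.rpow_le_rpow_of_nonpos (by norm_num) hQ2 (by
                  have : (0 : ℝ) ≤ k := Nat.cast_nonneg k
                  linarith)
            _ = x ^ k := by
                rw [← Real.rpow_mul_natCast (by norm_num)]
                congr 1; ring
        refine le_trans ?_ (mul_le_mul_of_nonneg_left h4 (Real.rpow_nonneg hQ0.le _))
        rw [polyAbs_pow, ← Real.rpow_natCast_mul hQ0.le, ← Real.rpow_add hQ0, ← Real.rpow_add hQ0]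
        refine Real.rpow_le_rpow_of_exponent_le (by linarith) ?_
        push_cast
        have : (0 : ℝ) ≤ k := Nat.cast_nonneg k
        linarith
      calc _ ≤ C * ((k : ℝ) + 1 + 1) * polyAbs w ^ (-(1 + ((k : ℝ) + 1) / 20)) *
            polyAbs (w ^ (k + 1)) ^ (1 / 40 : ℝ) := by
              have := polyAbs_nonneg (w ^ (k + 1))
              gcongr
        _ = C * ((k : ℝ) + 2) * (polyAbs w ^ (-(1 + ((k : ℝ) + 1) / 20)) *
            polyAbs (w ^ (k + 1)) ^ (1 / 40 : ℝ)) := by ring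
        _ ≤ C * ((k : ℝ) + 2) * (polyAbs w ^ (-(1 + 1 / 80) : ℝ) * x ^ k) := by gcongr
        _ = _ := by ring
    calc _ ≤ ∑ k ∈ Finset.range K,
          C * polyAbs w ^ (-(1 + 1 / 80) : ℝ) * (((k : ℝ) + 2) * x ^ k) :=
            Finset.sum_le_sum fun k _ => h1 k
      _ = C * polyAbs w ^ (-(1 + 1 / 80) : ℝ) *
          ∑ k ∈ Finset.range K, ((k : ℝ) + 2) * x ^ k := by rw [Finset.mul_sum]
      _ ≤ C * polyAbs w ^ (-(1 + 1 / 80) : ℝ) * G := by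
          gcongr
          exact hsum.sum_le_tsum _ fun k _ => by positivity
      _ = _ := by ring
  · intro T hT
    rw [← Finset.mul_sum]
    exact mul_le_mul_of_nonneg_left (hZ T hT) (by positivity)

end FormPair


/-! ### Exponential sums over a residue class -/

section Modulus

variable {F : Type*} [Field F] {r N : F[X]}

theorem rN_spec (hr : r ≠ 0) : ∃ g, g ≠ 0 ∧ rN r N * g = r * N ∧ g ∣ r ∧ g ∣ N := by
  classical
  have h0 : EuclideanDomain.gcd r N ≠ 0 := fun h => hr (EuclideanDomain.gcd_eq_zero_iff.mp h).1
  have h1 : EuclideanDomain.gcd r N ∣ r * N := (EuclideanDomain.gcd_dvd_left r N).mul_right N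
  refine ⟨EuclideanDomain.gcd r N, h0, ?_, EuclideanDomain.gcd_dvd_left r N,
    EuclideanDomain.gcd_dvd_right r N⟩
  rw [rN, mul_comm]
  convert EuclideanDomain.mul_div_cancel' h0 h1 using 3

theorem rN_ne_zero (hr : r ≠ 0) (hN : N ≠ 0) : rN r N ≠ 0 := by
  obtain ⟨g, -, hg, -, -⟩ := rN_spec (N := N) hr
  exact left_ne_zero_of_mul (hg ▸ mul_ne_zero hr hN)

theorem dvd_rN (hr : r ≠ 0) : r ∣ rN r N := by
  obtain ⟨g, hg0, hg, -, s, hs⟩ := rN_spec (N := N) hr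
  exact ⟨s, mul_right_cancel₀ hg0 (by linear_combination hg + r * hs)⟩

theorem dvd_rN_right (hr : r ≠ 0) : N ∣ rN r N := by
  obtain ⟨g, hg0, hg, ⟨s, hs⟩, -⟩ := rN_spec (N := N) hr
  exact ⟨s, mul_right_cancel₀ hg0 (by linear_combination hg + N * hs)⟩

end Modulus

section Detection

variable {F : Type*} [Field F] [Fintype F] (p : ℕ) [Fact p.Prime] [Algebra (ZMod p) F] {n : ℕ}

open scoped Classical in
/-- The congruence `x ≡ b (mod N)`, detected by additive characters. -/
theorem indicator_eq_sum_chi {N : F[X]} (hN : N ≠ 0) [Fintype (Res N)] (b x : Fin n → F[X]) :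
    (if ∀ i, N ∣ x i - b i then (1 : ℂ) else 0) = ((polyAbs N ^ n : ℝ) : ℂ)⁻¹ *
      ∑ w : Fin n → Res N, psi p (ofPoly ((fun i => (w i).out) ⬝ᵥ (x - b)) / ofPoly N) := by
  have h1 := sum_char_dotProduct (chi_isPrimitive p hN) fun i => toRes N (x i - b i)
  have h2 : ∀ w : Fin n → Res N,
      psi p (ofPoly ((fun i => (w i).out) ⬝ᵥ (x - b)) / ofPoly N) =
        chi p N ((fun i => toRes N (x i - b i)) ⬝ᵥ w) := fun w => by
    rw [← chi_toRes]
    congr 1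
    rw [dotProduct_comm, RingHom.map_dotProduct]
    congr 1
    funext i
    exact toRes_out (w i)
  rw [Finset.sum_congr rfl fun w _ => h2 w, h1]
  have h3 : ((polyAbs N ^ n : ℝ) : ℂ) ≠ 0 := by exact_mod_cast (pow_pos (polyAbs_pos hN) n).ne'
  have h4 : ((Fintype.card (Fin n → Res N) : ℕ) : ℂ) = ((polyAbs N ^ n : ℝ) : ℂ) := by
    rw [← card_res_pi hN, Complex.ofReal_natCast]
  have h5 : ((fun i => toRes N (x i - b i)) = 0) ↔ ∀ i, N ∣ x i - b i := by
    simp only [funext_iff, Pi.zero_apply, toRes_eq_zero]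
  by_cases h : ∀ i, N ∣ x i - b i
  · rw [if_pos h, if_pos (h5.mpr h), h4, inv_mul_cancel₀ h3]
  · rw [if_neg h, if_neg (fun h' => h (h5.mp h')), mul_zero]

end Detection

namespace FormPair

variable {F : Type*} [Field F] {n : ℕ} (Φ : FormPair F n)
variable (p : ℕ) [Fact p.Prime] [Algebra (ZMod p) F]

theorem summand_add_linear (r : F[X]) (a : F[X] × F[X]) (y x : Fin n → F[X]) :
    Φ.summand p r a y x = psi p (ofPoly (y ⬝ᵥ x) / ofPoly r) * Φ.summand p r a 0 x := by
  rw [summand, summand, ← psi_add, ← add_div, ← map_add]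
  congr 3
  simp only [poly, zero_dotProduct]
  ring

variable [Fintype F]

/-- A sum twisted by an additive character modulo `N` either vanishes or is a complete sum modulo
`r` with a linear term. -/
theorem norm_avg_twist_le {r N R : F[X]} (hN : N ≠ 0) (hR : R ≠ 0) (hrR : r ∣ R)
    (hNR : N ∣ R) (a : F[X] × F[X]) (b w : Fin n → F[X]) :
    ‖avg R fun x => psi p (ofPoly (w ⬝ᵥ (x - b)) / ofPoly N) * Φ.summand p r a 0 x‖ ≤
      Φ.supSum p r a := by
  have hr : r ≠ 0 := fun h => hR (by simpa [h] using hrR)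
  have hr' := ofPoly_eq_zero.not.mpr hr
  have hN' := ofPoly_eq_zero.not.mpr hN
  by_cases hw : ∀ i, N ∣ r * w i
  · choose y hy using hw
    have h1 : ∀ x : Fin n → F[X],
        psi p (ofPoly (w ⬝ᵥ (x - b)) / ofPoly N) * Φ.summand p r a 0 x =
          psi p (-(ofPoly (w ⬝ᵥ b) / ofPoly N)) * Φ.summand p r a y x := fun x => by
      rw [Φ.summand_add_linear p r a y x, ← mul_assoc, ← psi_add]
      congr 2
      have h2 : r * (w ⬝ᵥ x) = N * (y ⬝ᵥ x) := by
        rw [← smul_eq_mul, ← smul_dotProduct, ← smul_eq_mul, ← smul_dotProduct]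
        congr 1
        funext i
        simp [hy]
      have h3 := congrArg (ofPoly (F := F)) h2
      rw [dotProduct_sub, map_sub]
      simp only [map_mul] at h3
      field_simp
      linear_combination h3
    rw [avg_congr h1, avg_const_mul hR, avg_of_dvd hR hrR (Φ.summand_periodic p r a y), norm_mul,
      norm_psi, one_mul]
    exact Φ.norm_expSum_le_supSum p hr a y
  -- a translation of `x i` by a multiple of `r` multiplies the average by a constant other than `1`
  · push Not at hw
    obtain ⟨i, hi⟩ := hw
    obtain ⟨g, hg⟩ : ∃ g, psi p (ofPoly (r * w i * g) / ofPoly N) ≠ 1 := by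
      by_contra! h
      exact hi (dvd_of_forall_psi_eq_one p hN h)
    have hper : PeriodicMod R fun x : Fin n → F[X] =>
        psi p (ofPoly (w ⬝ᵥ (x - b)) / ofPoly N) * Φ.summand p r a 0 x := by
      refine PeriodicMod.mul (fun x y hxy => psi_div_congr p ?_)
        ((Φ.summand_periodic p r a 0).of_dvd hrR)
      rw [← dotProduct_sub]
      exact Finset.dvd_sum fun i _ => ((hNR.trans (by simpa using hxy i)).mul_left _)
    have h1 := avg_shift hR hper (Pi.single i (r * g))
    have h2 : ∀ x : Fin n → F[X],
        psi p (ofPoly (w ⬝ᵥ (x + Pi.single i (r * g) - b)) / ofPoly N) *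
          Φ.summand p r a 0 (x + Pi.single i (r * g)) =
        psi p (ofPoly (r * w i * g) / ofPoly N) *
          (psi p (ofPoly (w ⬝ᵥ (x - b)) / ofPoly N) * Φ.summand p r a 0 x) := fun x => by
      have h3 : Φ.summand p r a 0 (x + Pi.single i (r * g)) = Φ.summand p r a 0 x := by
        refine Φ.summand_periodic p r a 0 _ _ fun j => ?_
        rw [Pi.add_apply, add_sub_cancel_left]
        by_cases hj : j = i
        · subst hj; simp
        · simp [hj]
      rw [h3, ← mul_assoc, ← psi_add]
      congr 2
      rw [← add_div, ← map_add]
      congr 2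
      have : x + Pi.single i (r * g) - b = Pi.single i (r * g) + (x - b) := by abel
      rw [this, dotProduct_add, dotProduct_single]
      ring
    rw [avg_congr h2, avg_const_mul hR] at h1
    have h4 : (avg R fun x : Fin n → F[X] =>
        psi p (ofPoly (w ⬝ᵥ (x - b)) / ofPoly N) * Φ.summand p r a 0 x) = 0 := by
      by_contra hne
      exact hg (mul_right_cancel₀ hne (h1.trans (one_mul _).symm))
    rw [h4, norm_zero]
    exact Φ.supSum_nonneg p r a

open scoped Classical in
theorem finsum_residues_eq {r N : F[X]} (hr : r ≠ 0) (hN : N ≠ 0) {g : (Fin n → F[X]) → ℂ}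
    (hg : PeriodicMod r g) (b : Fin n → F[X]) : ∑ᶠ x ∈ residues b N r, g x =
      ((polyAbs (rN r N) ^ n : ℝ) : ℂ) *
        avg (rN r N) (fun x => (if ∀ i, N ∣ x i - b i then (1 : ℂ) else 0) * g x) := by
  have hR := rN_ne_zero hr hN
  have hper : PeriodicMod (rN r N) fun x : Fin n → F[X] =>
      (if ∀ i, N ∣ x i - b i then (1 : ℂ) else 0) * g x := by
    refine PeriodicMod.mul (fun x y hxy => if_congr (forall_congr' fun i => ?_) rfl rfl)
      (hg.of_dvd (dvd_rN hr))
    have h := (dvd_rN_right hr).trans (hxy i)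
    rw [← dvd_iff_dvd_of_dvd_sub (a := N) (b := x i - b i) (c := y i - b i) (by simpa using h)]
  have h3 : ((polyAbs (rN r N) ^ n : ℝ) : ℂ) ≠ 0 := by
    exact_mod_cast (pow_pos (polyAbs_pos hR) n).ne'
  rw [avg_eq_finsum_box hR hper, mul_inv_cancel_left₀ h3]
  rw [finsum_mem_def, finsum_mem_def]
  refine finsum_congr fun x => ?_
  simp only [Set.indicator_apply, residues, Set.mem_ofPred_eq]
  by_cases h1 : ∀ i, polyAbs (x i) < polyAbs (rN r N)
  · by_cases h2 : ∀ i, N ∣ x i - b i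
    · rw [if_pos ⟨h1, h2⟩, if_pos h1, if_pos h2, one_mul]
    · rw [if_neg fun h => h2 h.2, if_pos h1, if_neg h2, zero_mul]
  · rw [if_neg fun h => h1 h.1, if_neg h1]

/-- The sums over the residue classes in a fixed class modulo `N` are bounded by the complete
sums modulo `r`. -/
theorem norm_finsum_residues_le {r N : F[X]} (hr : r ≠ 0) (hN : N ≠ 0) (b : Fin n → F[X])
    (a : F[X] × F[X]) : ‖∑ᶠ x ∈ residues b N r, Φ.summand p r a 0 x‖ ≤
      polyAbs (rN r N) ^ n * Φ.supSum p r a := by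
  classical
  have hR := rN_ne_zero hr hN
  have := finite_res hN
  have := Fintype.ofFinite (Res N)
  have hpos : 0 < polyAbs N ^ n := pow_pos (polyAbs_pos hN) n
  have hRpos : 0 < polyAbs (rN r N) ^ n := pow_pos (polyAbs_pos hR) n
  rw [finsum_residues_eq hr hN (Φ.summand_periodic p r a 0), norm_mul, Complex.norm_real,
    Real.norm_of_nonneg hRpos.le]
  gcongr
  have h1 : ∀ x : Fin n → F[X], (if ∀ i, N ∣ x i - b i then (1 : ℂ) else 0) *
      Φ.summand p r a 0 x = ((polyAbs N ^ n : ℝ) : ℂ)⁻¹ * ∑ w : Fin n → Res N,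
        psi p (ofPoly ((fun i => (w i).out) ⬝ᵥ (x - b)) / ofPoly N) * Φ.summand p r a 0 x :=
    fun x => by rw [indicator_eq_sum_chi p hN, mul_assoc, Finset.sum_mul]
  rw [avg_congr h1, avg_const_mul hR, avg_sum hR, norm_mul, norm_inv, Complex.norm_real,
    Real.norm_of_nonneg hpos.le, inv_mul_le_iff₀ hpos, ← card_res_pi hN]
  refine (norm_sum_le _ _).trans ((Finset.sum_le_sum fun w _ =>
    Φ.norm_avg_twist_le p hN hR (dvd_rN hr) (dvd_rN_right hr) a b fun i => (w i).out).trans ?_)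
  simp

end FormPair


/-! ### The tensor and the certificates attached to the two forms -/

section Bridge

variable {F : Type*} [Field F] {n : ℕ}

/-- A matrix of corank at most one has a left inverse after one coordinate is adjoined. -/
theorem exists_corank_certificate (hn : 0 < n) (M : Matrix (Fin n) (Fin n) F[X])
    (hM : n ≤ (M.map (algebraMap F[X] (RatFunc F))).rank + 1) :
    ∃ (B : Matrix (Fin n) (Fin n) F[X]) (b : Fin n → F[X]) (i₀ : Fin n) (E : F[X]), E ≠ 0 ∧
      ∀ i j, (B * M) i j + b i * (if j = i₀ then 1 else 0) = if i = j then E else 0 := by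
  classical
  set K := RatFunc F
  set A := M.map (algebraMap F[X] K) with hA
  have hker : Module.finrank K A.mulVecLin.ker ≤ 1 := by
    have h1 := LinearMap.finrank_range_add_finrank_ker A.mulVecLin
    rw [Module.finrank_fin_fun] at h1
    have h2 : A.rank = Module.finrank K A.mulVecLin.range := rfl
    omega
  -- a coordinate that does not vanish on the kernel, if the latter is not zero
  obtain ⟨i₀, hi₀⟩ : ∃ i₀ : Fin n, ∀ x, A.mulVec x = 0 → x i₀ = 0 → x = 0 := by
    obtain ⟨u, hu⟩ := finrank_le_one_iff.mp hker
    by_cases hu0 : (u : Fin n → K) = 0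
    · refine ⟨⟨0, hn⟩, fun x hx _ => ?_⟩
      obtain ⟨c, hc⟩ := hu ⟨x, hx⟩
      have := congrArg Subtype.val hc
      simpa [hu0] using this.symm
    · obtain ⟨i, hi⟩ := Function.ne_iff.mp hu0
      refine ⟨i, fun x hx hxi => ?_⟩
      obtain ⟨c, hc⟩ := hu ⟨x, hx⟩
      have hc' : c • (u : Fin n → K) = x := congrArg Subtype.val hc
      have h2 := congrFun hc' i
      rw [hxi, Pi.smul_apply, smul_eq_mul] at h2
      rcases mul_eq_zero.mp h2 with h | h
      · rw [← hc', h, zero_smul]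
      · exact absurd h hi
  let f : (Fin n → K) →ₗ[K] (Fin n → K) × K := A.mulVecLin.prod (LinearMap.proj i₀)
  have hf : f.ker = ⊥ := by
    rw [LinearMap.ker_eq_bot']
    intro x hx
    exact hi₀ x (congrArg Prod.fst hx) (congrArg Prod.snd hx)
  obtain ⟨g, hg⟩ := f.exists_leftInverse_of_injective hf
  let B' : Fin n → Fin n → K := fun i j => g (Pi.single j 1, 0) i
  let b' : Fin n → K := fun i => g (0, 1) i
  have hgexp : ∀ (y : Fin n → K) (t : K) i, g (y, t) i = ∑ j, B' i j * y j + b' i * t := by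
    intro y t i
    have h1 : (y, t) = ∑ j, y j • ((Pi.single j 1, 0) : (Fin n → K) × K) + t • (0, 1) := by
      refine Prod.ext ?_ ?_
      · simp only [Prod.fst_add, Prod.fst_sum, Prod.smul_fst, smul_zero, add_zero]
        funext j
        simp [Finset.sum_apply, Pi.single_apply]
      · simp [Prod.snd_sum]
    rw [h1, map_add, map_sum]
    simp only [map_smul, Pi.add_apply, Finset.sum_apply, Pi.smul_apply, smul_eq_mul]
    congr 1
    · exact Finset.sum_congr rfl fun j _ => mul_comm _ _
    · exact mul_comm _ _
  have hinv : ∀ i j, ∑ k, B' i k * A k j + b' i * (if j = i₀ then 1 else 0) =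
      if i = j then 1 else 0 := by
    intro i j
    have h1 := congrFun (LinearMap.congr_fun hg (Pi.single j 1)) i
    have h2 : f (Pi.single j 1) = (fun k => A k j, if j = i₀ then 1 else 0) := by
      refine Prod.ext ?_ ?_
      · funext k
        simp [f]
      · simp [f, Pi.single_apply, eq_comm]
    rw [LinearMap.comp_apply, h2, hgexp, LinearMap.id_apply, Pi.single_apply] at h1
    exact h1
  -- clear denominators
  obtain ⟨E, hE⟩ := IsLocalization.exist_integer_multiples_of_finite (nonZeroDivisors F[X])
    (fun x : Fin n × Option (Fin n) => x.2.elim (b' x.1) (B' x.1))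
  choose C hC using hE
  have hE0 : (E : F[X]) ≠ 0 := nonZeroDivisors.coe_ne_zero E
  refine ⟨Matrix.of fun i j => C (i, some j), fun i => C (i, none), i₀, E, hE0, fun i j => ?_⟩
  apply IsFractionRing.injective F[X] K
  have h1 := congrArg (fun z => algebraMap F[X] K E * z) (hinv i j)
  rw [mul_add, Finset.mul_sum] at h1
  simp only [← mul_assoc] at h1
  have hB : ∀ k, algebraMap F[X] K (C (i, some k)) = algebraMap F[X] K E * B' i k := fun k =>
    (hC (i, some k)).trans (Algebra.smul_def _ _)
  have hb : algebraMap F[X] K (C (i, none)) = algebraMap F[X] K E * b' i :=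
    (hC (i, none)).trans (Algebra.smul_def _ _)
  rw [Matrix.mul_apply, map_add, map_sum, map_mul, hb]
  simp only [map_mul, Matrix.of_apply, hB]
  rw [apply_ite (algebraMap F[X] K), apply_ite (algebraMap F[X] K), map_one, map_zero]
  refine h1.trans ?_
  split_ifs <;> simp

/-- The coefficients of `Φ` describe the cubic form `G` and its derivatives. -/
structure FormPair.Represents (Φ : FormPair F n) (G : MvPolynomial (Fin n) F[X]) : Prop where
  eq_sum : G = ∑ i, ∑ j, ∑ k, MvPolynomial.C (Φ.c i j k) * MvPolynomial.X i * MvPolynomial.X j *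
        MvPolynomial.X k
  pderiv : ∀ k, MvPolynomial.pderiv k G =
        ∑ i, ∑ j, MvPolynomial.C (3 * Φ.c i j k) * MvPolynomial.X i * MvPolynomial.X j
  hessian : ∀ j k, MvPolynomial.pderiv j (MvPolynomial.pderiv k G) =
        ∑ i, MvPolynomial.C (6 * Φ.c i j k) * MvPolynomial.X i

theorem exists_formPair (h6 : (6 : F) ≠ 0) (hn : 0 < n) {F₁ : MvPolynomial (Fin n) F[X]}
    (hF₁ : F₁.IsHomogeneous 3) {M : Matrix (Fin n) (Fin n) F[X]} (hM : M.IsSymm)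
    (hns : NonsingularForm F₁) (hMrank : n ≤ (M.map (algebraMap F[X] (RatFunc F))).rank + 1) :
    ∃ Φ : FormPair F n, Φ.M = M ∧ Φ.Represents F₁ := by
  obtain ⟨c, hc, h1, h2, h3⟩ := exists_symTensor h6 hF₁
  obtain ⟨B, b, i₀, E, hE, hcor⟩ := exists_corank_certificate hn M hMrank
  obtain ⟨D, Δ, hΔ, hcert⟩ := exists_nonsingCert (c := c) fun x hx => by
    have hgrad : ∀ k, evalBar (gradPoly c k) x = triV (fun i j k =>
        ((algebraMap (RatFunc F) (KBar F)).comp (algebraMap F[X] (RatFunc F))) (c i j k)) x x k := by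
      intro k
      simp [evalBar, gradPoly, triV]
    have hzero : triV (fun i j k =>
        ((algebraMap (RatFunc F) (KBar F)).comp (algebraMap F[X] (RatFunc F))) (c i j k)) x x = 0 :=
      funext fun k => (hgrad k).symm.trans (hx k)
    refine hns x ?_ fun k => ?_
    · rw [evalBar, eval₂_cubic _ h1, tri, hzero, zero_dotProduct]
    · rw [evalBar, eval₂_cubic_grad _ (h2 k), hzero, Pi.zero_apply, mul_zero]
  exact ⟨⟨c, M, hc, hM, h6, D, Δ, hΔ, hcert, B, b, i₀, E, hE, hcor⟩, rfl, h1, h2, h3⟩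

theorem six_ne_zero_of_char {p : ℕ} [hp : Fact p.Prime] (h3 : 3 < p) [Algebra (ZMod p) F] :
    (6 : F) ≠ 0 := by
  have hchar : CharP F p := charP_of_injective_algebraMap (algebraMap (ZMod p) F).injective p
  intro h
  have h1 : ((6 : ℕ) : F) = 0 := by exact_mod_cast h
  rw [CharP.cast_eq_zero_iff F p] at h1
  have h2 : p ∣ 2 * 3 := h1
  rcases (Nat.Prime.dvd_mul hp.out).mp h2 with h | h <;>
    exact absurd (Nat.le_of_dvd (by norm_num) h) (by omega)

variable {F₁ : MvPolynomial (Fin n) F[X]} {Φ : FormPair F n}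

theorem FormPair.Represents.eval (h : Φ.Represents F₁) (x : Fin n → F[X]) :
    MvPolynomial.eval x F₁ = tri Φ.c x x x := by
  rw [← MvPolynomial.eval₂_id, eval₂_cubic _ h.eq_sum]
  rfl

theorem eval_quadOf (M : Matrix (Fin n) (Fin n) F[X]) (x : Fin n → F[X]) :
    MvPolynomial.eval x (quadOf M) = x ⬝ᵥ M.mulVec x := by
  rw [← MvPolynomial.eval₂_id, eval₂_quadOf]
  rfl

theorem FormPair.Represents.poly_eq (h : Φ.Represents F₁) (a : F[X] × F[X]) (x : Fin n → F[X]) :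
    a.1 * MvPolynomial.eval x F₁ + a.2 * MvPolynomial.eval x (quadOf Φ.M) = Φ.poly a 0 x := by
  rw [h.eval, eval_quadOf, FormPair.poly, zero_dotProduct, add_zero]

theorem FormPair.Represents.phase_eq (h : Φ.Represents F₁) (p : ℕ) [Fact p.Prime]
    [Algebra (ZMod p) F] (r : F[X]) (a : F[X] × F[X]) (x : Fin n → F[X]) :
    phase p F₁ (quadOf Φ.M) r a x = Φ.summand p r a 0 x := by
  rw [phase, h.poly_eq, FormPair.summand]

end Bridge

section Series

variable {F : Type*} [Field F] [Fintype F] {n : ℕ} {F₁ : MvPolynomial (Fin n) F[X]}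
  {Φ : FormPair F n} (p : ℕ) [Fact p.Prime] [Algebra (ZMod p) F]

/-- The contribution of the numerator `a` to the term of the singular series belonging to `r`. -/
def localTerm (p : ℕ) [Fact p.Prime] {F : Type*} [Field F] [Fintype F] [Algebra (ZMod p) F] {n : ℕ}
    (F₁ F₂ : MvPolynomial (Fin n) F[X]) (b : Fin n → F[X]) (N r : F[X]) (a : F[X] × F[X]) : ℂ :=
  ((polyAbs (rN r N) ^ n)⁻¹ : ℝ) * ∑ᶠ x ∈ residues b N r, phase p F₁ F₂ r a x

theorem norm_localTerm_le (h : Φ.Represents F₁) {r N : F[X]} (hr : r ≠ 0) (hN : N ≠ 0)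
    (b : Fin n → F[X]) (a : F[X] × F[X]) :
    ‖localTerm p F₁ (quadOf Φ.M) b N r a‖ ≤ Φ.supSum p r a := by
  have hpos : 0 < polyAbs (rN r N) ^ n := pow_pos (polyAbs_pos (rN_ne_zero hr hN)) n
  have h1 := Φ.norm_finsum_residues_le p hr hN b a
  simp only [← h.phase_eq p] at h1
  rw [localTerm, norm_mul, Complex.norm_real, Real.norm_of_nonneg (inv_pos.mpr hpos).le,
    inv_mul_le_iff₀ hpos]
  exact h1

theorem seriesTerm_eq_sum (F₁ F₂ : MvPolynomial (Fin n) F[X]) (b : Fin n → F[X]) (N r : F[X]) :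
    seriesTerm p F₁ F₂ b N r = ∑ a ∈ numer r, localTerm p F₁ F₂ b N r a := by
  rw [seriesTerm, completeSum, finsum_mem_eq_finite_toFinset_sum _ (finite_numerators r),
    Finset.mul_sum]
  rfl

theorem norm_seriesTerm_le (h : Φ.Represents F₁) {r N : F[X]} (hr : r ≠ 0) (hN : N ≠ 0)
    (b : Fin n → F[X]) : ‖seriesTerm p F₁ (quadOf Φ.M) b N r‖ ≤ Φ.majorant p r := by
  rw [seriesTerm_eq_sum]
  exact (norm_sum_le _ _).trans (Finset.sum_le_sum fun a _ => norm_localTerm_le p h hr hN b a)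

theorem majorant_le_mul (Φ : FormPair F n) {r : F[X]} (hr : r ≠ 0) :
    Φ.majorant p r ≤ Φ.majorant p r * polyAbs r ^ (1 / 40 : ℝ) :=
  le_mul_of_one_le_right (Φ.majorant_nonneg p r)
    (Real.one_le_rpow (one_le_polyAbs hr) (by norm_num))

theorem summable_norm_seriesTerm (hn : 18 < n) (h : Φ.Represents F₁) {N : F[X]} (hN : N ≠ 0)
    (b : Fin n → F[X]) : Summable fun r : {r : F[X] // r.Monic} =>
      ‖seriesTerm p F₁ (quadOf Φ.M) b N r.1‖ :=
  (Φ.summable_majorant p hn).of_nonneg_of_le (fun _ => norm_nonneg _) fun r =>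
    (norm_seriesTerm_le p h r.2.ne_zero hN b).trans (majorant_le_mul p Φ r.2.ne_zero)

end Series


/-! ### Topology and Haar measure of the completion at infinity -/

section Topology

open scoped Pointwise

variable (F : Type*) [Field F] [Fintype F]

/-- The ball `|α| < q ^ k`, as a subgroup of `K_∞`. -/
def ballInf (k : ℤ) : AddSubgroup (KInf F) where
  carrier := {α | absInf α < (Fintype.card F : ℝ) ^ k}
  zero_mem' := by simpa using zpow_pos (q_pos F) k
  add_mem' ha hb := (absInf_add_le _ _).trans_lt (max_lt ha hb)
  neg_mem' ha := by simpa using ha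

variable {F}

theorem mem_ballInf {k : ℤ} {α : KInf F} :
    α ∈ ballInf F k ↔ absInf α < (Fintype.card F : ℝ) ^ k := Iff.rfl

theorem tInf_ne_zero {F : Type*} [Field F] : (tInf : KInf F) ≠ 0 :=
  ofPoly_eq_zero.not.mpr Polynomial.X_ne_zero

theorem absInf_tInf_zpow (k : ℤ) : absInf (tInf ^ k : KInf F) = (Fintype.card F : ℝ) ^ k := by
  obtain ⟨m, rfl | rfl⟩ := k.eq_nat_or_neg
  · rw [zpow_natCast, zpow_natCast, absInf_tInf_pow]
  · rw [zpow_neg, zpow_neg, absInf_inv, zpow_natCast, zpow_natCast, absInf_tInf_pow]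

theorem tInf_zpow_mul_mem_ballInf {k m : ℤ} {α : KInf F} :
    tInf ^ k * α ∈ ballInf F (k + m) ↔ α ∈ ballInf F m := by
  have hq := zpow_pos (q_pos F) k
  rw [mem_ballInf, mem_ballInf, absInf_mul, absInf_tInf_zpow, zpow_add₀ (q_pos F).ne',
    mul_lt_mul_iff_right₀ hq]

theorem exists_ballInf_subset {s : Set (KInf F)} {x : KInf F} (hs : s ∈ nhds x) :
    ∃ k : ℤ, {y | y - x ∈ ballInf F k} ⊆ s := by
  obtain ⟨D, hD⟩ := exists_coeff_ball_subset hs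
  refine ⟨-D, fun y hy => hD fun m hm => ?_⟩
  exact (absInf_lt_zpow_iff _ _).mp hy m (by omega)

theorem isOpen_ballInf (k : ℤ) : IsOpen (ballInf F k : Set (KInf F)) := by
  have h0 : IsOpen (ballInf F 0 : Set (KInf F)) := by
    obtain ⟨x, hx⟩ := interior_unitInterval_nonempty F
    refine AddSubgroup.isOpen_of_mem_nhds (g := x) (ballInf F 0) ?_
    refine Filter.mem_of_superset (mem_interior_iff_mem_nhds.mp hx) fun α hα => ?_
    simpa [mem_ballInf, unitInterval] using hα
  have h1 : (ballInf F k : Set (KInf F)) = (fun α => tInf ^ (-k) * α) ⁻¹' ballInf F 0 := by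
    ext α
    rw [Set.mem_preimage, SetLike.mem_coe, SetLike.mem_coe, ← tInf_zpow_mul_mem_ballInf (k := -k),
      neg_add_cancel]
  rw [h1]
  exact h0.preimage (continuous_const.mul continuous_id)

theorem ballInf_mem_nhds (k : ℤ) : (ballInf F k : Set (KInf F)) ∈ nhds 0 :=
  (isOpen_ballInf k).mem_nhds (ballInf F k).zero_mem

theorem coe_ballInf_zero : (ballInf F 0 : Set (KInf F)) = unitInterval F := by
  ext α
  simp [mem_ballInf, unitInterval]

theorem isCompact_ballInf (k : ℤ) : IsCompact (ballInf F k : Set (KInf F)) := by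
  have h1 : (ballInf F k : Set (KInf F)) = (fun α => tInf ^ k * α) '' unitInterval F := by
    ext α
    rw [← coe_ballInf_zero]
    constructor
    · intro h
      have h2 := (tInf_zpow_mul_mem_ballInf (k := -k)).mpr h
      rw [neg_add_cancel] at h2
      refine ⟨tInf ^ (-k) * α, h2, ?_⟩
      change tInf ^ k * (tInf ^ (-k) * α) = α
      rw [← mul_assoc, ← zpow_add₀ tInf_ne_zero, add_neg_cancel, zpow_zero, one_mul]
    · rintro ⟨β, hβ, rfl⟩
      have h2 := (tInf_zpow_mul_mem_ballInf (k := k)).mpr hβ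
      rw [add_zero] at h2
      exact h2
  rw [h1]
  exact (isCompact_unitInterval F).image (continuous_const.mul continuous_id)

theorem exists_mem_ballInf (α : KInf F) : ∃ k : ℕ, α ∈ ballInf F k := by
  obtain ⟨k, hk⟩ := pow_unbounded_of_one_lt (absInf α) (one_lt_q F)
  exact ⟨k, by rw [mem_ballInf, zpow_natCast]; exact hk⟩

instance instLocallyCompactSpaceKInf : LocallyCompactSpace (KInf F) :=
  (isCompact_ballInf 0).locallyCompactSpace_of_mem_nhds_of_addGroup (ballInf_mem_nhds 0)

instance instSigmaCompactSpaceKInf : SigmaCompactSpace (KInf F) :=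
  ⟨fun k : ℕ => ballInf F k, fun k => isCompact_ballInf k, Set.eq_univ_of_forall fun α =>
    Set.mem_iUnion.mpr (exists_mem_ballInf α)⟩

instance instSecondCountableKInf : SecondCountableTopology (KInf F) := by
  have h1 : (nhds (0 : KInf F)).IsCountablyGenerated := by
    have : (nhds (0 : KInf F)).HasBasis (fun _ : ℤ => True) fun k => (ballInf F k : Set (KInf F)) :=
      ⟨fun s => ⟨fun hs => by
        obtain ⟨k, hk⟩ := exists_ballInf_subset hs
        exact ⟨k, trivial, fun y hy => hk (by simpa using hy)⟩, fun ⟨k, _, hk⟩ =>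
          Filter.mem_of_superset (ballInf_mem_nhds k) hk⟩⟩
    exact (Filter.HasCountableBasis.mk this (Set.to_countable _)).isCountablyGenerated
  have := IsUniformAddGroup.uniformity_countably_generated (α := KInf F)
  let _ := UniformSpace.pseudoMetricSpace (KInf F)
  exact EMetric.secondCountable_of_sigmaCompact (KInf F)

instance instIsAddHaarMeasureHaarInf : (haarInf F).IsAddHaarMeasure := by
  unfold haarInf; infer_instance

instance instRegularHaarInf : (haarInf F).Regular := by
  unfold haarInf; infer_instance

instance instSigmaFiniteHaarInf : SigmaFinite (haarInf F) := inferInstance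

theorem haarInf_unitInterval : haarInf F (unitInterval F) = 1 :=
  Measure.addHaarMeasure_self (K₀ :=
    ⟨⟨unitInterval F, isCompact_unitInterval F⟩, interior_unitInterval_nonempty F⟩)

theorem haarInf_ballInf_one : haarInf F (ballInf F 1) = Fintype.card F := by
  have h1 : (ballInf F 1 : Set (KInf F)) =
      ⋃ a : F, (fun α => HahnSeries.C (-a) + α) ⁻¹' ballInf F 0 := by
    ext α
    rw [Set.mem_iUnion, SetLike.mem_coe, mem_ballInf, absInf_lt_zpow_iff]
    constructor
    · intro h
      refine ⟨α.coeff 0, ?_⟩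
      change _ ∈ ballInf F 0
      rw [mem_ballInf, absInf_lt_zpow_iff]
      intro m hm
      rw [HahnSeries.coeff_add, HahnSeries.C_apply, HahnSeries.coeff_single]
      split_ifs with h0
      · subst h0; ring
      · rw [h m (by omega), zero_add]
    · rintro ⟨a, ha⟩ m hm
      have ha : _ ∈ ballInf F 0 := ha
      rw [mem_ballInf, absInf_lt_zpow_iff] at ha
      have := ha m (by omega)
      rw [HahnSeries.coeff_add, HahnSeries.C_apply, HahnSeries.coeff_single,
        if_neg (by omega), zero_add] at this
      exact this
  have hdisj : Pairwise (Function.onFun Disjoint fun a : F =>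
      (fun α : KInf F => HahnSeries.C (-a) + α) ⁻¹' ballInf F 0) := by
    intro a b hab
    refine Set.disjoint_left.mpr fun α ha hb => hab ?_
    have h2 := (ballInf F 0).sub_mem hb ha
    rw [mem_ballInf, absInf_lt_zpow_iff] at h2
    have h3 := h2 0 (by simp)
    simp only [HahnSeries.coeff_sub, HahnSeries.coeff_add, HahnSeries.C_apply,
      HahnSeries.coeff_single, if_true] at h3
    linear_combination h3
  rw [h1, measure_iUnion hdisj fun a =>
    ((isOpen_ballInf 0).preimage (continuous_const.add continuous_id)).measurableSet]
  simp only [measure_preimage_add, coe_ballInf_zero, haarInf_unitInterval]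
  rw [tsum_fintype]
  simp

/-- The element `t` as a unit of `K_∞`. -/
def tUnit (F : Type*) [Field F] [Fintype F] : (KInf F)ˣ := Units.mk0 tInf tInf_ne_zero

theorem tUnit_zpow_smul (k : ℤ) (α : KInf F) : tUnit F ^ k • α = tInf ^ k * α := by
  rw [Units.smul_def, Units.val_zpow_eq_zpow_val, smul_eq_mul]
  rfl

theorem distribHaarChar_tUnit_zpow (k : ℤ) :
    distribHaarChar (KInf F) (tUnit F ^ k) = (Fintype.card F : NNReal) ^ k := by
  rw [map_zpow]
  congr 1
  refine distribHaarChar_eq_of_measure_smul_eq_mul (μ := haarInf F) (s := unitInterval F)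
    (by rw [haarInf_unitInterval]; exact one_ne_zero)
    (by rw [haarInf_unitInterval]; exact ENNReal.one_ne_top) ?_
  have : tUnit F • unitInterval F = ballInf F 1 := by
    rw [← coe_ballInf_zero]
    ext α
    have h := tInf_zpow_mul_mem_ballInf (k := -1) (m := 1) (α := α)
    rw [neg_add_cancel] at h
    rw [Set.mem_smul_set_iff_inv_smul_mem, ← zpow_neg_one, tUnit_zpow_smul]
    exact h
  rw [this, haarInf_ballInf_one, haarInf_unitInterval]
  simp

/-- The factor by which multiplication by `t ^ k` scales the Haar measure. -/
theorem map_affine_haarInf (k : ℤ) (x₀ : KInf F) :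
    (haarInf F).map (fun x => tInf ^ k * (x - x₀)) =
      ((Fintype.card F : NNReal) ^ (-k)) • haarInf F := by
  have hcont : Continuous fun x : KInf F => tInf ^ k * (x - x₀) :=
    continuous_const.mul (continuous_id.sub continuous_const)
  ext s hs
  rw [Measure.map_apply hcont.measurable hs, Measure.smul_apply, ENNReal.smul_def, smul_eq_mul,
    ← distribHaarChar_tUnit_zpow, distribHaarChar_mul]
  refine Eq.trans ?_ (measure_preimage_add (haarInf F) (-x₀) _)
  congr 1
  ext α
  rw [Set.mem_preimage, Set.mem_preimage, Set.mem_smul_set_iff_inv_smul_mem, ← zpow_neg, neg_neg,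
    tUnit_zpow_smul, sub_eq_neg_add]

end Topology


section ChangeOfVariables

variable {F : Type*} [Field F] [Fintype F] {n : ℕ}

instance instIsAddHaarMeasureHaarInfPi : (haarInfPi F n).IsAddHaarMeasure := by
  unfold haarInfPi; infer_instance

instance instIsAddHaarMeasureHaarInfProd : (haarInfProd F).IsAddHaarMeasure := by
  unfold haarInfProd; infer_instance

instance instSigmaFiniteHaarInfPi : SigmaFinite (haarInfPi F n) := by
  unfold haarInfPi; infer_instance

instance instSigmaFiniteHaarInfProd : SigmaFinite (haarInfProd F) := by
  unfold haarInfProd; infer_instance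

/-- The affine map `x ↦ t ^ k (x - x₀)` of `K_∞`. -/
def affineEquiv (k : ℤ) (x₀ : KInf F) : KInf F ≃ᵐ KInf F :=
  ((Homeomorph.subRight x₀).trans (Homeomorph.mulLeft₀ (tInf ^ k)
    (zpow_ne_zero k tInf_ne_zero))).toMeasurableEquiv

theorem map_affineEquiv (k : ℤ) (x₀ : KInf F) : (haarInf F).map (affineEquiv k x₀) =
    ((Fintype.card F : NNReal) ^ (-k)) • haarInf F := map_affine_haarInf k x₀

theorem integral_affine_pi (k : ℤ) (x₀ : Fin n → KInf F) (f : (Fin n → KInf F) → ℂ) :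
    ∫ x, f (fun i => tInf ^ k * (x i - x₀ i)) ∂(haarInfPi F n) =
      ((((Fintype.card F : ℝ) ^ (-k)) ^ n : ℝ) : ℂ) * ∫ x, f x ∂(haarInfPi F n) := by
  let e : (Fin n → KInf F) ≃ᵐ (Fin n → KInf F) :=
    MeasurableEquiv.piCongrRight fun i => affineEquiv k (x₀ i)
  set c : NNReal := (Fintype.card F : NNReal) ^ (-k) with hc
  have h1 : (haarInfPi F n).map e = (c ^ n) • haarInfPi F n := by
    have h2 : (haarInfPi F n).map e = Measure.pi fun i => (haarInf F).map (affineEquiv k (x₀ i)) := by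
      have : ∀ i, SigmaFinite ((haarInf F).map (affineEquiv k (x₀ i))) := fun i => by
        rw [map_affineEquiv]; infer_instance
      exact Measure.pi_map_pi fun i => (affineEquiv k (x₀ i)).measurable.aemeasurable
    rw [h2]
    simp only [map_affineEquiv]
    refine Measure.pi_eq fun s hs => ?_
    simp only [Measure.smul_apply, haarInfPi, Measure.pi_pi, ENNReal.smul_def, smul_eq_mul,
      Finset.prod_mul_distrib, Finset.prod_const, Finset.card_univ, Fintype.card_fin, hc]
    push_cast
    rfl
  have h3 : ∫ x, f (e x) ∂(haarInfPi F n) = ∫ x, f x ∂((haarInfPi F n).map e) :=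
    (integral_map_equiv e f).symm
  have h4 : (fun x => f (e x)) = fun x : Fin n → KInf F => f fun i => tInf ^ k * (x i - x₀ i) := rfl
  rw [h4] at h3
  rw [h3, h1, integral_smul_nnreal_measure, NNReal.smul_def, Complex.real_smul]
  simp [hc]

theorem integral_scale_prod (k m : ℤ) (f : KInf F × KInf F → ℂ) :
    ∫ θ, f (tInf ^ k * θ.1, tInf ^ m * θ.2) ∂(haarInfProd F) =
      (((Fintype.card F : ℝ) ^ (-(k + m)) : ℝ) : ℂ) * ∫ γ, f γ ∂(haarInfProd F) := by
  let e : KInf F × KInf F ≃ᵐ KInf F × KInf F :=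
    MeasurableEquiv.prodCongr (affineEquiv k 0) (affineEquiv m 0)
  have h1 : (haarInfProd F).map e =
      ((Fintype.card F : NNReal) ^ (-(k + m))) • haarInfProd F := by
    have h2 : (haarInfProd F).map e = ((haarInf F).map (affineEquiv k 0)).prod
        ((haarInf F).map (affineEquiv m 0)) :=
      (Measure.map_prod_map _ _ (affineEquiv k 0).measurable (affineEquiv m 0).measurable).symm
    rw [h2, map_affineEquiv, map_affineEquiv, Measure.prod_smul_left, Measure.prod_smul_right,
      smul_smul, neg_add, zpow_add₀ (by simp)]
    rfl
  have h3 : ∫ x, f (e x) ∂(haarInfProd F) = ∫ x, f x ∂((haarInfProd F).map e) :=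
    (integral_map_equiv e f).symm
  have h4 : (fun x => f (e x)) =
      fun θ : KInf F × KInf F => f (tInf ^ k * θ.1, tInf ^ m * θ.2) := by
    funext θ
    have : e θ = (tInf ^ k * (θ.1 - 0), tInf ^ m * (θ.2 - 0)) := rfl
    rw [this, sub_zero, sub_zero]
  rw [h4] at h3
  rw [h3, h1, integral_smul_nnreal_measure, NNReal.smul_def, Complex.real_smul]
  simp

/-- A function that a translation multiplies by a constant different from `1` has integral zero. -/
theorem setIntegral_eq_zero_of_shift {G : Type*} [AddCommGroup G] [MeasurableSpace G]
    [MeasurableAdd G] (μ : Measure G) [μ.IsAddRightInvariant] (A : AddSubgroup G)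
    (hA : MeasurableSet (A : Set G)) {f : G → ℂ} {z : G} (hz : z ∈ A) {c : ℂ} (hc : c ≠ 1)
    (h : ∀ x ∈ A, f (x + z) = c * f x) : ∫ x in A, f x ∂μ = 0 := by
  have h1 : ∫ x in A, f x ∂μ = ∫ x, (A : Set G).indicator f x ∂μ := (integral_indicator hA).symm
  have h2 := integral_add_right_eq_self (μ := μ) ((A : Set G).indicator f) z
  have h3 : ∀ x, (A : Set G).indicator f (x + z) = c * (A : Set G).indicator f x := fun x => by
    by_cases hx : x ∈ A
    · rw [Set.indicator_of_mem (show x ∈ (A : Set G) from hx),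
        Set.indicator_of_mem (show x + z ∈ (A : Set G) from A.add_mem hx hz), h x hx]
    · rw [Set.indicator_of_notMem (show x ∉ (A : Set G) from hx),
        Set.indicator_of_notMem (show x + z ∉ (A : Set G) from fun h' =>
          hx ((A.add_mem_cancel_right hz).mp h')), mul_zero]
  simp only [h3, integral_const_mul] at h2
  rw [h1]
  by_contra hne
  exact hc (mul_right_cancel₀ hne (h2.trans (one_mul _).symm))

end ChangeOfVariables

section Continuity

variable {F : Type*} [Field F] [Fintype F] {n : ℕ} (p : ℕ) [Fact p.Prime] [Algebra (ZMod p) F]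

theorem psi_eq_of_sub_mem {α β : KInf F} (h : α - β ∈ ballInf F (-1)) : psi p α = psi p β := by
  have h1 : α = (α - β) + β := by ring
  rw [h1, psi_add, psi_of_absInf_le p h, one_mul]

theorem continuous_psi : Continuous (psi p : KInf F → ℂ) := by
  refine IsLocallyConstant.continuous ((IsLocallyConstant.iff_eventually_eq _).mpr fun α => ?_)
  have h1 : {β : KInf F | β - α ∈ ballInf F (-1)} ∈ nhds α :=
    ((isOpen_ballInf (-1)).preimage (continuous_id.sub continuous_const)).mem_nhds
      (by simp)
  exact Filter.mem_of_superset h1 fun β hβ => psi_eq_of_sub_mem p hβ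

theorem continuous_evalInf {F : Type*} [Field F] {n : ℕ} (G : MvPolynomial (Fin n) F[X]) :
    Continuous (evalInf G) := by
  have : evalInf G = fun x => MvPolynomial.eval x (MvPolynomial.map ofPoly G) :=
    funext fun x => MvPolynomial.eval₂_eq_eval_map _ _ _
  rw [this]
  exact MvPolynomial.continuous_eval _

/-- A ball with an arbitrary radius is one of the balls `ballInf`. -/
theorem exists_ballInf_eq {ρ : ℝ} (hρ : 0 < ρ) :
    ∃ k : ℤ, ∀ α : KInf F, absInf α < ρ ↔ α ∈ ballInf F k := by
  obtain ⟨k, hk1, hk2⟩ := exists_mem_Ioc_zpow hρ (one_lt_q F)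
  refine ⟨k + 1, fun α => ?_⟩
  rw [mem_ballInf]
  by_cases h : α = 0
  · subst h
    simp only [absInf_zero, hρ, true_iff]
    exact zpow_pos (q_pos F) _
  refine ⟨fun h1 => h1.trans_le hk2, fun h1 => ?_⟩
  rw [absInf_of_ne h, zpow_lt_zpow_iff_right₀ (one_lt_q F)] at h1
  rw [absInf_of_ne h]
  refine lt_of_le_of_lt ?_ hk1
  rw [zpow_le_zpow_iff_right₀ (one_lt_q F)]
  omega

end Continuity


/-! ### The gradients at a common zero -/

section Minors

variable {F : Type*} [Field F] {n : ℕ}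

/-- The `2 × 2` minors of the Jacobian matrix of `F₁` and `F₂`. -/
def jacobianMinor (F₁ F₂ : MvPolynomial (Fin n) F[X]) (ij : Fin n × Fin n) :
    MvPolynomial (Fin n) F[X] :=
  MvPolynomial.pderiv ij.1 F₁ * MvPolynomial.pderiv ij.2 F₂ -
    MvPolynomial.pderiv ij.2 F₁ * MvPolynomial.pderiv ij.1 F₂

/-- The equations that define the singular points of `V(F₁, F₂)`. -/
def singularEquations (F₁ F₂ : MvPolynomial (Fin n) F[X]) :
    Option (Option (Fin n × Fin n)) → MvPolynomial (Fin n) F[X]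
  | none => F₁
  | some none => F₂
  | some (some ij) => jacobianMinor F₁ F₂ ij

/-- Non-singularity of the complete intersection as an identity of polynomials, which can be
specialized to any ring. -/
theorem exists_singular_certificate {F₁ F₂ : MvPolynomial (Fin n) F[X]}
    (hX : NonsingularPair F₁ F₂) : ∃ (D : ℕ) (Δ : F[X]), Δ ≠ 0 ∧
      ∀ {S : Type*} [CommRing S] (φ : F[X] →+* S) (x : Fin n → S) (i : Fin n),
        φ Δ * x i ^ D ∈ Ideal.span
          (Set.range fun s => MvPolynomial.eval₂ φ x (singularEquations F₁ F₂ s)) := by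
  obtain ⟨D, Δ, hΔ, h⟩ := exists_C_mul_X_pow_mem_span (singularEquations F₁ F₂) fun x hx => by
    by_contra hne
    have hind := hX x hne (hx none) (hx (some none))
    set a : Fin n → KBar F := fun i => evalBar (MvPolynomial.pderiv i F₁) x
    set b : Fin n → KBar F := fun i => evalBar (MvPolynomial.pderiv i F₂) x
    have hminor : ∀ i j, a i * b j - a j * b i = 0 := fun i j => by
      have := hx (some (some (i, j)))
      simp only [singularEquations, jacobianMinor, evalBar, MvPolynomial.eval₂_sub,
        MvPolynomial.eval₂_mul] at this
      exact this
    rw [LinearIndependent.pair_iff] at hind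
    have ha : a = 0 := by
      by_contra ha
      obtain ⟨i, hi⟩ := Function.ne_iff.mp ha
      have := hind (b i) (-a i) (by
        funext j
        simp only [Pi.add_apply, Pi.smul_apply, smul_eq_mul, Pi.zero_apply]
        linear_combination -(hminor i j))
      exact hi (neg_eq_zero.mp this.2)
    have := hind 1 0 (by rw [ha]; simp)
    exact one_ne_zero this.1
  refine ⟨D, Δ, hΔ, fun φ x i => ?_⟩
  have h1 := Ideal.mem_map_of_mem (MvPolynomial.eval₂Hom φ x) (h i)
  rw [Ideal.map_span, ← Set.range_comp] at h1
  simpa [Function.comp_def] using h1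

end Minors

section Centre

variable {F : Type*} [Field F] [Fintype F] {n : ℕ}

/-- The linear combination of the gradients at `x₀`. -/
def gradComb (F₁ F₂ : MvPolynomial (Fin n) F[X]) (x₀ : Fin n → KInf F) (γ : KInf F × KInf F)
    (i : Fin n) : KInf F :=
  γ.1 * evalInf (MvPolynomial.pderiv i F₁) x₀ + γ.2 * evalInf (MvPolynomial.pderiv i F₂) x₀

/-- At the origin the Hessian matrix would have rank `0`. -/
theorem centre_ne_zero {F₁ : MvPolynomial (Fin n) F[X]} {M : Matrix (Fin n) (Fin n) F[X]}
    {x₀ : Fin n → KInf F} (hn : 2 < n) {Φ : FormPair F n} (hΦ : Φ.Represents F₁)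
    (hx₀ : IsCentre F₁ M x₀) : x₀ ≠ 0 := by
  rintro rfl
  have h1 : hessian F₁ (0 : Fin n → KInf F) = 0 := by
    ext i j : 2
    simp [hessian, evalInf, hΦ.hessian]
  have h2 := hx₀.rank_hessian
  rw [h1, Matrix.rank_zero] at h2
  omega

/-- The gradients at a non-trivial common zero over `K_∞` are linearly independent. -/
theorem exists_minor_ne_zero {F : Type*} [Field F] {n : ℕ} {F₁ F₂ : MvPolynomial (Fin n) F[X]}
    (hX : NonsingularPair F₁ F₂) {x₀ : Fin n → KInf F} (h0 : x₀ ≠ 0) (h1 : evalInf F₁ x₀ = 0)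
    (h2 : evalInf F₂ x₀ = 0) :
    ∃ i j, evalInf (MvPolynomial.pderiv i F₁) x₀ * evalInf (MvPolynomial.pderiv j F₂) x₀ -
      evalInf (MvPolynomial.pderiv j F₁) x₀ * evalInf (MvPolynomial.pderiv i F₂) x₀ ≠ 0 := by
  obtain ⟨D, Δ, hΔ, h⟩ := exists_singular_certificate hX
  by_contra! hall
  apply h0
  funext i
  have h3 := h ofPoly x₀ i
  have h4 : Ideal.span (Set.range fun s =>
      MvPolynomial.eval₂ ofPoly x₀ (singularEquations F₁ F₂ s)) = ⊥ := by
    rw [Ideal.span_eq_bot]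
    rintro _ ⟨s, rfl⟩
    match s with
    | none => exact h1
    | some none => exact h2
    | some (some (i, j)) =>
      simpa only [singularEquations, jacobianMinor, evalInf, MvPolynomial.eval₂_sub,
        MvPolynomial.eval₂_mul] using hall i j
  rw [h4, Ideal.mem_bot] at h3
  exact eq_zero_of_pow_eq_zero ((mul_eq_zero.mp h3).resolve_left (ofPoly_eq_zero.not.mpr hΔ))

/-- The lower bound for combinations of the gradients comes from Cramer's rule for a minor that does
not vanish. -/
theorem exists_gradComb_bound {F₁ F₂ : MvPolynomial (Fin n) F[X]} (hX : NonsingularPair F₁ F₂)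
    {x₀ : Fin n → KInf F} (h0 : x₀ ≠ 0) (h1 : evalInf F₁ x₀ = 0) (h2 : evalInf F₂ x₀ = 0) :
    ∃ ε : ℝ, 0 < ε ∧ ∀ γ, ε * max (absInf γ.1) (absInf γ.2) ≤
      ⨆ i, absInf (gradComb F₁ F₂ x₀ γ i) := by
  obtain ⟨i, j, hm⟩ := exists_minor_ne_zero hX h0 h1 h2
  set a : Fin n → KInf F := fun i => evalInf (MvPolynomial.pderiv i F₁) x₀
  set b : Fin n → KInf F := fun i => evalInf (MvPolynomial.pderiv i F₂) x₀
  set m := a i * b j - a j * b i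
  set B := max (max (absInf (a i)) (absInf (a j))) (max (absInf (b i)) (absInf (b j)))
  have hai : absInf (a i) ≤ B := (le_max_left _ _).trans (le_max_left _ _)
  have haj : absInf (a j) ≤ B := (le_max_right _ _).trans (le_max_left _ _)
  have hbi : absInf (b i) ≤ B := (le_max_left _ _).trans (le_max_right _ _)
  have hbj : absInf (b j) ≤ B := (le_max_right _ _).trans (le_max_right _ _)
  have hB0 : 0 ≤ B := (absInf_nonneg _).trans hai
  have hmpos : 0 < absInf m := absInf_pos hm
  refine ⟨absInf m / (B + 1), by positivity, fun γ => ?_⟩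
  set g := gradComb F₁ F₂ x₀ γ
  set G := ⨆ i, absInf (g i)
  have hG : ∀ i, absInf (g i) ≤ G := fun i =>
    le_ciSup (f := fun i => absInf (g i)) (Set.finite_range _).bddAbove i
  have hG0 : 0 ≤ G := (absInf_nonneg _).trans (hG i)
  have e1 : γ.1 * m = g i * b j - g j * b i := by
    simp only [g, gradComb, m, a, b]; ring
  have e2 : γ.2 * m = a i * g j - a j * g i := by
    simp only [g, gradComb, m, a, b]; ring
  have key : ∀ s t u v : KInf F, absInf s ≤ G → absInf t ≤ B → absInf u ≤ G → absInf v ≤ B →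
      absInf (s * t - u * v) ≤ G * (B + 1) := by
    intro s t u v hs ht hu hv
    refine (absInf_sub_le _ _).trans (max_le ?_ ?_) <;> rw [absInf_mul] <;>
      exact mul_le_mul (by assumption) (by linarith) (absInf_nonneg _) hG0
  rw [div_mul_eq_mul_div, div_le_iff₀ (by linarith), mul_max_of_nonneg _ _ hmpos.le]
  refine max_le ?_ ?_
  · rw [mul_comm, ← absInf_mul, e1]
    exact key _ _ _ _ (hG i) hbj (hG j) hbi
  · rw [mul_comm, ← absInf_mul, e2, mul_comm (a i), mul_comm (a j)]
    exact key _ _ _ _ (hG j) hai (hG i) haj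

theorem gradMin_eq (F₁ F₂ : MvPolynomial (Fin n) F[X]) (x₀ : Fin n → KInf F) :
    gradMin F₁ F₂ x₀ = ⨅ γ : {γ : KInf F × KInf F // max (absInf γ.1) (absInf γ.2) = 1},
      ⨆ i, absInf (gradComb F₁ F₂ x₀ γ.1 i) := rfl

theorem gradMin_pos {F₁ F₂ : MvPolynomial (Fin n) F[X]} (hX : NonsingularPair F₁ F₂)
    {x₀ : Fin n → KInf F} (h0 : x₀ ≠ 0) (h1 : evalInf F₁ x₀ = 0) (h2 : evalInf F₂ x₀ = 0) :
    0 < gradMin F₁ F₂ x₀ := by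
  obtain ⟨ε, hε, h⟩ := exists_gradComb_bound hX h0 h1 h2
  have : Nonempty {γ : KInf F × KInf F // max (absInf γ.1) (absInf γ.2) = 1} :=
    ⟨⟨(1, 1), by simp⟩⟩
  rw [gradMin_eq]
  refine hε.trans_le (le_ciInf fun γ => ?_)
  have := h γ.1
  rwa [γ.2, mul_one] at this

/-- The largest coordinate of a combination of the gradients, compared with `λ`. -/
theorem exists_gradMin_mul_le (hn : 0 < n) (F₁ F₂ : MvPolynomial (Fin n) F[X])
    (x₀ : Fin n → KInf F) (γ : KInf F × KInf F) : ∃ j,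
      gradMin F₁ F₂ x₀ * max (absInf γ.1) (absInf γ.2) ≤ absInf (gradComb F₁ F₂ x₀ γ j) := by
  have : Nonempty (Fin n) := ⟨⟨0, hn⟩⟩
  obtain ⟨j, hj⟩ := Finite.exists_max fun j => absInf (gradComb F₁ F₂ x₀ γ j)
  refine ⟨j, ?_⟩
  set R := max (absInf γ.1) (absInf γ.2) with hR
  have hR0 : 0 ≤ R := (absInf_nonneg _).trans (le_max_left _ _)
  rcases hR0.eq_or_lt with h | hRpos
  · rw [← h, mul_zero]; exact absInf_nonneg _
  obtain ⟨c, hc⟩ : ∃ c : KInf F, absInf c = R := by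
    rcases max_choice (absInf γ.1) (absInf γ.2) with h | h
    · exact ⟨γ.1, h.symm⟩
    · exact ⟨γ.2, h.symm⟩
  have hscale : ∀ α : KInf F, absInf (c⁻¹ * α) = absInf α / R := fun α => by
    rw [absInf_mul, absInf_inv, hc, div_eq_inv_mul]
  have hmem : max (absInf (c⁻¹ * γ.1)) (absInf (c⁻¹ * γ.2)) = 1 := by
    rw [hscale, hscale, max_div_div_right hR0, ← hR, div_self hRpos.ne']
  rw [← le_div_iff₀ hRpos, gradMin_eq]
  refine (ciInf_le ⟨0, ?_⟩ ⟨(c⁻¹ * γ.1, c⁻¹ * γ.2), hmem⟩).trans (ciSup_le fun i => ?_)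
  · rintro _ ⟨γ, rfl⟩
    exact Real.iSup_nonneg fun i => absInf_nonneg _
  · have : gradComb F₁ F₂ x₀ (c⁻¹ * γ.1, c⁻¹ * γ.2) i = c⁻¹ * gradComb F₁ F₂ x₀ γ i := by
      simp only [gradComb]; ring
    rw [this, hscale]
    exact div_le_div_of_nonneg_right (hj i) hR0

end Centre


/-! ### Vanishing of the oscillatory integral -/

section Bounds

variable {F : Type*} [Field F] [Fintype F] {n : ℕ}

theorem absInf_natCast_le_one (m : ℕ) : absInf (m : KInf F) ≤ 1 := by
  induction m with
  | zero => simp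
  | succ m ih =>
    rw [Nat.cast_succ]
    exact (absInf_add_le _ _).trans (max_le ih (by simp))

theorem absInf_mul_le_of_le_one {a x : KInf F} {B : ℝ} (ha : absInf a ≤ 1) (hx : absInf x ≤ B) :
    absInf (a * x) ≤ B := by
  rw [absInf_mul]
  calc _ ≤ 1 * absInf x := mul_le_mul_of_nonneg_right ha (absInf_nonneg x)
    _ ≤ B := by rwa [one_mul]

theorem absInf_tri_le {c : Fin n → Fin n → Fin n → KInf F} {B X Y Z : ℝ}
    (hc : ∀ i j k, absInf (c i j k) ≤ B) (hX : 0 ≤ X) (hY : 0 ≤ Y) (hZ : 0 ≤ Z) (hB : 0 ≤ B)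
    {x y z : Fin n → KInf F} (hx : ∀ i, absInf (x i) ≤ X) (hy : ∀ i, absInf (y i) ≤ Y)
    (hz : ∀ i, absInf (z i) ≤ Z) : absInf (tri c x y z) ≤ B * X * Y * Z := by
  have h0 : 0 ≤ B * X * Y * Z := by positivity
  rw [tri_eq_sum]
  refine absInf_sum_le _ _ h0 fun i _ => absInf_sum_le _ _ h0 fun j _ =>
    absInf_sum_le _ _ h0 fun k _ => ?_
  rw [absInf_mul, absInf_mul, absInf_mul]
  have := absInf_nonneg (c i j k)
  have := absInf_nonneg (x i)
  have := absInf_nonneg (y j)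
  have := absInf_nonneg (z k)
  have := hc i j k
  have := hx i
  have := hy j
  have := hz k
  gcongr

theorem absInf_bilin_le {M : Matrix (Fin n) (Fin n) (KInf F)} {B X Y : ℝ}
    (hM : ∀ i j, absInf (M i j) ≤ B) (hX : 0 ≤ X) (hY : 0 ≤ Y) (hB : 0 ≤ B)
    {x y : Fin n → KInf F} (hx : ∀ i, absInf (x i) ≤ X) (hy : ∀ i, absInf (y i) ≤ Y) :
    absInf (x ⬝ᵥ M.mulVec y) ≤ X * (B * Y) := by
  have h0 : 0 ≤ X * (B * Y) := by positivity
  refine absInf_sum_le _ _ h0 fun i _ => ?_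
  rw [absInf_mul]
  have h1 : absInf (M.mulVec y i) ≤ B * Y := by
    change absInf (∑ j, M i j * y j) ≤ _
    refine absInf_sum_le _ _ (by positivity) fun j _ => ?_
    rw [absInf_mul]
    exact mul_le_mul (hM i j) (hy j) (absInf_nonneg _) hB
  exact mul_le_mul (hx i) h1 (absInf_nonneg _) hX

/-- Taylor expansion to first order of a cubic form near `x`. -/
theorem absInf_cubic_taylor_le {c : Fin n → Fin n → Fin n → KInf F} (hc : SymTensor c) {B X U V : ℝ}
    (hB : 0 ≤ B) (hcB : ∀ i j k, absInf (c i j k) ≤ B) (hX : 1 ≤ X) (hV : 0 ≤ V) (hVU : V ≤ U)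
    (hU : U ≤ 1) {x u v : Fin n → KInf F} (hx : ∀ i, absInf (x i) ≤ X) (hu : ∀ i, absInf (u i) ≤ U)
    (hv : ∀ i, absInf (v i) ≤ V) :
    absInf (tri c (x + u + v) (x + u + v) (x + u + v) - tri c (x + u) (x + u) (x + u) -
      3 * triV c x x ⬝ᵥ v) ≤ B * X * U * V := by
  have hU0 : 0 ≤ U := hV.trans hVU
  have hX0 : 0 ≤ X := by linarith
  have e : tri c (x + u + v) (x + u + v) (x + u + v) - tri c (x + u) (x + u) (x + u) -
      3 * triV c x x ⬝ᵥ v = ((6 : ℕ) : KInf F) * tri c x u v + ((3 : ℕ) : KInf F) * tri c u u v +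
        ((3 : ℕ) : KInf F) * tri c v v (x + u) + tri c v v v := by
    rw [hc.tri_add (x + u) v, triV_add_left, triV_add_right, triV_add_right]
    simp only [add_dotProduct]
    rw [hc.triV_comm u x]
    simp only [tri]
    push_cast
    ring
  have hxu : ∀ i, absInf ((x + u) i) ≤ X := fun i =>
    (absInf_add_le _ _).trans (max_le (hx i) ((hu i).trans (hU.trans hX)))
  have h1 := absInf_tri_le hcB hX0 hU0 hV hB hx hu hv
  have h2 := absInf_tri_le hcB hU0 hU0 hV hB hu hu hv
  have h3 := absInf_tri_le hcB hV hV hX0 hB hv hv hxu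
  have h4 := absInf_tri_le hcB hV hV hV hB hv hv hv
  have e2 : B * U * U * V ≤ B * X * U * V := by
    have : U ≤ X := hU.trans hX
    gcongr
  have e3 : B * V * V * X ≤ B * X * U * V := by
    calc B * V * V * X = B * X * V * V := by ring
      _ ≤ B * X * U * V := by gcongr
  have e4 : B * V * V * V ≤ B * X * U * V := by
    have : V ≤ X := hVU.trans (hU.trans hX)
    gcongr
  rw [e]
  refine (absInf_add_le _ _).trans (max_le ((absInf_add_le _ _).trans (max_le
    ((absInf_add_le _ _).trans (max_le ?_ ?_)) ?_)) (h4.trans e4))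
  · exact absInf_mul_le_of_le_one (absInf_natCast_le_one 6) h1
  · exact absInf_mul_le_of_le_one (absInf_natCast_le_one 3) (h2.trans e2)
  · exact absInf_mul_le_of_le_one (absInf_natCast_le_one 3) (h3.trans e3)

/-- Taylor expansion to first order of a quadratic form near `x`. -/
theorem absInf_quadratic_taylor_le {M : Matrix (Fin n) (Fin n) (KInf F)} (hM : M.IsSymm)
    {B U V : ℝ} (hB : 0 ≤ B) (hMB : ∀ i j, absInf (M i j) ≤ B) (hV : 0 ≤ V) (hVU : V ≤ U)
    {x u v : Fin n → KInf F} (hu : ∀ i, absInf (u i) ≤ U) (hv : ∀ i, absInf (v i) ≤ V) :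
    absInf ((x + u + v) ⬝ᵥ M.mulVec (x + u + v) - (x + u) ⬝ᵥ M.mulVec (x + u) -
      2 * (M.mulVec x ⬝ᵥ v)) ≤ B * U * V := by
  have hU0 : 0 ≤ U := hV.trans hVU
  have e : (x + u + v) ⬝ᵥ M.mulVec (x + u + v) - (x + u) ⬝ᵥ M.mulVec (x + u) -
      2 * (M.mulVec x ⬝ᵥ v) = ((2 : ℕ) : KInf F) * (u ⬝ᵥ M.mulVec v) + v ⬝ᵥ M.mulVec v := by
    rw [Matrix.mulVec_add, Matrix.mulVec_add]
    simp only [add_dotProduct, dotProduct_add]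
    rw [dotProduct_mulVec_comm hM x v, dotProduct_mulVec_comm hM u v, dotProduct_comm v,
      dotProduct_comm v]
    push_cast
    ring
  rw [e]
  refine (absInf_add_le _ _).trans (max_le ?_ ?_)
  · refine absInf_mul_le_of_le_one (absInf_natCast_le_one 2) ?_
    refine (absInf_bilin_le hMB hU0 hV hB hu hv).trans (le_of_eq (by ring))
  · refine (absInf_bilin_le hMB hV hV hB hv hv).trans ?_
    calc V * (B * V) = B * V * V := by ring
      _ ≤ _ := by gcongr

end Bounds


/-! ### The singular integral -/

section SingularIntegral

variable {F : Type*} [Field F] [Fintype F] {n : ℕ}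

/-- The subgroup `𝕋ⁿ` of `K_∞ⁿ`. -/
def cubeInf (F : Type*) [Field F] [Fintype F] (n : ℕ) : AddSubgroup (Fin n → KInf F) :=
  AddSubgroup.pi Set.univ fun _ => ballInf F 0

/-- The subgroup of `K_∞²` cut out by `|γ₁|, |γ₂| < q ^ k`. -/
def squareInf (F : Type*) [Field F] [Fintype F] (k : ℤ) : AddSubgroup (KInf F × KInf F) :=
  (ballInf F k).prod (ballInf F k)

theorem coe_cubeInf : (cubeInf F n : Set (Fin n → KInf F)) = {x | ∀ i, x i ∈ unitInterval F} := by
  ext x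
  simp only [cubeInf, AddSubgroup.coe_pi, Set.mem_univ_pi, coe_ballInf_zero]
  rfl

theorem coe_cubeInf_eq_pi : (cubeInf F n : Set (Fin n → KInf F)) =
    Set.univ.pi fun _ => (ballInf F 0 : Set (KInf F)) := rfl

theorem isOpen_cubeInf : IsOpen (cubeInf F n : Set (Fin n → KInf F)) := by
  rw [coe_cubeInf_eq_pi]
  exact isOpen_set_pi Set.finite_univ fun _ _ => isOpen_ballInf 0

theorem isCompact_cubeInf : IsCompact (cubeInf F n : Set (Fin n → KInf F)) := by
  rw [coe_cubeInf_eq_pi]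
  exact isCompact_univ_pi fun _ => isCompact_ballInf 0

theorem isOpen_squareInf (k : ℤ) : IsOpen (squareInf F k : Set (KInf F × KInf F)) :=
  (isOpen_ballInf k).prod (isOpen_ballInf k)

theorem isCompact_squareInf (k : ℤ) : IsCompact (squareInf F k : Set (KInf F × KInf F)) :=
  (isCompact_ballInf k).prod (isCompact_ballInf k)

theorem exists_squareInf_eq {ρ : ℝ} (hρ : 0 < ρ) : ∃ k : ℤ,
    {γ : KInf F × KInf F | max (absInf γ.1) (absInf γ.2) < ρ} = squareInf F k := by
  obtain ⟨k, hk⟩ := exists_ballInf_eq (F := F) hρ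
  refine ⟨k, Set.ext fun γ => ?_⟩
  change max _ _ < ρ ↔ γ.1 ∈ ballInf F k ∧ γ.2 ∈ ballInf F k
  rw [max_lt_iff, hk, hk]

variable (p : ℕ) [Fact p.Prime] [Algebra (ZMod p) F]

/-- The phase `ψ(γ₁ F₁(x₀ + t⁻ᴸ x) + γ₂ F₂(x₀ + t⁻ᴸ x))`. -/
def localPhase {F : Type*} [Field F] [Algebra (ZMod p) F] {n : ℕ}
    (F₁ F₂ : MvPolynomial (Fin n) F[X]) (x₀ : Fin n → KInf F) (L : ℕ)
    (γ : KInf F × KInf F) (x : Fin n → KInf F) : ℂ :=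
  psi p (γ.1 * evalInf F₁ (fun i => x₀ i + (tInf ^ L)⁻¹ * x i) +
    γ.2 * evalInf F₂ (fun i => x₀ i + (tInf ^ L)⁻¹ * x i))

/-- The inner integral of the singular integral. -/
def localIntegral (F₁ F₂ : MvPolynomial (Fin n) F[X]) (x₀ : Fin n → KInf F) (L : ℕ)
    (γ : KInf F × KInf F) : ℂ :=
  ∫ x in (cubeInf F n : Set (Fin n → KInf F)), localPhase p F₁ F₂ x₀ L γ x ∂(haarInfPi F n)

theorem singularIntegral_eq (F₁ F₂ : MvPolynomial (Fin n) F[X]) (x₀ : Fin n → KInf F) (L : ℕ) :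
    singularIntegral p F₁ F₂ x₀ L = (((hat F L) ^ n)⁻¹ : ℝ) *
      ∫ γ in {γ : KInf F × KInf F |
        max (absInf γ.1) (absInf γ.2) < (gradMin F₁ F₂ x₀ * (hat F L)⁻¹)⁻¹},
        localIntegral p F₁ F₂ x₀ L γ ∂(haarInfProd F) := by
  simp only [localIntegral, coe_cubeInf]
  rfl

variable {Φ : FormPair F n} {F₁ : MvPolynomial (Fin n) F[X]}

theorem exists_absInf_le {ι : Type*} [Finite ι] (f : ι → KInf F) :
    ∃ B : ℝ, 0 < B ∧ ∀ i, absInf (f i) ≤ B := by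
  obtain ⟨B, hB⟩ := (Set.finite_range fun i => absInf (f i)).bddAbove
  exact ⟨max B 1, by positivity, fun i => (hB ⟨i, rfl⟩).trans (le_max_left _ _)⟩

/-- The oscillation kills the inner integral outside the domain of integration of `σ_∞`: a shift
of `x` along the coordinate in which `γ₁ ∇F₁(x₀) + γ₂ ∇F₂(x₀)` is largest multiplies the integrand
by a constant different from `1`. -/
theorem exists_localIntegral_eq_zero (hn : 0 < n) (h : Φ.Represents F₁) {x₀ : Fin n → KInf F}
    (hl : 0 < gradMin F₁ (quadOf Φ.M) x₀) : ∃ L₀ : ℕ, ∀ L : ℕ, L₀ ≤ L → ∀ γ : KInf F × KInf F,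
      (gradMin F₁ (quadOf Φ.M) x₀ * (hat F L)⁻¹)⁻¹ ≤ max (absInf γ.1) (absInf γ.2) →
      localIntegral p F₁ (quadOf Φ.M) x₀ L γ = 0 := by
  set l := gradMin F₁ (quadOf Φ.M) x₀ with hldef
  obtain ⟨B₁, hB₁, hc⟩ := exists_absInf_le fun ijk : Fin n × Fin n × Fin n =>
    (ofPoly (Φ.c ijk.1 ijk.2.1 ijk.2.2) : KInf F)
  obtain ⟨B₂, hB₂, hM⟩ := exists_absInf_le fun ij : Fin n × Fin n =>
    (ofPoly (Φ.M ij.1 ij.2) : KInf F)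
  obtain ⟨X₀, hX₀, hx⟩ := exists_absInf_le x₀
  set B := max B₁ B₂
  set X := max X₀ 1
  have hB : 0 < B := hB₁.trans_le (le_max_left _ _)
  have hX1 : 1 ≤ X := le_max_right _ _
  have hX0 : 0 < X := by linarith
  have hq := one_lt_q F
  set q : ℝ := (Fintype.card F : ℝ) with hqdef
  have hq0 : 0 < q := by linarith
  obtain ⟨L₀, hL₀⟩ := pow_unbounded_of_one_lt (B * X / l) hq
  refine ⟨L₀, fun L hL γ hγ => ?_⟩
  have hqL : B * X / l < q ^ L := hL₀.trans_le (pow_le_pow_right₀ hq.le hL)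
  have hhat : hat F (L : ℝ) = q ^ L := by rw [hat, Real.rpow_natCast]
  set R := max (absInf γ.1) (absInf γ.2) with hR
  have hγ' : q ^ L ≤ l * R := by
    rw [hhat, mul_inv, inv_inv, inv_mul_le_iff₀ hl] at hγ
    exact hγ
  have hqLpos : 0 < q ^ L := by positivity
  have hR0 : 0 < R := by
    by_contra! h0
    nlinarith
  obtain ⟨j, hj⟩ := exists_gradMin_mul_le hn F₁ (quadOf Φ.M) x₀ γ
  rw [← hldef, ← hR] at hj
  set g := gradComb F₁ (quadOf Φ.M) x₀ γ j with hg
  have hgpos : 0 < absInf g := lt_of_lt_of_le (by positivity) hj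
  have hg0 : g ≠ 0 := fun h0 => by rw [h0, absInf_zero] at hgpos; exact hgpos.false
  have ht0 : (tInf ^ L : KInf F) ≠ 0 := pow_ne_zero _ tInf_ne_zero
  have htL : absInf ((tInf ^ L)⁻¹ : KInf F) = (q ^ L)⁻¹ := by
    rw [absInf_inv]
    congr 1
    exact absInf_tInf_pow L
  -- the shift by `β` changes the linear term by an element of absolute value `q⁻¹`
  obtain ⟨β, hβ1, hβ0, hβ2⟩ := exists_psi_mul_ne_one p (mul_ne_zero hg0 (inv_ne_zero ht0))
  have hβabs : absInf (g * (tInf ^ L)⁻¹ * β) = q⁻¹ := by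
    rw [absInf_of_ne hβ0, hβ2, zpow_neg_one]
  set V := absInf ((tInf ^ L)⁻¹ * β) with hV
  have hgV : absInf g * V = q⁻¹ := by rw [hV, ← absInf_mul, ← mul_assoc, hβabs]
  have hVpos : 0 < V := by
    by_contra! h0
    have : V = 0 := le_antisymm h0 (absInf_nonneg _)
    rw [this, mul_zero] at hgV
    exact (inv_pos.mpr hq0).ne hgV
  have hlRV : l * R * V ≤ q⁻¹ := hgV ▸ mul_le_mul_of_nonneg_right hj hVpos.le
  have hVU : q ^ L * V ≤ q⁻¹ := (mul_le_mul_of_nonneg_right hγ' hVpos.le).trans hlRV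
  have hq1 : q⁻¹ < 1 := inv_lt_one_of_one_lt₀ hq
  have hβlt : absInf β < 1 := by
    have : V = (q ^ L)⁻¹ * absInf β := by rw [hV, absInf_mul, htL]
    rw [this, mul_inv_cancel_left₀ hqLpos.ne'] at hVU
    linarith
  have hVU' : V ≤ (q ^ L)⁻¹ := by
    rw [← one_div, le_div_iff₀ hqLpos, mul_comm]
    linarith
  have hU1 : (q ^ L)⁻¹ ≤ 1 := inv_le_one_of_one_le₀ (one_le_pow₀ hq.le)
  -- the terms of higher order in the shift are negligible for large `L`
  have herr : R * (B * X * (q ^ L)⁻¹ * V) < q⁻¹ := by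
    have h1 : B * X * (q ^ L)⁻¹ < l := by
      rw [← div_eq_mul_inv, div_lt_iff₀ hqLpos, mul_comm l]
      rwa [div_lt_iff₀ hl] at hqL
    calc R * (B * X * (q ^ L)⁻¹ * V) = B * X * (q ^ L)⁻¹ * (R * V) := by ring
      _ < l * (R * V) := mul_lt_mul_of_pos_right h1 (by positivity)
      _ = l * R * V := by ring
      _ ≤ q⁻¹ := hlRV
  refine setIntegral_eq_zero_of_shift (haarInfPi F n) (cubeInf F n)
    isOpen_cubeInf.measurableSet (z := Pi.single j β) ?_ hβ1 fun y hy => ?_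
  · rw [← SetLike.mem_coe, coe_cubeInf]
    intro i
    rcases eq_or_ne i j with rfl | hij
    · simpa [unitInterval] using hβlt
    · simp [unitInterval, hij]
  rw [← SetLike.mem_coe, coe_cubeInf] at hy
  rw [localPhase, localPhase, ← psi_add]
  refine psi_eq_of_sub_mem p ?_
  set u : Fin n → KInf F := fun i => (tInf ^ L)⁻¹ * y i
  set v : Fin n → KInf F := Pi.single j ((tInf ^ L)⁻¹ * β) with hv
  have eshift : (fun i => x₀ i + (tInf ^ L)⁻¹ * (y + Pi.single j β : Fin n → KInf F) i) =
      x₀ + u + v := by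
    funext i
    rcases eq_or_ne i j with rfl | hij
    · simp [u, v, mul_add, add_assoc]
    · simp [u, v, hij]
  have ebase : (fun i => x₀ i + (tInf ^ L)⁻¹ * y i) = x₀ + u := rfl
  rw [eshift, ebase]
  have hu : ∀ i, absInf (u i) ≤ (q ^ L)⁻¹ := fun i => by
    rw [absInf_mul, htL]
    exact mul_le_of_le_one_right (inv_pos.mpr hqLpos).le (hy i).le
  have hv' : ∀ i, absInf (v i) ≤ V := fun i => by
    rcases eq_or_ne i j with rfl | hij
    · simp [hv, hV]
    · simp [hv, hij, hVpos.le]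
  have hx' : ∀ i, absInf (x₀ i) ≤ X := fun i => (hx i).trans (le_max_left _ _)
  have e1 : ∀ x, evalInf F₁ x = tri (fun i j k => ofPoly (Φ.c i j k)) x x x := fun x =>
    eval₂_cubic _ h.eq_sum x
  have e2 : ∀ x, evalInf (quadOf Φ.M) x = x ⬝ᵥ (Φ.M.map ofPoly).mulVec x := fun x =>
    eval₂_quadOf _ _ x
  have hcs : SymTensor fun i j k => (ofPoly (Φ.c i j k) : KInf F) := Φ.symm_c.map _
  have hMs : (Φ.M.map (ofPoly : F[X] →+* KInf F)).IsSymm := Φ.symm_M.map _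
  have t1 := absInf_cubic_taylor_le hcs hB.le (fun i j k => (hc (i, j, k)).trans (le_max_left _ _))
    hX1 hVpos.le hVU' hU1 hx' hu hv'
  have t2 := absInf_quadratic_taylor_le hMs hB.le (fun i j => (hM (i, j)).trans (le_max_right _ _))
    hVpos.le hVU' (x := x₀) hu hv'
  have hg' : g = γ.1 * (3 * triV (fun i j k => ofPoly (Φ.c i j k)) x₀ x₀ j) +
      γ.2 * (2 * (Φ.M.map ofPoly).mulVec x₀ j) := by
    rw [hg, gradComb, evalInf, evalInf, eval₂_cubic_grad _ (h.pderiv j), eval₂_quadOf_grad _ Φ.symm_M]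
  rw [e1, e1, e2, e2, hg']
  rw [hv, dotProduct_single, ← hv] at t1 t2
  set w : KInf F := (tInf ^ L)⁻¹ * β
  set E₁ := tri (fun i j k => ofPoly (Φ.c i j k)) (x₀ + u + v) (x₀ + u + v) (x₀ + u + v)
  set E₁' := tri (fun i j k => ofPoly (Φ.c i j k)) (x₀ + u) (x₀ + u) (x₀ + u)
  set E₂ := (x₀ + u + v) ⬝ᵥ (Φ.M.map ofPoly).mulVec (x₀ + u + v)
  set E₂' := (x₀ + u) ⬝ᵥ (Φ.M.map ofPoly).mulVec (x₀ + u)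
  set T₁ := triV (fun i j k => ofPoly (Φ.c i j k)) x₀ x₀ j
  set T₂ := (Φ.M.map ofPoly).mulVec x₀ j
  have efin : γ.1 * E₁ + γ.2 * E₂ -
      ((γ.1 * (3 * T₁) + γ.2 * (2 * T₂)) * (tInf ^ L)⁻¹ * β + (γ.1 * E₁' + γ.2 * E₂')) =
      γ.1 * (E₁ - E₁' - 3 * (T₁ * w)) + γ.2 * (E₂ - E₂' - 2 * (T₂ * w)) := by
    simp only [w]; ring
  rw [efin, mem_ballInf, zpow_neg_one]
  refine lt_of_le_of_lt ((absInf_add_le _ _).trans (max_le ?_ ?_)) herr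
  · rw [absInf_mul]
    exact mul_le_mul (le_max_left _ _) t1 (absInf_nonneg _) hR0.le
  · rw [absInf_mul]
    refine mul_le_mul (le_max_right _ _) (t2.trans ?_) (absInf_nonneg _) hR0.le
    have : B ≤ B * X := le_mul_of_one_le_right hB.le hX1
    gcongr

end SingularIntegral


section MainTermIntegrals

variable {F : Type*} [Field F] [Fintype F] {n : ℕ} (p : ℕ) [Fact p.Prime] [Algebra (ZMod p) F]

theorem continuous_localPhase {F : Type*} [Field F] [Fintype F] [Algebra (ZMod p) F] {n : ℕ}
    (F₁ F₂ : MvPolynomial (Fin n) F[X]) (x₀ : Fin n → KInf F)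
    (L : ℕ) : Continuous fun z : (KInf F × KInf F) × (Fin n → KInf F) =>
      localPhase p F₁ F₂ x₀ L z.1 z.2 := by
  have h1 := continuous_evalInf F₁
  have h2 := continuous_evalInf F₂
  have hx : Continuous fun z : (KInf F × KInf F) × (Fin n → KInf F) =>
      (fun i => x₀ i + (tInf ^ L)⁻¹ * z.2 i : Fin n → KInf F) := by
    fun_prop
  exact (continuous_psi p).comp ((continuous_fst.fst.mul (h1.comp hx)).add
    (continuous_fst.snd.mul (h2.comp hx)))

theorem norm_localPhase {F : Type*} [Field F] [Algebra (ZMod p) F] {n : ℕ}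
    (F₁ F₂ : MvPolynomial (Fin n) F[X]) (x₀ : Fin n → KInf F) (L : ℕ)
    (γ : KInf F × KInf F) (x : Fin n → KInf F) : ‖localPhase p F₁ F₂ x₀ L γ x‖ = 1 :=
  norm_psi p _

theorem localPhase_add {F : Type*} [Field F] [Algebra (ZMod p) F] {n : ℕ}
    (F₁ F₂ : MvPolynomial (Fin n) F[X]) (x₀ : Fin n → KInf F) (L : ℕ)
    (γ γ' : KInf F × KInf F) (x : Fin n → KInf F) : localPhase p F₁ F₂ x₀ L (γ + γ') x =
      localPhase p F₁ F₂ x₀ L γ' x * localPhase p F₁ F₂ x₀ L γ x := by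
  rw [localPhase, localPhase, localPhase, ← psi_add]
  congr 1
  rw [Prod.fst_add, Prod.snd_add]
  ring

/-- The singular integral is positive: by Fubini it is the integral over `𝕋ⁿ` of
`∫_Γ ψ(γ₁ G₁(x) + γ₂ G₂(x)) dγ` with `Γ` a compact open group, which is the volume of `Γ` if the
character is trivial on `Γ`, in particular for `x` near `0`, and `0` otherwise. -/
theorem singularIntegral_pos {F₁ F₂ : MvPolynomial (Fin n) F[X]} {x₀ : Fin n → KInf F}
    (h1 : evalInf F₁ x₀ = 0) (h2 : evalInf F₂ x₀ = 0) (hl : 0 < gradMin F₁ F₂ x₀) (L : ℕ) :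
    0 < (singularIntegral p F₁ F₂ x₀ L).re ∧ (singularIntegral p F₁ F₂ x₀ L).im = 0 := by
  classical
  have hh : 0 < hat F (L : ℝ) := Real.rpow_pos_of_pos (q_pos F) _
  obtain ⟨k, hk⟩ := exists_squareInf_eq (F := F)
    (ρ := (gradMin F₁ F₂ x₀ * (hat F (L : ℝ))⁻¹)⁻¹) (by positivity)
  set C : Set (Fin n → KInf F) := (cubeInf F n : Set (Fin n → KInf F)) with hC
  set Q : Set (KInf F × KInf F) := (squareInf F k : Set (KInf F × KInf F)) with hQ
  have hCm : MeasurableSet C := isOpen_cubeInf.measurableSet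
  have hQm : MeasurableSet Q := (isOpen_squareInf k).measurableSet
  have hCfin : haarInfPi F n C < ⊤ := isCompact_cubeInf.measure_lt_top
  have hQfin : haarInfProd F Q < ⊤ := (isCompact_squareInf k).measure_lt_top
  have : IsFiniteMeasure ((haarInfPi F n).restrict C) := ⟨by simpa using hCfin⟩
  have : IsFiniteMeasure ((haarInfProd F).restrict Q) := ⟨by simpa using hQfin⟩
  have hcont := continuous_localPhase p F₁ F₂ x₀ L
  have hint : Integrable (fun z : (KInf F × KInf F) × (Fin n → KInf F) =>
      localPhase p F₁ F₂ x₀ L z.1 z.2)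
      (((haarInfProd F).restrict Q).prod ((haarInfPi F n).restrict C)) :=
    Integrable.of_bound hcont.aestronglyMeasurable 1
      (Filter.Eventually.of_forall fun z => (norm_localPhase p F₁ F₂ x₀ L z.1 z.2).le)
  set V : ℝ := (haarInfProd F).real Q with hV
  have hVpos : 0 < V := by
    refine ENNReal.toReal_pos (IsOpen.measure_ne_zero _ (isOpen_squareInf k) ⟨0, ?_⟩) hQfin.ne
    exact (squareInf F k).zero_mem
  let T : Set (Fin n → KInf F) := {x | ∀ γ ∈ Q, localPhase p F₁ F₂ x₀ L γ x = 1}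
  have hinner : ∀ x, ∫ γ in Q, localPhase p F₁ F₂ x₀ L γ x ∂(haarInfProd F) =
      ((T.indicator (fun _ => V) x : ℝ) : ℂ) := fun x => by
    by_cases hx : x ∈ T
    · rw [Set.indicator_of_mem hx, setIntegral_congr_fun hQm (g := fun _ => (1 : ℂ)) hx]
      simp [hV]
    · rw [Set.indicator_of_notMem hx]
      have hx' : ∃ γ ∈ Q, localPhase p F₁ F₂ x₀ L γ x ≠ 1 := by
        simpa only [T, Set.mem_ofPred_eq, not_forall, exists_prop] using hx
      obtain ⟨z, hz, hz1⟩ := hx'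
      exact_mod_cast setIntegral_eq_zero_of_shift (haarInfProd F) (squareInf F k) hQm hz hz1
        fun γ _ => localPhase_add p F₁ F₂ x₀ L γ z x
  have hswap : ∫ γ in Q, localIntegral p F₁ F₂ x₀ L γ ∂(haarInfProd F) =
      ((∫ x in C, T.indicator (fun _ => V) x ∂(haarInfPi F n) : ℝ) : ℂ) := by
    unfold localIntegral
    rw [integral_integral_swap hint]
    simp only [hinner]
    exact integral_ofReal
  have hpos : 0 < ∫ x in C, T.indicator (fun _ => V) x ∂(haarInfPi F n) := by
    have hi : Integrable (T.indicator fun _ => V) ((haarInfPi F n).restrict C) := by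
      have h3 := hint.integral_prod_right
      simp only [hinner] at h3
      simpa using h3.re
    rw [integral_pos_iff_support_of_nonneg (fun x => Set.indicator_nonneg (fun _ _ => hVpos.le) x) hi]
    -- a neighbourhood of `0` on which the character is trivial
    set U : Set (Fin n → KInf F) := {x | evalInf F₁ (fun i => x₀ i + (tInf ^ L)⁻¹ * x i) ∈
      ballInf F (-k - 1)} ∩ {x | evalInf F₂ (fun i => x₀ i + (tInf ^ L)⁻¹ * x i) ∈
      ballInf F (-k - 1)} with hU
    have hxc : Continuous fun x : Fin n → KInf F =>
        (fun i => x₀ i + (tInf ^ L)⁻¹ * x i : Fin n → KInf F) := by fun_prop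
    have hUo : IsOpen U := ((isOpen_ballInf _).preimage ((continuous_evalInf F₁).comp hxc)).inter
      ((isOpen_ballInf _).preimage ((continuous_evalInf F₂).comp hxc))
    have hUC : U ∩ C ⊆ (Function.support (T.indicator fun _ => V)) ∩ C := by
      rintro x ⟨⟨hx1, hx2⟩, hxC⟩
      refine ⟨?_, hxC⟩
      rw [Function.mem_support, Set.indicator_of_mem]
      · exact hVpos.ne'
      rintro γ ⟨hγ1, hγ2⟩
      rw [localPhase]
      have hmul : ∀ a b : KInf F, a ∈ ballInf F k → b ∈ ballInf F (-k - 1) →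
          a * b ∈ ballInf F (-1) := fun a b ha hb => by
        rw [mem_ballInf] at *
        rw [absInf_mul]
        calc absInf a * absInf b < (Fintype.card F : ℝ) ^ k * (Fintype.card F : ℝ) ^ (-k - 1) :=
              mul_lt_mul'' ha hb (absInf_nonneg _) (absInf_nonneg _)
          _ = _ := by rw [← zpow_add₀ (q_pos F).ne']; congr 1; ring
      rw [psi_eq_of_sub_mem p (β := 0), psi_zero]
      rw [sub_zero]
      exact AddSubgroup.add_mem _ (hmul _ _ hγ1 hx1) (hmul _ _ hγ2 hx2)
    rw [Measure.restrict_apply' hCm]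
    refine lt_of_lt_of_le (pos_iff_ne_zero.mpr (IsOpen.measure_ne_zero _ (hUo.inter isOpen_cubeInf)
      ⟨0, ⟨?_, ?_⟩, (cubeInf F n).zero_mem⟩)) (measure_mono hUC)
    · simp only [Set.mem_ofPred_eq, Pi.zero_apply, mul_zero, add_zero]
      rw [h1]; exact AddSubgroup.zero_mem _
    · simp only [Set.mem_ofPred_eq, Pi.zero_apply, mul_zero, add_zero]
      rw [h2]; exact AddSubgroup.zero_mem _
  rw [singularIntegral_eq, hk, hswap, ← Complex.ofReal_mul]
  exact ⟨by rw [Complex.ofReal_re]; positivity, Complex.ofReal_im _⟩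

/-- The oscillatory integral without linear term, in terms of the inner integral of `σ_∞`. -/
theorem oscInt_zero (F₁ F₂ : MvPolynomial (Fin n) F[X]) (x₀ : Fin n → KInf F) (L P : ℕ) (s : F[X])
    (θ : KInf F × KInf F) : oscInt p F₁ F₂ x₀ L P s θ 0 = (((hat F L) ^ n)⁻¹ : ℝ) *
      localIntegral p F₁ F₂ x₀ L (tInf ^ (3 * P : ℤ) * θ.1, tInf ^ (2 * P : ℤ) * θ.2) := by
  have ht0 : (tInf ^ L : KInf F) ≠ 0 := pow_ne_zero _ tInf_ne_zero
  set γ : KInf F × KInf F := (tInf ^ (3 * P : ℤ) * θ.1, tInf ^ (2 * P : ℤ) * θ.2) with hγ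
  have h1 : ∀ x : Fin n → KInf F, (weight x₀ L x : ℂ) *
      psi p (tInf ^ (3 * P) * θ.1 * evalInf F₁ x + tInf ^ (2 * P) * θ.2 * evalInf F₂ x +
        tInf ^ P * (∑ i, ofPoly ((0 : Fin n → F[X]) i) * x i) / ofPoly s) =
      (cubeInf F n : Set (Fin n → KInf F)).indicator (localPhase p F₁ F₂ x₀ L γ)
        (fun i => tInf ^ (L : ℤ) * (x i - x₀ i)) := fun x => by
    have hx : (fun i => x₀ i + (tInf ^ L)⁻¹ * (tInf ^ (L : ℤ) * (x i - x₀ i))) = x := by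
      funext i
      rw [zpow_natCast, inv_mul_cancel_left₀ ht0]
      ring
    by_cases hm : (fun i => tInf ^ (L : ℤ) * (x i - x₀ i)) ∈
        (cubeInf F n : Set (Fin n → KInf F))
    · rw [Set.indicator_of_mem hm]
      rw [coe_cubeInf] at hm
      have hw : weight x₀ L x = 1 := if_pos fun i => by simpa [unitInterval] using hm i
      rw [hw, localPhase, hx, hγ]
      simp only [Pi.zero_apply, map_zero, zero_mul, Finset.sum_const_zero, mul_zero, zero_div,
        add_zero, Complex.ofReal_one, one_mul]
      norm_cast
    · rw [Set.indicator_of_notMem hm]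
      rw [coe_cubeInf] at hm
      have hw : weight x₀ L x = 0 := if_neg fun h => hm fun i => by simpa [unitInterval] using h i
      rw [hw, Complex.ofReal_zero, zero_mul]
  rw [oscInt]
  simp only [h1]
  rw [integral_affine_pi (L : ℤ) x₀, integral_indicator isOpen_cubeInf.measurableSet]
  congr 2
  rw [hat, Real.rpow_natCast, zpow_neg, zpow_natCast, inv_pow]

theorem oscInt_zero_eq_zero {F₁ F₂ : MvPolynomial (Fin n) F[X]} {x₀ : Fin n → KInf F} {L : ℕ}
    {k : ℤ} (hk : ∀ γ ∉ squareInf F k, localIntegral p F₁ F₂ x₀ L γ = 0) (P : ℕ) (s : F[X])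
    {θ : KInf F × KInf F} (hθ : (tInf ^ (3 * P : ℤ) * θ.1, tInf ^ (2 * P : ℤ) * θ.2) ∉ squareInf F k) :
    oscInt p F₁ F₂ x₀ L P s θ 0 = 0 := by
  rw [oscInt_zero, hk _ hθ, mul_zero]

theorem setIntegral_oscInt_eq {F₁ F₂ : MvPolynomial (Fin n) F[X]} {x₀ : Fin n → KInf F} {L : ℕ}
    {k : ℤ} (hk : ∀ γ ∉ squareInf F k, localIntegral p F₁ F₂ x₀ L γ = 0)
    (hk' : {γ : KInf F × KInf F | max (absInf γ.1) (absInf γ.2) <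
      (gradMin F₁ F₂ x₀ * (hat F L)⁻¹)⁻¹} = squareInf F k) (P : ℕ) (s : F[X])
    {S : Set (KInf F × KInf F)} (hS : ∀ θ : KInf F × KInf F,
      (tInf ^ (3 * P : ℤ) * θ.1, tInf ^ (2 * P : ℤ) * θ.2) ∈ squareInf F k → θ ∈ S) :
    ∫ θ in S, oscInt p F₁ F₂ x₀ L P s θ 0 ∂(haarInfProd F) =
      (((Fintype.card F : ℝ) ^ (-(5 * P : ℤ)) : ℝ) : ℂ) * singularIntegral p F₁ F₂ x₀ L := by
  rw [setIntegral_eq_integral_of_forall_compl_eq_zero fun θ hθ =>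
    oscInt_zero_eq_zero p hk P s fun h => hθ (hS θ h)]
  simp only [oscInt_zero]
  rw [integral_const_mul, integral_scale_prod (3 * P) (2 * P)
    (localIntegral p F₁ F₂ x₀ L), singularIntegral_eq, hk',
    setIntegral_eq_integral_of_forall_compl_eq_zero hk]
  have : (3 * P + 2 * P : ℤ) = 5 * P := by ring
  rw [this]
  ring

/-- A bound that needs nothing of the domain of integration. -/
theorem exists_norm_setIntegral_oscInt_le {F₁ F₂ : MvPolynomial (Fin n) F[X]} {x₀ : Fin n → KInf F}
    {L : ℕ} {k : ℤ} (hk : ∀ γ ∉ squareInf F k, localIntegral p F₁ F₂ x₀ L γ = 0) :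
    ∃ C : ℝ, 0 ≤ C ∧ ∀ (P : ℕ) (s : F[X]) (S : Set (KInf F × KInf F)),
      ‖∫ θ in S, oscInt p F₁ F₂ x₀ L P s θ 0 ∂(haarInfProd F)‖ ≤
        C * (Fintype.card F : ℝ) ^ (-(5 * P : ℤ)) := by
  set V := (haarInfPi F n).real (cubeInf F n : Set (Fin n → KInf F)) with hV
  set Q : Set (KInf F × KInf F) := (squareInf F k : Set (KInf F × KInf F)) with hQ
  have hQm : MeasurableSet Q := (isOpen_squareInf k).measurableSet
  have hQfin : haarInfProd F Q < ⊤ := (isCompact_squareInf k).measure_lt_top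
  have hh : 0 < hat F (L : ℝ) := Real.rpow_pos_of_pos (q_pos F) _
  have hloc : ∀ γ, ‖localIntegral p F₁ F₂ x₀ L γ‖ ≤ V := fun γ => by
    have := norm_setIntegral_le_of_norm_le_const (μ := haarInfPi F n) (C := 1)
      isCompact_cubeInf.measure_lt_top fun x _ => (norm_localPhase p F₁ F₂ x₀ L γ x).le
    rwa [one_mul] at this
  set c := ((hat F (L : ℝ)) ^ n)⁻¹ * V with hc
  have hc0 : 0 ≤ c := by positivity
  refine ⟨c * (haarInfProd F).real Q, by positivity, fun P s S => ?_⟩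
  let e : KInf F × KInf F → KInf F × KInf F :=
    fun θ => (tInf ^ (3 * P : ℤ) * θ.1, tInf ^ (2 * P : ℤ) * θ.2)
  have he : Continuous e := by fun_prop
  let Q' := e ⁻¹' Q
  have hQ'm : MeasurableSet Q' := hQm.preimage he.measurable
  have hvol : (haarInfProd F).real Q' =
      (Fintype.card F : ℝ) ^ (-(5 * P : ℤ)) * (haarInfProd F).real Q := by
    have h1 := integral_scale_prod (3 * P) (2 * P) (Q.indicator fun _ : KInf F × KInf F => (1 : ℂ))
    have h2 : (fun θ : KInf F × KInf F => Q.indicator (fun _ => (1 : ℂ))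
        (tInf ^ (3 * P : ℤ) * θ.1, tInf ^ (2 * P : ℤ) * θ.2)) = Q'.indicator fun _ => 1 := rfl
    rw [h2, integral_indicator hQm, integral_indicator hQ'm] at h1
    have h3 : (3 * P + 2 * P : ℤ) = 5 * P := by ring
    rw [h3] at h1
    simp only [setIntegral_const, Complex.real_smul, mul_one] at h1
    exact_mod_cast h1
  have hQ'fin : haarInfProd F Q' < ⊤ := by
    by_contra! htop
    have h0 : (haarInfProd F).real Q' = 0 := by
      rw [Measure.real, top_le_iff.mp htop, ENNReal.toReal_top]
    have hVpos : 0 < (haarInfProd F).real Q :=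
      ENNReal.toReal_pos (IsOpen.measure_ne_zero _ (isOpen_squareInf k)
        ⟨0, (squareInf F k).zero_mem⟩) hQfin.ne
    have : 0 < (haarInfProd F).real Q' := hvol ▸ mul_pos (zpow_pos (q_pos F) _) hVpos
    exact this.ne' h0
  have hg : Integrable (Q'.indicator fun _ => c) (haarInfProd F) :=
    (integrable_indicator_iff hQ'm).mpr (integrableOn_const hQ'fin.ne)
  have hbound : ∀ θ, ‖oscInt p F₁ F₂ x₀ L P s θ 0‖ ≤ Q'.indicator (fun _ => c) θ := fun θ => by
    by_cases hθ : θ ∈ Q'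
    · rw [Set.indicator_of_mem hθ, oscInt_zero, norm_mul, Complex.norm_real,
        Real.norm_of_nonneg (by positivity), hc]
      exact mul_le_mul_of_nonneg_left (hloc _) (by positivity)
    · rw [Set.indicator_of_notMem hθ, oscInt_zero_eq_zero p hk P s hθ, norm_zero]
  calc ‖∫ θ in S, oscInt p F₁ F₂ x₀ L P s θ 0 ∂(haarInfProd F)‖
      ≤ ∫ θ in S, Q'.indicator (fun _ => c) θ ∂(haarInfProd F) :=
        norm_integral_le_of_norm_le hg.integrableOn (Filter.Eventually.of_forall hbound)
    _ ≤ ∫ θ, Q'.indicator (fun _ => c) θ ∂(haarInfProd F) :=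
        setIntegral_le_integral hg
          (Filter.Eventually.of_forall fun θ => Set.indicator_nonneg (fun _ _ => hc0) θ)
    _ = c * (haarInfProd F).real Q * (Fintype.card F : ℝ) ^ (-(5 * P : ℤ)) := by
        rw [integral_indicator hQ'm, setIntegral_const, hvol, smul_eq_mul]
        ring

end MainTermIntegrals


/-! ### Rational points on lines -/

section Lines

variable {F : Type*} [Field F] [Fintype F]

theorem hat_pos (Y : ℝ) : 0 < hat F Y := Real.rpow_pos_of_pos (q_pos F) _

theorem hat_add (Y Z : ℝ) : hat F (Y + Z) = hat F Y * hat F Z := Real.rpow_add (q_pos F) _ _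

theorem hat_neg (Y : ℝ) : hat F (-Y) = (hat F Y)⁻¹ := Real.rpow_neg (q_pos F).le _

theorem hat_le_iff {Y Z : ℝ} : hat F Y ≤ hat F Z ↔ Y ≤ Z :=
  Real.rpow_le_rpow_left_iff (one_lt_q F)

theorem hat_lt_iff {Y Z : ℝ} : hat F Y < hat F Z ↔ Y < Z :=
  Real.rpow_lt_rpow_left_iff (one_lt_q F)

theorem polyAbs_eq_hat {f : F[X]} (hf : f ≠ 0) : polyAbs f = hat F f.natDegree := by
  rw [polyAbs_of_ne hf, hat, Real.rpow_natCast]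

theorem sqrt_polyAbs {r : F[X]} (hr : r ≠ 0) : √(polyAbs r) = hat F (r.natDegree / 2) := by
  rw [polyAbs_eq_hat hr, Real.sqrt_eq_iff_mul_self_eq (hat_pos _).le (hat_pos _).le, ← hat_add]
  congr 1; ring

/-- The bounds on `d c` in the definition of `lines`. -/
def ShortVector (R₁ R₂ : ℕ) (r : F[X]) (u : F[X] × F[X]) : Prop :=
  polyAbs u.1 ≤ hat F (((R₁ : ℝ) - R₂) / 2) * √(polyAbs r) ∧
    polyAbs u.2 < (hat F (((R₁ : ℝ) - R₂) / 2))⁻¹ * √(polyAbs r)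

/-- Dirichlet's box principle: a numerator lies on a line with a short equation. -/
theorem exists_shortVector {R₁ R₂ : ℕ} (hR : R₂ ≤ R₁) {r : F[X]} (hr : r ≠ 0) (a : F[X] × F[X]) :
    ∃ u : F[X] × F[X], u ≠ 0 ∧ r ∣ u.1 * a.1 + u.2 * a.2 ∧ ShortVector R₁ R₂ r u := by
  classical
  obtain ⟨e, rfl⟩ := Nat.exists_eq_add_of_le hR
  set ρ := r.natDegree with hρ
  set A := (e + ρ) / 2
  set B := ρ - A
  have hX : ∀ k : ℕ, (Polynomial.X ^ k : F[X]) ≠ 0 := fun k => pow_ne_zero _ Polynomial.X_ne_zero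
  have hXabs : ∀ k : ℕ, polyAbs (Polynomial.X ^ k : F[X]) = (Fintype.card F : ℝ) ^ k := fun k => by
    rw [polyAbs_of_ne (hX k), Polynomial.natDegree_X_pow]
  -- a box of `q |r|` pairs, two of which agree modulo `r`
  set S := lowPolys (Polynomial.X ^ (A + 1) : F[X]) ×ˢ lowPolys (Polynomial.X ^ B : F[X]) with hS
  have hcard : (lowPolys r).card < S.card := by
    have : ((lowPolys r).card : ℝ) < S.card := by
      rw [hS, Finset.card_product, Nat.cast_mul, card_lowPolys hr, card_lowPolys (hX _),
        card_lowPolys (hX _), hXabs, hXabs, polyAbs_of_ne hr, ← pow_add]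
      exact pow_lt_pow_right₀ (one_lt_q F) (by omega)
    exact_mod_cast this
  obtain ⟨x, hx, y, hy, hxy, he⟩ := Finset.exists_ne_map_eq_of_card_lt_of_maps_to hcard
    (f := fun u => (u.1 * a.1 + u.2 * a.2) % r) fun u _ => mod_mem_lowPolys hr _
  rw [hS, Finset.mem_product, mem_lowPolys, mem_lowPolys] at hx hy
  refine ⟨x - y, sub_ne_zero.mpr hxy, ?_, ?_, ?_⟩
  · have h1 := dvd_sub_mod r (x.1 * a.1 + x.2 * a.2)
    have h2 := dvd_sub_mod r (y.1 * a.1 + y.2 * a.2)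
    have he' : (x.1 * a.1 + x.2 * a.2) % r = (y.1 * a.1 + y.2 * a.2) % r := he
    rw [he'] at h1
    convert dvd_sub h1 h2 using 1
    rw [Prod.fst_sub, Prod.snd_sub]
    ring
  · have h1 : polyAbs (x - y).1 < polyAbs (Polynomial.X ^ (A + 1) : F[X]) :=
      polyAbs_sub_lt hx.1 hy.1
    rw [sqrt_polyAbs hr, ← hat_add]
    by_cases h0 : (x - y).1 = 0
    · rw [h0, polyAbs_zero]; exact (hat_pos _).le
    rw [polyAbs_of_ne h0, hXabs, pow_lt_pow_iff_right₀ (one_lt_q F)] at h1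
    rw [polyAbs_eq_hat h0, hat_le_iff]
    have h2 : 2 * (x - y).1.natDegree ≤ e + ρ := by omega
    have h3 : (2 : ℝ) * (x - y).1.natDegree ≤ e + ρ := by exact_mod_cast h2
    push_cast
    linarith
  · have h1 : polyAbs (x - y).2 < polyAbs (Polynomial.X ^ B : F[X]) := polyAbs_sub_lt hx.2 hy.2
    rw [sqrt_polyAbs hr, ← hat_neg, ← hat_add]
    by_cases h0 : (x - y).2 = 0
    · rw [h0, polyAbs_zero]; exact hat_pos _
    rw [polyAbs_of_ne h0, hXabs, pow_lt_pow_iff_right₀ (one_lt_q F)] at h1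
    rw [polyAbs_eq_hat h0, hat_lt_iff]
    have h2 : 2 * (x - y).2.natDegree + e < ρ := by omega
    have h3 : (2 : ℝ) * (x - y).2.natDegree + e < ρ := by exact_mod_cast h2
    push_cast
    linarith

/-- A non-zero vector is a multiple of a primitive one. -/
theorem exists_primitive_mul {F : Type*} [Field F] {u : F[X] × F[X]} (hu : u ≠ 0) :
    ∃ (g : F[X]) (c : F[X] × F[X]), g ≠ 0 ∧ Primitive c ∧ u = (g * c.1, g * c.2) := by
  classical
  obtain ⟨u₁, u₂⟩ := u
  have hne : ¬(u₁ = 0 ∧ u₂ = 0) := fun h => hu (by rw [h.1, h.2]; rfl)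
  set g := EuclideanDomain.gcd u₁ u₂ with hg
  have hg0 : g ≠ 0 := fun h => hne (EuclideanDomain.gcd_eq_zero_iff.mp h)
  obtain ⟨c₁, hc₁⟩ := EuclideanDomain.gcd_dvd_left u₁ u₂
  obtain ⟨c₂, hc₂⟩ := EuclideanDomain.gcd_dvd_right u₁ u₂
  rw [← hg] at hc₁ hc₂
  have hcop : IsCoprime c₁ c₂ := by
    have h1 := EuclideanDomain.gcd_eq_gcd_ab u₁ u₂
    rw [← hg] at h1
    refine ⟨EuclideanDomain.gcdA u₁ u₂, EuclideanDomain.gcdB u₁ u₂, mul_left_cancel₀ hg0 ?_⟩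
    rw [mul_one]
    conv_rhs => rw [h1]
    linear_combination EuclideanDomain.gcdA u₁ u₂ * (-hc₁) - EuclideanDomain.gcdB u₁ u₂ * hc₂
  -- divide by the leading coefficient of the first entry that does not vanish
  obtain ⟨l, hl0, hl⟩ : ∃ l : F, l ≠ 0 ∧ ((Polynomial.C l * c₁).Monic ∨
      (Polynomial.C l * c₁ = 0 ∧ (Polynomial.C l * c₂).Monic)) := by
    have hmon : ∀ f : F[X], f ≠ 0 → (Polynomial.C f.leadingCoeff⁻¹ * f).Monic := fun f hf => by
      rw [mul_comm]; exact Polynomial.monic_mul_leadingCoeff_inv hf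
    by_cases h : c₁ = 0
    · have h2 : c₂ ≠ 0 := fun h2 => hne ⟨by rw [hc₁, h, mul_zero], by rw [hc₂, h2, mul_zero]⟩
      exact ⟨c₂.leadingCoeff⁻¹, inv_ne_zero (Polynomial.leadingCoeff_ne_zero.mpr h2),
        Or.inr ⟨by rw [h, mul_zero], hmon _ h2⟩⟩
    · exact ⟨c₁.leadingCoeff⁻¹, inv_ne_zero (Polynomial.leadingCoeff_ne_zero.mpr h),
        Or.inl (hmon _ h)⟩
  have hCC : Polynomial.C l⁻¹ * Polynomial.C l = (1 : F[X]) := by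
    rw [← Polynomial.C_mul, inv_mul_cancel₀ hl0, Polynomial.C_1]
  refine ⟨Polynomial.C l⁻¹ * g, (Polynomial.C l * c₁, Polynomial.C l * c₂),
    mul_ne_zero (Polynomial.C_ne_zero.mpr (inv_ne_zero hl0)) hg0, ⟨?_, hl⟩, ?_⟩
  · obtain ⟨x, y, hxy⟩ := hcop
    exact ⟨Polynomial.C l⁻¹ * x, Polynomial.C l⁻¹ * y, by
      linear_combination (x * c₁ + y * c₂) * hCC + hxy⟩
  · refine Prod.ext ?_ ?_
    · change u₁ = _
      linear_combination hc₁ - g * c₁ * hCC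
    · change u₂ = _
      linear_combination hc₂ - g * c₂ * hCC

theorem Primitive.ne_zero {F : Type*} [Field F] {c : F[X] × F[X]} (hc : Primitive c) :
    c.1 ≠ 0 ∨ c.2 ≠ 0 := by
  rcases hc.2 with h | h
  · exact Or.inl h.ne_zero
  · exact Or.inr h.2.ne_zero

theorem Primitive.eq_of_mul_eq {F : Type*} [Field F] {c c' : F[X] × F[X]} (hc : Primitive c)
    (hc' : Primitive c') (h : c.1 * c'.2 = c.2 * c'.1) : c = c' := by
  have h1 : c.1 ∣ c'.1 := hc.1.dvd_of_dvd_mul_left ⟨c'.2, h.symm⟩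
  have h2 : c'.1 ∣ c.1 := hc'.1.dvd_of_dvd_mul_right ⟨c.2, by rw [h, mul_comm]⟩
  rcases hc.2 with hm | ⟨h0, hm⟩
  · have hm' : c'.1.Monic := by
      rcases hc'.2 with hm' | ⟨h0', -⟩
      · exact hm'
      · rw [h0'] at h2
        exact absurd (zero_dvd_iff.mp h2) hm.ne_zero
    have he := Polynomial.eq_of_monic_of_associated hm hm' (associated_of_dvd_dvd h1 h2)
    refine Prod.ext he (mul_left_cancel₀ hm.ne_zero ?_)
    rw [h, ← he, mul_comm]
  · have h0' : c'.1 = 0 := by rw [h0] at h1; exact zero_dvd_iff.mp h1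
    have hm' : c'.2.Monic := hc'.2.elim (fun h => absurd h0' h.ne_zero) And.right
    have hu := hc.1
    have hu' := hc'.1
    rw [h0, isCoprime_zero_left] at hu
    rw [h0', isCoprime_zero_left] at hu'
    exact Prod.ext (h0.trans h0'.symm) (by rw [hm.eq_one_of_isUnit hu, hm'.eq_one_of_isUnit hu'])

/-- A numerator generates the unit ideal modulo `r`. -/
theorem dvd_of_dvd_mul_numerators {r : F[X]} {a : F[X] × F[X]} (ha : a ∈ numerators r) {D : F[X]}
    (h1 : r ∣ D * a.1) (h2 : r ∣ D * a.2) : r ∣ D := by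
  classical
  set e := EuclideanDomain.gcd (EuclideanDomain.gcd a.1 a.2) r with he
  have hunit : IsUnit e := ha.2.2 e
    ((EuclideanDomain.gcd_dvd_left _ _).trans (EuclideanDomain.gcd_dvd_left _ _))
    ((EuclideanDomain.gcd_dvd_left _ _).trans (EuclideanDomain.gcd_dvd_right _ _))
    (EuclideanDomain.gcd_dvd_right _ _)
  have e1 := EuclideanDomain.gcd_eq_gcd_ab (EuclideanDomain.gcd a.1 a.2) r
  have e2 := EuclideanDomain.gcd_eq_gcd_ab a.1 a.2
  rw [← hunit.dvd_mul_right, he, e1]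
  have h3 : r ∣ D * EuclideanDomain.gcd a.1 a.2 := by
    rw [e2, mul_add, ← mul_assoc, ← mul_assoc]
    exact dvd_add (h1.mul_right _) (h2.mul_right _)
  rw [mul_add, ← mul_assoc]
  exact dvd_add (h3.mul_right _) ((dvd_mul_right r _).mul_left _)

/-- Every numerator lies on a line, if `|r|` is so small that the last condition in the definition
of `lines` is automatic. -/
theorem exists_mem_lines_onLine {R₁ R₂ : ℕ} (hR : R₂ ≤ R₁) {r : F[X]} (hr : r ≠ 0)
    (hrR : polyAbs r ≤ hat F R₂) (a : F[X] × F[X]) :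
    ∃ dc ∈ lines R₁ R₂ r, OnLine dc.1 dc.2 a r := by
  classical
  obtain ⟨u, hu0, ⟨k₀, hk₀⟩, hs1, hs2⟩ := exists_shortVector hR hr a
  obtain ⟨g, c, hg0, hc, rfl⟩ := exists_primitive_mul hu0
  set e := EuclideanDomain.gcd g k₀ with he
  have he0 : e ≠ 0 := fun h => hg0 (EuclideanDomain.gcd_eq_zero_iff.mp h).1
  obtain ⟨d₀, hd₀⟩ := EuclideanDomain.gcd_dvd_left g k₀
  obtain ⟨k₁, hk₁⟩ := EuclideanDomain.gcd_dvd_right g k₀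
  rw [← he] at hd₀ hk₁
  have hd₀0 : d₀ ≠ 0 := right_ne_zero_of_mul (hd₀ ▸ hg0)
  set l := d₀.leadingCoeff⁻¹ with hl
  have hl0 : l ≠ 0 := inv_ne_zero (Polynomial.leadingCoeff_ne_zero.mpr hd₀0)
  set d := d₀ * Polynomial.C l with hd
  have hdm : d.Monic := Polynomial.monic_mul_leadingCoeff_inv hd₀0
  set k := k₁ * Polynomial.C l with hk
  have hcop : IsCoprime k d := by
    have h1 := EuclideanDomain.gcd_eq_gcd_ab g k₀
    rw [← he] at h1
    have h2 : IsCoprime k₁ d₀ := by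
      refine ⟨EuclideanDomain.gcdB g k₀, EuclideanDomain.gcdA g k₀, mul_left_cancel₀ he0 ?_⟩
      rw [mul_one]
      conv_rhs => rw [h1]
      linear_combination -EuclideanDomain.gcdA g k₀ * hd₀ - EuclideanDomain.gcdB g k₀ * hk₁
    have hu : IsUnit (Polynomial.C l) := Polynomial.isUnit_C.mpr hl0.isUnit
    exact (isCoprime_mul_unit_right_left hu _ _).mpr
      ((isCoprime_mul_unit_right_right hu _ _).mpr h2)
  have hline : d * (c.1 * a.1 + c.2 * a.2) = k * r := by
    have h1 : d₀ * (c.1 * a.1 + c.2 * a.2) = k₁ * r := by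
      refine mul_left_cancel₀ he0 ?_
      linear_combination hk₀ - (c.1 * a.1 + c.2 * a.2) * hd₀ + r * hk₁
    rw [hd, hk]
    linear_combination Polynomial.C l * h1
  have hdr : d ∣ r := hcop.symm.dvd_of_dvd_mul_left ⟨_, hline.symm⟩
  have hdg : d ∣ g := by
    refine ⟨Polynomial.C l⁻¹ * e, ?_⟩
    have hCC : Polynomial.C l * Polynomial.C l⁻¹ = (1 : F[X]) := by
      rw [← Polynomial.C_mul, mul_inv_cancel₀ hl0, Polynomial.C_1]
    rw [hd]
    linear_combination hd₀ - d₀ * e * hCC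
  have hle : ∀ f, polyAbs (d * f) ≤ polyAbs (g * f) := fun f => by
    rw [polyAbs_mul d, polyAbs_mul g]
    exact mul_le_mul_of_nonneg_right (polyAbs_le_of_dvd hg0 hdg) (polyAbs_nonneg f)
  refine ⟨(d, c), ⟨hdr, hdm, hc, (hle _).trans hs1, (hle _).trans_lt hs2, ?_⟩, k, hcop, hline⟩
  have hR' : hat F (R₂ : ℝ) ≤ hat F R₁ := hat_le_iff.mpr (by exact_mod_cast hR)
  rcases hc.ne_zero with h | h
  · exact le_max_of_le_right (hrR.trans (le_mul_of_one_le_right (hat_pos _).le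
      (one_le_polyAbs (mul_ne_zero hdm.ne_zero h))))
  · exact le_max_of_le_left ((hrR.trans hR').trans (le_mul_of_one_le_right (hat_pos _).le
      (one_le_polyAbs (mul_ne_zero hdm.ne_zero h))))

/-- A numerator lies on at most one line: two short equations are proportional, because `r` divides
their determinant, which is smaller than `r`. -/
theorem onLine_unique {R₁ R₂ : ℕ} {r : F[X]} (hr : r ≠ 0) {a : F[X] × F[X]} (ha : a ∈ numerators r)
    {x y : F[X] × (F[X] × F[X])} (hx : x ∈ lines R₁ R₂ r) (hy : y ∈ lines R₁ R₂ r)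
    (hxa : OnLine x.1 x.2 a r) (hya : OnLine y.1 y.2 a r) : x = y := by
  obtain ⟨d, c⟩ := x
  obtain ⟨d', c'⟩ := y
  obtain ⟨k, hk, ek⟩ := hxa
  obtain ⟨k', hk', ek'⟩ := hya
  obtain ⟨-, hd, hc, hx1, hx2, -⟩ := hx
  obtain ⟨-, hd', hc', hy1, hy2, -⟩ := hy
  simp only at *
  set H := hat F (((R₁ : ℝ) - R₂) / 2) with hH
  have hHpos : 0 < H := hat_pos _
  set s := √(polyAbs r)
  have hs : 0 < s := Real.sqrt_pos.mpr (polyAbs_pos hr)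
  have hss : (H * s) * (H⁻¹ * s) = polyAbs r := by
    rw [mul_mul_mul_comm, mul_inv_cancel₀ hHpos.ne', one_mul,
      Real.mul_self_sqrt (polyAbs_nonneg r)]
  have hdet : d * d' * (c.1 * c'.2 - c.2 * c'.1) = 0 := by
    refine eq_zero_of_dvd_of_polyAbs_lt (g := r) (dvd_of_dvd_mul_numerators ha ?_ ?_) ?_
    · refine ⟨d' * c'.2 * k - d * c.2 * k', ?_⟩
      linear_combination d' * c'.2 * ek - d * c.2 * ek'
    · refine ⟨d * c.1 * k' - d' * c'.1 * k, ?_⟩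
      linear_combination d * c.1 * ek' - d' * c'.1 * ek
    · have : d * d' * (c.1 * c'.2 - c.2 * c'.1) =
          (d * c.1) * (d' * c'.2) - (d' * c'.1) * (d * c.2) := by ring
      rw [this, ← hss]
      refine polyAbs_sub_lt ?_ ?_ <;> rw [polyAbs_mul]
      · exact mul_lt_mul' hx1 hy2 (polyAbs_nonneg _) (mul_pos hHpos hs)
      · exact mul_lt_mul' hy1 hx2 (polyAbs_nonneg _) (mul_pos hHpos hs)
  have hcc : c = c' := hc.eq_of_mul_eq hc' (sub_eq_zero.mp
    ((mul_eq_zero.mp hdet).resolve_left (mul_ne_zero hd.ne_zero hd'.ne_zero)))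
  subst hcc
  have hkd : k * d' = k' * d := by
    refine mul_right_cancel₀ hr ?_
    linear_combination d * ek' - d' * ek
  have h1 : d ∣ d' := hk.symm.dvd_of_dvd_mul_left ⟨k', by rw [hkd, mul_comm]⟩
  have h2 : d' ∣ d := hk'.symm.dvd_of_dvd_mul_left ⟨k, by rw [← hkd, mul_comm]⟩
  rw [Polynomial.eq_of_monic_of_associated hd hd' (associated_of_dvd_dvd h1 h2)]

theorem finite_lines (R₁ R₂ : ℕ) {r : F[X]} (hr : r ≠ 0) : (lines R₁ R₂ r).Finite := by
  have hfin : ∀ B : ℝ, {f : F[X] | polyAbs f ≤ B}.Finite := fun B => by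
    obtain ⟨k, hk⟩ := pow_unbounded_of_one_lt B (one_lt_q F)
    refine (finite_polyAbs_lt (Polynomial.X ^ k)).subset fun f hf => ?_
    change polyAbs f < _
    rw [polyAbs_of_ne (pow_ne_zero k Polynomial.X_ne_zero), Polynomial.natDegree_X_pow]
    exact lt_of_le_of_lt hf hk
  refine ((hfin (polyAbs r)).prod ((hfin (hat F (((R₁ : ℝ) - R₂) / 2) * √(polyAbs r))).prod
    (hfin ((hat F (((R₁ : ℝ) - R₂) / 2))⁻¹ * √(polyAbs r))))).subset fun x hx => ?_
  obtain ⟨h1, h2, -, h3, h4, -⟩ := hx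
  have hle : ∀ f, polyAbs f ≤ polyAbs (x.1 * f) := fun f => by
    rw [polyAbs_mul]
    exact le_mul_of_one_le_left (polyAbs_nonneg f) (one_le_polyAbs h2.ne_zero)
  exact ⟨polyAbs_le_of_dvd hr h1, (hle _).trans h3, ((hle _).trans_lt h4).le⟩

end Lines


/-! ### The asymptotic formula for the main term -/

section MainTerm

variable {F : Type*} [Field F] [Fintype F] {n : ℕ} (p : ℕ) [Fact p.Prime] [Algebra (ZMod p) F]

open scoped Classical in
/-- The numerators on a line. -/
def lineNumer (r d : F[X]) (c : F[X] × F[X]) : Finset (F[X] × F[X]) :=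
  (numer r).filter fun a => OnLine d c a r

/-- The line sum without linear term is the part of a term of the singular series belonging to the
numerators on the line. -/
theorem lineSum_zero (F₁ F₂ : MvPolynomial (Fin n) F[X]) (b : Fin n → F[X]) (N r d : F[X])
    (c : F[X] × F[X]) : (((polyAbs (rN r N) ^ n)⁻¹ : ℝ) : ℂ) * lineSum p F₁ F₂ b N r d c 0 =
      ∑ a ∈ lineNumer r d c, localTerm p F₁ F₂ b N r a := by
  have hset : {a | a ∈ numerators r ∧ OnLine d c a r} = (lineNumer r d c : Set (F[X] × F[X])) := by
    ext a
    simp [lineNumer, mem_numer]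
  rw [lineSum, hset, finsum_mem_coe_finset, Finset.mul_sum]
  refine Finset.sum_congr rfl fun a _ => ?_
  simp [localTerm, psi_zero]

/-- The contribution of the denominator `r` to the main term, without the factor `q ^ (nP)`. -/
def denomTerm (F₁ F₂ : MvPolynomial (Fin n) F[X]) (x₀ : Fin n → KInf F) (L : ℕ)
    (b : Fin n → F[X]) (N : F[X]) (P R₁ R₂ : ℕ) (r : F[X]) : ℂ :=
  (((polyAbs (rN r N) ^ n)⁻¹ : ℝ) : ℂ) * ∑ᶠ dc ∈ lines R₁ R₂ r,
    ∫ θ in box R₁ R₂ r \ weylPart n P r dc.2,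
      lineSum p F₁ F₂ b N r dc.1 dc.2 0 * oscInt p F₁ F₂ x₀ L P (rN r N) θ 0 ∂(haarInfProd F)

theorem denomTerm_eq (F₁ F₂ : MvPolynomial (Fin n) F[X]) (x₀ : Fin n → KInf F) (L : ℕ)
    (b : Fin n → F[X]) (N : F[X]) (P R₁ R₂ : ℕ) {r : F[X]} (hr : r ≠ 0) :
    denomTerm p F₁ F₂ x₀ L b N P R₁ R₂ r = ∑ dc ∈ (finite_lines R₁ R₂ hr).toFinset,
      ∑ a ∈ lineNumer r dc.1 dc.2, localTerm p F₁ F₂ b N r a *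
        ∫ θ in box R₁ R₂ r \ weylPart n P r dc.2,
          oscInt p F₁ F₂ x₀ L P (rN r N) θ 0 ∂(haarInfProd F) := by
  rw [denomTerm, finsum_mem_eq_finite_toFinset_sum _ (finite_lines R₁ R₂ hr), Finset.mul_sum]
  refine Finset.sum_congr rfl fun dc _ => ?_
  rw [integral_const_mul, ← mul_assoc, lineSum_zero, Finset.sum_mul]

/-- Different lines have no numerator in common. -/
theorem pairwiseDisjoint_lineNumer (R₁ R₂ : ℕ) {r : F[X]} (hr : r ≠ 0) :
    Set.PairwiseDisjoint ((finite_lines R₁ R₂ hr).toFinset : Set (F[X] × (F[X] × F[X])))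
      fun dc => lineNumer r dc.1 dc.2 := by
  classical
  intro x hx y hy hxy
  rw [Finset.mem_coe, Set.Finite.mem_toFinset] at hx hy
  refine Finset.disjoint_left.mpr fun a ha hb => hxy ?_
  simp only [lineNumer, Finset.mem_filter, mem_numer] at ha hb
  exact onLine_unique hr ha.1 hx hy ha.2 hb.2

theorem sum_lineNumer_le (R₁ R₂ : ℕ) {r : F[X]} (hr : r ≠ 0) {f : F[X] × F[X] → ℝ}
    (hf : ∀ a, 0 ≤ f a) : ∑ dc ∈ (finite_lines R₁ R₂ hr).toFinset,
      ∑ a ∈ lineNumer r dc.1 dc.2, f a ≤ ∑ a ∈ numer r, f a := by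
  classical
  rw [← Finset.sum_biUnion (pairwiseDisjoint_lineNumer R₁ R₂ hr)]
  refine Finset.sum_le_sum_of_subset_of_nonneg (fun a ha => ?_) fun a _ _ => hf a
  obtain ⟨dc, -, h⟩ := Finset.mem_biUnion.mp ha
  exact (Finset.mem_filter.mp h).1

theorem sum_lineNumer_eq {R₁ R₂ : ℕ} (hR : R₂ ≤ R₁) {r : F[X]} (hr : r ≠ 0)
    (hrR : polyAbs r ≤ hat F R₂) (f : F[X] × F[X] → ℂ) :
    ∑ dc ∈ (finite_lines R₁ R₂ hr).toFinset, ∑ a ∈ lineNumer r dc.1 dc.2, f a =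
      ∑ a ∈ numer r, f a := by
  classical
  rw [← Finset.sum_biUnion (pairwiseDisjoint_lineNumer R₁ R₂ hr)]
  refine Finset.sum_congr (Finset.ext fun a => ?_) fun _ _ => rfl
  rw [Finset.mem_biUnion]
  refine ⟨fun ⟨dc, _, h⟩ => (Finset.mem_filter.mp h).1, fun ha => ?_⟩
  obtain ⟨dc, h1, h2⟩ := exists_mem_lines_onLine hR hr hrR a
  exact ⟨dc, (Set.Finite.mem_toFinset _).mpr h1, Finset.mem_filter.mpr ⟨ha, h2⟩⟩

variable {F₁ : MvPolynomial (Fin n) F[X]} {Φ : FormPair F n}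

theorem norm_denomTerm_le (h : Φ.Represents F₁) {x₀ : Fin n → KInf F} {L P : ℕ} {N : F[X]}
    (hN : N ≠ 0) (b : Fin n → F[X]) (R₁ R₂ : ℕ) {r : F[X]} (hr : r ≠ 0) {C : ℝ}
    (hC : ∀ (s : F[X]) (S : Set (KInf F × KInf F)),
      ‖∫ θ in S, oscInt p F₁ (quadOf Φ.M) x₀ L P s θ 0 ∂(haarInfProd F)‖ ≤ C) :
    ‖denomTerm p F₁ (quadOf Φ.M) x₀ L b N P R₁ R₂ r‖ ≤ C * Φ.majorant p r := by
  have hC0 : 0 ≤ C := (norm_nonneg _).trans (hC 0 ∅)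
  rw [denomTerm_eq _ _ _ _ _ _ _ _ _ _ hr]
  refine (norm_sum_le _ _).trans ((Finset.sum_le_sum fun dc _ => norm_sum_le _ _).trans ?_)
  rw [FormPair.majorant, mul_comm, Finset.sum_mul]
  refine le_trans (Finset.sum_le_sum fun dc _ => Finset.sum_le_sum fun a _ => ?_)
    (sum_lineNumer_le R₁ R₂ hr fun a => mul_nonneg (Φ.supSum_nonneg p r a) hC0)
  rw [norm_mul]
  exact mul_le_mul (norm_localTerm_le p h hr hN b a) (hC _ _) (norm_nonneg _)
    (Φ.supSum_nonneg p r a)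

/-- If all the integrals over `θ` are equal, then the lines may be put together. -/
theorem denomTerm_eq_of_small {F₁ F₂ : MvPolynomial (Fin n) F[X]} {x₀ : Fin n → KInf F} {L P : ℕ}
    {N : F[X]} (b : Fin n → F[X]) {R₁ R₂ : ℕ} (hR : R₂ ≤ R₁) {r : F[X]} (hr : r ≠ 0)
    (hrR : polyAbs r ≤ hat F R₂) {I : ℂ} (hI : ∀ c : F[X] × F[X],
      ∫ θ in box R₁ R₂ r \ weylPart n P r c, oscInt p F₁ F₂ x₀ L P (rN r N) θ 0
        ∂(haarInfProd F) = I) :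
    denomTerm p F₁ F₂ x₀ L b N P R₁ R₂ r = I * seriesTerm p F₁ F₂ b N r := by
  rw [denomTerm_eq _ _ _ _ _ _ _ _ _ _ hr]
  simp only [hI]
  rw [sum_lineNumer_eq hR hr hrR fun a => localTerm p F₁ F₂ b N r a * I, seriesTerm_eq_sum,
    ← Finset.sum_mul, mul_comm]

/-- For small `r` the domain of integration contains the support of the oscillatory integral. -/
theorem mem_box_diff_weylPart {k : ℤ} {A : ℝ} {P R₁ R₂ : ℕ} (hn : 16 < n)
    (hR₁ : |(R₁ : ℝ) - 4 / 3 * P| ≤ A) (hR₂ : |(R₂ : ℝ) - 1 / 3 * P| ≤ A) {r : F[X]} (hr : r ≠ 0)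
    (hrP : (r.natDegree : ℝ) ≤ P / 3 - (|(k : ℝ)| + A)) (c : F[X] × F[X]) {θ : KInf F × KInf F}
    (hθ : (tInf ^ (3 * P : ℤ) * θ.1, tInf ^ (2 * P : ℤ) * θ.2) ∈ squareInf F k) :
    θ ∈ box R₁ R₂ r \ weylPart n P r c := by
  obtain ⟨h1, h2⟩ := hθ
  have hA : 0 ≤ A := (abs_nonneg _).trans hR₁
  have hk := le_abs_self (k : ℝ)
  have hk0 := abs_nonneg (k : ℝ)
  have hρ : (0 : ℝ) ≤ r.natDegree := Nat.cast_nonneg _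
  have hP : (0 : ℝ) ≤ P := Nat.cast_nonneg _
  rw [abs_le] at hR₁ hR₂
  have key : ∀ (m : ℤ) (α : KInf F), tInf ^ m * α ∈ ballInf F k → absInf α < hat F (k - m) :=
    fun m α hα => by
      rw [mem_ballInf, absInf_mul, absInf_tInf_zpow, ← lt_div_iff₀' (zpow_pos (q_pos F) m),
        ← zpow_sub₀ (q_pos F).ne'] at hα
      rw [hat]
      exact_mod_cast hα
  have e1 : absInf θ.1 < hat F (k - 3 * P) := by exact_mod_cast key _ _ h1
  have e2 : absInf θ.2 < hat F (k - 2 * P) := by exact_mod_cast key _ _ h2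
  have hone : hat F (0 : ℝ) = 1 := Real.rpow_zero _
  rw [weylPart, box]
  have hmul : ∀ {α : KInf F} {Y : ℝ}, absInf α < hat F Y →
      polyAbs r * absInf α < hat F (r.natDegree + Y) := fun h => by
    rw [hat_add, ← polyAbs_eq_hat hr]
    exact mul_lt_mul_of_pos_left h (polyAbs_pos hr)
  refine ⟨⟨?_, ?_, ?_, ?_⟩, ?_⟩
  · change absInf θ.1 < 1
    rw [← hone]
    exact e1.trans_le (hat_le_iff.mpr (by linarith))
  · change absInf θ.2 < 1
    rw [← hone]
    exact e2.trans_le (hat_le_iff.mpr (by linarith))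
  · rw [← hat_neg]
    exact (hmul e1).trans_le (hat_le_iff.mpr (by linarith))
  · rw [← hat_neg]
    exact (hmul e2).trans_le (hat_le_iff.mpr (by linarith))
  · rintro ⟨-, h3, -⟩
    rw [polyAbs_eq_hat hr, ← hat_neg, ← hat_add] at h3
    have h4 := hat_lt_iff.mp (h3.trans e1)
    have hn' : (16 : ℝ) < n := by exact_mod_cast hn
    -- the omitted set lies outside the support, because its exponent is at most `8 / 3 < 3`
    have hd : 8 * ((n : ℝ) - 16) / (3 * (n : ℝ) - 24) ≤ 8 / 3 := by
      rw [div_le_div_iff₀ (by linarith) (by norm_num)]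
      linarith
    have := mul_le_mul_of_nonneg_right hd hP
    linarith

theorem finsum_mem_eq_tsum_subtype {F : Type*} [Field F] {S : Set F[X]} {q : F[X] → Prop}
    (hS : S.Finite) (hSq : ∀ r ∈ S, q r) (m : F[X] → ℂ) :
    ∑ᶠ r ∈ S, m r = ∑' r : {r // q r}, S.indicator m r := by
  have h1 : ∑' r : {r // q r}, S.indicator m r = ∑' r, {r | q r}.indicator (S.indicator m) r :=
    tsum_subtype {r | q r} (S.indicator m)
  have h2 : {r | q r}.indicator (S.indicator m) = S.indicator m := by
    have h3 : {r | q r} ∩ S = S := Set.inter_eq_right.mpr hSq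
    rw [Set.indicator_indicator, h3]
  rw [h1, h2, finsum_mem_def, tsum_eq_finsum (hS.subset Set.support_indicator_subset)]

/-- The asymptotic formula. For `|r| ≤ q ^ (P/3 - O(1))` the domains of integration contain the
support of the oscillatory integral, and the lines partition the numerators, so that the
contribution of `r` is the expected one; the other `r` are controlled by the convergence of
`∑ majorant r * |r| ^ (1/40)`. -/
theorem exists_mainTerm_bound (hn : 18 < n) (h : Φ.Represents F₁) {x₀ : Fin n → KInf F} {L : ℕ}
    {k : ℤ} (hk : ∀ γ ∉ squareInf F k, localIntegral p F₁ (quadOf Φ.M) x₀ L γ = 0)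
    (hk' : {γ : KInf F × KInf F | max (absInf γ.1) (absInf γ.2) <
      (gradMin F₁ (quadOf Φ.M) x₀ * (hat F L)⁻¹)⁻¹} = squareInf F k) {N : F[X]} (hN : N ≠ 0)
    (A : ℝ) : ∃ C : ℝ, ∀ (b : Fin n → F[X]) (P R₁ R₂ : ℕ), R₂ ≤ R₁ →
      |(R₁ : ℝ) - 4 / 3 * P| ≤ A → |(R₂ : ℝ) - 1 / 3 * P| ≤ A →
      ‖mainTerm p F₁ (quadOf Φ.M) x₀ L b N P R₁ R₂ - singularIntegral p F₁ (quadOf Φ.M) x₀ L *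
        singularSeries p F₁ (quadOf Φ.M) b N * (hat F (((n : ℝ) - 5) * P) : ℝ)‖ ≤
      C * hat F (((n : ℝ) - 5 - 1 / 120) * P) := by
  set F₂ := quadOf Φ.M with hF₂
  obtain ⟨C₁, hC₁, hI⟩ := exists_norm_setIntegral_oscInt_le p hk
  set σ := singularIntegral p F₁ F₂ x₀ L with hσ
  have hsum := Φ.summable_majorant p hn
  set Z := ∑' r : {r : F[X] // r.Monic}, Φ.majorant p r.1 * polyAbs r.1 ^ (1 / 40 : ℝ) with hZ
  set C₀ : ℝ := |(k : ℝ)| + A with hC₀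
  refine ⟨(C₁ + ‖σ‖) * hat F (C₀ / 40) * Z, fun b P R₁ R₂ hR hR₁ hR₂ => ?_⟩
  have hA : 0 ≤ A := (abs_nonneg _).trans hR₁
  set S : Set F[X] := {r : F[X] | r.Monic ∧ polyAbs r ≤ hat F R₁ * hat F R₂} with hS
  have hSfin : S.Finite := by
    refine (finite_polyAbs_lt (Polynomial.X ^ (R₁ + R₂ + 1) : F[X])).subset fun r hr => ?_
    rw [Set.mem_ofPred_eq, polyAbs_of_ne (pow_ne_zero _ Polynomial.X_ne_zero),
      Polynomial.natDegree_X_pow]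
    refine hr.2.trans_lt ?_
    rw [hat, hat, Real.rpow_natCast, Real.rpow_natCast, ← pow_add]
    exact pow_lt_pow_right₀ (one_lt_q F) (by omega)
  set m := denomTerm p F₁ F₂ x₀ L b N P R₁ R₂ with hm
  set Q : ℝ := (Fintype.card F : ℝ) ^ (-(5 * P : ℤ)) with hQ
  have hQpos : 0 < Q := zpow_pos (q_pos F) _
  have hmain : mainTerm p F₁ F₂ x₀ L b N P R₁ R₂ =
      ((hat F P ^ n : ℝ) : ℂ) * ∑' r : {r : F[X] // r.Monic}, S.indicator m r := by
    rw [← finsum_mem_eq_tsum_subtype hSfin (fun r hr => hr.1)]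
    rfl
  have hhat : hat F (((n : ℝ) - 5) * P) = hat F P ^ n * Q := by
    rw [hQ, hat, hat, ← Real.rpow_natCast, ← Real.rpow_mul (q_pos F).le, ← Real.rpow_intCast,
      ← Real.rpow_add (q_pos F)]
    congr 1
    push_cast; ring
  set s := fun r : {r : F[X] // r.Monic} => seriesTerm p F₁ F₂ b N r.1 with hs
  have hs_sum : Summable s := (summable_norm_seriesTerm p hn h hN b).of_norm
  -- the bound for each term of the difference
  have hterm : ∀ r : {r : F[X] // r.Monic}, ‖S.indicator m r - (Q : ℂ) * σ * s r‖ ≤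
      (C₁ + ‖σ‖) * hat F (C₀ / 40) * hat F (-(P / 120)) * Q *
        (Φ.majorant p r.1 * polyAbs r.1 ^ (1 / 40 : ℝ)) := by
    rintro ⟨r, hrm⟩
    have hr := hrm.ne_zero
    have hmaj := Φ.majorant_nonneg p r
    -- small `r` contribute exactly the expected term, and `|r| ^ (1/40)` is large for the others
    by_cases hsmall : (r.natDegree : ℝ) ≤ P / 3 - C₀
    · have hk0 := abs_nonneg (k : ℝ)
      have hrR : polyAbs r ≤ hat F R₂ := by
        rw [polyAbs_eq_hat hr, hat_le_iff]
        rw [abs_le] at hR₂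
        linarith
      have hrS : r ∈ S := ⟨hrm, hrR.trans (le_mul_of_one_le_left (hat_pos _).le
        (by rw [hat, Real.rpow_natCast]; exact one_le_pow₀ (one_lt_q F).le))⟩
      have hmr : m r = (Q * σ) * seriesTerm p F₁ F₂ b N r :=
        denomTerm_eq_of_small p b hR hr hrR fun c => setIntegral_oscInt_eq p hk hk' P _
          fun θ hθ => mem_box_diff_weylPart (by omega) hR₁ hR₂ hr hsmall c hθ
      simp only [Set.indicator_of_mem hrS, hmr, hs, sub_self, norm_zero]
      have := hat_pos (F := F) (C₀ / 40)
      have := hat_pos (F := F) (-(P / 120))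
      have := Real.rpow_nonneg (polyAbs_nonneg r) (1 / 40 : ℝ)
      positivity
    · have h1 : ‖S.indicator m r‖ ≤ C₁ * Q * Φ.majorant p r := by
        by_cases hrS : r ∈ S
        · rw [Set.indicator_of_mem hrS]
          exact norm_denomTerm_le p h hN b R₁ R₂ hr fun s S => hI P s S
        · rw [Set.indicator_of_notMem hrS, norm_zero]
          positivity
      have h2 : ‖(Q : ℂ) * σ * s ⟨r, hrm⟩‖ ≤ Q * ‖σ‖ * Φ.majorant p r := by
        rw [norm_mul, norm_mul, Complex.norm_real, Real.norm_of_nonneg hQpos.le]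
        exact mul_le_mul_of_nonneg_left (norm_seriesTerm_le p h hr hN b) (by positivity)
      have h3 : 1 ≤ hat F (C₀ / 40) * hat F (-(P / 120)) * polyAbs r ^ (1 / 40 : ℝ) := by
        rw [polyAbs_eq_hat hr]
        have : hat F (r.natDegree : ℝ) ^ (1 / 40 : ℝ) = hat F (r.natDegree * (1 / 40)) := by
          rw [hat, hat, ← Real.rpow_mul (q_pos F).le]
        rw [this, ← hat_add, ← hat_add]
        refine Real.one_le_rpow (one_lt_q F).le ?_
        linarith
      calc ‖S.indicator m r - (Q : ℂ) * σ * s ⟨r, hrm⟩‖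
          ≤ C₁ * Q * Φ.majorant p r + Q * ‖σ‖ * Φ.majorant p r :=
            (norm_sub_le _ _).trans (add_le_add h1 h2)
        _ = (C₁ + ‖σ‖) * Q * Φ.majorant p r * 1 := by ring
        _ ≤ (C₁ + ‖σ‖) * Q * Φ.majorant p r *
            (hat F (C₀ / 40) * hat F (-(P / 120)) * polyAbs r ^ (1 / 40 : ℝ)) :=
            mul_le_mul_of_nonneg_left h3 (by positivity)
        _ = _ := by ring
  have hfinS : (Function.support fun r : {r : F[X] // r.Monic} => S.indicator m r.1).Finite :=
    (hSfin.preimage Subtype.val_injective.injOn).subset fun r hr => by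
      by_contra hrS
      exact hr (Set.indicator_of_notMem (s := S) hrS m)
  have hsumS : Summable fun r : {r : F[X] // r.Monic} => S.indicator m r.1 :=
    summable_of_hasFiniteSupport hfinS
  have hdiff : mainTerm p F₁ F₂ x₀ L b N P R₁ R₂ - σ * singularSeries p F₁ F₂ b N *
      ((hat F (((n : ℝ) - 5) * P) : ℝ) : ℂ) = ((hat F P ^ n : ℝ) : ℂ) *
        ∑' r : {r : F[X] // r.Monic}, (S.indicator m r - (Q : ℂ) * σ * s r) := by
    rw [hsumS.tsum_sub (hs_sum.mul_left _), tsum_mul_left, hmain, hhat]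
    have : singularSeries p F₁ F₂ b N = ∑' r, s r := rfl
    rw [this]
    push_cast
    ring
  have hbound := tsum_of_norm_bounded (hsum.hasSum.mul_left
    ((C₁ + ‖σ‖) * hat F (C₀ / 40) * hat F (-(P / 120)) * Q)) hterm
  rw [hdiff, norm_mul, Complex.norm_real, Real.norm_of_nonneg (pow_pos (hat_pos _) n).le]
  have hfin : hat F (((n : ℝ) - 5 - 1 / 120) * P) = hat F P ^ n * Q * hat F (-(P / 120)) := by
    rw [← hhat, ← hat_add]
    congr 1; ring
  rw [hfin]
  calc hat F (P : ℝ) ^ n * ‖∑' r : {r : F[X] // r.Monic}, (S.indicator m r - (Q : ℂ) * σ * s r)‖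
      ≤ hat F (P : ℝ) ^ n * ((C₁ + ‖σ‖) * hat F (C₀ / 40) * hat F (-(P / 120)) * Q * Z) :=
        mul_le_mul_of_nonneg_left hbound (pow_pos (hat_pos _) n).le
    _ = _ := by ring

end MainTerm


/-! ### Partial sums of the singular series and congruences -/

section Divisors

variable {F : Type*} [Field F] [Fintype F]

theorem finite_monicDivisors (R : F[X]) : {r : F[X] | r.Monic ∧ r ∣ R ∧ R ≠ 0}.Finite := by
  refine (finite_polyAbs_lt (Polynomial.X * R)).subset fun r hr => ?_
  obtain ⟨-, h, hR⟩ := hr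
  rw [Set.mem_ofPred_eq, polyAbs_mul]
  have h1 := polyAbs_le_of_dvd hR h
  have h2 : polyAbs (Polynomial.X : F[X]) = Fintype.card F := by
    rw [polyAbs_of_ne Polynomial.X_ne_zero, Polynomial.natDegree_X, pow_one]
  rw [h2]
  nlinarith [one_lt_q F, polyAbs_pos hR]

/-- The monic divisors of `R`. -/
def monicDivisors (R : F[X]) : Finset F[X] := (finite_monicDivisors R).toFinset

theorem mem_monicDivisors {R r : F[X]} (hR : R ≠ 0) : r ∈ monicDivisors R ↔ r.Monic ∧ r ∣ R := by
  simp [monicDivisors, hR]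

theorem eq_of_smul_numerators_eq {r s : F[X]} (hr : r.Monic) (hs : s.Monic) {a a' : F[X] × F[X]}
    (ha : a ∈ numerators r) (ha' : a' ∈ numerators s) (h1 : s * a.1 = r * a'.1)
    (h2 : s * a.2 = r * a'.2) : r = s ∧ a = a' := by
  have d1 : r ∣ s := dvd_of_dvd_mul_numerators ha ⟨_, h1⟩ ⟨_, h2⟩
  have d2 : s ∣ r := dvd_of_dvd_mul_numerators ha' ⟨_, h1.symm⟩ ⟨_, h2.symm⟩
  have e := Polynomial.eq_of_monic_of_associated hr hs (associated_of_dvd_dvd d1 d2)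
  subst e
  exact ⟨rfl, Prod.ext (mul_left_cancel₀ hr.ne_zero h1) (mul_left_cancel₀ hr.ne_zero h2)⟩

/-- Reduction of a pair of fractions `a / R` to lowest terms. -/
theorem exists_numerators_mul_eq {R : F[X]} (hR : R ≠ 0) {a : F[X] × F[X]}
    (h1 : polyAbs a.1 < polyAbs R) (h2 : polyAbs a.2 < polyAbs R) :
    ∃ r s, ∃ a' ∈ numerators r, r.Monic ∧ r * s = R ∧ a.1 = a'.1 * s ∧ a.2 = a'.2 * s := by
  classical
  set g := EuclideanDomain.gcd (EuclideanDomain.gcd a.1 a.2) R with hg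
  have hg1 : g ∣ a.1 := (EuclideanDomain.gcd_dvd_left _ _).trans (EuclideanDomain.gcd_dvd_left _ _)
  have hg2 : g ∣ a.2 := (EuclideanDomain.gcd_dvd_left _ _).trans (EuclideanDomain.gcd_dvd_right _ _)
  have hgR : g ∣ R := EuclideanDomain.gcd_dvd_right _ _
  obtain ⟨r₀, hr₀⟩ := hgR
  have hg0 : g ≠ 0 := left_ne_zero_of_mul (hr₀ ▸ hR)
  have hr₀0 : r₀ ≠ 0 := right_ne_zero_of_mul (hr₀ ▸ hR)
  set u := r₀.leadingCoeff with hu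
  have hu0 : u ≠ 0 := Polynomial.leadingCoeff_ne_zero.mpr hr₀0
  have hCC : Polynomial.C u⁻¹ * Polynomial.C u = (1 : F[X]) := by
    rw [← Polynomial.C_mul, inv_mul_cancel₀ hu0, Polynomial.C_1]
  set s := g * Polynomial.C u with hs
  have hCu : IsUnit (Polynomial.C u) := Polynomial.isUnit_C.mpr hu0.isUnit
  have hs0 : s ≠ 0 := mul_ne_zero hg0 hCu.ne_zero
  have hsd : ∀ f, g ∣ f → s ∣ f := fun f h => (hCu.mul_right_dvd).mpr h
  obtain ⟨b₁, hb₁⟩ := hsd _ hg1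
  obtain ⟨b₂, hb₂⟩ := hsd _ hg2
  have hrs : r₀ * Polynomial.C u⁻¹ * s = R := by
    rw [hr₀, hs]; linear_combination g * r₀ * hCC
  have hrm : (r₀ * Polynomial.C u⁻¹).Monic := Polynomial.monic_mul_leadingCoeff_inv hr₀0
  have hlt : ∀ f b, f = s * b → polyAbs f < polyAbs R →
      polyAbs b < polyAbs (r₀ * Polynomial.C u⁻¹) :=
    fun f b hf hlt => by
      rw [hf, ← hrs, polyAbs_mul s, polyAbs_mul _ s, mul_comm] at hlt
      exact lt_of_mul_lt_mul_right hlt (polyAbs_nonneg s)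
  refine ⟨r₀ * Polynomial.C u⁻¹, s, (b₁, b₂), ⟨hlt _ _ hb₁ h1, hlt _ _ hb₂ h2,
    fun e he1 he2 he3 => ?_⟩, hrm, hrs, by rw [hb₁, mul_comm], by rw [hb₂, mul_comm]⟩
  have hse : s * e ∣ g := by
    refine EuclideanDomain.dvd_gcd (EuclideanDomain.dvd_gcd ?_ ?_) ?_
    · rw [hb₁]; exact mul_dvd_mul_left s he1
    · rw [hb₂]; exact mul_dvd_mul_left s he2
    · rw [← hrs, mul_comm]; exact mul_dvd_mul_right he3 s
  have hss : s * e ∣ s * 1 := by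
    rw [mul_one]
    exact hse.trans (dvd_mul_right g _)
  exact isUnit_of_dvd_one ((mul_dvd_mul_iff_left hs0).mp hss)

/-- A sum over all pairs of fractions with denominator `R`, sorted by their denominators in lowest
terms. -/
theorem sum_lowPolys_eq_sum_numer {R : F[X]} (hR : R ≠ 0) (G : F[X] × F[X] → ℂ)
    (H : F[X] → F[X] × F[X] → ℂ) (hGH : ∀ r s a, r * s = R → G (a.1 * s, a.2 * s) = H r a) :
    ∑ a ∈ lowPolys R ×ˢ lowPolys R, G a = ∑ r ∈ monicDivisors R, ∑ a ∈ numer r, H r a := by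
  classical
  rw [Finset.sum_sigma']
  symm
  have hdiv : ∀ {r}, r ∈ monicDivisors R → r * (R / r) = R := fun {r} hr => by
    rw [mem_monicDivisors hR] at hr
    exact EuclideanDomain.mul_div_cancel' hr.1.ne_zero hr.2
  refine Finset.sum_bij (fun x _ => (x.2.1 * (R / x.1), x.2.2 * (R / x.1))) ?_ ?_ ?_ ?_
  · rintro ⟨r, a⟩ hx
    simp only [Finset.mem_sigma, mem_numer] at hx
    have h := hdiv hx.1
    have hR0 : R / r ≠ 0 := right_ne_zero_of_mul (h ▸ hR)
    have key : ∀ f, polyAbs f < polyAbs r → polyAbs (f * (R / r)) < polyAbs R := fun f hf => by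
      rw [polyAbs_mul]
      conv_rhs => rw [← h, polyAbs_mul]
      exact mul_lt_mul_of_pos_right hf (polyAbs_pos hR0)
    rw [Finset.mem_product, mem_lowPolys, mem_lowPolys]
    exact ⟨key _ hx.2.1, key _ hx.2.2.1⟩
  · rintro ⟨r, a⟩ hx ⟨s, a'⟩ hy hxy
    simp only [Finset.mem_sigma, mem_numer] at hx hy
    have hr := hdiv hx.1
    have hs := hdiv hy.1
    have hrm := (mem_monicDivisors hR).mp hx.1
    have hsm := (mem_monicDivisors hR).mp hy.1
    simp only [Prod.mk.injEq] at hxy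
    have key : ∀ f f', f * (R / r) = f' * (R / s) → s * f = r * f' := fun f f' h => by
      refine mul_right_cancel₀ hR ?_
      linear_combination r * s * h + s * f * (-hr) + r * f' * hs
    obtain ⟨rfl, rfl⟩ := eq_of_smul_numerators_eq hrm.1 hsm.1 hx.2 hy.2 (key _ _ hxy.1)
      (key _ _ hxy.2)
    rfl
  · rintro a ha
    rw [Finset.mem_product, mem_lowPolys, mem_lowPolys] at ha
    obtain ⟨r, s, a', ha', hrm, hrs, e1, e2⟩ := exists_numerators_mul_eq hR ha.1 ha.2
    have hmem : r ∈ monicDivisors R := (mem_monicDivisors hR).mpr ⟨hrm, s, hrs.symm⟩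
    have hs : R / r = s := mul_left_cancel₀ hrm.ne_zero ((hdiv hmem).trans hrs.symm)
    exact ⟨⟨r, a'⟩, Finset.mem_sigma.mpr ⟨hmem, mem_numer.mpr ha'⟩, by
      simp only [hs]; exact Prod.ext e1.symm e2.symm⟩
  · intro x hx
    exact (hGH _ _ _ (hdiv (Finset.mem_sigma.mp hx).1)).symm

variable (p : ℕ) [Fact p.Prime] [Algebra (ZMod p) F]

theorem sum_lowPolys_psi {R : F[X]} (hR : R ≠ 0) (f : F[X]) [Decidable (R ∣ f)] :
    ∑ a ∈ lowPolys R, psi p (ofPoly (a * f) / ofPoly R) = if R ∣ f then (polyAbs R : ℂ) else 0 := by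
  classical
  have := finite_res hR
  have := Fintype.ofFinite (Res R)
  have h1 : ∑ a ∈ lowPolys R, psi p (ofPoly (a * f) / ofPoly R) =
      ∑ z : Res R, chi p R (z * toRes R f) := by
    refine Finset.sum_bij (fun a _ => toRes R a) (fun _ _ => Finset.mem_univ _)
      (fun a ha b hb h => injOn_toRes R (mem_lowPolys.mp ha) (mem_lowPolys.mp hb) h)
      (fun z _ => ⟨z.out % R, mod_mem_lowPolys hR _, ?_⟩) fun a _ => ?_
    · conv_rhs => rw [← toRes_out z]
      exact (toRes_eq_iff.mpr (dvd_sub_mod R _)).symm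
    · rw [← map_mul, chi_toRes]
  rw [h1, AddChar.sum_mulShift _ (chi_isPrimitive p hR)]
  simp only [toRes_eq_zero]
  split_ifs
  · have : (Fintype.card (Res R) : ℝ) = polyAbs R := by
      rw [← card_res hR, Nat.card_eq_fintype_card]
    exact_mod_cast this
  · exact Nat.cast_zero

end Divisors

section PartialSums

variable {F : Type*} [Field F] [Fintype F] {n : ℕ} (p : ℕ) [Fact p.Prime] [Algebra (ZMod p) F]

open scoped Classical in
/-- The indicator function of the vectors congruent to `b` modulo `N`. -/
def congIndicator {F : Type*} [Field F] {n : ℕ} (b : Fin n → F[X]) (N : F[X])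
    (x : Fin n → F[X]) : ℂ := if ∀ i, N ∣ x i - b i then 1 else 0

open scoped Classical in
/-- The indicator function of the common zeros of `F₁`, `F₂` modulo `R` congruent to `b` modulo
`N`. -/
def solIndicator {F : Type*} [Field F] {n : ℕ} (F₁ F₂ : MvPolynomial (Fin n) F[X])
    (b : Fin n → F[X]) (N R : F[X]) (x : Fin n → F[X]) : ℂ :=
  congIndicator b N x *
    if R ∣ MvPolynomial.eval x F₁ ∧ R ∣ MvPolynomial.eval x F₂ then 1 else 0

/-- The indicator function is expanded into additive characters modulo `R`, which are sorted by their
exact denominators `r`. -/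
theorem solIndicator_eq_sum (F₁ F₂ : MvPolynomial (Fin n) F[X]) (b : Fin n → F[X]) (N : F[X])
    {R : F[X]} (hR : R ≠ 0) (x : Fin n → F[X]) :
    ((polyAbs R : ℂ) ^ 2) * solIndicator F₁ F₂ b N R x = ∑ r ∈ monicDivisors R, ∑ a ∈ numer r,
      congIndicator b N x * phase p F₁ F₂ r a x := by
  classical
  set f₁ := MvPolynomial.eval x F₁
  set f₂ := MvPolynomial.eval x F₂
  have h1 : ∑ a ∈ lowPolys R ×ˢ lowPolys R, psi p (ofPoly (a.1 * f₁ + a.2 * f₂) / ofPoly R) =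
      (polyAbs R : ℂ) ^ 2 * if R ∣ f₁ ∧ R ∣ f₂ then 1 else 0 := by
    simp only [map_add, add_div, psi_add]
    rw [Finset.sum_product]
    simp only [← Finset.mul_sum, ← Finset.sum_mul, sum_lowPolys_psi p hR]
    by_cases c1 : R ∣ f₁ <;> by_cases c2 : R ∣ f₂ <;> simp [c1, c2, sq]
  have h2 := sum_lowPolys_eq_sum_numer hR
    (fun a => psi p (ofPoly (a.1 * f₁ + a.2 * f₂) / ofPoly R)) (fun r a => phase p F₁ F₂ r a x)
    fun r s a hrs => ?_
  · rw [h1] at h2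
    simp only [← Finset.mul_sum]
    rw [solIndicator, mul_left_comm, h2]
  · have hr0 : r ≠ 0 := left_ne_zero_of_mul (hrs ▸ hR)
    have hs0 : s ≠ 0 := right_ne_zero_of_mul (hrs ▸ hR)
    have h1 : (ofPoly r : KInf F) ≠ 0 := ofPoly_eq_zero.not.mpr hr0
    have h2 : (ofPoly s : KInf F) ≠ 0 := ofPoly_eq_zero.not.mpr hs0
    rw [phase, ← hrs]
    congr 1
    rw [div_eq_div_iff (by rw [map_mul]; exact mul_ne_zero h1 h2) h1, ← map_mul, ← map_mul]
    congr 1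
    ring

variable {F₁ : MvPolynomial (Fin n) F[X]} {Φ : FormPair F n}

theorem periodicMod_congIndicator {F : Type*} [Field F] {n : ℕ} (b : Fin n → F[X]) (N : F[X]) :
    PeriodicMod N (congIndicator b N) := fun x y hxy => by
  have : (∀ i, N ∣ x i - b i) ↔ ∀ i, N ∣ y i - b i := forall_congr' fun i => by
    have e : x i - b i = (x i - y i) + (y i - b i) := by ring
    rw [e, dvd_add_right (hxy i)]
  rw [congIndicator, congIndicator]
  by_cases h : ∀ i, N ∣ y i - b i
  · rw [if_pos h, if_pos (this.mpr h)]
  · rw [if_neg h, if_neg (this.not.mpr h)]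

theorem rN_dvd {F : Type*} [Field F] {r N R : F[X]} (hr : r ∣ R) (hN : N ∣ R) : rN r N ∣ R := by
  classical
  have h : rN r N = EuclideanDomain.lcm r N := by
    rw [rN, EuclideanDomain.lcm]
  rw [h]
  exact EuclideanDomain.lcm_dvd hr hN

theorem avg_eq_localTerm (h : Φ.Represents F₁) {r N R : F[X]} (hr : r ∣ R) (hN : N ∣ R)
    (hR : R ≠ 0) (b : Fin n → F[X]) (a : F[X] × F[X]) :
    avg R (fun x => congIndicator b N x *
      phase p F₁ (quadOf Φ.M) r a x) = localTerm p F₁ (quadOf Φ.M) b N r a := by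
  classical
  have hr0 : r ≠ 0 := fun h => hR (zero_dvd_iff.mp (h ▸ hr))
  have hN0 : N ≠ 0 := fun h => hR (zero_dvd_iff.mp (h ▸ hN))
  have hper : PeriodicMod r (phase p F₁ (quadOf Φ.M) r a) := by
    have : phase p F₁ (quadOf Φ.M) r a = Φ.summand p r a 0 := funext fun x => h.phase_eq p r a x
    rw [this]
    exact Φ.summand_periodic p r a 0
  have hper' : PeriodicMod (rN r N) fun x => congIndicator b N x * phase p F₁ (quadOf Φ.M) r a x :=
    ((periodicMod_congIndicator b N).of_dvd (dvd_rN_right hr0)).mul (hper.of_dvd (dvd_rN hr0))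
  have hpos : ((polyAbs (rN r N) ^ n : ℝ) : ℂ) ≠ 0 :=
    Complex.ofReal_ne_zero.mpr (pow_pos (polyAbs_pos (rN_ne_zero hr0 hN0)) n).ne'
  rw [avg_of_dvd hR (rN_dvd hr hN) hper', localTerm, FormPair.finsum_residues_eq hr0 hN0 hper,
    Complex.ofReal_inv, inv_mul_cancel_left₀ hpos]
  exact avg_congr fun x => by
    rw [congIndicator]

/-- The terms of the singular series with `r ∣ R` count solutions of congruences modulo `R`. -/
theorem sum_seriesTerm_eq (h : Φ.Represents F₁) {N R : F[X]} (hN : N ∣ R) (hR : R ≠ 0)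
    (b : Fin n → F[X]) : ∑ r ∈ monicDivisors R, seriesTerm p F₁ (quadOf Φ.M) b N r =
      (polyAbs R : ℂ) ^ 2 * avg R (solIndicator F₁ (quadOf Φ.M) b N R) := by
  classical
  rw [← avg_const_mul hR, avg_congr fun x => solIndicator_eq_sum p F₁ (quadOf Φ.M) b N hR x,
    avg_sum hR]
  refine Finset.sum_congr rfl fun r hr => ?_
  rw [avg_sum hR, seriesTerm_eq_sum]
  refine Finset.sum_congr rfl fun a _ => ?_
  rw [← avg_eq_localTerm p h ((mem_monicDivisors hR).mp hr).2 hN hR]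

end PartialSums


/-! ### Approximation of local zeros -/

section Approximation

open IsDedekindDomain

variable {F : Type*} [Field F]

/-- The prime of `F[t]` generated by a prime element. -/
def primeOf {w : F[X]} (hw : Prime w) : HeightOneSpectrum F[X] where
  asIdeal := Ideal.span {w}
  isPrime := (Ideal.span_singleton_prime hw.ne_zero).mpr hw
  ne_bot := by simpa using hw.ne_zero

theorem valued_algebraMap_le_iff {w : F[X]} (hw : Prime w) (f : F[X]) (K : ℕ) :
    Valued.v ((algebraMap F[X] ((primeOf hw).adicCompletionIntegers (RatFunc F)) f :
      (primeOf hw).adicCompletionIntegers (RatFunc F)) : (primeOf hw).adicCompletion (RatFunc F)) ≤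
      WithZero.exp (-(K : ℤ)) ↔ w ^ K ∣ f := by
  have h1 := HeightOneSpectrum.valuedAdicCompletion_eq_valuation (K := RatFunc F)
    (v := primeOf hw) f
  rw [HeightOneSpectrum.valuation_of_algebraMap] at h1
  refine (iff_of_eq (congrArg (· ≤ WithZero.exp (-(K : ℤ))) h1)).trans ?_
  rw [HeightOneSpectrum.intValuation_le_pow_iff_mem]
  change f ∈ Ideal.span {w} ^ K ↔ _
  rw [Ideal.span_singleton_pow, Ideal.mem_span_singleton]

/-- The ideals of multiples of powers of `w` in `𝒪_w`. Only these four properties of the completion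
are needed: polynomials are dense, and the filtration is decreasing and separated and induces the
`w`-adic one on `F[t]`. -/
theorem exists_ideal_filtration {w : F[X]} (hw : Prime w) :
    ∃ I : ℕ → Ideal ((primeOf hw).adicCompletionIntegers (RatFunc F)), Antitone I ∧
      (∀ K f, algebraMap F[X] _ f ∈ I K ↔ w ^ K ∣ f) ∧
      (∀ K s, ∃ f : F[X], s - algebraMap F[X] _ f ∈ I K) ∧
      ∀ s, s ≠ 0 → ∃ K, s ∉ I K := by
  set v := primeOf hw
  set S := v.adicCompletionIntegers (RatFunc F)
  let I : ℕ → Ideal S := fun K =>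
    { carrier := {s | Valued.v (s : v.adicCompletion (RatFunc F)) ≤ WithZero.exp (-(K : ℤ))}
      zero_mem' := by simp
      add_mem' := fun {a b} ha hb => by
        change Valued.v ((a : v.adicCompletion (RatFunc F)) + b) ≤ _
        exact Valuation.map_add_le _ ha hb
      smul_mem' := fun c a ha => by
        change Valued.v ((c : v.adicCompletion (RatFunc F)) * a) ≤ _
        rw [map_mul]
        exact mul_le_of_le_one_of_le c.2 ha }
  refine ⟨I, fun K K' hK s hs => le_trans (show Valued.v _ ≤ WithZero.exp _ from hs)
    (WithZero.exp_le_exp.mpr (by omega)),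
    fun K f => valued_algebraMap_le_iff hw f K, fun K s => ?_, fun s hs => ?_⟩
  · set A := v.adicCompletion (RatFunc F)
    have hle : Valued.v (algebraMap F[X] A (w ^ K)) ≤ WithZero.exp (-(K : ℤ)) :=
      (valued_algebraMap_le_iff hw (w ^ K) K).mpr dvd_rfl
    have hne : algebraMap F[X] A (w ^ K) ≠ 0 := by
      have : (algebraMap F[X] S (w ^ K) : A) ≠ 0 := by
        simpa using fun h => absurd h hw.ne_zero
      exact this
    -- a point of `F(t)` close to `s`
    have hopen : IsOpen {y : A | Valued.v.restrict (y - s) ≤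
        Valued.v.restrict (algebraMap F[X] A (w ^ K))} :=
      (Valued.isOpen_closedBall (R := A) (by
        simpa [Valuation.restrict_eq_zero_iff] using hne)).preimage
          (continuous_id.sub continuous_const)
    obtain ⟨k, hk⟩ := (HeightOneSpectrum.denseRange_algebraMap (K := RatFunc F) v).exists_mem_open
      hopen ⟨(s : A), by
        rw [Set.mem_ofPred_eq, sub_self, map_zero]; exact zero_le⟩
    have hk' : Valued.v (algebraMap (RatFunc F) A k - s) ≤ WithZero.exp (-(K : ℤ)) :=
      ((Valuation.restrict_le_iff _).mp hk).trans hle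
    have hK1 : WithZero.exp (-(K : ℤ)) ≤ 1 := by
      rw [← WithZero.exp_zero, WithZero.exp_le_exp]; omega
    have hk1 : v.valuation (RatFunc F) k ≤ 1 := by
      rw [← HeightOneSpectrum.valuedAdicCompletion_eq_valuation']
      have e : (algebraMap (RatFunc F) A k) = (algebraMap (RatFunc F) A k - s) + s := by ring
      change Valued.v (algebraMap (RatFunc F) A k) ≤ 1
      rw [e]
      exact Valuation.map_add_le _ (hk'.trans hK1) s.2
    -- a polynomial close to that point
    obtain ⟨f, hf⟩ := v.exists_valuation_sub_lt_of_integer hk1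
      (Units.mk0 (WithZero.exp (-(K : ℤ))) WithZero.exp_ne_zero)
    refine ⟨f, ?_⟩
    change Valued.v ((s : A) - algebraMap F[X] A f) ≤ _
    have hf' : Valued.v (algebraMap (RatFunc F) A (algebraMap F[X] (RatFunc F) f - k)) ≤
        WithZero.exp (-(K : ℤ)) := by
      have := HeightOneSpectrum.valuedAdicCompletion_eq_valuation' (v := v)
        (algebraMap F[X] (RatFunc F) f - k)
      exact (le_of_eq this).trans hf.le
    have e : (s : A) - algebraMap F[X] A f = -((algebraMap (RatFunc F) A k - s) +
        algebraMap (RatFunc F) A (algebraMap F[X] (RatFunc F) f - k)) := by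
      rw [map_sub, ← IsScalarTower.algebraMap_apply]
      ring
    rw [e, Valuation.map_neg]
    exact Valuation.map_add_le _ hk' hf'
  · have h0 : Valued.v (s : v.adicCompletion (RatFunc F)) ≠ 0 := by
      simpa using hs
    refine ⟨(1 - WithZero.log (Valued.v (s : v.adicCompletion (RatFunc F)))).toNat, fun h => ?_⟩
    have h' : Valued.v (s : v.adicCompletion (RatFunc F)) ≤ WithZero.exp _ := h
    rw [← WithZero.log_le_iff_le_exp h0] at h'
    omega

end Approximation


/-! ### Existence of a global zero -/

section GlobalZero

variable {F : Type*} [Field F] {σ : Type*}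

/-- The coefficients of `g` are polynomials of total degree at most `d` in the variables. -/
def CoeffDegreeLE (d : ℕ) (g : (MvPolynomial σ F)[X]) : Prop := ∀ j, (g.coeff j).totalDegree ≤ d

theorem CoeffDegreeLE.sum {ι : Type*} {s : Finset ι} {d : ℕ} {g : ι → (MvPolynomial σ F)[X]}
    (h : ∀ i ∈ s, CoeffDegreeLE d (g i)) : CoeffDegreeLE d (∑ i ∈ s, g i) := fun j => by
  rw [Polynomial.finsetSum_coeff]
  exact MvPolynomial.totalDegree_finsetSum_le fun i hi => h i hi j

theorem CoeffDegreeLE.mul {d e : ℕ} {f g : (MvPolynomial σ F)[X]} (hf : CoeffDegreeLE d f)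
    (hg : CoeffDegreeLE e g) : CoeffDegreeLE (d + e) (f * g) := fun j => by
  rw [Polynomial.coeff_mul]
  exact MvPolynomial.totalDegree_finsetSum_le fun x _ =>
    (MvPolynomial.totalDegree_mul _ _).trans (add_le_add (hf _) (hg _))

theorem CoeffDegreeLE.map_C (f : F[X]) :
    CoeffDegreeLE 0 (f.map (MvPolynomial.C : F →+* MvPolynomial σ F)) := fun j => by
  rw [Polynomial.coeff_map, MvPolynomial.totalDegree_C]

/-- The polynomial `∑_{l < D} X_{i,l} t ^ l` with indeterminate coefficients. -/
def genericPoly (F : Type*) [Field F] {n : ℕ} (D : ℕ) (i : Fin n) :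
    (MvPolynomial (Fin n × Fin D) F)[X] :=
  ∑ l : Fin D, Polynomial.C (MvPolynomial.X (i, l)) * Polynomial.X ^ (l : ℕ)

theorem coeffDegreeLE_genericPoly {n : ℕ} (D : ℕ) (i : Fin n) :
    CoeffDegreeLE 1 (genericPoly F D i) :=
  CoeffDegreeLE.sum fun l _ j => by
    rw [Polynomial.coeff_C_mul_X_pow]
    split_ifs
    · rw [MvPolynomial.totalDegree_X]
    · simp

theorem natDegree_genericPoly_le {n : ℕ} (D : ℕ) (i : Fin n) :
    (genericPoly F D i).natDegree ≤ D :=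
  Polynomial.natDegree_sum_le_of_forall_le _ _ fun l _ =>
    (Polynomial.natDegree_C_mul_X_pow_le _ _).trans l.2.le

/-- The specialization of `genericPoly`. -/
def specialPoly {n D : ℕ} (ξ : Fin n × Fin D → F) (i : Fin n) : F[X] :=
  ∑ l : Fin D, Polynomial.C (ξ (i, l)) * Polynomial.X ^ (l : ℕ)

theorem map_genericPoly {n D : ℕ} (ξ : Fin n × Fin D → F) (i : Fin n) :
    (genericPoly F D i).map (MvPolynomial.eval ξ) = specialPoly ξ i := by
  simp [genericPoly, specialPoly, Polynomial.map_sum]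

theorem map_map_C {ξ : σ → F} (f : F[X]) :
    (f.map (MvPolynomial.C : F →+* MvPolynomial σ F)).map (MvPolynomial.eval ξ) = f := by
  rw [Polynomial.map_map]
  have : (MvPolynomial.eval ξ).comp MvPolynomial.C = RingHom.id F := by
    ext; simp
  rw [this, Polynomial.map_id]

theorem coeff_specialPoly {n D : ℕ} (ξ : Fin n × Fin D → F) (i : Fin n) (l : Fin D) :
    (specialPoly ξ i).coeff l = ξ (i, l) := by
  simp only [specialPoly, Polynomial.finsetSum_coeff, Polynomial.coeff_C_mul_X_pow, Fin.val_inj]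
  simp

/-- A cubic and a quadratic form over `F[t]` in more than `13` variables have a common non-trivial
zero: the coefficients of polynomials of large degree satisfy few equations, so that the theorem of
Chevalley and Warning applies. -/
theorem exists_global_zero [Fintype F] {n : ℕ} (hn : 13 < n) (c : Fin n → Fin n → Fin n → F[X])
    (M : Matrix (Fin n) (Fin n) F[X]) :
    ∃ z : Fin n → F[X], z ≠ 0 ∧ tri c z z z = 0 ∧ z ⬝ᵥ M.mulVec z = 0 := by
  classical
  obtain ⟨p, hchar⟩ := CharP.exists F
  have hp : p ≠ 0 := CharP.char_ne_zero_of_finite F p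
  have hp1 : p ≠ 1 := CharP.char_ne_one F p
  have : Fact p.Prime := ⟨(CharP.char_is_prime_or_zero F p).resolve_right hp⟩
  obtain ⟨H₁, hH₁⟩ := (Set.finite_range fun ijk : Fin n × Fin n × Fin n =>
    (c ijk.1 ijk.2.1 ijk.2.2).natDegree).bddAbove
  obtain ⟨H₂, hH₂⟩ := (Set.finite_range fun ij : Fin n × Fin n => (M ij.1 ij.2).natDegree).bddAbove
  set H := max H₁ H₂
  have hc : ∀ i j k, (c i j k).natDegree ≤ H := fun i j k =>
    (hH₁ ⟨(i, j, k), rfl⟩).trans (le_max_left _ _)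
  have hM : ∀ i j, (M i j).natDegree ≤ H := fun i j => (hH₂ ⟨(i, j), rfl⟩).trans (le_max_right _ _)
  -- there are `n D` unknowns; the degrees of the equations add up to
  -- `3 (H + 3 D + 1) + 2 (H + 2 D + 1) = 13 D + 5 H + 5 < 14 D`
  set D := 5 * H + 6 with hD
  set A := MvPolynomial (Fin n × Fin D) F
  set Z : Fin n → A[X] := genericPoly F D
  set κ : F →+* A := MvPolynomial.C
  set G₁ : A[X] := ∑ i, ∑ j, ∑ k, (c i j k).map κ * Z i * Z j * Z k with hG₁
  set G₂ : A[X] := ∑ i, ∑ j, (M i j).map κ * Z i * Z j with hG₂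
  have hZ := fun i => coeffDegreeLE_genericPoly (F := F) (n := n) D i
  have hZd := fun i => natDegree_genericPoly_le (F := F) (n := n) D i
  have d₁ : CoeffDegreeLE 3 G₁ := CoeffDegreeLE.sum fun i _ => CoeffDegreeLE.sum fun j _ =>
    CoeffDegreeLE.sum fun k _ => (((CoeffDegreeLE.map_C _).mul (hZ i)).mul (hZ j)).mul (hZ k)
  have d₂ : CoeffDegreeLE 2 G₂ := CoeffDegreeLE.sum fun i _ => CoeffDegreeLE.sum fun j _ =>
    ((CoeffDegreeLE.map_C _).mul (hZ i)).mul (hZ j)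
  have n₁ : G₁.natDegree ≤ H + D + D + D :=
    Polynomial.natDegree_sum_le_of_forall_le _ _ fun i _ =>
    Polynomial.natDegree_sum_le_of_forall_le _ _ fun j _ =>
    Polynomial.natDegree_sum_le_of_forall_le _ _ fun k _ =>
      Polynomial.natDegree_mul_le_of_le (Polynomial.natDegree_mul_le_of_le
        (Polynomial.natDegree_mul_le_of_le (Polynomial.natDegree_map_le.trans (hc i j k)) (hZd i))
        (hZd j)) (hZd k)
  have n₂ : G₂.natDegree ≤ H + D + D :=
    Polynomial.natDegree_sum_le_of_forall_le _ _ fun i _ =>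
    Polynomial.natDegree_sum_le_of_forall_le _ _ fun j _ =>
      Polynomial.natDegree_mul_le_of_le
        (Polynomial.natDegree_mul_le_of_le (Polynomial.natDegree_map_le.trans (hM i j)) (hZd i))
        (hZd j)
  have hmm : ∀ (ξ : Fin n × Fin D → F) (g : F[X]), (g.map κ).map (MvPolynomial.eval ξ) = g :=
    fun ξ g => map_map_C g
  have e₁ : ∀ ξ, G₁.map (MvPolynomial.eval ξ) =
      tri c (specialPoly ξ) (specialPoly ξ) (specialPoly ξ) := fun ξ => by
    rw [tri_eq_sum]
    simp only [hG₁, Polynomial.map_sum, Polynomial.map_mul, Z, map_genericPoly, hmm]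
  have e₂ : ∀ ξ, G₂.map (MvPolynomial.eval ξ) =
      specialPoly ξ ⬝ᵥ M.mulVec (specialPoly ξ) := fun ξ => by
    simp only [hG₂, Polynomial.map_sum, Polynomial.map_mul, Z, map_genericPoly, hmm,
      dotProduct, Matrix.mulVec, Finset.mul_sum]
    exact Finset.sum_congr rfl fun i _ => Finset.sum_congr rfl fun j _ => by ring
  set s : Finset (ℕ ⊕ ℕ) := (Finset.range (H + D + D + D + 1)).disjSum
    (Finset.range (H + D + D + 1)) with hs
  set f : ℕ ⊕ ℕ → A := Sum.elim G₁.coeff G₂.coeff with hf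
  have hsum : ∑ i ∈ s, (f i).totalDegree < Fintype.card (Fin n × Fin D) := by
    rw [hs, Finset.sum_disjSum, Fintype.card_prod, Fintype.card_fin, Fintype.card_fin]
    have h1 := Finset.sum_le_card_nsmul (Finset.range (H + D + D + D + 1))
      (fun j => (f (Sum.inl j)).totalDegree) 3 fun j _ => d₁ j
    have h2 := Finset.sum_le_card_nsmul (Finset.range (H + D + D + 1))
      (fun j => (f (Sum.inr j)).totalDegree) 2 fun j _ => d₂ j
    rw [Finset.card_range, smul_eq_mul] at h1 h2
    have h3 : 14 * D ≤ n * D := Nat.mul_le_mul_right D hn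
    omega
  have hdvd := char_dvd_card_solutions_of_sum_lt p hsum
  set T := {ξ : Fin n × Fin D → F // ∀ i ∈ s, MvPolynomial.eval ξ (f i) = 0}
  have hzero : ∀ ξ : Fin n × Fin D → F, (∀ i ∈ s, MvPolynomial.eval ξ (f i) = 0) ↔
      tri c (specialPoly ξ) (specialPoly ξ) (specialPoly ξ) = 0 ∧
        specialPoly ξ ⬝ᵥ M.mulVec (specialPoly ξ) = 0 := fun ξ => by
    rw [← e₁, ← e₂, Polynomial.ext_iff, Polynomial.ext_iff]
    simp only [Polynomial.coeff_map, Polynomial.coeff_zero]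
    refine ⟨fun h => ⟨fun j => ?_, fun j => ?_⟩, fun h i _ => ?_⟩
    · by_cases hj : j < H + D + D + D + 1
      · exact h (Sum.inl j) (by simpa [hs] using hj)
      · rw [Polynomial.coeff_eq_zero_of_natDegree_lt (by omega), map_zero]
    · by_cases hj : j < H + D + D + 1
      · exact h (Sum.inr j) (by simpa [hs] using hj)
      · rw [Polynomial.coeff_eq_zero_of_natDegree_lt (by omega), map_zero]
    · rcases i with j | j
      · exact h.1 j
      · exact h.2 j
  have h0 : specialPoly (0 : Fin n × Fin D → F) = 0 := by
    funext i
    simp [specialPoly]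
  let t₀ : T := ⟨0, (hzero 0).mpr (by
    rw [h0]; exact ⟨by rw [tri_eq_sum]; simp, zero_dotProduct _⟩)⟩
  have hcard : 1 < Fintype.card T := by
    have hpos : 0 < Fintype.card T := Fintype.card_pos_iff.mpr ⟨t₀⟩
    have hp2 : 2 ≤ p := (Fact.out : p.Prime).two_le
    exact lt_of_lt_of_le hp2 (Nat.le_of_dvd hpos hdvd)
  obtain ⟨ξ, hξ⟩ := Fintype.exists_ne_of_one_lt_card hcard t₀
  obtain ⟨g1, g2⟩ := (hzero ξ.1).mp ξ.2
  refine ⟨specialPoly ξ.1, fun hz => hξ (Subtype.ext (funext fun il => ?_)), g1, g2⟩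
  rw [← coeff_specialPoly ξ.1 il.1 il.2, hz]
  simp [t₀]

end GlobalZero

/-! ### Approximate zeros at a prime -/

section Approximable

variable {F : Type*} [Field F] {n : ℕ}

/-- There are points of `F[t]ⁿ` congruent to `b` modulo `w ^ e` at which `F₁` and `F₂` are divisible
by arbitrarily high powers of `w`, while the power of `w` that divides a certain `2 × 2` minor of
the Jacobian matrix is bounded. -/
def Approximable (F₁ F₂ : MvPolynomial (Fin n) F[X]) (b : Fin n → F[X]) (w : F[X]) (e : ℕ) : Prop :=
  ∃ (ij : Fin n × Fin n) (μ : ℕ), ∀ K : ℕ, ∃ y : Fin n → F[X],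
    w ^ K ∣ MvPolynomial.eval y F₁ ∧ w ^ K ∣ MvPolynomial.eval y F₂ ∧ (∀ l, w ^ e ∣ y l - b l) ∧
      ¬w ^ μ ∣ MvPolynomial.eval y (jacobianMinor F₁ F₂ ij)

theorem eval₂_sub_mem {R S : Type*} [CommRing R] [CommRing S] (φ : R →+* S) (I : Ideal S)
    {x y : Fin n → S} (h : ∀ i, x i - y i ∈ I) (G : MvPolynomial (Fin n) R) :
    MvPolynomial.eval₂ φ x G - MvPolynomial.eval₂ φ y G ∈ I := by
  rw [← Ideal.Quotient.eq, MvPolynomial.eval₂_comp_left, MvPolynomial.eval₂_comp_left]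
  congr 1
  funext i
  exact Ideal.Quotient.eq.mpr (h i)

/-- A non-trivial common zero in a domain over `F[t]` is a smooth point. -/
theorem exists_jacobianMinor_ne_zero {F₁ F₂ : MvPolynomial (Fin n) F[X]} (hX : NonsingularPair F₁ F₂)
    {S : Type*} [CommRing S] [IsDomain S] {φ : F[X] →+* S} (hφ : Function.Injective φ)
    {x : Fin n → S} (hx : x ≠ 0) (h1 : MvPolynomial.eval₂ φ x F₁ = 0)
    (h2 : MvPolynomial.eval₂ φ x F₂ = 0) :
    ∃ ij, MvPolynomial.eval₂ φ x (jacobianMinor F₁ F₂ ij) ≠ 0 := by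
  obtain ⟨D, Δ, hΔ, h⟩ := exists_singular_certificate hX
  by_contra! hall
  obtain ⟨i, hi⟩ := Function.ne_iff.mp hx
  have h3 := h φ x i
  have h4 : Ideal.span (Set.range fun s => MvPolynomial.eval₂ φ x (singularEquations F₁ F₂ s)) = ⊥ := by
    rw [Ideal.span_eq_bot]
    rintro _ ⟨s, rfl⟩
    match s with
    | none => exact h1
    | some none => exact h2
    | some (some ij) => exact hall ij
  rw [h4, Ideal.mem_bot] at h3
  exact hi (eq_zero_of_pow_eq_zero ((mul_eq_zero.mp h3).resolve_left
    ((map_ne_zero_iff φ hφ).mpr hΔ)))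

open IsDedekindDomain in
/-- Approximation of a non-trivial local zero by polynomials. -/
theorem approximable_of_ne_zero {F₁ F₂ : MvPolynomial (Fin n) F[X]} (hX : NonsingularPair F₁ F₂)
    {w : F[X]} (hw : Prime w) {e : ℕ} {b : Fin n → F[X]}
    {x : Fin n → (primeOf hw).adicCompletionIntegers (RatFunc F)} (hx : x ≠ 0)
    (h1 : MvPolynomial.aeval x F₁ = 0) (h2 : MvPolynomial.aeval x F₂ = 0)
    (hb : ∀ i, algebraMap F[X] ((primeOf hw).adicCompletionIntegers (RatFunc F)) (w ^ e) ∣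
      x i - algebraMap F[X] _ (b i)) : Approximable F₁ F₂ b w e := by
  obtain ⟨I, hanti, hI1, hI2, hI3⟩ := exists_ideal_filtration hw
  set φ := algebraMap F[X] ((primeOf hw).adicCompletionIntegers (RatFunc F))
  have hφ : Function.Injective φ := FaithfulSMul.algebraMap_injective _ _
  obtain ⟨ij, hij⟩ := exists_jacobianMinor_ne_zero hX hφ hx h1 h2
  obtain ⟨μ, hμ⟩ := hI3 _ hij
  refine ⟨ij, μ, fun K => ?_⟩
  choose y hy using fun l => hI2 (max K (max μ e)) (x l)
  have hev : ∀ G : MvPolynomial (Fin n) F[X], ∀ k ≤ max K (max μ e),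
      MvPolynomial.eval₂ φ x G - φ (MvPolynomial.eval y G) ∈ I k := fun G k hk => by
    have := eval₂_sub_mem φ (I k) (x := x) (y := fun l => φ (y l))
      (fun i => hanti hk (hy i)) G
    have e : MvPolynomial.eval₂ φ (fun l => φ (y l)) G = φ (MvPolynomial.eval y G) := by
      rw [← MvPolynomial.eval₂_id, MvPolynomial.eval₂_comp_left, RingHom.comp_id]
      rfl
    rwa [e] at this
  refine ⟨y, ?_, ?_, fun l => ?_, fun hd => hμ ?_⟩
  · rw [← hI1]
    have := hev F₁ K (le_max_left _ _)
    rwa [show MvPolynomial.eval₂ φ x F₁ = 0 from h1, zero_sub, neg_mem_iff] at this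
  · rw [← hI1]
    have := hev F₂ K (le_max_left _ _)
    rwa [show MvPolynomial.eval₂ φ x F₂ = 0 from h2, zero_sub, neg_mem_iff] at this
  · rw [← hI1, map_sub]
    have h3 : x l - φ (b l) ∈ I e := Ideal.mem_of_dvd _ (hb l) ((hI1 e _).mpr dvd_rfl)
    have h4 := hanti ((le_max_right μ e).trans (le_max_right K _)) (hy l)
    have h5 := sub_mem h3 h4
    rwa [sub_sub_sub_cancel_left] at h5
  · have h3 := hev (jacobianMinor F₁ F₂ ij) μ ((le_max_left _ _).trans (le_max_right _ _))
    have h4 := add_mem h3 ((hI1 μ _).mpr hd)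
    rwa [sub_add_cancel] at h4

/-- When the local zero is the origin, a global zero divisible by `w ^ e` serves as approximation. -/
theorem approximable_of_zero {F₁ F₂ : MvPolynomial (Fin n) F[X]} (hX : NonsingularPair F₁ F₂)
    {w : F[X]} (hw : Prime w) {e : ℕ} {b : Fin n → F[X]} (hb : ∀ i, w ^ e ∣ b i) {z : Fin n → F[X]}
    (hz : z ≠ 0) (hze : ∀ i, w ^ e ∣ z i) (h1 : MvPolynomial.eval z F₁ = 0)
    (h2 : MvPolynomial.eval z F₂ = 0) : Approximable F₁ F₂ b w e := by
  obtain ⟨ij, hij⟩ := exists_jacobianMinor_ne_zero hX (φ := RingHom.id F[X])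
    Function.injective_id hz (by rwa [MvPolynomial.eval₂_id]) (by rwa [MvPolynomial.eval₂_id])
  rw [MvPolynomial.eval₂_id] at hij
  obtain ⟨μ, hμ⟩ : ∃ μ, ¬w ^ μ ∣ MvPolynomial.eval z (jacobianMinor F₁ F₂ ij) := by
    by_contra! hall
    exact (FiniteMultiplicity.of_not_isUnit hw.not_isUnit hij).not_pow_dvd_of_multiplicity_lt
      (Nat.lt_succ_self _) (hall _)
  exact ⟨ij, μ, fun K => ⟨z, h1 ▸ dvd_zero _, h2 ▸ dvd_zero _, fun l => dvd_sub (hze l) (hb l), hμ⟩⟩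

end Approximable


/-! ### Lifting approximate zeros -/

section Hensel

variable {F : Type*} [Field F] {n : ℕ}

/-- The first order Taylor expansion of a polynomial, up to multiples of the square of `d`. -/
theorem sq_dvd_eval_add_sub {R : Type*} [CommRing R] (G : MvPolynomial (Fin n) R) {d : R}
    (x : Fin n → R) {h : Fin n → R} (hd : ∀ l, d ∣ h l) :
    d ^ 2 ∣ MvPolynomial.eval (x + h) G - MvPolynomial.eval x G -
      ∑ l, MvPolynomial.eval x (MvPolynomial.pderiv l G) * h l := by
  induction G using MvPolynomial.induction_on with
  | C a => simp
  | add f g hf hg =>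
    convert dvd_add hf hg using 1
    simp only [map_add, add_mul, Finset.sum_add_distrib]
    ring
  | mul_X f i hf =>
    have h1 : d ∣ MvPolynomial.eval (x + h) f - MvPolynomial.eval x f := by
      have h2 : d ∣ ∑ l, MvPolynomial.eval x (MvPolynomial.pderiv l f) * h l :=
        Finset.dvd_sum fun l _ => (hd l).mul_left _
      have h3 := dvd_add ((Dvd.intro d (sq d).symm).trans hf) h2
      rwa [sub_add_cancel] at h3
    have h4 : ∑ l, MvPolynomial.eval x (MvPolynomial.pderiv l (f * MvPolynomial.X i)) * h l =
        (∑ l, MvPolynomial.eval x (MvPolynomial.pderiv l f) * h l) * x i +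
          MvPolynomial.eval x f * h i := by
      simp only [Derivation.leibniz, smul_eq_mul, map_add, map_mul, MvPolynomial.eval_X,
        MvPolynomial.pderiv_X, add_mul, Finset.sum_add_distrib, Finset.sum_mul]
      rw [add_comm]
      congr 1
      · exact Finset.sum_congr rfl fun l _ => by ring
      · rw [Finset.sum_eq_single i (fun l _ hl => by simp [hl]) (by simp)]
        simp
    rw [h4]
    have h5 := mul_dvd_mul h1 (hd i)
    rw [← sq] at h5
    simp only [map_mul, MvPolynomial.eval_X, Pi.add_apply]
    convert dvd_add (hf.mul_right (x i)) h5 using 1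
    ring

theorem dvd_eval_sub {R : Type*} [CommRing R] (G : MvPolynomial (Fin n) R) {d : R}
    {x y : Fin n → R} (h : ∀ i, d ∣ x i - y i) :
    d ∣ MvPolynomial.eval x G - MvPolynomial.eval y G := by
  have := eval₂_sub_mem (RingHom.id R) (Ideal.span {d})
    (fun i => Ideal.mem_span_singleton.mpr (h i)) G
  rwa [MvPolynomial.eval₂_id, MvPolynomial.eval₂_id, Ideal.mem_span_singleton] at this

variable {F₁ F₂ : MvPolynomial (Fin n) F[X]} {w : F[X]} {ij : Fin n × Fin n}

/-- A Newton step in the two variables of a minor of the Jacobian matrix. -/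
theorem exists_newton_step (hw : Prime w) {ν k : ℕ} (hk : 2 * ν + 1 ≤ k) {x : Fin n → F[X]}
    (h1 : w ^ k ∣ MvPolynomial.eval x F₁) (h2 : w ^ k ∣ MvPolynomial.eval x F₂)
    (hm : w ^ ν ∣ MvPolynomial.eval x (jacobianMinor F₁ F₂ ij))
    (hm' : ¬w ^ (ν + 1) ∣ MvPolynomial.eval x (jacobianMinor F₁ F₂ ij)) :
    ∃ x' : Fin n → F[X], (∀ l, l ≠ ij.1 → l ≠ ij.2 → x' l = x l) ∧
      (∀ l, w ^ (k - ν) ∣ x' l - x l) ∧ w ^ (k + 1) ∣ MvPolynomial.eval x' F₁ ∧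
        w ^ (k + 1) ∣ MvPolynomial.eval x' F₂ := by
  classical
  obtain ⟨i, j⟩ := ij
  obtain ⟨f₁, hf₁⟩ := h1
  obtain ⟨f₂, hf₂⟩ := h2
  obtain ⟨u, hu⟩ := hm
  have hwu : ¬w ∣ u := fun ⟨s, hs⟩ => hm' ⟨s, by rw [hu, hs]; ring⟩
  have hij : i ≠ j := fun h => hm' (by
    subst h
    simp [jacobianMinor])
  obtain ⟨s, t, hst⟩ : IsCoprime u w :=
    ((Irreducible.coprime_iff_not_dvd hw.irreducible).mpr hwu).symm
  set g := fun (l : Fin n) (G : MvPolynomial (Fin n) F[X]) =>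
    MvPolynomial.eval x (MvPolynomial.pderiv l G) with hg
  have hminor : g i F₁ * g j F₂ - g j F₁ * g i F₂ = w ^ ν * u := by
    rw [← hu]
    simp [jacobianMinor, hg]
  -- Cramer's rule modulo `w`, with `s` the inverse of `u`
  set h : Fin n → F[X] := Pi.single i (w ^ (k - ν) * (-s * (g j F₂ * f₁ - g j F₁ * f₂))) +
    Pi.single j (w ^ (k - ν) * (-s * (g i F₁ * f₂ - g i F₂ * f₁))) with hh
  have hhi : h i = w ^ (k - ν) * (-s * (g j F₂ * f₁ - g j F₁ * f₂)) := by simp [hh, hij]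
  have hhj : h j = w ^ (k - ν) * (-s * (g i F₁ * f₂ - g i F₂ * f₁)) := by simp [hh, hij.symm]
  have hhl : ∀ l, l ≠ i → l ≠ j → h l = 0 := fun l hi hj => by simp [hh, hi, hj]
  have hdvd : ∀ l, w ^ (k - ν) ∣ h l := fun l => by
    by_cases hi : l = i
    · rw [hi, hhi]; exact dvd_mul_right _ _
    by_cases hj : l = j
    · rw [hj, hhj]; exact dvd_mul_right _ _
    rw [hhl l hi hj]; exact dvd_zero _
  have hsum : ∀ G, ∑ l, g l G * h l = g i G * h i + g j G * h j := fun G => by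
    rw [← Finset.sum_pair hij (f := fun l => g l G * h l)]
    symm
    refine Finset.sum_subset (Finset.subset_univ _) fun l _ hl => ?_
    simp only [Finset.mem_insert, Finset.mem_singleton, not_or] at hl
    rw [hhl l hl.1 hl.2, mul_zero]
  have hpow : w ^ (k - ν) * w ^ ν = w ^ k := by rw [← pow_add]; congr 1; omega
  have hsq : w ^ (k + 1) ∣ (w ^ (k - ν)) ^ 2 := by
    rw [← pow_mul]; exact pow_dvd_pow w (by omega)
  have hstep : ∀ G f, MvPolynomial.eval x G = w ^ k * f →
      g i G * h i + g j G * h j = -(w ^ k * (u * s) * f) →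
        w ^ (k + 1) ∣ MvPolynomial.eval (x + h) G := by
    intro G f hf hlin
    have h1 := hsq.trans (sq_dvd_eval_add_sub G x hdvd)
    rw [show ∑ l, MvPolynomial.eval x (MvPolynomial.pderiv l G) * h l = _ from hsum G, hlin, hf] at h1
    have h2 : w ^ (k + 1) ∣ w ^ k * f - w ^ k * (u * s) * f :=
      ⟨t * f, by linear_combination (-(w ^ k) * f) * hst⟩
    convert dvd_add h1 h2 using 1
    ring
  refine ⟨x + h, fun l hi hj => by rw [Pi.add_apply, hhl l hi hj, add_zero], fun l => ?_,
    hstep F₁ f₁ hf₁ ?_, hstep F₂ f₂ hf₂ ?_⟩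
  · rw [Pi.add_apply, add_sub_cancel_left]; exact hdvd l
  · rw [hhi, hhj, ← hpow]
    linear_combination (-(w ^ (k - ν)) * s * f₁) * hminor
  · rw [hhi, hhj, ← hpow]
    linear_combination (-(w ^ (k - ν)) * s * f₂) * hminor

/-- Hensel's lemma: an approximate zero is close to better ones that differ from it only in the two
variables of a minor of the Jacobian matrix. -/
theorem exists_lift (hw : Prime w) {ν k : ℕ} (hk : 2 * ν + 1 ≤ k) {x : Fin n → F[X]}
    (h1 : w ^ k ∣ MvPolynomial.eval x F₁) (h2 : w ^ k ∣ MvPolynomial.eval x F₂)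
    (hm : w ^ ν ∣ MvPolynomial.eval x (jacobianMinor F₁ F₂ ij))
    (hm' : ¬w ^ (ν + 1) ∣ MvPolynomial.eval x (jacobianMinor F₁ F₂ ij)) (m : ℕ) :
    ∃ x' : Fin n → F[X], (∀ l, l ≠ ij.1 → l ≠ ij.2 → x' l = x l) ∧
      (∀ l, w ^ (k - ν) ∣ x' l - x l) ∧ w ^ m ∣ MvPolynomial.eval x' F₁ ∧
        w ^ m ∣ MvPolynomial.eval x' F₂ := by
  induction m with
  | zero => exact ⟨x, fun _ _ _ => rfl, fun l => by simp, by simp, by simp⟩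
  | succ m ih =>
    by_cases hmk : m + 1 ≤ k
    · exact ⟨x, fun _ _ _ => rfl, fun l => by simp, (pow_dvd_pow w hmk).trans h1,
        (pow_dvd_pow w hmk).trans h2⟩
    obtain ⟨y, hy1, hy2, hy3, hy4⟩ := ih
    have hdiff := dvd_eval_sub (jacobianMinor F₁ F₂ ij)
      (fun l => (pow_dvd_pow w (show ν + 1 ≤ k - ν by omega)).trans (hy2 l))
    have hym : w ^ ν ∣ MvPolynomial.eval y (jacobianMinor F₁ F₂ ij) :=
      (dvd_iff_dvd_of_dvd_sub ((pow_dvd_pow w (Nat.le_succ ν)).trans hdiff)).mpr hm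
    have hym' : ¬w ^ (ν + 1) ∣ MvPolynomial.eval y (jacobianMinor F₁ F₂ ij) :=
      (dvd_iff_dvd_of_dvd_sub hdiff).not.mpr hm'
    obtain ⟨z, hz1, hz2, hz3, hz4⟩ := exists_newton_step hw (k := m) (by omega) hy3 hy4 hym hym'
    refine ⟨z, fun l hi hj => (hz1 l hi hj).trans (hy1 l hi hj), fun l => ?_, hz3, hz4⟩
    have h5 := dvd_add ((pow_dvd_pow w (show k - ν ≤ m - ν by omega)).trans (hz2 l)) (hy2 l)
    rwa [sub_add_sub_cancel] at h5

end Hensel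

section LocalDensity

variable {F : Type*} [Field F] [Fintype F] {n : ℕ}

/-- The average of an indicator function is real, and bounded from below by any set of incongruent
points at which it is `1`. -/
theorem exists_avg_eq_ofReal {R : F[X]} (hR : R ≠ 0) {g : (Fin n → F[X]) → ℂ} (hg : PeriodicMod R g)
    (h01 : ∀ x, g x = 0 ∨ g x = 1) {ι : Type*} [Fintype ι] (X : ι → Fin n → F[X])
    (hX : ∀ a, g (X a) = 1) (hinj : ∀ a a', (∀ l, R ∣ X a l - X a' l) → a = a') :
    ∃ d : ℝ, avg R g = d ∧ (polyAbs R ^ n)⁻¹ * Fintype.card ι ≤ d := by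
  classical
  have := finite_res hR
  have := Fintype.ofFinite (Res R)
  obtain ⟨G, hG⟩ := hg.exists_lift
  set s : Finset (Fin n → Res R) := Finset.univ.filter fun z => G z = 1 with hs
  have hG01 : ∀ z, G z = if z ∈ s then 1 else 0 := fun z => by
    have hz : G z = g fun i => (z i).out := by
      rw [hG]; simp only [toRes_out]
    by_cases h : z ∈ s
    · rw [if_pos h]; exact (Finset.mem_filter.mp h).2
    · rw [if_neg h, hz]
      refine (h01 _).resolve_right fun h1 => h (Finset.mem_filter.mpr ⟨Finset.mem_univ _, ?_⟩)
      rw [hz, h1]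
  refine ⟨(polyAbs R ^ n)⁻¹ * s.card, ?_, ?_⟩
  · rw [avg_eq_sum g G hG, Finset.sum_congr rfl fun z _ => hG01 z]
    simp
  · have hcard : Fintype.card ι ≤ s.card := by
      rw [← Finset.card_univ]
      refine Finset.card_le_card_of_injOn (fun a i => toRes R (X a i)) (fun a _ => ?_)
        fun a _ a' _ h => hinj a a' fun l => toRes_eq_iff.mp (congrFun h l)
      simp only [hs, Finset.coe_filter, Finset.mem_univ, true_and, Set.mem_ofPred_eq]
      rw [← hG, hX]
    have := polyAbs_nonneg R
    gcongr

theorem solIndicator_eq_zero_or_one {F : Type*} [Field F] {n : ℕ} (F₁ F₂ : MvPolynomial (Fin n) F[X])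
    (b : Fin n → F[X]) (N R : F[X]) (x : Fin n → F[X]) :
    solIndicator F₁ F₂ b N R x = 0 ∨ solIndicator F₁ F₂ b N R x = 1 := by
  classical
  rw [solIndicator, congIndicator]
  split_ifs <;> simp

theorem solIndicator_eq_one {F : Type*} [Field F] {n : ℕ} {F₁ F₂ : MvPolynomial (Fin n) F[X]}
    {b : Fin n → F[X]} {N R : F[X]} {x : Fin n → F[X]} : solIndicator F₁ F₂ b N R x = 1 ↔
      (∀ i, N ∣ x i - b i) ∧ R ∣ MvPolynomial.eval x F₁ ∧ R ∣ MvPolynomial.eval x F₂ := by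
  classical
  rw [solIndicator, congIndicator]
  split_ifs with h1 h2 <;> simp_all

theorem periodicMod_solIndicator {F : Type*} [Field F] {n : ℕ} (F₁ F₂ : MvPolynomial (Fin n) F[X])
    (b : Fin n → F[X]) {N R : F[X]} (hN : N ∣ R) :
    PeriodicMod R (solIndicator F₁ F₂ b N R) := by
  have key : ∀ x y : Fin n → F[X], (∀ i, R ∣ x i - y i) → solIndicator F₁ F₂ b N R y = 1 →
      solIndicator F₁ F₂ b N R x = 1 := fun x y h hy => by
    rw [solIndicator_eq_one] at hy ⊢
    refine ⟨fun i => ?_, (dvd_iff_dvd_of_dvd_sub (dvd_eval_sub F₁ h)).mpr hy.2.1,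
      (dvd_iff_dvd_of_dvd_sub (dvd_eval_sub F₂ h)).mpr hy.2.2⟩
    have := dvd_add (hN.trans (h i)) (hy.1 i)
    rwa [sub_add_sub_cancel] at this
  intro x y h
  rcases solIndicator_eq_zero_or_one F₁ F₂ b N R y with hy | hy
  · rcases solIndicator_eq_zero_or_one F₁ F₂ b N R x with hx | hx
    · rw [hx, hy]
    · rw [key y x (fun i => by rw [← neg_sub, dvd_neg]; exact h i) hx] at hy
      exact absurd hy one_ne_zero
  · rw [hy, key x y h hy]

/-- The density at a prime with approximate zeros is bounded from below: in Hensel's lemma the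
variables that do not occur in the minor are free. -/
theorem Approximable.exists_density_bound {F₁ F₂ : MvPolynomial (Fin n) F[X]} {b : Fin n → F[X]}
    {w : F[X]} (hw : Prime w) {e : ℕ} (h : Approximable F₁ F₂ b w e) :
    ∃ (c : ℝ) (κ : ℕ), 0 < c ∧ e ≤ κ ∧ ∀ m, κ ≤ m → ∃ d : ℝ, c ≤ d ∧
      (polyAbs (w ^ m) : ℂ) ^ 2 * avg (w ^ m) (solIndicator F₁ F₂ b (w ^ e) (w ^ m)) = d := by
  classical
  obtain ⟨ij, μ, h⟩ := h
  -- high enough for Hensel's lemma, and for the lifts to remain congruent to `b` modulo `w ^ e`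
  set κ := 2 * μ + 1 + e with hκ
  obtain ⟨y, hy1, hy2, hyb, hym⟩ := h κ
  obtain ⟨ν, hν, hν'⟩ : ∃ ν, w ^ ν ∣ MvPolynomial.eval y (jacobianMinor F₁ F₂ ij) ∧
      ¬w ^ (ν + 1) ∣ MvPolynomial.eval y (jacobianMinor F₁ F₂ ij) := by
    by_contra! hall
    have : ∀ ν, w ^ ν ∣ MvPolynomial.eval y (jacobianMinor F₁ F₂ ij) := fun ν => by
      induction ν with
      | zero => simp
      | succ ν ih => exact hall ν ih
    exact hym (this μ)
  have hνμ : ν < μ := by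
    by_contra! hle
    exact hym ((pow_dvd_pow w hle).trans hν)
  have hij : ij.1 ≠ ij.2 := fun h => hν' (by simp [jacobianMinor, h])
  set W := polyAbs w with hW
  have hWpos : 0 < W := polyAbs_pos hw.ne_zero
  obtain ⟨n', rfl⟩ : ∃ n', n = n' + 2 := by
    have h1 : ({ij.1, ij.2} : Finset (Fin n)).card ≤ n := by
      simpa using Finset.card_le_univ ({ij.1, ij.2} : Finset (Fin n))
    rw [Finset.card_pair hij] at h1
    exact ⟨n - 2, by omega⟩
  refine ⟨(W ^ (κ * n'))⁻¹, κ, by positivity, by omega, fun m hm => ?_⟩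
  obtain ⟨m', rfl⟩ := Nat.exists_eq_add_of_le hm
  set T : Finset (Fin (n' + 2)) := ({ij.1, ij.2} : Finset (Fin (n' + 2)))ᶜ with hT
  have hTmem : ∀ l, l ∈ T ↔ l ≠ ij.1 ∧ l ≠ ij.2 := fun l => by simp [hT]
  have hTcard : T.card = n' := by
    rw [hT, Finset.card_compl, Finset.card_pair hij, Fintype.card_fin]; omega
  -- the values of the free variables are prescribed modulo `w ^ (κ + m')`
  let base : (T → lowPolys (w ^ m')) → Fin (n' + 2) → F[X] := fun v l =>
    y l + w ^ κ * if hl : l ∈ T then (v ⟨l, hl⟩ : F[X]) else 0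
  have hbase : ∀ v l, w ^ κ ∣ base v l - y l := fun v l =>
    ⟨_, by simp only [base]; rw [add_sub_cancel_left]⟩
  have hlift : ∀ v, ∃ x : Fin (n' + 2) → F[X], (∀ l, l ≠ ij.1 → l ≠ ij.2 → x l = base v l) ∧
      (∀ l, w ^ (κ - ν) ∣ x l - base v l) ∧ w ^ (κ + m') ∣ MvPolynomial.eval x F₁ ∧
        w ^ (κ + m') ∣ MvPolynomial.eval x F₂ := fun v => by
    have hmin := dvd_eval_sub (jacobianMinor F₁ F₂ ij)
      fun l => (pow_dvd_pow w (show ν + 1 ≤ κ by omega)).trans (hbase v l)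
    exact exists_lift hw (by omega)
      ((dvd_iff_dvd_of_dvd_sub (dvd_eval_sub F₁ (hbase v))).mpr hy1)
      ((dvd_iff_dvd_of_dvd_sub (dvd_eval_sub F₂ (hbase v))).mpr hy2)
      ((dvd_iff_dvd_of_dvd_sub ((pow_dvd_pow w (Nat.le_succ ν)).trans hmin)).mpr hν)
      ((dvd_iff_dvd_of_dvd_sub hmin).not.mpr hν') _
  choose X hX1 hX2 hX3 hX4 using hlift
  have hw0 : w ^ (κ + m') ≠ 0 := pow_ne_zero _ hw.ne_zero
  have hone : ∀ v, solIndicator F₁ F₂ b (w ^ e) (w ^ (κ + m')) (X v) = 1 := fun v => by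
    refine solIndicator_eq_one.mpr ⟨fun l => ?_, hX3 v, hX4 v⟩
    have h1 := (pow_dvd_pow w (show e ≤ κ - ν by omega)).trans (hX2 v l)
    have h2 := (pow_dvd_pow w (show e ≤ κ by omega)).trans (hbase v l)
    have h3 := dvd_add (dvd_add h1 h2) (hyb l)
    rwa [sub_add_sub_cancel, sub_add_sub_cancel] at h3
  have hinj : ∀ v v', (∀ l, w ^ (κ + m') ∣ X v l - X v' l) → v = v' := fun v v' hvv => by
    funext l
    have hl := (hTmem l.1).mp l.2
    have h1 := hvv l.1
    rw [hX1 v _ hl.1 hl.2, hX1 v' _ hl.1 hl.2] at h1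
    simp only [base, dif_pos l.2, add_sub_add_left_eq_sub, ← mul_sub, pow_add] at h1
    have h2 := (mul_dvd_mul_iff_left (pow_ne_zero κ hw.ne_zero)).mp h1
    exact Subtype.ext (sub_eq_zero.mp (eq_zero_of_dvd_of_polyAbs_lt h2
      (polyAbs_sub_lt (mem_lowPolys.mp (v l).2) (mem_lowPolys.mp (v' l).2))))
  obtain ⟨d, hd1, hd2⟩ := exists_avg_eq_ofReal hw0
    (periodicMod_solIndicator F₁ F₂ b (pow_dvd_pow w (show e ≤ κ + m' by omega)))
    (solIndicator_eq_zero_or_one F₁ F₂ b _ _) X hone hinj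
  refine ⟨polyAbs (w ^ (κ + m')) ^ 2 * d, ?_, by rw [hd1]; push_cast; ring⟩
  have hcard : (Fintype.card (T → lowPolys (w ^ m')) : ℝ) = W ^ (m' * n') := by
    rw [Fintype.card_fun, Fintype.card_coe, Fintype.card_coe, hTcard, Nat.cast_pow,
      card_lowPolys (pow_ne_zero _ hw.ne_zero), polyAbs_pow, ← pow_mul]
  rw [hcard, polyAbs_pow, ← hW] at hd2
  rw [polyAbs_pow, ← hW]
  refine le_trans (le_of_eq ?_) (mul_le_mul_of_nonneg_left hd2 (by positivity))
  rw [inv_eq_iff_eq_inv, mul_inv, mul_inv, inv_inv]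
  field_simp
  ring

end LocalDensity


/-! ### Products over primes -/

section Primes

variable {F : Type*} [Field F] [Fintype F]

theorem finite_monicPrimes (m : ℕ) :
    {w : F[X] | w.Monic ∧ Prime w ∧ w.natDegree ≤ m}.Finite := by
  refine (finite_polyAbs_lt (Polynomial.X ^ (m + 1))).subset fun w hw => ?_
  rw [Set.mem_ofPred_eq, polyAbs_of_ne (pow_ne_zero _ Polynomial.X_ne_zero),
    polyAbs_of_ne hw.1.ne_zero, Polynomial.natDegree_X_pow]
  exact pow_lt_pow_right₀ (one_lt_q F) (by have := hw.2.2; omega)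

/-- The monic primes of degree at most `m`. -/
def monicPrimes (F : Type*) [Field F] [Fintype F] (m : ℕ) : Finset F[X] :=
  (finite_monicPrimes (F := F) m).toFinset

theorem mem_monicPrimes {m : ℕ} {w : F[X]} :
    w ∈ monicPrimes F m ↔ w.Monic ∧ Prime w ∧ w.natDegree ≤ m := by
  simp [monicPrimes]

theorem monicPrimes_mono {m m' : ℕ} (h : m ≤ m') : monicPrimes F m ⊆ monicPrimes F m' :=
  fun w hw => by
  rw [mem_monicPrimes] at *
  exact ⟨hw.1, hw.2.1, hw.2.2.trans h⟩

theorem isCoprime_of_monic_prime {F : Type*} [Field F] {w w' : F[X]} (hm : w.Monic) (hw : Prime w)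
    (hm' : w'.Monic) (hw' : Prime w') (hne : w ≠ w') : IsCoprime w w' :=
  (Irreducible.coprime_iff_not_dvd hw.irreducible).mpr fun h =>
    hne (Polynomial.eq_of_monic_of_associated hm hm'
      ((hw.dvd_prime_iff_associated hw').mp h))

/-- Prime factorization. -/
theorem exists_associated_prod {N : F[X]} (hN : N ≠ 0) : ∃ e : F[X] → ℕ,
    (∀ w, N.natDegree < w.natDegree → e w = 0) ∧
      ∀ m, N.natDegree ≤ m → Associated N (∏ w ∈ monicPrimes F m, w ^ e w) := by
  classical
  induction N using UniqueFactorizationMonoid.induction_on_prime with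
  | h₁ => exact absurd rfl hN
  | h₂ x hx => exact ⟨fun _ => 0, fun _ _ => rfl, fun m _ => by
      simpa using associated_one_iff_isUnit.mpr hx⟩
  | h₃ a q ha hq ih =>
    obtain ⟨e, he, hprod⟩ := ih ha
    set w₀ := q * Polynomial.C q.leadingCoeff⁻¹ with hw₀
    have hm₀ : w₀.Monic := Polynomial.monic_mul_leadingCoeff_inv hq.ne_zero
    have hu : IsUnit (Polynomial.C q.leadingCoeff⁻¹) :=
      Polynomial.isUnit_C.mpr (inv_ne_zero (Polynomial.leadingCoeff_ne_zero.mpr hq.ne_zero)).isUnit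
    have hass : Associated q w₀ := associated_mul_unit_right q _ hu
    have hp₀ : Prime w₀ := hass.prime hq
    have hdeg : w₀.natDegree = q.natDegree :=
      Polynomial.natDegree_eq_of_degree_eq (Polynomial.degree_eq_degree_of_associated hass.symm)
    have hmul : (q * a).natDegree = q.natDegree + a.natDegree :=
      Polynomial.natDegree_mul hq.ne_zero ha
    refine ⟨fun w => e w + if w = w₀ then 1 else 0, fun w hw => ?_, fun m hm => ?_⟩
    · have h1 : w ≠ w₀ := fun h => by rw [h] at hw; omega
      change e w + (if w = w₀ then 1 else 0) = 0
      rw [he w (by omega), if_neg h1]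
    · have h1 : w₀ ∈ monicPrimes F m := mem_monicPrimes.mpr ⟨hm₀, hp₀, by omega⟩
      simp only [pow_add, Finset.prod_mul_distrib]
      have h2 : ∏ w ∈ monicPrimes F m, w ^ (if w = w₀ then 1 else 0) = w₀ := by
        rw [Finset.prod_eq_single w₀ (fun w _ hw => by simp [hw]) fun h => absurd h1 h]
        simp
      rw [h2, mul_comm q]
      exact (hprod m (by omega)).mul_mul hass

/-- The Chinese remainder theorem for averages, for several prime powers. -/
theorem avg_prod {n : ℕ} {m : ℕ} {T : Finset F[X]} (hT : ∀ w ∈ T, w.Monic ∧ Prime w)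
    {g : F[X] → (Fin n → F[X]) → ℂ} (hg : ∀ w ∈ T, PeriodicMod (w ^ m) (g w)) :
    PeriodicMod (∏ w ∈ T, w ^ m) (fun x => ∏ w ∈ T, g w x) ∧
      avg (∏ w ∈ T, w ^ m) (fun x => ∏ w ∈ T, g w x) = ∏ w ∈ T, avg (w ^ m) (g w) := by
  classical
  induction T using Finset.induction_on with
  | empty =>
    refine ⟨fun x y _ => by simp, ?_⟩
    simp only [Finset.prod_empty]
    exact avg_const one_ne_zero 1
  | insert w T hw ih =>
    obtain ⟨ih1, ih2⟩ := ih (fun w hw => hT w (Finset.mem_insert_of_mem hw))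
      fun w hw => hg w (Finset.mem_insert_of_mem hw)
    have hw1 := hT w (Finset.mem_insert_self _ _)
    have hg1 := hg w (Finset.mem_insert_self _ _)
    have hcop : IsCoprime (w ^ m) (∏ w ∈ T, w ^ m) := IsCoprime.prod_right fun w' hw' => by
      have hw2 := hT w' (Finset.mem_insert_of_mem hw')
      exact (isCoprime_of_monic_prime hw1.1 hw1.2 hw2.1 hw2.2
        fun h => hw (h ▸ hw')).pow
    have hne : ∏ w ∈ T, w ^ m ≠ 0 := Finset.prod_ne_zero_iff.mpr fun w' hw' =>
      pow_ne_zero _ (hT w' (Finset.mem_insert_of_mem hw')).2.ne_zero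
    simp only [Finset.prod_insert hw]
    refine ⟨(hg1.of_dvd (dvd_mul_right _ _)).mul (ih1.of_dvd (dvd_mul_left _ _)), ?_⟩
    rw [avg_mul_of_coprime (pow_ne_zero _ hw1.2.ne_zero) hne hcop hg1 ih1, ih2]

theorem prod_dvd_iff {F : Type*} [Field F] {m : F[X] → ℕ} {T : Finset F[X]}
    (hT : ∀ w ∈ T, w.Monic ∧ Prime w) (y : F[X]) :
    (∏ w ∈ T, w ^ m w) ∣ y ↔ ∀ w ∈ T, w ^ m w ∣ y := by
  refine ⟨fun h w hw => (Finset.dvd_prod_of_mem (fun w => w ^ m w) hw).trans h, fun h =>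
    Finset.prod_dvd_of_coprime (fun w hw w' hw' hne => ?_) h⟩
  exact (isCoprime_of_monic_prime (hT w hw).1 (hT w hw).2 (hT w' hw').1 (hT w' hw').2 hne).pow

end Primes

/-! ### Positivity of the singular series -/

section Positivity

variable {F : Type*} [Field F] [Fintype F] {n : ℕ} (p : ℕ) [Fact p.Prime] [Algebra (ZMod p) F]

/-- The normalized number of solutions modulo `w ^ m`. -/
def localDensity (F₁ F₂ : MvPolynomial (Fin n) F[X]) (b : Fin n → F[X]) (e : F[X] → ℕ) (m : ℕ)
    (w : F[X]) : ℂ :=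
  (polyAbs (w ^ m) : ℂ) ^ 2 * avg (w ^ m) (solIndicator F₁ F₂ b (w ^ e w) (w ^ m))

theorem polyAbs_prod {ι : Type*} (T : Finset ι) (f : ι → F[X]) :
    polyAbs (∏ w ∈ T, f w) = ∏ w ∈ T, polyAbs (f w) := by
  classical
  induction T using Finset.induction_on with
  | empty => simp
  | insert w T hw ih => rw [Finset.prod_insert hw, Finset.prod_insert hw, polyAbs_mul, ih]

theorem solIndicator_prod {F : Type*} [Field F] {n : ℕ} (F₁ F₂ : MvPolynomial (Fin n) F[X])
    (b : Fin n → F[X]) {N : F[X]}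
    {e : F[X] → ℕ} {m : ℕ} {T : Finset F[X]} (hT : ∀ w ∈ T, w.Monic ∧ Prime w)
    (hN : Associated N (∏ w ∈ T, w ^ e w)) (x : Fin n → F[X]) :
    solIndicator F₁ F₂ b N (∏ w ∈ T, w ^ m) x =
      ∏ w ∈ T, solIndicator F₁ F₂ b (w ^ e w) (w ^ m) x := by
  have hiff : solIndicator F₁ F₂ b N (∏ w ∈ T, w ^ m) x = 1 ↔
      ∀ w ∈ T, solIndicator F₁ F₂ b (w ^ e w) (w ^ m) x = 1 := by
    simp only [solIndicator_eq_one, hN.dvd_iff_dvd_left, prod_dvd_iff (m := e) hT,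
      prod_dvd_iff (m := fun _ => m) hT]
    exact ⟨fun h w hw => ⟨fun i => h.1 i w hw, h.2.1 w hw, h.2.2 w hw⟩,
      fun h => ⟨fun i w hw => (h w hw).1 i, fun w hw => (h w hw).2.1, fun w hw => (h w hw).2.2⟩⟩
  by_cases h : ∀ w ∈ T, solIndicator F₁ F₂ b (w ^ e w) (w ^ m) x = 1
  · rw [hiff.mpr h, Finset.prod_eq_one h]
  · rw [(solIndicator_eq_zero_or_one _ _ _ _ _ _).resolve_right (hiff.not.mpr h)]
    push Not at h
    obtain ⟨w, hw, h1⟩ := h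
    exact (Finset.prod_eq_zero hw
      ((solIndicator_eq_zero_or_one _ _ _ _ _ _).resolve_right h1)).symm

variable {F₁ : MvPolynomial (Fin n) F[X]} {Φ : FormPair F n}

/-- A partial sum of the singular series is a product of local densities. -/
theorem sum_seriesTerm_eq_prod (h : Φ.Represents F₁) {N : F[X]} (b : Fin n → F[X]) {e : F[X] → ℕ}
    {m : ℕ} {T : Finset F[X]} (hT : ∀ w ∈ T, w.Monic ∧ Prime w)
    (hN : Associated N (∏ w ∈ T, w ^ e w)) (hm : ∀ w ∈ T, e w ≤ m) :
    ∑ r ∈ monicDivisors (∏ w ∈ T, w ^ m), seriesTerm p F₁ (quadOf Φ.M) b N r =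
      ∏ w ∈ T, localDensity F₁ (quadOf Φ.M) b e m w := by
  have hne : ∏ w ∈ T, w ^ m ≠ 0 := Finset.prod_ne_zero_iff.mpr fun w hw =>
    pow_ne_zero _ (hT w hw).2.ne_zero
  have hdvd : N ∣ ∏ w ∈ T, w ^ m :=
    hN.dvd.trans (Finset.prod_dvd_prod_of_dvd _ _ fun w hw => pow_dvd_pow w (hm w hw))
  rw [sum_seriesTerm_eq p h hdvd hne b, avg_congr (solIndicator_prod F₁ (quadOf Φ.M) b hT hN),
    (avg_prod hT fun w hw => periodicMod_solIndicator F₁ (quadOf Φ.M) b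
      (pow_dvd_pow w (hm w hw))).2]
  have hsq : ((polyAbs (∏ w ∈ T, w ^ m) : ℝ) : ℂ) ^ 2 = ∏ w ∈ T, (polyAbs (w ^ m) : ℂ) ^ 2 := by
    rw [polyAbs_prod, Complex.ofReal_prod, Finset.prod_pow]
  simp only [localDensity]
  rw [hsq, Finset.prod_mul_distrib]

/-- The denominator `1` contributes `1` to the singular series with `N = 1`. -/
theorem seriesTerm_one (h : Φ.Represents F₁) (b : Fin n → F[X]) :
    seriesTerm p F₁ (quadOf Φ.M) b 1 1 = 1 := by
  have h1 := sum_seriesTerm_eq p h (N := 1) (R := 1) dvd_rfl one_ne_zero b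
  have h2 : monicDivisors (1 : F[X]) = {1} := by
    ext r
    rw [mem_monicDivisors one_ne_zero, Finset.mem_singleton]
    exact ⟨fun hr => hr.1.eq_one_of_isUnit (isUnit_of_dvd_one hr.2), fun hr => by
      subst hr; exact ⟨Polynomial.monic_one, dvd_rfl⟩⟩
  have h3 : ∀ x, solIndicator F₁ (quadOf Φ.M) b 1 1 x = 1 := fun x =>
    solIndicator_eq_one.mpr ⟨fun _ => one_dvd _, one_dvd _, one_dvd _⟩
  rw [h2, Finset.sum_singleton, avg_congr h3, avg_const one_ne_zero] at h1
  simpa using h1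

/-- Convergence of the majorant without the additional power of `|r|`. -/
theorem summable_majorant' (hn : 18 < n) (Φ : FormPair F n) :
    Summable fun r : {r : F[X] // r.Monic} => Φ.majorant p r.1 :=
  (Φ.summable_majorant p hn).of_nonneg_of_le (fun r => Φ.majorant_nonneg p r.1)
    fun r => majorant_le_mul p Φ r.2.ne_zero

/-- The product of the densities at the large primes is at least `1/2`. -/
theorem exists_prod_localDensity_ge (p : ℕ) [Fact p.Prime] {F : Type*} [Field F] [Fintype F]
    [Algebra (ZMod p) F] {F₁ : MvPolynomial (Fin n) F[X]} {Φ : FormPair F n} (hn : 18 < n)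
    (h : Φ.Represents F₁) : ∃ m₀ : ℕ,
    ∀ (b : Fin n → F[X]) (m : ℕ) (e : F[X] → ℕ) (T : Finset F[X]),
      (∀ w ∈ T, w.Monic ∧ Prime w ∧ m₀ < w.natDegree ∧ e w = 0) →
      ∃ d : ℝ, 1 / 2 ≤ d ∧ ∏ w ∈ T, localDensity F₁ (quadOf Φ.M) b e m w = d := by
  classical
  -- a divisor other than `1` of a product of large primes has large degree, hence lies outside `s`
  obtain ⟨s, hs⟩ := summable_iff_vanishing_norm.mp (summable_majorant' p hn Φ) (1 / 2) (by norm_num)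
  refine ⟨s.sup fun r => r.1.natDegree, fun b m e T hT => ?_⟩
  have hT' : ∀ w ∈ T, w.Monic ∧ Prime w := fun w hw => ⟨(hT w hw).1, (hT w hw).2.1⟩
  have hN : Associated (1 : F[X]) (∏ w ∈ T, w ^ e w) := by
    rw [Finset.prod_eq_one fun w hw => by rw [(hT w hw).2.2.2, pow_zero]]
  have hem : ∀ w ∈ T, e w ≤ m := fun w hw => by rw [(hT w hw).2.2.2]; exact Nat.zero_le _
  set R := ∏ w ∈ T, w ^ m with hR
  have hne : R ≠ 0 := Finset.prod_ne_zero_iff.mpr fun w hw =>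
    pow_ne_zero _ (hT' w hw).2.ne_zero
  have hprod := sum_seriesTerm_eq_prod p h b hT' hN hem
  have havg := sum_seriesTerm_eq p h (one_dvd R) hne b
  obtain ⟨d, hd, -⟩ := exists_avg_eq_ofReal hne
    (periodicMod_solIndicator F₁ (quadOf Φ.M) b (one_dvd R))
    (solIndicator_eq_zero_or_one F₁ (quadOf Φ.M) b 1 R) (ι := Empty) Empty.elim
    (fun a => a.elim) fun a => a.elim
  refine ⟨polyAbs R ^ 2 * d, ?_, by rw [← hprod, havg, hd]; push_cast; rfl⟩
  have h1mem : (1 : F[X]) ∈ monicDivisors R :=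
    (mem_monicDivisors hne).mpr ⟨Polynomial.monic_one, one_dvd _⟩
  have htail : ‖∑ r ∈ (monicDivisors R).erase 1, seriesTerm p F₁ (quadOf Φ.M) b 1 r‖ ≤ 1 / 2 := by
    have hmon : ∀ r ∈ (monicDivisors R).erase 1, r.Monic := fun r hr =>
      ((mem_monicDivisors hne).mp (Finset.mem_of_mem_erase hr)).1
    refine (norm_sum_le _ _).trans ((Finset.sum_le_sum fun r hr =>
      norm_seriesTerm_le p h (hmon r hr).ne_zero one_ne_zero b).trans ?_)
    have h2 := hs (((monicDivisors R).erase 1).subtype fun r => r.Monic) ?_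
    · rw [Finset.sum_subtype_of_mem (fun r => Φ.majorant p r) hmon] at h2
      exact (le_abs_self _).trans h2.le
    · refine Finset.disjoint_left.mpr fun r hr hrs => ?_
      rw [Finset.mem_subtype, Finset.mem_erase, mem_monicDivisors hne] at hr
      have hnu : ¬IsUnit r.1 := fun hu => hr.1 (hr.2.1.eq_one_of_isUnit hu)
      obtain ⟨q, hq, hqr⟩ := WfDvdMonoid.exists_irreducible_factor hnu r.2.ne_zero
      have hqp := hq.prime
      obtain ⟨w, hw, hqw⟩ := (Prime.dvd_finsetProd_iff hqp _).mp (hqr.trans hr.2.2)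
      have hqw' := hqp.dvd_of_dvd_pow hqw
      have hass := (hqp.dvd_prime_iff_associated (hT w hw).2.1).mp hqw'
      have h3 : w.natDegree ≤ r.1.natDegree :=
        Polynomial.natDegree_le_of_dvd (hass.symm.dvd.trans hqr) r.2.ne_zero
      have h4 : r.1.natDegree ≤ s.sup fun r => r.1.natDegree :=
        Finset.le_sup (f := fun r : {r : F[X] // r.Monic} => r.1.natDegree) hrs
      have h5 := (hT w hw).2.2.1
      omega
  have hsum : ((polyAbs R ^ 2 * d : ℝ) : ℂ) = 1 +
      ∑ r ∈ (monicDivisors R).erase 1, seriesTerm p F₁ (quadOf Φ.M) b 1 r := by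
    rw [← seriesTerm_one p h b, Finset.add_sum_erase _ _ h1mem, havg, hd]
    push_cast; rfl
  have hre := congrArg Complex.re hsum
  rw [Complex.ofReal_re, Complex.add_re, Complex.one_re] at hre
  have := (abs_le.mp ((Complex.abs_re_le_norm _).trans htail)).1
  linarith

/-- Local solubility yields approximate zeros; if the local zero is `0`, then a multiple of a global
zero takes its place. -/
theorem approximable_of_locallySoluble (hn : 18 < n) (h : Φ.Represents F₁)
    (hX : NonsingularPair F₁ (quadOf Φ.M)) {N : F[X]} (hN : N ≠ 0) {b : Fin n → F[X]}
    (hloc : LocallySoluble F₁ (quadOf Φ.M) b N) {w : F[X]} (hw : Prime w) {e : ℕ}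
    (he : w ^ e ∣ N) : Approximable F₁ (quadOf Φ.M) b w e := by
  obtain ⟨x, h1, h2, hb⟩ := hloc (primeOf hw)
  have hb' := fun i => (map_dvd (algebraMap F[X] ((primeOf hw).adicCompletionIntegers (RatFunc F)))
    he).trans (hb i)
  by_cases hx : x = 0
  · obtain ⟨I, -, hI, -⟩ := exists_ideal_filtration hw
    obtain ⟨z, hz, hz1, hz2⟩ := exists_global_zero (by omega) Φ.c Φ.M
    refine approximable_of_zero hX hw (fun i => ?_) (z := N • z) (smul_ne_zero hN hz)
      (fun i => he.mul_right (z i)) ?_ ?_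
    · rw [← hI]
      have h3 := hb' i
      rw [hx, Pi.zero_apply, zero_sub, dvd_neg] at h3
      exact Ideal.mem_of_dvd _ h3 ((hI e _).mpr dvd_rfl)
    · have h3 : tri Φ.c (N • z) (N • z) (N • z) = N ^ 3 * tri Φ.c z z z := by
        simp only [tri_eq_sum, Finset.mul_sum, Pi.smul_apply, smul_eq_mul]
        exact Finset.sum_congr rfl fun i _ => Finset.sum_congr rfl fun j _ =>
          Finset.sum_congr rfl fun k _ => by ring
      rw [h.eval, h3, hz1, mul_zero]
    · rw [eval_quadOf, Matrix.mulVec_smul, smul_dotProduct, dotProduct_smul, hz2, smul_zero,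
        smul_zero]
  · exact approximable_of_ne_zero hX hw hx h1 h2 hb'

/-- The singular series is positive under local solubility. The partial sums over the divisors of
`∏_{deg w ≤ m} w ^ m` are products of local densities; finitely many factors are bounded from below
by Hensel's lemma, and the product of the others is at least `1/2`. -/
theorem singularSeries_pos (hn : 18 < n) (h : Φ.Represents F₁)
    (hX : NonsingularPair F₁ (quadOf Φ.M)) {N : F[X]} (hN : N ≠ 0) {b : Fin n → F[X]}
    (hloc : LocallySoluble F₁ (quadOf Φ.M) b N) :
    0 < (singularSeries p F₁ (quadOf Φ.M) b N).re ∧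
      (singularSeries p F₁ (quadOf Φ.M) b N).im = 0 := by
  classical
  obtain ⟨m₁, hm₁⟩ := exists_prod_localDensity_ge p hn h
  obtain ⟨e, he0, he⟩ := exists_associated_prod hN
  set m₀ := max m₁ N.natDegree with hm₀
  set T₀ := monicPrimes F m₀ with hT₀
  have hprime : ∀ m, ∀ w ∈ monicPrimes F m, w.Monic ∧ Prime w := fun m w hw =>
    ⟨(mem_monicPrimes.mp hw).1, (mem_monicPrimes.mp hw).2.1⟩
  have happ : ∀ w ∈ T₀, ∃ (c : ℝ) (κ : ℕ), 0 < c ∧ e w ≤ κ ∧ ∀ m, κ ≤ m → ∃ d : ℝ, c ≤ d ∧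
      localDensity F₁ (quadOf Φ.M) b e m w = d := fun w hw =>
    (approximable_of_locallySoluble hn h hX hN hloc (hprime _ w hw).2
      ((Finset.dvd_prod_of_mem (fun w => w ^ e w) hw).trans
        (he m₀ (le_max_right _ _)).symm.dvd)).exists_density_bound (hprime _ w hw).2
  choose! c κ hc hκe hκ using happ
  set m₂ := max m₀ (T₀.sup κ) with hm₂
  set C := (∏ w ∈ T₀, c w) * (1 / 2) with hC
  have hCpos : 0 < C := mul_pos (Finset.prod_pos hc) (by norm_num)
  -- the partial sums are real and bounded from below
  have hpartial : ∀ m, m₂ ≤ m → ∃ d : ℝ, C ≤ d ∧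
      ∑ r ∈ monicDivisors (∏ w ∈ monicPrimes F m, w ^ m),
        seriesTerm p F₁ (quadOf Φ.M) b N r = d := by
    intro m hm
    have hm0 : m₀ ≤ m := (le_max_left _ _).trans hm
    have hsub : T₀ ⊆ monicPrimes F m := monicPrimes_mono hm0
    have hκm : ∀ w ∈ T₀, κ w ≤ m := fun w hw =>
      (Finset.le_sup hw).trans ((le_max_right _ _).trans hm)
    have hout : ∀ w ∈ monicPrimes F m \ T₀, m₀ < w.natDegree := fun w hw => by
      rw [Finset.mem_sdiff, hT₀, mem_monicPrimes, mem_monicPrimes] at hw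
      by_contra! hle
      exact hw.2 ⟨hw.1.1, hw.1.2.1, hle⟩
    have hout0 : ∀ w ∈ monicPrimes F m \ T₀, e w = 0 := fun w hw =>
      he0 w (lt_of_le_of_lt (le_max_right _ _) (hout w hw))
    have hem : ∀ w ∈ monicPrimes F m, e w ≤ m := fun w hw => by
      by_cases hw0 : w ∈ T₀
      · exact (hκe w hw0).trans (hκm w hw0)
      · rw [hout0 w (Finset.mem_sdiff.mpr ⟨hw, hw0⟩)]; exact Nat.zero_le _
    rw [sum_seriesTerm_eq_prod p h b (hprime m) (he m ((le_max_right _ _).trans hm0)) hem,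
      ← Finset.prod_sdiff hsub]
    obtain ⟨d₁, hd₁, hd₁'⟩ := hm₁ b m e (monicPrimes F m \ T₀) fun w hw =>
      ⟨(hprime m w (Finset.mem_sdiff.mp hw).1).1, (hprime m w (Finset.mem_sdiff.mp hw).1).2,
        lt_of_le_of_lt (le_max_left _ _) (hout w hw), hout0 w hw⟩
    have hd := fun w hw => hκ w hw m (hκm w hw)
    choose! d hd2 hd3 using hd
    refine ⟨d₁ * ∏ w ∈ T₀, d w, ?_, ?_⟩
    · rw [hC, mul_comm]
      exact mul_le_mul hd₁ (Finset.prod_le_prod (fun w hw => (hc w hw).le) hd2)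
        (Finset.prod_nonneg fun w hw => (hc w hw).le) (by linarith)
    · rw [hd₁', Finset.prod_congr rfl hd3]
      push_cast; rfl
  -- the partial sums exhaust the series
  have hRne : ∀ m, ∏ w ∈ monicPrimes F m, w ^ m ≠ 0 := fun m =>
    Finset.prod_ne_zero_iff.mpr fun w hw => pow_ne_zero _ (hprime m w hw).2.ne_zero
  set D : ℕ → Finset {r : F[X] // r.Monic} := fun m =>
    (monicDivisors (∏ w ∈ monicPrimes F m, w ^ m)).subtype fun r => r.Monic with hD
  have hmono : ∀ m m', m ≤ m' → ∏ w ∈ monicPrimes F m, w ^ m ∣ ∏ w ∈ monicPrimes F m', w ^ m' :=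
    fun m m' hmm => (Finset.prod_dvd_prod_of_dvd _ _ fun w _ => pow_dvd_pow w hmm).trans
      (Finset.prod_dvd_prod_of_subset _ _ _ (monicPrimes_mono hmm))
  have hDtop : Filter.Tendsto D Filter.atTop Filter.atTop := by
    refine Filter.tendsto_atTop_finset_of_monotone (fun m m' hmm r hr => ?_) fun r => ?_
    · rw [hD, Finset.mem_subtype, mem_monicDivisors (hRne _)] at *
      exact ⟨hr.1, hr.2.trans (hmono m m' hmm)⟩
    · obtain ⟨e', -, he'⟩ := exists_associated_prod r.2.ne_zero
      set m' := max r.1.natDegree ((monicPrimes F r.1.natDegree).sup e')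
      refine ⟨m', ?_⟩
      rw [hD, Finset.mem_subtype, mem_monicDivisors (hRne _)]
      refine ⟨r.2, (he' _ le_rfl).dvd.trans ((Finset.prod_dvd_prod_of_dvd _ _ fun w hw =>
        pow_dvd_pow w ((Finset.le_sup hw).trans (le_max_right _ _))).trans
          (Finset.prod_dvd_prod_of_subset _ _ _ (monicPrimes_mono (le_max_left _ _))))⟩
  have hsum : Summable fun r : {r : F[X] // r.Monic} => seriesTerm p F₁ (quadOf Φ.M) b N r.1 :=
    (summable_norm_seriesTerm p hn h hN b).of_norm
  have hlim := hsum.hasSum.comp hDtop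
  have hDsum : ∀ m, ∑ r ∈ D m, seriesTerm p F₁ (quadOf Φ.M) b N r.1 =
      ∑ r ∈ monicDivisors (∏ w ∈ monicPrimes F m, w ^ m), seriesTerm p F₁ (quadOf Φ.M) b N r :=
    fun m => Finset.sum_subtype_of_mem (fun r => seriesTerm p F₁ (quadOf Φ.M) b N r)
      fun r hr => ((mem_monicDivisors (hRne m)).mp hr).1
  have hre : C ≤ (singularSeries p F₁ (quadOf Φ.M) b N).re := by
    refine ge_of_tendsto ((Complex.continuous_re.tendsto _).comp hlim)
      (Filter.eventually_atTop.mpr ⟨m₂, fun m hm => ?_⟩)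
    obtain ⟨d, hd1, hd2⟩ := hpartial m hm
    simp only [Function.comp_apply, hDsum, hd2, Complex.ofReal_re]
    exact hd1
  refine ⟨hCpos.trans_le hre, tendsto_nhds_unique ((Complex.continuous_im.tendsto _).comp hlim) ?_⟩
  refine tendsto_const_nhds.congr' (Filter.eventually_atTop.mpr ⟨m₂, fun m hm => ?_⟩)
  obtain ⟨d, -, hd2⟩ := hpartial m hm
  simp only [Function.comp_apply, hDsum, hd2, Complex.ofReal_im]

end Positivity

end

end FFCircle

theorem mainTheorem5 (p : ℕ) [Fact p.Prime] (hp : 3 < p)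
    {F : Type*} [Field F] [Fintype F] [Algebra (ZMod p) F]
    (n : ℕ) (hn : 18 < n)
    (F₁ : MvPolynomial (Fin n) (Polynomial F)) (hF₁ : F₁.IsHomogeneous 3)
    (M : Matrix (Fin n) (Fin n) (Polynomial F)) (hM : M.IsSymm)
    (F₂ : MvPolynomial (Fin n) (Polynomial F)) (hF₂ : F₂ = FFCircle.quadOf M)
    (hX : FFCircle.NonsingularPair F₁ F₂)
    (hF₁ns : FFCircle.NonsingularForm F₁)
    (hMrank : n ≤ (M.map (algebraMap (Polynomial F) (RatFunc F))).rank + 1)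
    (x₀ : Fin n → FFCircle.KInf F) (hx₀ : FFCircle.IsCentre F₁ M x₀) :
    (∃ L₀ : ℕ, ∀ L : ℕ, L₀ ≤ L →
      (0 < (FFCircle.singularIntegral p F₁ F₂ x₀ L).re ∧
        (FFCircle.singularIntegral p F₁ F₂ x₀ L).im = 0) ∧
      ∃ δ : ℝ, 0 < δ ∧
        ∀ N : Polynomial F, N ≠ 0 → ∀ A : ℝ, ∃ C : ℝ,
          ∀ b : Fin n → Polynomial F,
            N ∣ MvPolynomial.eval b F₁ → N ∣ MvPolynomial.eval b F₂ →
            ∀ P R₁ R₂ : ℕ, 1 ≤ P → 1 ≤ R₂ → R₂ ≤ R₁ →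
              |(R₁ : ℝ) - 4 / 3 * P| ≤ A → |(R₂ : ℝ) - 1 / 3 * P| ≤ A →
              ‖FFCircle.mainTerm p F₁ F₂ x₀ L b N P R₁ R₂ -
                  FFCircle.singularIntegral p F₁ F₂ x₀ L *
                    FFCircle.singularSeries p F₁ F₂ b N *
                    (FFCircle.hat F (((n : ℝ) - 5) * P) : ℝ)‖ ≤
                C * FFCircle.hat F (((n : ℝ) - 5 - δ) * P)) ∧
    (∀ N : Polynomial F, N ≠ 0 → ∀ b : Fin n → Polynomial F,
      N ∣ MvPolynomial.eval b F₁ → N ∣ MvPolynomial.eval b F₂ →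
      (Summable fun r : {r : Polynomial F // r.Monic} =>
        ‖FFCircle.seriesTerm p F₁ F₂ b N r.1‖) ∧
      (FFCircle.LocallySoluble F₁ F₂ b N →
        0 < (FFCircle.singularSeries p F₁ F₂ b N).re ∧
          (FFCircle.singularSeries p F₁ F₂ b N).im = 0)) := by
  obtain ⟨Φ, rfl, hΦ⟩ := FFCircle.exists_formPair (FFCircle.six_ne_zero_of_char (F := F) hp)
    (by omega) hF₁ hM hF₁ns hMrank
  subst hF₂
  have hl := FFCircle.gradMin_pos hX (FFCircle.centre_ne_zero (by omega) hΦ hx₀)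
    hx₀.cubic_zero hx₀.quadric_zero
  refine ⟨?_, fun N hN b _ _ => ⟨FFCircle.summable_norm_seriesTerm p hn hΦ hN b, fun hloc =>
    FFCircle.singularSeries_pos p hn hΦ hX hN hloc⟩⟩
  obtain ⟨L₀, hL₀⟩ := FFCircle.exists_localIntegral_eq_zero p (by omega) hΦ hl
  refine ⟨L₀, fun L hL => ⟨FFCircle.singularIntegral_pos p hx₀.cubic_zero hx₀.quadric_zero hl L,
    1 / 120, by norm_num, fun N hN A => ?_⟩⟩
  obtain ⟨k, hk⟩ := FFCircle.exists_squareInf_eq (F := F)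
    (inv_pos.mpr (mul_pos hl (inv_pos.mpr (FFCircle.hat_pos (F := F) L))))
  obtain ⟨C, hC⟩ := FFCircle.exists_mainTerm_bound p hn hΦ (L := L) (fun γ hγ => hL₀ L hL γ
    (not_lt.mp fun hlt => hγ (hk.subset hlt))) hk hN A
  exact ⟨C, fun b _ _ P R₁ R₂ _ _ hR h₁ h₂ => hC b P R₁ R₂ hR h₁ h₂⟩
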